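/- **Theorem.** Fix constants $\mathscr R,\tau,K,L,\gamma>0$ and $\kappa\in(0,1)$. Consider a sequence of integer pairs $(n,p)$ with $n,p\ge 1$, $p/n\le\gamma$ and $p\to+\infty$ along the sequence, and for each pair a linear model $\boldsymbol y=\boldsymbol X\boldsymbol\beta+\boldsymbol\varepsilon$ with $\boldsymbol X\in\mathbb R^{n\times p}$, deterministic $\boldsymbol\beta\in\mathbb R^p$ and $\boldsymbol\varepsilon\in\mathbb R^n$, and the estimator $$\hat{\boldsymbol\beta}=\operatorname*{argmin}_{\boldsymbol b\in\mathbb R^p}\ \frac1n\sum_{i=1}^n\rho(y_i-\boldsymbol x_i^\top\boldsymbol b)+g(\boldsymbol b),$$ where $\boldsymbol x_i^\top$ is the $i$-th row of $\boldsymbol X$. All of these objects, and the probability space, may change with $(n,p)$. Assume for every pair: 1. $\rho:\mathbb R\to\mathbb R$ is convex and continuously differentiable, $\psi=\rho'$ is $L$-Lipschitz, and $K^2\le\psi'(x)+\psi(x)^2$ for almost every $x\in\mathbb R$. 2. $g:\mathbb R^p\to\mathbb R$ is such that $\boldsymbol b\mapsto g(\boldsymbol b)-\tau\|\boldsymbol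 b\|_2^2/2$ is convex. 3. The rows of $\boldsymbol X$ are i.i.d. $N(\boldsymbol 0,\boldsymbol\Sigma)$, where $\boldsymbol\Sigma\in\mathbb R^{p\times p}$ is symmetric with all eigenvalues in $[\kappa,1/\kappa]$. The noise $\boldsymbol\varepsilon$ is independent of $\boldsymbol X$ and has a density with respect to Lebesgue measure on $\mathbb R^n$. 4. $\mathbb E\|\boldsymbol\Sigma^{1/2}(\hat{\boldsymbol\beta}-\boldsymbol\beta)\|_2^2\le\mathscr R$. Let $\boldsymbol\psi=(\psi(y_i-\boldsymbol x_i^\top\hat{\boldsymbol\beta}))_{i\le n}$, regarded as a function of $\boldsymbol y$ with $\boldsymbol X$ held fixed, and let $[\nabla_{\boldsymbol y}\boldsymbol\psi]^\top\in\mathbb R^{n\times n}$ be its Jacobian. For $j\in[p]=\{1,\dots,p\}$ let $\boldsymbol e_j$ be the $j$-th standard basis vector, $\Omega_{jj}=\boldsymbol e_j^\top\boldsymbol\Sigma^{-1}\boldsymbol e_j$, $\boldsymbol z_j=\boldsymbol X\boldsymbol\Sigma^{-1}\Omega_{jj}^{-1}\boldsymbol e_j$, and $$\xi_j=\|\boldsymbol\psi\|_2^{-1}\bigl[\boldsymbol\psi^\top\boldsymbol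 z_j-n^{-1}\|\boldsymbol z_j\|_2^2(\beta_j-\hat\beta_j)\operatorname{trace}(\nabla_{\boldsymbol y}\boldsymbol\psi)\bigr],$$ $$\xi_j'=\|\boldsymbol\psi\|_2^{-1}\bigl[\boldsymbol\psi^\top\boldsymbol z_j-\Omega_{jj}^{-1}(\beta_j-\hat\beta_j)\operatorname{trace}(\nabla_{\boldsymbol y}\boldsymbol\psi)\bigr].$$ With probability one $\boldsymbol\psi\ne\boldsymbol 0$ and the Jacobian exists at the observed $\boldsymbol y$, so that $\xi_j$ and $\xi_j'$ are well defined. Moreover, for every positive sequence $(a_p)$ with $\lim_{p\to+\infty}a_p=+\infty$ there are sets $J_{n,p}\subseteq[p]$ with $|J_{n,p}|/p\ge 1-a_p/p$ such that, for every $t\in\mathbb R$, $$\max_{j\in J_{n,p}}\Bigl\{\bigl|\mathbb P(\Omega_{jj}^{1/2}\xi_j\le t)-\Phi(t)\bigr|+\bigl|\mathbb P(\Omega_{jj}^{1/2}\xi_j'\le t)-\Phi(t)\bigr|\Bigr\}\longrightarrow 0$$ along the sequence, where $\Phi$ is the standard normal cumulative distribution function and a maximum over the empty set is $0$. -/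

import Mathlib

open MeasureTheory ProbabilityTheory Filter Topology
open scoped MatrixOrder

namespace RobustM

/-- The loss `ρ` is convex and continuously differentiable, its derivative `ψ = ρ'` is
`L`-Lipschitz, and `K² ≤ ψ' + ψ²` almost everywhere. (A Lipschitz `ψ` is differentiable
almost everywhere, so `deriv (deriv ρ)` is the derivative of `ψ` almost everywhere.) -/
structure LossAssumption (ρ : ℝ → ℝ) (K : ℝ) (L : NNReal) : Prop where
  convex : ConvexOn ℝ Set.univ ρ
  contDiff : ContDiff ℝ 1 ρ
  lipschitz : LipschitzWith L (deriv ρ)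
  lower : ∀ᵐ x : ℝ, K ^ 2 ≤ deriv (deriv ρ) x + (deriv ρ x) ^ 2

/-- The penalty `g` is `τ`-strongly convex: `b ↦ g b - τ ‖b‖² / 2` is convex. -/
def PenaltyAssumption {p : ℕ} (g : EuclideanSpace ℝ (Fin p) → ℝ) (τ : ℝ) : Prop :=
  ConvexOn ℝ Set.univ (fun b => g b - τ * ‖b‖ ^ 2 / 2)

/-- `S` is symmetric with all eigenvalues in `[κ, 1/κ]`. -/
structure CovarianceAssumption {p : ℕ} (S : Matrix (Fin p) (Fin p) ℝ) (κ : ℝ) : Prop where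
  hermitian : S.IsHermitian
  eigenvalues_mem : ∀ i, hermitian.eigenvalues i ∈ Set.Icc κ (1 / κ)

/-- The rows `x i` of the design are i.i.d. `N(0, S)`; the noise vector `ε` is independent of
the design and has a density with respect to the Lebesgue measure on `ℝⁿ`. -/
structure SamplingAssumption {Ω : Type*} [MeasurableSpace Ω] (μ : Measure Ω) {n p : ℕ}
    (S : Matrix (Fin p) (Fin p) ℝ) (x : Fin n → Ω → EuclideanSpace ℝ (Fin p))
    (ε : Ω → EuclideanSpace ℝ (Fin n)) : Prop where
  law_rows : ∀ i, HasLaw (x i) (multivariateGaussian 0 S) μ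
  indep_rows : iIndepFun x μ
  indep_noise : IndepFun ε (fun ω i => x i ω) μ
  density_noise : HasPDF ε μ volume

section Deterministic

variable {n p : ℕ}

/-- The design matrix with the given rows. -/
def designMatrix (r : Fin n → EuclideanSpace ℝ (Fin p)) : Matrix (Fin n) (Fin p) ℝ :=
  Matrix.of fun i j => r i j

/-- The product `X b`, for `b ∈ ℝᵖ`, as a vector of the Euclidean space `ℝⁿ`. -/
noncomputable def mulVecE (X : Matrix (Fin n) (Fin p) ℝ) (b : EuclideanSpace ℝ (Fin p)) :
    EuclideanSpace ℝ (Fin n) :=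
  WithLp.toLp 2 (X.mulVec b.ofLp)

/-- The criterion `(1/n) ∑ᵢ ρ(yᵢ - xᵢᵀ b) + g(b)`. -/
noncomputable def criterion (ρ : ℝ → ℝ) (g : EuclideanSpace ℝ (Fin p) → ℝ)
    (X : Matrix (Fin n) (Fin p) ℝ) (y : EuclideanSpace ℝ (Fin n))
    (b : EuclideanSpace ℝ (Fin p)) : ℝ :=
  (1 / (n : ℝ)) * ∑ i, ρ (y i - mulVecE X b i) + g b

/-- The regularized M-estimator: the minimizer of the criterion
(see `existsUnique_minimizer`). -/
noncomputable def betaHat (ρ : ℝ → ℝ) (g : EuclideanSpace ℝ (Fin p) → ℝ)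
    (X : Matrix (Fin n) (Fin p) ℝ) (y : EuclideanSpace ℝ (Fin n)) :
    EuclideanSpace ℝ (Fin p) :=
  Classical.epsilon fun b => IsMinOn (criterion ρ g X y) Set.univ b

/-- `ψ(y - X β̂)`, with `ψ = ρ'` acting on each coordinate of the residual vector. -/
noncomputable def psiHat (ρ : ℝ → ℝ) (g : EuclideanSpace ℝ (Fin p) → ℝ)
    (X : Matrix (Fin n) (Fin p) ℝ) (y : EuclideanSpace ℝ (Fin n)) :
    EuclideanSpace ℝ (Fin n) :=
  WithLp.toLp 2 fun i => deriv ρ (y i - mulVecE X (betaHat ρ g X y) i)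

/-- The trace of the Jacobian of `y ↦ ψ(y - X β̂(y, X))`, with `X` held fixed. -/
noncomputable def trJacobian (ρ : ℝ → ℝ) (g : EuclideanSpace ℝ (Fin p) → ℝ)
    (X : Matrix (Fin n) (Fin p) ℝ) (y : EuclideanSpace ℝ (Fin n)) : ℝ :=
  LinearMap.trace ℝ (EuclideanSpace ℝ (Fin n))
    (fderiv ℝ (fun y' => psiHat ρ g X y') y : EuclideanSpace ℝ (Fin n) →ₗ[ℝ] EuclideanSpace ℝ (Fin n))

/-- `Ω_jj = e_jᵀ S⁻¹ e_j`. -/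
noncomputable def precisionDiag (S : Matrix (Fin p) (Fin p) ℝ) (j : Fin p) : ℝ := S⁻¹ j j

/-- `z_j = X S⁻¹ Ω_jj⁻¹ e_j`. -/
noncomputable def zvec (S : Matrix (Fin p) (Fin p) ℝ) (X : Matrix (Fin n) (Fin p) ℝ)
    (j : Fin p) : EuclideanSpace ℝ (Fin n) :=
  mulVecE (X * S⁻¹) ((precisionDiag S j)⁻¹ • EuclideanSpace.single j (1 : ℝ))

/-- `ξ_j = ‖ψ‖⁻¹ [ψᵀ z_j - n⁻¹ ‖z_j‖² (β_j - β̂_j) tr(∇_y ψ)]`. -/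
noncomputable def xi (ρ : ℝ → ℝ) (g : EuclideanSpace ℝ (Fin p) → ℝ)
    (S : Matrix (Fin p) (Fin p) ℝ) (β : EuclideanSpace ℝ (Fin p))
    (X : Matrix (Fin n) (Fin p) ℝ) (y : EuclideanSpace ℝ (Fin n)) (j : Fin p) : ℝ :=
  ‖psiHat ρ g X y‖⁻¹ * (inner ℝ (psiHat ρ g X y) (zvec S X j)
    - (n : ℝ)⁻¹ * ‖zvec S X j‖ ^ 2 * (β j - betaHat ρ g X y j) * trJacobian ρ g X y)

/-- `ξ'_j = ‖ψ‖⁻¹ [ψᵀ z_j - Ω_jj⁻¹ (β_j - β̂_j) tr(∇_y ψ)]`. -/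
noncomputable def xi' (ρ : ℝ → ℝ) (g : EuclideanSpace ℝ (Fin p) → ℝ)
    (S : Matrix (Fin p) (Fin p) ℝ) (β : EuclideanSpace ℝ (Fin p))
    (X : Matrix (Fin n) (Fin p) ℝ) (y : EuclideanSpace ℝ (Fin n)) (j : Fin p) : ℝ :=
  ‖psiHat ρ g X y‖⁻¹ * (inner ℝ (psiHat ρ g X y) (zvec S X j)
    - (precisionDiag S j)⁻¹ * (β j - betaHat ρ g X y j) * trJacobian ρ g X y)

/-- The squared prediction error `‖S^{1/2} (b - β)‖²`, as an extended nonnegative real. -/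
noncomputable def predError (S : Matrix (Fin p) (Fin p) ℝ) (b β : EuclideanSpace ℝ (Fin p)) :
    ENNReal :=
  ‖Matrix.toEuclideanCLM (𝕜 := ℝ) (CFC.sqrt S) (b - β)‖ₑ ^ 2

end Deterministic

/-- The standard normal cumulative distribution function. -/
noncomputable def Phi (t : ℝ) : ℝ := cdf (gaussianReal 0 1) t

/-- For convex `ρ` and strongly convex `g` the criterion has exactly one minimizer. -/
theorem existsUnique_minimizer {n p : ℕ} {ρ : ℝ → ℝ} {g : EuclideanSpace ℝ (Fin p) → ℝ} {τ : ℝ}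
    (hρ : ConvexOn ℝ Set.univ ρ) (hτ : 0 < τ) (hg : PenaltyAssumption g τ)
    (X : Matrix (Fin n) (Fin p) ℝ) (y : EuclideanSpace ℝ (Fin n)) :
    ∃! b, IsMinOn (criterion ρ g X y) Set.univ b := by
  set c : EuclideanSpace ℝ (Fin p) → ℝ := fun b => criterion ρ g X y b - τ * ‖b‖ ^ 2 / 2 with hc
  have hlin : ∀ (a b : EuclideanSpace ℝ (Fin p)) (s t : ℝ) (i : Fin n),
      mulVecE X (s • a + t • b) i = s * mulVecE X a i + t * mulVecE X b i := by
    intro a b s t i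
    simp [mulVecE, Matrix.mulVec_add, Matrix.mulVec_smul]
  have hconv : ConvexOn ℝ Set.univ c := by
    refine ⟨convex_univ, ?_⟩
    intro a _ b _ s t hs ht hst
    have h1 := hg.2 (Set.mem_univ a) (Set.mem_univ b) hs ht hst
    have h2 : ∑ i, ρ (y i - mulVecE X (s • a + t • b) i)
        ≤ s * ∑ i, ρ (y i - mulVecE X a i) + t * ∑ i, ρ (y i - mulVecE X b i) := by
      rw [Finset.mul_sum, Finset.mul_sum, ← Finset.sum_add_distrib]
      refine Finset.sum_le_sum fun i _ => ?_
      have h3 := hρ.2 (Set.mem_univ (y i - mulVecE X a i)) (Set.mem_univ (y i - mulVecE X b i))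
        hs ht hst
      have h4 : s • (y i - mulVecE X a i) + t • (y i - mulVecE X b i)
          = y i - mulVecE X (s • a + t • b) i := by
        rw [hlin]
        simp only [smul_eq_mul]
        linear_combination (y i) * hst
      rw [h4] at h3
      simpa using h3
    have h5 := mul_le_mul_of_nonneg_left h2 (by positivity : (0 : ℝ) ≤ 1 / (n : ℝ))
    simp only [smul_eq_mul] at h1
    simp only [hc, criterion, smul_eq_mul]
    linarith
  have hcont : Continuous c := by
    rw [← continuousOn_univ]
    exact hconv.continuousOn isOpen_univ
  have hcrit : Continuous (criterion ρ g X y) := by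
    have : criterion ρ g X y = fun b => c b + τ * ‖b‖ ^ 2 / 2 := by
      funext b; simp [hc]
    rw [this]
    fun_prop
  obtain ⟨M, hM⟩ := (isCompact_closedBall (0 : EuclideanSpace ℝ (Fin p)) 1).exists_bound_of_continuousOn
    hcont.continuousOn
  have hM0 : ‖c 0‖ ≤ M := hM 0 (by simp)
  have hMnn : 0 ≤ M := (norm_nonneg _).trans hM0
  have hlow : ∀ b : EuclideanSpace ℝ (Fin p), 1 ≤ ‖b‖ → -(2 * M * ‖b‖) ≤ c b := by
    intro b hb
    have hb0 : 0 < ‖b‖ := by linarith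
    have hu : ‖c (‖b‖⁻¹ • b)‖ ≤ M := by
      apply hM
      simp [norm_smul, hb0.ne']
    have h1 := hconv.2 (Set.mem_univ (0 : EuclideanSpace ℝ (Fin p))) (Set.mem_univ b)
      (sub_nonneg.2 (inv_le_one_of_one_le₀ hb)) (inv_nonneg.2 hb0.le) (by ring)
    rw [smul_zero, zero_add] at h1
    simp only [smul_eq_mul] at h1
    rw [Real.norm_eq_abs] at hu hM0
    have h2 := mul_le_mul_of_nonneg_left h1 hb0.le
    have h3 : ‖b‖ * ((1 - ‖b‖⁻¹) * c 0 + ‖b‖⁻¹ * c b) = (‖b‖ - 1) * c 0 + c b := by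
      field_simp
    rw [h3] at h2
    nlinarith [neg_abs_le (c (‖b‖⁻¹ • b)), le_abs_self (c 0), abs_nonneg (c 0)]
  set r : ℝ := max 1 ((4 * M + 2 * |criterion ρ g X y 0|) / τ + 1) with hr
  have hr1 : 1 ≤ r := le_max_left _ _
  obtain ⟨b₀, hb₀, hmin⟩ := (isCompact_closedBall (0 : EuclideanSpace ℝ (Fin p)) r).exists_isMinOn
    ⟨0, by simp; linarith⟩ hcrit.continuousOn
  have hglob : IsMinOn (criterion ρ g X y) Set.univ b₀ := by
    intro b _
    by_cases hb : ‖b‖ ≤ r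
    · exact hmin (by simpa using hb)
    · push Not at hb
      have h0 : criterion ρ g X y b₀ ≤ criterion ρ g X y 0 := hmin (by simp; linarith)
      have h1 := hlow b (by linarith)
      have h2 : criterion ρ g X y b = c b + τ * ‖b‖ ^ 2 / 2 := by simp [hc]
      have h3 : (4 * M + 2 * |criterion ρ g X y 0|) / τ < ‖b‖ := by
        have := le_max_right 1 ((4 * M + 2 * |criterion ρ g X y 0|) / τ + 1)
        linarith
      rw [div_lt_iff₀ hτ] at h3
      have h4 : 1 ≤ ‖b‖ := by linarith
      have h5 : criterion ρ g X y 0 ≤ criterion ρ g X y b := by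
        rw [h2]
        nlinarith [le_abs_self (criterion ρ g X y 0), abs_nonneg (criterion ρ g X y 0),
          mul_le_mul_of_nonneg_left h3.le (by linarith : (0 : ℝ) ≤ ‖b‖),
          mul_le_mul_of_nonneg_left h4 (abs_nonneg (criterion ρ g X y 0))]
      exact h0.trans h5
  have hstrict : StrictConvexOn ℝ Set.univ (criterion ρ g X y) := by
    have : StrongConvexOn Set.univ τ (criterion ρ g X y) := by
      rw [strongConvexOn_iff_convex]
      have he : (fun b => criterion ρ g X y b - τ / (2 : ℝ) * ‖b‖ ^ 2) = c := by
        funext b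
        simp only [hc]
        ring
      rw [he]
      exact hconv
    exact this.strictConvexOn hτ
  exact ⟨b₀, hglob, fun b hb => hstrict.eq_of_isMinOn hb hglob (Set.mem_univ _) (Set.mem_univ _)⟩

end RobustM

/-! Fix a coordinate j and write h_j for the j-th entry of β̂ - β, V for the Jacobian of ψ in y, and
σ = Ω_jj^{-1/2}. The standardized column z = Ω_jj^{1/2} z_j is a standard Gaussian vector of ℝⁿ,
independent of the noise and of the remaining part of the design, and X depends on z only through
the addition of σz to column j. With everything else frozen, ψ becomes a function of z.

Moving z by η has, to first order, the same effect on ψ as moving the response by -σ h_j η, up to a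
rank one term (`norm_fderiv_score_add_sq_le`). Hence the divergence of f = ψ/‖ψ‖ in z is close to -σ
h_j tr V / ‖ψ‖, and Ω_jj^{1/2} ξ'_j is close to ⟨z, f(z)⟩ - div f(z). The second order Stein
inequality, combined with a Gaussian Poincaré inequality for an independent copy z', shows that
E(⟨z, f(z) - f(z')⟩ - div f(z))² is at most a constant times E‖Df‖² in Frobenius norm
(`lintegral_divergence_sub_sq_le`). So the statistic is close in mean square to ⟨z, f(z')⟩, which is
exactly standard normal because f(z') is a unit vector independent of z.

Strong convexity of the penalty and the Lipschitz property of the score give perturbation bounds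
under which E‖Df‖² is at most a constant times E[n h_j²/‖ψ‖²] + 1/n. It remains to show that this
energy is small for most j, and for this its sum over j is bounded by a constant. If ‖ψ‖² ≥ nK²/4,
the sum is controlled by the estimation error. Otherwise K² ≤ ψ' + ψ² forces tr V to be of order n,
so that h_j can be recovered from the pivot and from ⟨z, ψ⟩. The sum over j of the squares of the
latter is controlled by the operator norm of X, while the second moment of each pivot is controlled
by its own energy with a factor that becomes O(1/n) in the sum. For large n the loop closes
(`sum_lintegral_energyAt_le_of_pos`). At most a_p coordinates then have energy above a constant
divided by a_p, and the others form J_{n,p}.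

The difference between the two statistics is the product of the fluctuation of Ω_jj‖z_j‖²/n around
1, of order n^{-1/2}, and a correction of order at most the square root of n times the energy. It is
therefore negligible on the same coordinates.

Three devices make this rigorous. The norm ‖ψ‖ is replaced by √(‖ψ‖² + ν(1 + h_j²)), which makes f
globally Lipschitz, and ν tends to 0 at the end by Fatou's lemma. A Lipschitz cutoff of the operator
norm of X restricts to designs of norm O(√n). The Gaussian inequalities, proved for smooth maps,
pass to Lipschitz maps by mollification. -/

namespace RobustM

/-! ### Standard Gaussian measure: density and integration by parts. -/

section GaussianAnalysis

set_option linter.unusedSectionVars false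

open Module

variable {E : Type*} [NormedAddCommGroup E] [InnerProductSpace ℝ E] [FiniteDimensional ℝ E]
  [MeasurableSpace E] [BorelSpace E]

/-- The Lebesgue density of the standard Gaussian measure. -/
noncomputable def stdGaussianDensity (x : E) : ℝ :=
  ((2 * Real.pi) ^ ((finrank ℝ E : ℝ) / 2))⁻¹ * Real.exp (-‖x‖ ^ 2 / 2)

lemma stdGaussianDensity_pos (x : E) : 0 < stdGaussianDensity x := by
  unfold stdGaussianDensity; positivity

lemma continuous_stdGaussianDensity : Continuous (stdGaussianDensity : E → ℝ) := by
  unfold stdGaussianDensity; fun_prop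

lemma hasFDerivAt_stdGaussianDensity (x : E) :
    HasFDerivAt stdGaussianDensity (-(stdGaussianDensity x) • innerSL ℝ x) x := by
  have h1 : HasFDerivAt (fun y : E => -‖y‖ ^ 2 / 2) (-(innerSL ℝ x)) x := by
    have h := ((hasStrictFDerivAt_norm_sq x).hasFDerivAt.neg).mul_const (2⁻¹ : ℝ)
    refine (h.congr_fderiv ?_).congr_of_eventuallyEq (Eventually.of_forall fun y => ?_)
    · ext v
      simp
    · simp [div_eq_mul_inv]
  have h2 := (h1.exp).const_mul ((2 * Real.pi) ^ ((finrank ℝ E : ℝ) / 2))⁻¹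
  refine h2.congr_fderiv ?_
  ext v
  simp [stdGaussianDensity]
  ring

lemma integral_cexp_inner_gaussian (t : E) :
    ∫ x : E, Complex.exp ((inner ℝ x t : ℝ) * Complex.I) * (stdGaussianDensity x : ℂ)
      = Complex.exp (-(‖t‖ : ℂ) ^ 2 / 2) := by
  have h := GaussianFourier.integral_cexp_neg_mul_sq_norm_add (b := (1 / 2 : ℂ)) (V := E)
    (by norm_num) Complex.I t
  have h1 : ∀ x : E, Complex.exp ((inner ℝ x t : ℝ) * Complex.I) * (stdGaussianDensity x : ℂ)
      = ((2 * Real.pi : ℝ) ^ ((finrank ℝ E : ℝ) / 2) : ℝ)⁻¹ *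
        Complex.exp (-(1 / 2 : ℂ) * ‖x‖ ^ 2 + Complex.I * (inner ℝ t x : ℝ)) := by
    intro x
    rw [Complex.exp_add, stdGaussianDensity, real_inner_comm]
    push_cast
    rw [mul_comm Complex.I]
    have : (-(‖x‖ : ℂ) ^ 2 / 2) = -(1 / 2) * (‖x‖ : ℂ) ^ 2 := by ring
    rw [this]
    ring
  simp_rw [h1]
  rw [integral_const_mul, h, ← mul_assoc]
  have h2 : ((((2 * Real.pi : ℝ) ^ ((finrank ℝ E : ℝ) / 2) : ℝ) : ℂ))⁻¹ *
      ((Real.pi : ℂ) / (1 / 2)) ^ ((finrank ℝ E : ℂ) / 2) = 1 := by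
    have h3 : ((Real.pi : ℂ) / (1 / 2)) = ((2 * Real.pi : ℝ) : ℂ) := by
      push_cast; ring
    have h4 : ((finrank ℝ E : ℂ) / 2) = (((finrank ℝ E : ℝ) / 2 : ℝ) : ℂ) := by push_cast; ring
    rw [h3, h4, ← Complex.ofReal_cpow (by positivity)]
    apply inv_mul_cancel₀
    rw [Complex.ofReal_ne_zero]
    positivity
  rw [Complex.ofReal_inv, h2, one_mul]
  congr 1
  rw [Complex.I_sq]
  ring

lemma integral_stdGaussianDensity : ∫ x : E, stdGaussianDensity x = 1 := by
  have h := integral_cexp_inner_gaussian (E := E) 0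
  simp only [inner_zero_right, Complex.ofReal_zero, zero_mul, Complex.exp_zero, one_mul,
    norm_zero] at h
  rw [integral_complex_ofReal] at h
  norm_num at h
  exact_mod_cast h

/-- Both sides have characteristic function exp(-‖t‖²/2), by `integral_cexp_inner_gaussian`. -/
lemma stdGaussian_eq_withDensity :
    stdGaussian E = volume.withDensity fun x => ENNReal.ofReal (stdGaussianDensity x) := by
  -- The Bochner integral of a nonintegrable function is 0, whereas this integral is 1.
  have hint : Integrable (stdGaussianDensity : E → ℝ) := by
    by_contra h
    have := integral_stdGaussianDensity (E := E)
    rw [integral_undef h] at this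
    norm_num at this
  have hprob : IsProbabilityMeasure
      (volume.withDensity fun x : E => ENNReal.ofReal (stdGaussianDensity x)) := by
    constructor
    rw [withDensity_apply _ MeasurableSet.univ, setLIntegral_univ,
      ← ofReal_integral_eq_lintegral_ofReal hint
      (Eventually.of_forall fun x => (stdGaussianDensity_pos x).le), integral_stdGaussianDensity]
    simp
  apply Measure.ext_of_charFun
  ext t
  rw [charFun_stdGaussian, charFun_apply, integral_withDensity_eq_integral_toReal_smul
    (by exact continuous_stdGaussianDensity.measurable.ennreal_ofReal) (by simp)]
  rw [← integral_cexp_inner_gaussian t]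
  congr 1
  ext x
  rw [ENNReal.toReal_ofReal (stdGaussianDensity_pos x).le, Complex.real_smul, mul_comm]

lemma stdGaussian_absolutelyContinuous : stdGaussian E ≪ (volume : Measure E) := by
  rw [stdGaussian_eq_withDensity]
  exact withDensity_absolutelyContinuous _ _

lemma integrable_stdGaussian_iff {u : E → ℝ} :
    Integrable u (stdGaussian E) ↔ Integrable fun x => u x * stdGaussianDensity x := by
  rw [stdGaussian_eq_withDensity, integrable_withDensity_iff_integrable_smul'
    (by exact continuous_stdGaussianDensity.measurable.ennreal_ofReal) (by simp)]
  simp only [ENNReal.toReal_ofReal (stdGaussianDensity_pos _).le, smul_eq_mul, mul_comm]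

lemma integral_stdGaussian_eq (u : E → ℝ) :
    ∫ x, u x ∂(stdGaussian E) = ∫ x, u x * stdGaussianDensity x := by
  rw [stdGaussian_eq_withDensity, integral_withDensity_eq_integral_toReal_smul
    (by exact continuous_stdGaussianDensity.measurable.ennreal_ofReal) (by simp)]
  simp only [ENNReal.toReal_ofReal (stdGaussianDensity_pos _).le, smul_eq_mul, mul_comm]

/-- Continuous functions of at most polynomial growth. -/
def PolyGrowth (u : E → ℝ) : Prop :=
  Continuous u ∧ ∃ (C : ℝ) (m : ℕ), 0 ≤ C ∧ ∀ x, |u x| ≤ C * (1 + ‖x‖) ^ m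

namespace PolyGrowth

lemma add {u v : E → ℝ} (hu : PolyGrowth u) (hv : PolyGrowth v) :
    PolyGrowth fun x => u x + v x := by
  obtain ⟨hu1, C, m, hC, h⟩ := hu
  obtain ⟨hv1, C', m', hC', h'⟩ := hv
  refine ⟨hu1.add hv1, C + C', m + m', by positivity, fun x => ?_⟩
  have h1 : (1 + ‖x‖) ^ m ≤ (1 + ‖x‖) ^ (m + m') :=
    pow_le_pow_right₀ (by linarith [norm_nonneg x]) (by omega)
  have h2 : (1 + ‖x‖) ^ m' ≤ (1 + ‖x‖) ^ (m + m') :=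
    pow_le_pow_right₀ (by linarith [norm_nonneg x]) (by omega)
  calc |u x + v x| ≤ |u x| + |v x| := abs_add_le _ _
    _ ≤ C * (1 + ‖x‖) ^ (m + m') + C' * (1 + ‖x‖) ^ (m + m') :=
        add_le_add ((h x).trans (mul_le_mul_of_nonneg_left h1 hC))
          ((h' x).trans (mul_le_mul_of_nonneg_left h2 hC'))
    _ = _ := by ring

lemma mul {u v : E → ℝ} (hu : PolyGrowth u) (hv : PolyGrowth v) :
    PolyGrowth fun x => u x * v x := by
  obtain ⟨hu1, C, m, hC, h⟩ := hu
  obtain ⟨hv1, C', m', hC', h'⟩ := hv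
  refine ⟨hu1.mul hv1, C * C', m + m', by positivity, fun x => ?_⟩
  calc |u x * v x| = |u x| * |v x| := abs_mul _ _
    _ ≤ (C * (1 + ‖x‖) ^ m) * (C' * (1 + ‖x‖) ^ m') :=
        mul_le_mul (h x) (h' x) (abs_nonneg _) (by positivity)
    _ = _ := by ring

lemma const (c : ℝ) : PolyGrowth fun _ : E => c :=
  ⟨continuous_const, |c|, 0, abs_nonneg c, fun x => by simp⟩

lemma neg {u : E → ℝ} (hu : PolyGrowth u) : PolyGrowth fun x => - u x := by
  simpa using (const (-1)).mul hu

lemma sub {u v : E → ℝ} (hu : PolyGrowth u) (hv : PolyGrowth v) :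
    PolyGrowth fun x => u x - v x := by
  simpa [sub_eq_add_neg] using hu.add hv.neg

lemma sum {κ : Type*} (s : Finset κ) {u : κ → E → ℝ} (hu : ∀ i ∈ s, PolyGrowth (u i)) :
    PolyGrowth fun x => ∑ i ∈ s, u i x := by
  classical
  induction s using Finset.induction_on with
  | empty => simpa using const 0
  | insert i s hi ih =>
    simp only [Finset.sum_insert hi]
    exact (hu i (by simp)).add (ih fun k hk => hu k (by simp [hk]))

lemma inner_left (e : E) : PolyGrowth fun x : E => inner ℝ e x := by
  refine ⟨by fun_prop, ‖e‖, 1, norm_nonneg e, fun x => ?_⟩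
  calc |inner ℝ e x| ≤ ‖e‖ * ‖x‖ := abs_real_inner_le_norm e x
    _ ≤ _ := by
      rw [pow_one]
      exact mul_le_mul_of_nonneg_left (by linarith) (norm_nonneg e)

lemma of_bounded {u : E → ℝ} (hc : Continuous u) {C : ℝ} (h : ∀ x, |u x| ≤ C) :
    PolyGrowth u :=
  ⟨hc, C, 0, (abs_nonneg _).trans (h 0), fun x => by simpa using h x⟩

end PolyGrowth

/-- A Gaussian vector has moments of every order. -/
lemma PolyGrowth.integrable {u : E → ℝ} (hu : PolyGrowth u) : Integrable u (stdGaussian E) := by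
  obtain ⟨hu1, C, m, hC, h⟩ := hu
  have h0 : MemLp (fun x : E => ‖x‖) (m : ENNReal) (stdGaussian E) :=
    (IsGaussian.memLp_id (stdGaussian E) (m : ENNReal) (ENNReal.natCast_ne_top m)).norm
  have h1 : MemLp (fun x : E => 1 + ‖x‖) (m : ENNReal) (stdGaussian E) :=
    (memLp_const (1 : ℝ)).add h0
  have h2 : Integrable (fun x : E => ‖1 + ‖x‖‖ ^ m) (stdGaussian E) := h1.integrable_norm_pow'
  refine (h2.const_mul C).mono' hu1.aestronglyMeasurable (Eventually.of_forall fun x => ?_)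
  rw [Real.norm_eq_abs, Real.norm_eq_abs, abs_of_nonneg (by positivity : 0 ≤ 1 + ‖x‖)]
  exact h x

/-- Gaussian integration by parts. -/
lemma integral_gaussian_by_parts {u v : E → ℝ} {u' v' : E → E →L[ℝ] ℝ} (e : E)
    (hu : ∀ x, HasFDerivAt u (u' x) x) (hv : ∀ x, HasFDerivAt v (v' x) x)
    (gu : PolyGrowth u) (gv : PolyGrowth v)
    (gu' : PolyGrowth fun x => u' x e) (gv' : PolyGrowth fun x => v' x e) :
    ∫ x, u x * (inner ℝ e x * v x - v' x e) ∂(stdGaussian E)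
      = ∫ x, v x * u' x e ∂(stdGaussian E) := by
  have hg : ∀ x, HasFDerivAt (fun x => v x * stdGaussianDensity x)
      (v x • (-(stdGaussianDensity x) • innerSL ℝ x) + stdGaussianDensity x • v' x) x :=
    fun x => (hv x).mul (hasFDerivAt_stdGaussianDensity x)
  have hg' : ∀ x, fderiv ℝ (fun x => v x * stdGaussianDensity x) x e
      = -((inner ℝ e x * v x - v' x e) * stdGaussianDensity x) := by
    intro x
    rw [(hg x).fderiv]
    simp [real_inner_comm x e]
    ring
  -- Lebesgue integration by parts, with the density attached to v: differentiating it produces the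
  -- factor ⟨e, x⟩.
  have h := integral_mul_fderiv_eq_neg_fderiv_mul_of_integrable (μ := (volume : Measure E))
    (f := u) (g := fun x => v x * stdGaussianDensity x) (v := e) ?_ ?_ ?_
    (fun x _ => (hu x).differentiableAt) (fun x _ => (hg x).differentiableAt)
  · rw [integral_stdGaussian_eq, integral_stdGaussian_eq]
    simp only [hg', (hu _).fderiv] at h
    have h3 := neg_inj.2 h
    rw [← integral_neg, neg_neg] at h3
    calc _ = _ := integral_congr_ae (Eventually.of_forall fun x => by ring)
      _ = _ := h3
      _ = _ := integral_congr_ae (Eventually.of_forall fun x => by ring)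
  · have := integrable_stdGaussian_iff.1 ((gv.mul gu').integrable)
    refine this.congr (Eventually.of_forall fun x => ?_)
    simp only [(hu x).fderiv]; ring
  · have := (integrable_stdGaussian_iff.1
      ((gu.mul (((PolyGrowth.inner_left e).mul gv).sub gv')).integrable)).neg
    refine this.congr (Eventually.of_forall fun x => ?_)
    simp only [hg', Pi.neg_apply]; ring
  · have := integrable_stdGaussian_iff.1 ((gu.mul gv).integrable)
    refine this.congr (Eventually.of_forall fun x => ?_)
    ring

end GaussianAnalysis

/-! ### Second order Stein inequality for smooth maps. -/

section SecondOrderStein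

set_option linter.unusedSectionVars false

open Module

variable {E : Type*} [NormedAddCommGroup E] [InnerProductSpace ℝ E] [FiniteDimensional ℝ E]
  [MeasurableSpace E] [BorelSpace E]

/-- Twice continuously differentiable maps with bounded first and second derivatives. -/
structure BoundedDerivs (f : E → E) : Prop where
  contDiff : ContDiff ℝ 2 f
  bound_fderiv : ∃ C, ∀ x, ‖fderiv ℝ f x‖ ≤ C
  bound_fderiv_fderiv : ∃ C, ∀ x, ‖fderiv ℝ (fderiv ℝ f) x‖ ≤ C

namespace BoundedDerivs

variable {f : E → E} (hf : BoundedDerivs f)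

include hf

lemma hasFDerivAt (x : E) : HasFDerivAt f (fderiv ℝ f x) x :=
  (hf.contDiff.differentiable (by norm_num) x).hasFDerivAt

lemma contDiff_fderiv : ContDiff ℝ 1 (fderiv ℝ f) :=
  hf.contDiff.fderiv_right (by norm_num)

lemma hasFDerivAt_fderiv (x : E) : HasFDerivAt (fderiv ℝ f) (fderiv ℝ (fderiv ℝ f) x) x :=
  (hf.contDiff_fderiv.differentiable (by norm_num) x).hasFDerivAt

lemma continuous_fderiv : Continuous (fderiv ℝ f) := hf.contDiff_fderiv.continuous

lemma continuous_fderiv_fderiv : Continuous (fderiv ℝ (fderiv ℝ f)) :=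
  hf.contDiff_fderiv.continuous_fderiv (by norm_num)

lemma norm_sub_le : ∃ C, 0 ≤ C ∧ ∀ x, ‖f x‖ ≤ ‖f 0‖ + C * ‖x‖ := by
  obtain ⟨C, hC⟩ := hf.bound_fderiv
  refine ⟨C, (norm_nonneg _).trans (hC 0), fun x => ?_⟩
  have h := convex_univ.norm_image_sub_le_of_norm_fderiv_le (𝕜 := ℝ) (f := f) (C := C)
    (fun z _ => (hf.hasFDerivAt z).differentiableAt) (fun z _ => hC z)
    (Set.mem_univ (0 : E)) (Set.mem_univ x)
  rw [sub_zero] at h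
  calc ‖f x‖ = ‖f 0 + (f x - f 0)‖ := by rw [add_sub_cancel]
    _ ≤ ‖f 0‖ + ‖f x - f 0‖ := norm_add_le _ _
    _ ≤ _ := by gcongr

lemma polyGrowth_coord (e : E) : PolyGrowth fun x => inner ℝ e (f x) := by
  obtain ⟨C, hC0, hC⟩ := hf.norm_sub_le
  have hc := hf.contDiff.continuous
  refine ⟨by fun_prop, ‖e‖ * (‖f 0‖ + C), 1, by positivity, fun x => ?_⟩
  calc |inner ℝ e (f x)| ≤ ‖e‖ * ‖f x‖ := abs_real_inner_le_norm _ _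
    _ ≤ ‖e‖ * ((‖f 0‖ + C) * (1 + ‖x‖)) := by
      refine mul_le_mul_of_nonneg_left ((hC x).trans ?_) (norm_nonneg e)
      nlinarith [norm_nonneg x, norm_nonneg (f 0)]
    _ = _ := by ring

lemma polyGrowth_fderiv (e e' : E) : PolyGrowth fun x => inner ℝ e (fderiv ℝ f x e') := by
  obtain ⟨C, hC⟩ := hf.bound_fderiv
  have hc := hf.continuous_fderiv
  refine PolyGrowth.of_bounded (by fun_prop) (C := ‖e‖ * (C * ‖e'‖)) fun x => ?_
  refine (abs_real_inner_le_norm _ _).trans (mul_le_mul_of_nonneg_left ?_ (norm_nonneg e))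
  exact ((fderiv ℝ f x).le_opNorm e').trans (mul_le_mul_of_nonneg_right (hC x) (norm_nonneg _))

lemma polyGrowth_fderiv_fderiv (e e' e'' : E) :
    PolyGrowth fun x => inner ℝ e (fderiv ℝ (fderiv ℝ f) x e' e'') := by
  obtain ⟨C, hC⟩ := hf.bound_fderiv_fderiv
  have hc := hf.continuous_fderiv_fderiv
  refine PolyGrowth.of_bounded (by fun_prop) (C := ‖e‖ * (C * ‖e'‖ * ‖e''‖)) fun x => ?_
  refine (abs_real_inner_le_norm _ _).trans (mul_le_mul_of_nonneg_left ?_ (norm_nonneg e))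
  exact ((fderiv ℝ (fderiv ℝ f) x).le_opNorm₂ e' e'').trans (by gcongr; exact hC x)

lemma hasFDerivAt_coord (e x : E) :
    HasFDerivAt (fun x => inner ℝ e (f x)) ((innerSL ℝ e).comp (fderiv ℝ f x)) x :=
  (innerSL ℝ e).hasFDerivAt.comp x (hf.hasFDerivAt x)

lemma hasFDerivAt_fderiv_coord (e e' x : E) :
    HasFDerivAt (fun x => inner ℝ e (fderiv ℝ f x e'))
      ((innerSL ℝ e).comp ((fderiv ℝ (fderiv ℝ f) x).flip e')) x := by
  have h := (hf.hasFDerivAt_fderiv x).clm_apply (hasFDerivAt_const e' x)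
  have h2 := (innerSL ℝ e).hasFDerivAt.comp x h
  refine h2.congr_fderiv ?_
  ext v
  simp

lemma fderiv_fderiv_symm (x e e' : E) :
    fderiv ℝ (fderiv ℝ f) x e e' = fderiv ℝ (fderiv ℝ f) x e' e :=
  second_derivative_symmetric (fun y => hf.hasFDerivAt y) (hf.hasFDerivAt_fderiv x) e e'

/-- The second order Stein inequality for smooth maps. -/
theorem second_order_stein {ι : Type*} [Fintype ι] (b : OrthonormalBasis ι ℝ E) :
    ∫ x, (∑ k, (inner ℝ (b k) x * inner ℝ (b k) (f x) - inner ℝ (b k) (fderiv ℝ f x (b k)))) ^ 2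
        ∂(stdGaussian E)
      ≤ ∫ x, (‖f x‖ ^ 2 + ∑ k, ‖fderiv ℝ f x (b k)‖ ^ 2) ∂(stdGaussian E) := by
  classical
  set δ : E → ℝ := fun x =>
    ∑ k, (inner ℝ (b k) x * inner ℝ (b k) (f x) - inner ℝ (b k) (fderiv ℝ f x (b k))) with hδ
  set δ' : E → E →L[ℝ] ℝ := fun x => ∑ k, ((inner ℝ (b k) x •
    ((innerSL ℝ (b k)).comp (fderiv ℝ f x)) + inner ℝ (b k) (f x) • innerSL ℝ (b k))
      - (innerSL ℝ (b k)).comp ((fderiv ℝ (fderiv ℝ f) x).flip (b k))) with hδ'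
  have hδd : ∀ x, HasFDerivAt δ (δ' x) x := by
    intro x
    refine HasFDerivAt.fun_sum fun k _ => ?_
    exact ((innerSL ℝ (b k)).hasFDerivAt.mul (hf.hasFDerivAt_coord (b k) x)).sub
      (hf.hasFDerivAt_fderiv_coord (b k) (b k) x)
  have hδe : ∀ x e, δ' x e = ∑ k, (inner ℝ (b k) x * inner ℝ (b k) (fderiv ℝ f x e)
      + inner ℝ (b k) (f x) * inner ℝ (b k) e
      - inner ℝ (b k) (fderiv ℝ (fderiv ℝ f) x e (b k))) := by
    intro x e
    simp [hδ']
  have gterm : ∀ k, PolyGrowth fun x =>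
      inner ℝ (b k) x * inner ℝ (b k) (f x) - inner ℝ (b k) (fderiv ℝ f x (b k)) := fun k =>
    ((PolyGrowth.inner_left _).mul (hf.polyGrowth_coord _)).sub (hf.polyGrowth_fderiv _ _)
  have gδ : PolyGrowth δ := PolyGrowth.sum _ fun k _ => gterm k
  have gδ' : ∀ e, PolyGrowth fun x => δ' x e := by
    intro e
    simp_rw [hδe]
    refine PolyGrowth.sum _ fun k _ => ?_
    exact (((PolyGrowth.inner_left _).mul (hf.polyGrowth_fderiv _ _)).add
      ((hf.polyGrowth_coord _).mul (PolyGrowth.const _))).sub (hf.polyGrowth_fderiv_fderiv _ _ _)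
  -- First integration by parts: one factor δ is kept as the function to differentiate, the other is
  -- expanded over the basis.
  have step1 : ∫ x, δ x ^ 2 ∂(stdGaussian E)
      = ∑ k, ∫ x, inner ℝ (b k) (f x) * δ' x (b k) ∂(stdGaussian E) := by
    have : ∀ x, δ x ^ 2 = ∑ k, δ x *
        (inner ℝ (b k) x * inner ℝ (b k) (f x) - inner ℝ (b k) (fderiv ℝ f x (b k))) := by
      intro x
      rw [← Finset.mul_sum, sq]
    simp_rw [this]
    rw [integral_finsetSum _ fun k _ => (gδ.mul (gterm k)).integrable]
    refine Finset.sum_congr rfl fun k _ => ?_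
    exact integral_gaussian_by_parts (b k) hδd (fun x => hf.hasFDerivAt_coord (b k) x) gδ
      (hf.polyGrowth_coord _) (gδ' _) (hf.polyGrowth_fderiv _ _)
  have gk : ∀ k l, PolyGrowth fun x => inner ℝ (b k) (f x) *
      (inner ℝ (b l) x * inner ℝ (b l) (fderiv ℝ f x (b k))
        - inner ℝ (b l) (fderiv ℝ (fderiv ℝ f) x (b l) (b k))) := fun k l =>
    (hf.polyGrowth_coord _).mul (((PolyGrowth.inner_left _).mul (hf.polyGrowth_fderiv _ _)).sub
      (hf.polyGrowth_fderiv_fderiv _ _ _))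
  have gkl : ∀ k l, PolyGrowth fun x => inner ℝ (b l) (fderiv ℝ f x (b k)) *
      inner ℝ (b k) (fderiv ℝ f x (b l)) := fun k l =>
    (hf.polyGrowth_fderiv _ _).mul (hf.polyGrowth_fderiv _ _)
  have gsq : ∀ k, PolyGrowth fun x => inner ℝ (b k) (f x) * inner ℝ (b k) (f x) := fun k =>
    (hf.polyGrowth_coord _).mul (hf.polyGrowth_coord _)
  -- Second integration by parts. By symmetry of the second derivative, the derivative of δ along b
  -- k is the k-th coordinate of f plus the expression ⟨x, u⟩ - div u for u = Df(b k), so the same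
  -- formula applies again. The outcome is E δ² = E(‖f‖² + tr((Df)²)).
  have step2 : ∀ k, ∫ x, inner ℝ (b k) (f x) * δ' x (b k) ∂(stdGaussian E)
      = ∫ x, (inner ℝ (b k) (f x) * inner ℝ (b k) (f x) + ∑ l,
        inner ℝ (b l) (fderiv ℝ f x (b k)) * inner ℝ (b k) (fderiv ℝ f x (b l)))
        ∂(stdGaussian E) := by
    intro k
    have e1 : ∀ x, inner ℝ (b k) (f x) * δ' x (b k) = inner ℝ (b k) (f x) * inner ℝ (b k) (f x)
        + ∑ l, inner ℝ (b k) (f x) * (inner ℝ (b l) x * inner ℝ (b l) (fderiv ℝ f x (b k))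
        - inner ℝ (b l) (fderiv ℝ (fderiv ℝ f) x (b l) (b k))) := by
      intro x
      rw [hδe]
      have : inner ℝ (b k) (f x) = ∑ l, inner ℝ (b l) (f x) * inner ℝ (b l) (b k) := by
        simp [orthonormal_iff_ite.1 b.orthonormal]
      nth_rewrite 3 [this]
      rw [Finset.mul_sum, Finset.mul_sum, ← Finset.sum_add_distrib]
      refine Finset.sum_congr rfl fun l _ => ?_
      rw [hf.fderiv_fderiv_symm x (b k) (b l)]
      ring
    simp_rw [e1]
    rw [integral_add (gsq k).integrable (PolyGrowth.sum _ fun l _ => gk k l).integrable,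
      integral_add (gsq k).integrable (PolyGrowth.sum _ fun l _ => gkl k l).integrable,
      integral_finsetSum _ fun l _ => (gk k l).integrable,
      integral_finsetSum _ fun l _ => (gkl k l).integrable]
    congr 1
    refine Finset.sum_congr rfl fun l _ => ?_
    exact integral_gaussian_by_parts (b l) (fun x => hf.hasFDerivAt_coord (b k) x)
      (fun x => hf.hasFDerivAt_fderiv_coord (b l) (b k) x) (hf.polyGrowth_coord _)
      (hf.polyGrowth_fderiv _ _) (hf.polyGrowth_fderiv _ _) (hf.polyGrowth_fderiv_fderiv _ _ _)
  have gsum : ∀ k, PolyGrowth fun x => inner ℝ (b k) (f x) * inner ℝ (b k) (f x) + ∑ l,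
        inner ℝ (b l) (fderiv ℝ f x (b k)) * inner ℝ (b k) (fderiv ℝ f x (b l)) := fun k =>
    (gsq k).add (PolyGrowth.sum _ fun l _ => gkl k l)
  have gnf : PolyGrowth fun x => ‖f x‖ ^ 2 + ∑ k, ‖fderiv ℝ f x (b k)‖ ^ 2 := by
    have e : ∀ y : E, ‖y‖ ^ 2 = ∑ l, inner ℝ (b l) y * inner ℝ (b l) y := by
      intro y
      rw [← b.sum_sq_inner_right y]
      exact Finset.sum_congr rfl fun l _ => by rw [sq]
    simp_rw [e]
    exact (PolyGrowth.sum _ fun l _ => gsq l).add (PolyGrowth.sum _ fun k _ =>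
      PolyGrowth.sum _ fun l _ => (hf.polyGrowth_fderiv _ _).mul (hf.polyGrowth_fderiv _ _))
  rw [step1, Finset.sum_congr rfl fun k _ => step2 k,
    ← integral_finsetSum _ fun k _ => (gsum k).integrable]
  refine integral_mono (PolyGrowth.sum _ fun k _ => gsum k).integrable gnf.integrable fun x => ?_
  simp only
  rw [Finset.sum_add_distrib]
  have e2 : ∀ y : E, ‖y‖ ^ 2 = ∑ l, inner ℝ (b l) y ^ 2 := fun y => (b.sum_sq_inner_right y).symm
  refine add_le_add (le_of_eq ?_) ?_
  · rw [e2]; exact Finset.sum_congr rfl fun l _ => by rw [sq]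
  -- The inequality tr(A²) ≤ ‖A‖² for the Frobenius norm, from 2xy ≤ x² + y² entrywise.
  · have h3 : ∑ k, ∑ l, inner ℝ (b l) (fderiv ℝ f x (b k)) * inner ℝ (b k) (fderiv ℝ f x (b l))
        ≤ ∑ k, ∑ l, (inner ℝ (b l) (fderiv ℝ f x (b k)) ^ 2
          + inner ℝ (b k) (fderiv ℝ f x (b l)) ^ 2) / 2 := by
      refine Finset.sum_le_sum fun k _ => Finset.sum_le_sum fun l _ => ?_
      nlinarith [sq_nonneg (inner ℝ (b l) (fderiv ℝ f x (b k))
        - inner ℝ (b k) (fderiv ℝ f x (b l)))]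
    refine h3.trans (le_of_eq ?_)
    simp_rw [e2, add_div, Finset.sum_add_distrib]
    rw [Finset.sum_comm (f := fun k l => inner ℝ (b k) (fderiv ℝ f x (b l)) ^ 2 / 2),
      ← Finset.sum_add_distrib]
    refine Finset.sum_congr rfl fun k _ => ?_
    rw [← Finset.sum_add_distrib]
    exact Finset.sum_congr rfl fun l _ => by ring

end BoundedDerivs

end SecondOrderStein

/-! ### Gaussian Poincaré inequality by rotation, and comparison with an independent copy. -/

section GaussianRotation

set_option linter.unusedSectionVars false

open Module

variable {E : Type*} [NormedAddCommGroup E] [InnerProductSpace ℝ E] [FiniteDimensional ℝ E]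
  [MeasurableSpace E] [BorelSpace E]

/-- Nonnegativity of the integral of the squared deviation of v from its mean I / c. -/
lemma sq_integral_le_mul_integral_sq {v : ℝ → ℝ} (hv : Continuous v) {c : ℝ} (hc : 0 < c) :
    (∫ θ in (0 : ℝ)..c, v θ) ^ 2 ≤ c * ∫ θ in (0 : ℝ)..c, v θ ^ 2 := by
  set I := ∫ θ in (0 : ℝ)..c, v θ with hI
  have h0 : 0 ≤ ∫ θ in (0 : ℝ)..c, (v θ - I / c) ^ 2 :=
    intervalIntegral.integral_nonneg hc.le fun θ _ => sq_nonneg _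
  have h1 : ∫ θ in (0 : ℝ)..c, (v θ - I / c) ^ 2
      = (∫ θ in (0 : ℝ)..c, v θ ^ 2) - 2 * (I / c) * I + c * (I / c) ^ 2 := by
    have : ∀ θ, (v θ - I / c) ^ 2 = v θ ^ 2 - 2 * (I / c) * v θ + (I / c) ^ 2 := fun θ => by ring
    simp_rw [this]
    rw [intervalIntegral.integral_add, intervalIntegral.integral_sub,
      intervalIntegral.integral_const_mul]
    · simp [hI]
    all_goals exact Continuous.intervalIntegrable (by fun_prop) _ _
  rw [h1] at h0
  have h2 : c * ((∫ θ in (0 : ℝ)..c, v θ ^ 2) - 2 * (I / c) * I + c * (I / c) ^ 2)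
      = c * (∫ θ in (0 : ℝ)..c, v θ ^ 2) - I ^ 2 := by
    field_simp
    ring
  nlinarith [mul_nonneg hc.le h0]

/-- Integration by parts against the constant function 1. -/
lemma integral_inner_sq_stdGaussian (v : E) :
    ∫ x, inner ℝ v x ^ 2 ∂(stdGaussian E) = ‖v‖ ^ 2 := by
  have h := integral_gaussian_by_parts (u := fun x => inner ℝ v x) (v := fun _ => (1 : ℝ))
    (u' := fun _ => innerSL ℝ v) (v' := fun _ => 0) v (fun x => (innerSL ℝ v).hasFDerivAt)
    (fun x => hasFDerivAt_const _ _) (PolyGrowth.inner_left v) (PolyGrowth.const 1)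
    (PolyGrowth.const _) (PolyGrowth.const _)
  simp only [mul_one, _root_.zero_apply, sub_zero, one_mul, innerSL_apply_apply,
    integral_const, probReal_univ, real_inner_self_eq_norm_sq, smul_eq_mul] at h
  rw [← h]
  exact integral_congr_ae (Eventually.of_forall fun x => by simp only [sq])

lemma integrable_inner_sq_stdGaussian (v : E) :
    Integrable (fun x => inner ℝ v x ^ 2) (stdGaussian E) := by
  simp_rw [sq]
  exact ((PolyGrowth.inner_left v).mul (PolyGrowth.inner_left v)).integrable

lemma lintegral_inner_sq_stdGaussian (v : E) :
    ∫⁻ x, ENNReal.ofReal (inner ℝ v x ^ 2) ∂(stdGaussian E) = ENNReal.ofReal (‖v‖ ^ 2) := by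
  rw [← integral_inner_sq_stdGaussian v, ofReal_integral_eq_lintegral_ofReal
    (integrable_inner_sq_stdGaussian v) (Eventually.of_forall fun x => sq_nonneg _)]

lemma lintegral_norm_apply_sq_stdGaussian {ι : Type*} [Fintype ι] (b : OrthonormalBasis ι ℝ E)
    (A : E →L[ℝ] E) :
    ∫⁻ x, ENNReal.ofReal (‖A x‖ ^ 2) ∂(stdGaussian E)
      = ENNReal.ofReal (∑ k, ‖A (b k)‖ ^ 2) := by
  have e : ∀ y : E, ‖y‖ ^ 2 = ∑ l, inner ℝ (b l) y ^ 2 := fun y => (b.sum_sq_inner_right y).symm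
  have h1 : ∀ x, ENNReal.ofReal (‖A x‖ ^ 2)
      = ∑ l, ENNReal.ofReal (inner ℝ (A.adjoint (b l)) x ^ 2) := by
    intro x
    rw [e, ENNReal.ofReal_sum_of_nonneg fun l _ => sq_nonneg _]
    exact Finset.sum_congr rfl fun l _ => by rw [ContinuousLinearMap.adjoint_inner_left]
  simp_rw [h1]
  rw [lintegral_finsetSum _ fun l _ => by fun_prop]
  simp_rw [lintegral_inner_sq_stdGaussian]
  rw [← ENNReal.ofReal_sum_of_nonneg fun l _ => sq_nonneg _]
  congr 1
  simp_rw [e]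
  rw [Finset.sum_comm]
  refine Finset.sum_congr rfl fun k _ => Finset.sum_congr rfl fun l _ => ?_
  rw [ContinuousLinearMap.adjoint_inner_right, real_inner_comm]

/-- The derivative is integrated along the quarter circle θ ↦ cos θ x + sin θ x', not along a
segment, because position and velocity on it form a rotation of the pair (x, x'). -/
lemma BoundedDerivs.norm_sub_sq_le_rotation {f : E → E} (hf : BoundedDerivs f) (x x' : E) :
    ‖f x - f x'‖ ^ 2 ≤ (Real.pi / 2) * ∫ θ in (0 : ℝ)..(Real.pi / 2),
      ‖fderiv ℝ f (Real.cos θ • x + Real.sin θ • x') (-Real.sin θ • x + Real.cos θ • x')‖ ^ 2 := by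
  have hc := hf.continuous_fderiv
  have hderiv : ∀ θ : ℝ, HasDerivAt (fun θ => f (Real.cos θ • x + Real.sin θ • x'))
      (fderiv ℝ f (Real.cos θ • x + Real.sin θ • x') (-Real.sin θ • x + Real.cos θ • x')) θ := by
    intro θ
    have h1 : HasDerivAt (fun θ : ℝ => Real.cos θ • x + Real.sin θ • x')
        (-Real.sin θ • x + Real.cos θ • x') θ :=
      ((Real.hasDerivAt_cos θ).smul_const x).add ((Real.hasDerivAt_sin θ).smul_const x')
    exact (hf.hasFDerivAt _).comp_hasDerivAt θ h1
  have hcont : Continuous fun θ : ℝ =>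
      fderiv ℝ f (Real.cos θ • x + Real.sin θ • x') (-Real.sin θ • x + Real.cos θ • x') := by
    fun_prop
  have h2 := intervalIntegral.integral_eq_sub_of_hasDerivAt (fun θ _ => hderiv θ)
    (hcont.intervalIntegrable 0 (Real.pi / 2))
  simp only [Real.cos_pi_div_two, zero_smul, Real.sin_pi_div_two, one_smul, zero_add,
    Real.cos_zero, Real.sin_zero, add_zero] at h2
  rw [norm_sub_rev, ← h2]
  refine le_trans ?_ (sq_integral_le_mul_integral_sq hcont.norm (by positivity))
  exact pow_le_pow_left₀ (norm_nonneg _)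
    (intervalIntegral.norm_integral_le_integral_norm (by positivity)) 2

/-- A Gaussian Poincaré inequality, for two independent copies. -/
theorem BoundedDerivs.lintegral_norm_sub_sq_le {f : E → E} (hf : BoundedDerivs f)
    {ι : Type*} [Fintype ι] (b : OrthonormalBasis ι ℝ E) :
    ∫⁻ x', ∫⁻ x, ENNReal.ofReal (‖f x - f x'‖ ^ 2) ∂(stdGaussian E) ∂(stdGaussian E)
      ≤ ENNReal.ofReal (Real.pi ^ 2 / 4) *
        ∫⁻ x, ENNReal.ofReal (∑ k, ‖fderiv ℝ f x (b k)‖ ^ 2) ∂(stdGaussian E) := by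
  have hc := hf.continuous_fderiv
  have hc0 := hf.contDiff.continuous
  set γ := stdGaussian E with hγ
  set G : E × E → ENNReal := fun z => ENNReal.ofReal (‖fderiv ℝ f z.1 z.2‖ ^ 2) with hG
  have hGm : Measurable G := by
    have : Continuous fun z : E × E => ‖fderiv ℝ f z.1 z.2‖ ^ 2 := by fun_prop
    exact this.measurable.ennreal_ofReal
  have hpt : ∀ z : E × E, ENNReal.ofReal (‖f z.1 - f z.2‖ ^ 2)
      ≤ ENNReal.ofReal (Real.pi / 2) * ∫⁻ θ in Set.Ioc (0 : ℝ) (Real.pi / 2),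
        G (ContinuousLinearMap.rotation θ z) := by
    intro z
    refine (ENNReal.ofReal_le_ofReal (hf.norm_sub_sq_le_rotation z.1 z.2)).trans ?_
    rw [ENNReal.ofReal_mul (by positivity), intervalIntegral.integral_of_le (by positivity),
      ofReal_integral_eq_lintegral_ofReal]
    · simp only [hG, ContinuousLinearMap.rotation_apply]
      exact le_rfl
    · have : Continuous fun θ : ℝ => ‖fderiv ℝ f (Real.cos θ • z.1 + Real.sin θ • z.2)
          (-Real.sin θ • z.1 + Real.cos θ • z.2)‖ ^ 2 := by fun_prop
      exact (this.integrableOn_Icc).mono_set Set.Ioc_subset_Icc_self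
    · exact Eventually.of_forall fun θ => sq_nonneg _
  have hmeas : Measurable fun q : (E × E) × ℝ => G (ContinuousLinearMap.rotation q.2 q.1) := by
    refine hGm.comp ?_
    have : Continuous fun q : (E × E) × ℝ => ContinuousLinearMap.rotation q.2 q.1 := by
      simp only [ContinuousLinearMap.rotation_apply]
      fun_prop
    exact this.measurable
  -- Rotation invariance makes position and velocity independent standard Gaussian vectors for each
  -- θ. Averaging ‖Df(position) velocity‖² over the velocity gives the squared Frobenius norm.
  have hmap : ∀ θ : ℝ, ∫⁻ z, G (ContinuousLinearMap.rotation θ z) ∂(γ.prod γ)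
      = ∫⁻ x, ENNReal.ofReal (∑ k, ‖fderiv ℝ f x (b k)‖ ^ 2) ∂γ := by
    intro θ
    have h1 := IsGaussian.map_rotation_eq_self (μ := γ)
      (integral_id_stdGaussian (E := E)) θ
    have h2 : ∫⁻ z, G z ∂((γ.prod γ).map (ContinuousLinearMap.rotation θ))
        = ∫⁻ z, G (ContinuousLinearMap.rotation θ z) ∂(γ.prod γ) :=
      lintegral_map hGm (by fun_prop)
    rw [← h2, h1, lintegral_prod _ hGm.aemeasurable]
    refine lintegral_congr fun x => ?_
    exact lintegral_norm_apply_sq_stdGaussian b (fderiv ℝ f x)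
  have hleft : ∫⁻ x', ∫⁻ x, ENNReal.ofReal (‖f x - f x'‖ ^ 2) ∂γ ∂γ
      = ∫⁻ z, ENNReal.ofReal (‖f z.1 - f z.2‖ ^ 2) ∂(γ.prod γ) := by
    rw [lintegral_prod_symm _ (by fun_prop)]
  rw [hleft]
  calc ∫⁻ z, ENNReal.ofReal (‖f z.1 - f z.2‖ ^ 2) ∂(γ.prod γ)
      ≤ ∫⁻ z, (ENNReal.ofReal (Real.pi / 2) * ∫⁻ θ in Set.Ioc (0 : ℝ) (Real.pi / 2),
        G (ContinuousLinearMap.rotation θ z)) ∂(γ.prod γ) := lintegral_mono hpt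
    _ = ENNReal.ofReal (Real.pi / 2) * ∫⁻ z, (∫⁻ θ in Set.Ioc (0 : ℝ) (Real.pi / 2),
        G (ContinuousLinearMap.rotation θ z)) ∂(γ.prod γ) :=
        lintegral_const_mul _ hmeas.lintegral_prod_right'
    _ = ENNReal.ofReal (Real.pi / 2) * ∫⁻ θ in Set.Ioc (0 : ℝ) (Real.pi / 2),
        (∫⁻ z, G (ContinuousLinearMap.rotation θ z) ∂(γ.prod γ)) := by
        rw [lintegral_lintegral_swap hmeas.aemeasurable]
    _ = _ := by
        simp_rw [hmap]
        rw [setLIntegral_const, Real.volume_Ioc, sub_zero, mul_comm (lintegral _ _), ← mul_assoc,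
          ← ENNReal.ofReal_mul (by positivity)]
        congr 2
        ring

/-- The comparison of the divergence `⟪x, f x⟫ - div f x` with the linear functional given by
the value of `f` at an independent copy, for smooth maps. -/
theorem BoundedDerivs.lintegral_divergence_sub_sq_le {f : E → E} (hf : BoundedDerivs f)
    {ι : Type*} [Fintype ι] (b : OrthonormalBasis ι ℝ E) :
    ∫⁻ x', ∫⁻ x, ENNReal.ofReal ((inner ℝ x (f x - f x')
        - ∑ k, inner ℝ (b k) (fderiv ℝ f x (b k))) ^ 2) ∂(stdGaussian E) ∂(stdGaussian E)
      ≤ ENNReal.ofReal (Real.pi ^ 2 / 4 + 1) *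
        ∫⁻ x, ENNReal.ofReal (∑ k, ‖fderiv ℝ f x (b k)‖ ^ 2) ∂(stdGaussian E) := by
  have hc := hf.continuous_fderiv
  have hc0 := hf.contDiff.continuous
  have e : ∀ y : E, ‖y‖ ^ 2 = ∑ l, inner ℝ (b l) y * inner ℝ (b l) y := by
    intro y
    rw [← b.sum_sq_inner_right y]
    exact Finset.sum_congr rfl fun l _ => by rw [sq]
  -- For fixed x' the map x ↦ f x - f x' has the derivative of f, so the Stein inequality applies to
  -- it. The Poincaré inequality then handles ‖f x - f x'‖².
  have hin : ∀ x', ∫⁻ x, ENNReal.ofReal ((inner ℝ x (f x - f x')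
        - ∑ k, inner ℝ (b k) (fderiv ℝ f x (b k))) ^ 2) ∂(stdGaussian E)
      ≤ (∫⁻ x, ENNReal.ofReal (‖f x - f x'‖ ^ 2) ∂(stdGaussian E))
        + ∫⁻ x, ENNReal.ofReal (∑ k, ‖fderiv ℝ f x (b k)‖ ^ 2) ∂(stdGaussian E) := by
    intro x'
    have hfd : fderiv ℝ (fun x => f x - f x') = fderiv ℝ f := by
      ext1 x; exact fderiv_sub_const _
    have hb : BoundedDerivs fun x => f x - f x' := by
      refine ⟨hf.contDiff.sub contDiff_const, ?_, ?_⟩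
      · rw [hfd]; exact hf.bound_fderiv
      · rw [hfd]; exact hf.bound_fderiv_fderiv
    have h1 := hb.second_order_stein b
    rw [hfd] at h1
    have e3 : ∀ x, inner ℝ x (f x - f x') - ∑ k, inner ℝ (b k) (fderiv ℝ f x (b k))
        = ∑ k, (inner ℝ (b k) x * inner ℝ (b k) (f x - f x')
          - inner ℝ (b k) (fderiv ℝ f x (b k))) := by
      intro x
      rw [Finset.sum_sub_distrib, ← b.sum_inner_mul_inner x (f x - f x')]
      simp_rw [real_inner_comm x]
    have gn : PolyGrowth fun x => ‖f x - f x'‖ ^ 2 := by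
      simp_rw [e]
      exact PolyGrowth.sum _ fun l _ => (hb.polyGrowth_coord _).mul (hb.polyGrowth_coord _)
    have gd : PolyGrowth fun x => ∑ k, ‖fderiv ℝ f x (b k)‖ ^ 2 := by
      simp_rw [e]
      exact PolyGrowth.sum _ fun k _ => PolyGrowth.sum _ fun l _ =>
        (hf.polyGrowth_fderiv _ _).mul (hf.polyGrowth_fderiv _ _)
    have gs : PolyGrowth fun x => ∑ k, (inner ℝ (b k) x * inner ℝ (b k) (f x - f x')
          - inner ℝ (b k) (fderiv ℝ f x (b k))) :=
      PolyGrowth.sum _ fun k _ => ((PolyGrowth.inner_left _).mul (hb.polyGrowth_coord _)).sub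
        (hf.polyGrowth_fderiv _ _)
    simp_rw [e3]
    rw [← ofReal_integral_eq_lintegral_ofReal (by simpa only [sq] using (gs.mul gs).integrable)
      (Eventually.of_forall fun x => sq_nonneg _)]
    refine (ENNReal.ofReal_le_ofReal h1).trans (le_of_eq ?_)
    rw [integral_add gn.integrable gd.integrable, ENNReal.ofReal_add
      (integral_nonneg fun x => sq_nonneg _)
      (integral_nonneg fun x => Finset.sum_nonneg fun k _ => sq_nonneg _),
      ofReal_integral_eq_lintegral_ofReal gn.integrable
        (Eventually.of_forall fun x => sq_nonneg _),
      ofReal_integral_eq_lintegral_ofReal gd.integrable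
        (Eventually.of_forall fun x => Finset.sum_nonneg fun k _ => sq_nonneg _)]
  refine (lintegral_mono hin).trans ?_
  rw [lintegral_add_right _ measurable_const, lintegral_const, measure_univ, mul_one,
    ENNReal.ofReal_add (by positivity) zero_le_one, ENNReal.ofReal_one, add_mul, one_mul]
  gcongr
  exact hf.lintegral_norm_sub_sq_le b

end GaussianRotation

/-! ### Extension of the Gaussian inequality to Lipschitz maps. -/

section Mollification

set_option linter.unusedSectionVars false

open Module

variable {E : Type*} [NormedAddCommGroup E] [InnerProductSpace ℝ E] [FiniteDimensional ℝ E]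
  [MeasurableSpace E] [BorelSpace E]

/-- The regularization of `f` by convolution with a normalized bump function. -/
noncomputable def mollify (φ : ContDiffBump (0 : E)) (f : E → E) : E → E :=
  convolution (φ.normed volume) f (ContinuousLinearMap.lsmul ℝ ℝ) volume

variable {f : E → E} {C : NNReal}

lemma norm_fderiv_le_of_lipschitzWith (hf : LipschitzWith C f) (x : E) : ‖fderiv ℝ f x‖ ≤ C :=
  norm_fderiv_le_of_lipschitz ℝ hf

lemma locallyIntegrable_fderiv_of_lipschitzWith (hf : LipschitzWith C f) :
    LocallyIntegrable (fderiv ℝ f) (volume : Measure E) := by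
  refine (locallyIntegrable_const (C : ℝ)).mono (measurable_fderiv ℝ f).aestronglyMeasurable
    (Eventually.of_forall fun x => ?_)
  simpa using norm_fderiv_le_of_lipschitzWith hf x

/-- Differentiation under the integral sign with the derivative on f: it exists almost everywhere by
Rademacher's theorem, and the Lipschitz constant gives the dominating function. The derivative of
the mollification is therefore an average of derivatives of f, with the same bound. -/
lemma hasFDerivAt_mollify (φ : ContDiffBump (0 : E)) (hf : LipschitzWith C f) (x : E) :
    HasFDerivAt (mollify φ f)
      (convolution (φ.normed volume) (fderiv ℝ f) (ContinuousLinearMap.lsmul ℝ ℝ) volume x) x := by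
  have hφc := (φ.contDiff_normed (μ := (volume : Measure E)) (n := 0)).continuous
  have hφs := φ.hasCompactSupport_normed (μ := (volume : Measure E))
  have hfc := hf.continuous
  refine (hasFDerivAt_integral_of_dominated_loc_of_lip (μ := (volume : Measure E))
    (F := fun x t => φ.normed volume t • f (x - t))
    (F' := fun t => φ.normed volume t • fderiv ℝ f (x - t))
    (bound := fun t => φ.normed volume t * C) (s := Set.univ) (x₀ := x) univ_mem
    ?_ ?_ ?_ ?_ ?_ ?_).2
  · exact Eventually.of_forall fun y =>
      (by fun_prop : Continuous fun t => φ.normed volume t • f (y - t)).aestronglyMeasurable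
  · exact (by fun_prop : Continuous fun t => φ.normed volume t • f (x - t)).integrable_of_hasCompactSupport
      hφs.smul_right
  · exact (hφc.measurable.smul ((measurable_fderiv ℝ f).comp
      (measurable_const.sub measurable_id))).aestronglyMeasurable
  · refine Eventually.of_forall fun t => LipschitzOnWith.of_dist_le_mul fun y _ z _ => ?_
    rw [dist_eq_norm, ← smul_sub, norm_smul, Real.coe_nnabs,
      Real.norm_of_nonneg (φ.nonneg_normed t),
      abs_of_nonneg (mul_nonneg (φ.nonneg_normed (μ := (volume : Measure E)) t) C.coe_nonneg),
      mul_assoc]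
    refine mul_le_mul_of_nonneg_left ?_ (φ.nonneg_normed t)
    have := hf.dist_le_mul (y - t) (z - t)
    rwa [dist_eq_norm, dist_sub_right] at this
  · exact ((φ.integrable_normed).mul_const _)
  · have h1 := hf.ae_differentiableAt (μ := (volume : Measure E))
    have h2 := (Measure.measurePreserving_sub_left (volume : Measure E) x).quasiMeasurePreserving.ae h1
    filter_upwards [h2] with t ht
    have h3 : HasFDerivAt (fun y => f (y - t)) (fderiv ℝ f (x - t)) x := by
      have := ht.hasFDerivAt.comp x ((hasFDerivAt_id x).sub_const t)
      simpa [Function.comp_def] using this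
    exact h3.const_smul (φ.normed volume t)

lemma norm_fderiv_mollify_le (φ : ContDiffBump (0 : E)) (hf : LipschitzWith C f) (x : E) :
    ‖fderiv ℝ (mollify φ f) x‖ ≤ C := by
  rw [(hasFDerivAt_mollify φ hf x).fderiv]
  have h := norm_integral_le_of_norm_le (μ := (volume : Measure E))
    (f := fun t => φ.normed volume t • fderiv ℝ f (x - t))
    ((φ.integrable_normed (μ := (volume : Measure E))).mul_const (C : ℝ))
    (Eventually.of_forall fun t => by
      rw [norm_smul, Real.norm_of_nonneg (φ.nonneg_normed t)]
      exact mul_le_mul_of_nonneg_left (norm_fderiv_le_of_lipschitzWith hf _) (φ.nonneg_normed t))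
  rw [integral_mul_const, φ.integral_normed, one_mul] at h
  exact h

/-- For the second derivative, one derivative falls on f, where it is bounded by C, and the other on
the bump function, whose derivative is integrable. -/
lemma boundedDerivs_mollify (φ : ContDiffBump (0 : E)) (hf : LipschitzWith C f) :
    BoundedDerivs (mollify φ f) := by
  have hφs := φ.hasCompactSupport_normed (μ := (volume : Measure E))
  have hφ1 := φ.contDiff_normed (μ := (volume : Measure E)) (n := 1)
  refine ⟨?_, ⟨C, norm_fderiv_mollify_le φ hf⟩, ?_⟩
  · exact hφs.contDiff_convolution_left (n := 2) _ (φ.contDiff_normed)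
      hf.continuous.locallyIntegrable
  · have hfd : fderiv ℝ (mollify φ f) = convolution (φ.normed volume) (fderiv ℝ f)
        (ContinuousLinearMap.lsmul ℝ ℝ) volume := by
      ext1 x
      exact (hasFDerivAt_mollify φ hf x).fderiv
    have hci : Integrable (fun t => ‖fderiv ℝ (φ.normed (volume : Measure E)) t‖ * (C : ℝ))
        (volume : Measure E) := by
      refine Integrable.mul_const ?_ _
      exact ((hφ1.continuous_fderiv (by norm_num)).integrable_of_hasCompactSupport
        (hφs.fderiv ℝ)).norm
    refine ⟨∫ t, ‖fderiv ℝ (φ.normed (volume : Measure E)) t‖ * C, fun x => ?_⟩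
    have h := hφs.hasFDerivAt_convolution_left (μ := (volume : Measure E))
      (ContinuousLinearMap.lsmul ℝ ℝ : ℝ →L[ℝ] (E →L[ℝ] E) →L[ℝ] (E →L[ℝ] E)) hφ1
      (locallyIntegrable_fderiv_of_lipschitzWith hf) x
    rw [hfd, h.fderiv]
    refine norm_integral_le_of_norm_le hci (Eventually.of_forall fun t => ?_)
    refine ContinuousLinearMap.opNorm_le_bound _ (by positivity) fun v => ?_
    rw [ContinuousLinearMap.precompL_apply, ContinuousLinearMap.lsmul_apply, norm_smul]
    calc _ ≤ (‖fderiv ℝ (φ.normed (volume : Measure E)) t‖ * ‖v‖) * C :=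
          mul_le_mul (ContinuousLinearMap.le_opNorm _ v) (norm_fderiv_le_of_lipschitzWith hf _)
            (norm_nonneg _) (by positivity)
      _ = _ := by ring

/-- Bump functions with support shrinking to the origin. -/
noncomputable def shrinkingBump (m : ℕ) : ContDiffBump (0 : E) where
  rIn := 1 / ((m : ℝ) + 1)
  rOut := 2 / ((m : ℝ) + 1)
  rIn_pos := by positivity
  rIn_lt_rOut := by
    apply div_lt_div_of_pos_right _ (by positivity)
    norm_num

lemma tendsto_rOut_shrinkingBump :
    Tendsto (fun m => (shrinkingBump m : ContDiffBump (0 : E)).rOut) atTop (𝓝 0) := by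
  have h := (tendsto_one_div_add_atTop_nhds_zero_nat (𝕜 := ℝ)).const_mul 2
  simp only [mul_zero] at h
  refine h.congr fun m => ?_
  simp [shrinkingBump, div_eq_mul_inv]

lemma tendsto_mollify (hf : LipschitzWith C f) (x : E) :
    Tendsto (fun m => mollify (shrinkingBump m) f x) atTop (𝓝 (f x)) :=
  ContDiffBump.convolution_tendsto_right_of_continuous tendsto_rOut_shrinkingBump hf.continuous x

/-- Lebesgue differentiation applied to the locally integrable function Df. The bounded ratio of the
two radii of the bumps, equal to 2, is what that theorem requires. -/
lemma ae_tendsto_fderiv_mollify (hf : LipschitzWith C f) :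
    ∀ᵐ x ∂(volume : Measure E),
      Tendsto (fun m => fderiv ℝ (mollify (shrinkingBump m) f) x) atTop (𝓝 (fderiv ℝ f x)) := by
  have h := ContDiffBump.ae_convolution_tendsto_right_of_locallyIntegrable
    (μ := (volume : Measure E)) (φ := fun m => (shrinkingBump m : ContDiffBump (0 : E))) (K := 2)
    tendsto_rOut_shrinkingBump (Eventually.of_forall fun m => by
      simp only [shrinkingBump]; rw [← mul_div_assoc, mul_one])
    (locallyIntegrable_fderiv_of_lipschitzWith hf)
  filter_upwards [h] with x hx
  exact hx.congr fun m => (hasFDerivAt_mollify _ hf x).fderiv.symm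

/-- The comparison of the divergence `⟪x, f x⟫ - div f x` with the linear functional given by
the value of `f` at an independent copy, for Lipschitz maps. -/
theorem lintegral_divergence_sub_sq_le (hf : LipschitzWith C f)
    {ι : Type*} [Fintype ι] (b : OrthonormalBasis ι ℝ E) :
    ∫⁻ x', ∫⁻ x, ENNReal.ofReal ((inner ℝ x (f x - f x')
        - ∑ k, inner ℝ (b k) (fderiv ℝ f x (b k))) ^ 2) ∂(stdGaussian E) ∂(stdGaussian E)
      ≤ ENNReal.ofReal (Real.pi ^ 2 / 4 + 1) *
        ∫⁻ x, ENNReal.ofReal (∑ k, ‖fderiv ℝ f x (b k)‖ ^ 2) ∂(stdGaussian E) := by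
  set fm : ℕ → E → E := fun m => mollify (shrinkingBump m) f with hfm
  have hb : ∀ m, BoundedDerivs (fm m) := fun m => boundedDerivs_mollify _ hf
  have hlim : ∀ᵐ x ∂(stdGaussian E),
      Tendsto (fun m => fderiv ℝ (fm m) x) atTop (𝓝 (fderiv ℝ f x)) :=
    stdGaussian_absolutelyContinuous.ae_le (ae_tendsto_fderiv_mollify hf)
  have hcont : ∀ m, Continuous fun z : E × E => (inner ℝ z.2 (fm m z.2 - fm m z.1)
      - ∑ k, inner ℝ (b k) (fderiv ℝ (fm m) z.2 (b k))) ^ 2 := by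
    intro m
    have h1 := (hb m).contDiff.continuous
    have h2 := (hb m).continuous_fderiv
    fun_prop
  have hmeas : ∀ m, Measurable fun z : E × E => ENNReal.ofReal ((inner ℝ z.2
      (fm m z.2 - fm m z.1) - ∑ k, inner ℝ (b k) (fderiv ℝ (fm m) z.2 (b k))) ^ 2) :=
    fun m => (hcont m).measurable.ennreal_ofReal
  -- The right side must converge, not merely be bounded below: the derivatives are bounded by C
  -- uniformly in m, which permits dominated convergence.
  have hR : Tendsto (fun m => ∫⁻ x, ENNReal.ofReal (∑ k, ‖fderiv ℝ (fm m) x (b k)‖ ^ 2)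
      ∂(stdGaussian E)) atTop
      (𝓝 (∫⁻ x, ENNReal.ofReal (∑ k, ‖fderiv ℝ f x (b k)‖ ^ 2) ∂(stdGaussian E))) := by
    refine tendsto_lintegral_of_dominated_convergence
      (fun _ => ENNReal.ofReal (∑ _k : ι, (C : ℝ) ^ 2)) (fun m => ?_) (fun m => ?_) ?_ ?_
    · have h2 := (hb m).continuous_fderiv
      exact (by fun_prop : Continuous fun x =>
        ∑ k, ‖fderiv ℝ (fm m) x (b k)‖ ^ 2).measurable.ennreal_ofReal
    · refine Eventually.of_forall fun x => ENNReal.ofReal_le_ofReal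
        (Finset.sum_le_sum fun k _ => pow_le_pow_left₀ (norm_nonneg _) ?_ 2)
      have h := (fderiv ℝ (fm m) x).le_opNorm (b k)
      rw [b.norm_eq_one, mul_one] at h
      exact h.trans (norm_fderiv_mollify_le _ hf x)
    · rw [lintegral_const]
      exact ENNReal.mul_ne_top ENNReal.ofReal_ne_top (measure_ne_top _ _)
    · filter_upwards [hlim] with x hx
      have hc : Continuous fun A : E →L[ℝ] E => ENNReal.ofReal (∑ k, ‖A (b k)‖ ^ 2) :=
        ENNReal.continuous_ofReal.comp (by fun_prop)
      exact (hc.tendsto _).comp hx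
  -- On the left side Fatou's lemma suffices, once here for fixed x' and once more for the outer
  -- integral.
  have hinner : ∀ x', ∫⁻ x, ENNReal.ofReal ((inner ℝ x (f x - f x')
        - ∑ k, inner ℝ (b k) (fderiv ℝ f x (b k))) ^ 2) ∂(stdGaussian E)
      ≤ liminf (fun m => ∫⁻ x, ENNReal.ofReal ((inner ℝ x (fm m x - fm m x')
        - ∑ k, inner ℝ (b k) (fderiv ℝ (fm m) x (b k))) ^ 2) ∂(stdGaussian E)) atTop := by
    intro x'
    refine le_trans (lintegral_mono_ae ?_) (lintegral_liminf_le fun m =>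
      (hmeas m).comp measurable_prodMk_left)
    filter_upwards [hlim] with x hx
    have h1 : Tendsto (fun m => ENNReal.ofReal ((inner ℝ x (fm m x - fm m x')
        - ∑ k, inner ℝ (b k) (fderiv ℝ (fm m) x (b k))) ^ 2)) atTop
        (𝓝 (ENNReal.ofReal ((inner ℝ x (f x - f x')
        - ∑ k, inner ℝ (b k) (fderiv ℝ f x (b k))) ^ 2))) := by
      refine (ENNReal.continuous_ofReal.tendsto _).comp (Tendsto.pow (Tendsto.sub ?_ ?_) 2)
      · exact (tendsto_const_nhds).inner ((tendsto_mollify hf x).sub (tendsto_mollify hf x'))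
      · have hc : Continuous fun A : E →L[ℝ] E => ∑ k, inner ℝ (b k) (A (b k)) := by
          fun_prop
        exact (hc.tendsto _).comp hx
    exact h1.liminf_eq.ge
  calc _ ≤ ∫⁻ x', liminf (fun m => ∫⁻ x, ENNReal.ofReal ((inner ℝ x (fm m x - fm m x')
        - ∑ k, inner ℝ (b k) (fderiv ℝ (fm m) x (b k))) ^ 2) ∂(stdGaussian E)) atTop
        ∂(stdGaussian E) := lintegral_mono hinner
    _ ≤ liminf (fun m => ∫⁻ x', ∫⁻ x, ENNReal.ofReal ((inner ℝ x (fm m x - fm m x')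
        - ∑ k, inner ℝ (b k) (fderiv ℝ (fm m) x (b k))) ^ 2) ∂(stdGaussian E)
        ∂(stdGaussian E)) atTop := lintegral_liminf_le fun m => (hmeas m).lintegral_prod_right'
    _ ≤ liminf (fun m => ENNReal.ofReal (Real.pi ^ 2 / 4 + 1) *
        ∫⁻ x, ENNReal.ofReal (∑ k, ‖fderiv ℝ (fm m) x (b k)‖ ^ 2) ∂(stdGaussian E)) atTop :=
        liminf_le_liminf (Eventually.of_forall fun m => (hb m).lintegral_divergence_sub_sq_le b)
    _ = _ := (ENNReal.Tendsto.const_mul hR (Or.inr ENNReal.ofReal_ne_top)).liminf_eq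

end Mollification

/-! ### Deterministic perturbation theory of the estimator. -/

section Estimator

/-- The deterministic assumptions on the loss, the penalty and the constants. -/
structure Regular {p : ℕ} (n : ℕ) (ρ : ℝ → ℝ) (g : EuclideanSpace ℝ (Fin p) → ℝ)
    (τ K : ℝ) (L : NNReal) : Prop where
  loss : LossAssumption ρ K L
  penalty : PenaltyAssumption g τ
  τ_pos : 0 < τ
  K_pos : 0 < K
  L_pos : 0 < (L : ℝ)
  n_pos : 0 < (n : ℝ)

section Loss

variable {ρ : ℝ → ℝ} {K : ℝ} {L : NNReal} (hρ : LossAssumption ρ K L)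

include hρ

lemma LossAssumption.hasDerivAt (x : ℝ) : HasDerivAt ρ (deriv ρ x) x :=
  (hρ.contDiff.differentiable (by norm_num) x).hasDerivAt

lemma LossAssumption.monotone : Monotone (deriv ρ) := by
  have h := hρ.convex.monotoneOn_deriv fun x _ => (hρ.hasDerivAt x).differentiableAt
  exact monotoneOn_univ.1 h

/-- ψ is monotone, so the increments of ψ and of its argument have the same sign, and one factor of
the square can be bounded by the Lipschitz property. -/
lemma LossAssumption.cocoercive (a b : ℝ) :
    (deriv ρ a - deriv ρ b) ^ 2 ≤ L * ((a - b) * (deriv ρ a - deriv ρ b)) := by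
  have h := hρ.lipschitz.dist_le_mul a b
  rw [Real.dist_eq, Real.dist_eq] at h
  rcases le_total a b with hab | hab
  · have h1 := hρ.monotone hab
    rw [abs_of_nonpos (by linarith), abs_of_nonpos (by linarith)] at h
    nlinarith
  · have h1 := hρ.monotone hab
    rw [abs_of_nonneg (by linarith), abs_of_nonneg (by linarith)] at h
    nlinarith

/-- A Lipschitz function is absolutely continuous, hence the integral of its derivative, and ψ' ≥ K²
- ψ² ≥ K² - c almost everywhere on the interval. -/
lemma LossAssumption.slope_le {a b c : ℝ} (hab : a ≤ b)
    (h : ∀ x ∈ Set.Icc a b, deriv ρ x ^ 2 ≤ c) :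
    (K ^ 2 - c) * (b - a) ≤ deriv ρ b - deriv ρ a := by
  have hac : AbsolutelyContinuousOnInterval (deriv ρ) a b :=
    (hρ.lipschitz.lipschitzOnWith (s := Set.uIcc a b)).absolutelyContinuousOnInterval
  rw [← hac.integral_deriv_eq_sub]
  have h1 : ∫ x in a..b, (K ^ 2 - c) ≤ ∫ x in a..b, deriv (deriv ρ) x := by
    refine intervalIntegral.integral_mono_ae_restrict hab (by simp) hac.intervalIntegrable_deriv ?_
    rw [EventuallyLE, ae_restrict_iff' measurableSet_Icc]
    filter_upwards [hρ.lower] with x hx hx'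
    have := h x hx'
    linarith
  rw [intervalIntegral.integral_const, smul_eq_mul] at h1
  linarith

/-- By continuity ψ² stays below 3K²/4 near x, which leaves a slope of at least K²/4. This is what
bounds the trace of the Jacobian from below. -/
lemma LossAssumption.eventually_slope_le (hK : 0 < K) {x : ℝ} (hx : deriv ρ x ^ 2 ≤ K ^ 2 / 2) :
    ∀ᶠ z in 𝓝 x, K ^ 2 / 4 * (z - x) ^ 2 ≤ (z - x) * (deriv ρ z - deriv ρ x) := by
  have hc : Continuous fun z => deriv ρ z ^ 2 := hρ.lipschitz.continuous.pow 2
  have h1 : ∀ᶠ z in 𝓝 x, deriv ρ z ^ 2 < 3 * K ^ 2 / 4 :=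
    hc.continuousAt.eventually_lt continuousAt_const (by nlinarith)
  obtain ⟨δ, hδ, hball⟩ := Metric.eventually_nhds_iff.1 h1
  filter_upwards [Metric.ball_mem_nhds x hδ] with z hz
  rw [Metric.mem_ball, Real.dist_eq] at hz
  rcases le_total z x with hzx | hzx
  · rw [abs_of_nonpos (by linarith)] at hz
    have := hρ.slope_le (c := 3 * K ^ 2 / 4) hzx fun w hw => (hball (by
      rw [Real.dist_eq, abs_of_nonpos (by linarith [hw.2])]; linarith [hw.1])).le
    nlinarith
  · rw [abs_of_nonneg (by linarith)] at hz
    have := hρ.slope_le (c := 3 * K ^ 2 / 4) hzx fun w hw => (hball (by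
      rw [Real.dist_eq, abs_of_nonneg (by linarith [hw.1])]; linarith [hw.2])).le
    nlinarith

/-- By monotonicity ψ vanishes between two of its zeros, where it would also have slope at least K²
> 0. -/
lemma LossAssumption.eq_of_deriv_eq_zero (hK : 0 < K) {a b : ℝ} (ha : deriv ρ a = 0)
    (hb : deriv ρ b = 0) : a = b := by
  wlog hab : a ≤ b generalizing a b
  · exact (this hb ha (le_of_not_ge hab)).symm
  have h := hρ.slope_le (c := 0) hab fun x hx => by
    have h1 := hρ.monotone hx.1
    have h2 := hρ.monotone hx.2
    have : deriv ρ x = 0 := by linarith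
    rw [this]; norm_num
  rw [ha, hb, sub_zero, sub_zero] at h
  have hK2 : 0 < K ^ 2 := by positivity
  nlinarith

end Loss

variable {n p : ℕ}

lemma mulVecE_apply (X : Matrix (Fin n) (Fin p) ℝ) (b : EuclideanSpace ℝ (Fin p)) (i : Fin n) :
    mulVecE X b i = ∑ k, X i k * b k := rfl

lemma mulVecE_sub (X : Matrix (Fin n) (Fin p) ℝ) (b c : EuclideanSpace ℝ (Fin p)) :
    mulVecE X (b - c) = mulVecE X b - mulVecE X c := by
  ext i; simp [mulVecE_apply, mul_sub, Finset.sum_sub_distrib]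

lemma mulVecE_smul (X : Matrix (Fin n) (Fin p) ℝ) (t : ℝ) (b : EuclideanSpace ℝ (Fin p)) :
    mulVecE X (t • b) = t • mulVecE X b := by
  ext i; simp [mulVecE_apply, Finset.mul_sum, mul_left_comm]

lemma add_mulVecE (X Y : Matrix (Fin n) (Fin p) ℝ) (b : EuclideanSpace ℝ (Fin p)) :
    mulVecE (X + Y) b = mulVecE X b + mulVecE Y b := by
  ext i; simp [mulVecE_apply, add_mul, Finset.sum_add_distrib]

lemma euclidean_inner_eq_sum {m : ℕ} (u v : EuclideanSpace ℝ (Fin m)) :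
    inner ℝ u v = ∑ i, u i * v i := by
  simp [PiLp.inner_apply, mul_comm]

lemma inner_mulVecE (X : Matrix (Fin n) (Fin p) ℝ) (b : EuclideanSpace ℝ (Fin p))
    (v : EuclideanSpace ℝ (Fin n)) :
    inner ℝ v (mulVecE X b) = inner ℝ (mulVecE X.transpose v) b := by
  simp only [euclidean_inner_eq_sum, mulVecE_apply, Matrix.transpose_apply, Finset.mul_sum,
    Finset.sum_mul]
  rw [Finset.sum_comm]
  exact Finset.sum_congr rfl fun i _ => Finset.sum_congr rfl fun j _ => by ring

lemma continuous_mulVecE : Continuous fun q : Matrix (Fin n) (Fin p) ℝ × EuclideanSpace ℝ (Fin p) =>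
    mulVecE q.1 q.2 := by
  unfold mulVecE
  refine (PiLp.continuous_toLp 2 _).comp ?_
  exact Continuous.matrix_mulVec continuous_fst ((PiLp.continuous_ofLp 2 _).comp continuous_snd)

/-- The rank one matrix with `j`-th column `η` and other columns zero. -/
def columnMatrix (η : EuclideanSpace ℝ (Fin n)) (j : Fin p) : Matrix (Fin n) (Fin p) ℝ :=
  Matrix.of fun i k => if k = j then η i else 0

lemma mulVecE_columnMatrix (η : EuclideanSpace ℝ (Fin n)) (j : Fin p)
    (b : EuclideanSpace ℝ (Fin p)) : mulVecE (columnMatrix η j) b = b j • η := by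
  ext i; simp [mulVecE_apply, columnMatrix, mul_comm]

/-- The residual vector `y - X β̂`. -/
noncomputable def residual (ρ : ℝ → ℝ) (g : EuclideanSpace ℝ (Fin p) → ℝ)
    (X : Matrix (Fin n) (Fin p) ℝ) (y : EuclideanSpace ℝ (Fin n)) : EuclideanSpace ℝ (Fin n) :=
  y - mulVecE X (betaHat ρ g X y)

variable {ρ : ℝ → ℝ} {g : EuclideanSpace ℝ (Fin p) → ℝ} {τ K : ℝ} {L : NNReal}

lemma psiHat_apply (X : Matrix (Fin n) (Fin p) ℝ) (y : EuclideanSpace ℝ (Fin n)) (i : Fin n) :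
    psiHat ρ g X y i = deriv ρ (residual ρ g X y i) := rfl

namespace Regular

variable (H : Regular n ρ g τ K L)

include H

lemma isMinOn_betaHat (X : Matrix (Fin n) (Fin p) ℝ) (y : EuclideanSpace ℝ (Fin n)) :
    IsMinOn (criterion ρ g X y) Set.univ (betaHat ρ g X y) :=
  Classical.epsilon_spec (existsUnique_minimizer H.loss.convex H.τ_pos H.penalty X y).exists

/-- First order optimality: Xᵀψ/n is a subgradient of g at β̂, with the quadratic gain of strong
convexity. Since g need not be differentiable, the criterion is compared at β̂ and at β̂ + t(c -
β̂), only the loss is differentiated, and t decreases to 0. -/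
lemma penalty_sub_ge (X : Matrix (Fin n) (Fin p) ℝ) (y : EuclideanSpace ℝ (Fin n))
    (c : EuclideanSpace ℝ (Fin p)) :
    1 / (n : ℝ) * inner ℝ (psiHat ρ g X y) (mulVecE X (c - betaHat ρ g X y))
      + τ / 2 * ‖c - betaHat ρ g X y‖ ^ 2 ≤ g c - g (betaHat ρ g X y) := by
  set b := betaHat ρ g X y with hb
  set v := mulVecE X (c - b) with hv
  set φ : ℝ → ℝ := fun t => 1 / (n : ℝ) * ∑ i, ρ (residual ρ g X y i - t * v i) with hφ
  have hφd : HasDerivAt φ (-(1 / (n : ℝ) * inner ℝ (psiHat ρ g X y) v)) 0 := by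
    have h1 : ∀ i, HasDerivAt (fun t => ρ (residual ρ g X y i - t * v i))
        (deriv ρ (residual ρ g X y i) * (-v i)) 0 := by
      intro i
      have h2 : HasDerivAt (fun t : ℝ => residual ρ g X y i - t * v i) (-v i) 0 := by
        simpa using ((hasDerivAt_id (0 : ℝ)).mul_const (v i)).const_sub (residual ρ g X y i)
      have h3 : HasDerivAt ρ (deriv ρ (residual ρ g X y i)) (residual ρ g X y i - 0 * v i) := by
        rw [zero_mul, sub_zero]; exact H.loss.hasDerivAt _
      exact h3.comp 0 h2
    have h4 := (HasDerivAt.fun_sum fun i (_ : i ∈ Finset.univ) => h1 i).const_mul (1 / (n : ℝ))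
    refine h4.congr_deriv ?_
    rw [euclidean_inner_eq_sum, ← mul_neg, ← Finset.sum_neg_distrib]
    simp only [psiHat_apply, mul_neg]
  have hslope := hφd.tendsto_slope_zero_right
  simp only [zero_add, smul_eq_mul] at hslope
  have hineq : ∀ᶠ t in 𝓝[>] (0 : ℝ), 0 ≤ t⁻¹ * (φ t - φ 0)
      + (g c - g b - τ / 2 * (1 - t) * ‖c - b‖ ^ 2) := by
    filter_upwards [Ioo_mem_nhdsGT (zero_lt_one' ℝ)] with t ht
    have hmin : criterion ρ g X y b ≤ criterion ρ g X y (b + t • (c - b)) :=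
      H.isMinOn_betaHat X y (Set.mem_univ _)
    have e1 : criterion ρ g X y b = φ 0 + g b := by
      simp [criterion, hφ, residual, hb]
    have e2 : criterion ρ g X y (b + t • (c - b)) = φ t + g (b + t • (c - b)) := by
      have : b + t • (c - b) = b - t • (b - c) := by
        rw [← neg_sub b c, smul_neg, ← sub_eq_add_neg]
      simp only [criterion, hφ]
      congr 3
      ext i
      rw [this, mulVecE_sub, mulVecE_smul]
      have hvi : v i = -(mulVecE X (b - c) i) := by
        simp [hv, mulVecE_sub]
      rw [hvi]
      simp only [residual, PiLp.sub_apply, PiLp.smul_apply, smul_eq_mul, ← hb]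
      congr 1
      ring
    have hconv := H.penalty.2 (Set.mem_univ b) (Set.mem_univ c) (by linarith [ht.2] : 0 ≤ 1 - t)
      ht.1.le (by ring)
    have e3 : (1 - t) • b + t • c = b + t • (c - b) := by
      rw [sub_smul, one_smul, smul_sub]; abel
    rw [e3] at hconv
    -- This identity turns the convexity of g - τ‖·‖²/2 into the quadratic gain of g along the
    -- segment.
    have e4 : ‖b + t • (c - b)‖ ^ 2
        = (1 - t) * ‖b‖ ^ 2 + t * ‖c‖ ^ 2 - t * (1 - t) * ‖c - b‖ ^ 2 := by
      rw [norm_add_sq_real, norm_smul, mul_pow, Real.norm_eq_abs, sq_abs, norm_sub_sq_real,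
        real_inner_smul_right, inner_sub_right, real_inner_self_eq_norm_sq, real_inner_comm]
      ring
    simp only [smul_eq_mul, e4] at hconv
    rw [e1, e2] at hmin
    have h5 : 0 ≤ (φ t - φ 0) + t * (g c - g b - τ / 2 * (1 - t) * ‖c - b‖ ^ 2) := by
      nlinarith
    have h6 := mul_nonneg (inv_nonneg.2 ht.1.le) h5
    rwa [mul_add, inv_mul_cancel_left₀ ht.1.ne'] at h6
  have hlim : Tendsto (fun t : ℝ => t⁻¹ * (φ t - φ 0)
      + (g c - g b - τ / 2 * (1 - t) * ‖c - b‖ ^ 2)) (𝓝[>] (0 : ℝ))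
      (𝓝 (-(1 / (n : ℝ) * inner ℝ (psiHat ρ g X y) v)
        + (g c - g b - τ / 2 * (1 - 0) * ‖c - b‖ ^ 2))) := by
    refine hslope.add (Tendsto.mono_left ?_ nhdsWithin_le_nhds)
    exact (by fun_prop : Continuous fun t : ℝ =>
      g c - g b - τ / 2 * (1 - t) * ‖c - b‖ ^ 2).tendsto 0
  have := ge_of_tendsto hlim hineq
  linarith

/-- Strong monotonicity of the optimality conditions, for two data sets. -/
lemma strong_monotone (X X' : Matrix (Fin n) (Fin p) ℝ) (y y' : EuclideanSpace ℝ (Fin n)) :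
    n * τ * ‖betaHat ρ g X' y' - betaHat ρ g X y‖ ^ 2
      ≤ inner ℝ (psiHat ρ g X' y') (mulVecE X' (betaHat ρ g X' y' - betaHat ρ g X y))
        - inner ℝ (psiHat ρ g X y) (mulVecE X (betaHat ρ g X' y' - betaHat ρ g X y)) := by
  have h1 := H.penalty_sub_ge X y (betaHat ρ g X' y')
  have h2 := H.penalty_sub_ge X' y' (betaHat ρ g X y)
  have e : mulVecE X' (betaHat ρ g X y - betaHat ρ g X' y')
      = -mulVecE X' (betaHat ρ g X' y' - betaHat ρ g X y) := by
    rw [mulVecE_sub, mulVecE_sub, neg_sub]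
  rw [e, inner_neg_right, norm_sub_rev] at h2
  have hn := H.n_pos
  have h3 : 1 / (n : ℝ) * (inner ℝ (psiHat ρ g X y)
      (mulVecE X (betaHat ρ g X' y' - betaHat ρ g X y))
      - inner ℝ (psiHat ρ g X' y') (mulVecE X' (betaHat ρ g X' y' - betaHat ρ g X y)))
      + τ * ‖betaHat ρ g X' y' - betaHat ρ g X y‖ ^ 2 ≤ 0 := by linarith
  have h4 := mul_le_mul_of_nonneg_left h3 hn.le
  rw [mul_add, ← mul_assoc, mul_one_div_cancel hn.ne', one_mul, mul_zero] at h4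
  linarith

/-- In strong monotonicity, X(b' - b) is rewritten as (y' - y - D b') minus the change of the
residual. The residual term, a sum of nonnegative products by monotonicity of ψ, moves to the left.
-/
lemma basic_inequality (X D : Matrix (Fin n) (Fin p) ℝ) (y y' : EuclideanSpace ℝ (Fin n)) :
    n * τ * ‖betaHat ρ g (X + D) y' - betaHat ρ g X y‖ ^ 2
      + ∑ i, (residual ρ g (X + D) y' i - residual ρ g X y i)
        * (psiHat ρ g (X + D) y' i - psiHat ρ g X y i)
      ≤ inner ℝ (y' - y - mulVecE D (betaHat ρ g (X + D) y'))
          (psiHat ρ g (X + D) y' - psiHat ρ g X y)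
        + inner ℝ (psiHat ρ g (X + D) y')
          (mulVecE D (betaHat ρ g (X + D) y' - betaHat ρ g X y)) := by
  have h := H.strong_monotone X (X + D) y y'
  set b := betaHat ρ g X y with hb
  set b' := betaHat ρ g (X + D) y' with hb'
  set u := psiHat ρ g X y
  set u' := psiHat ρ g (X + D) y'
  have e0 : ∑ i, (residual ρ g (X + D) y' i - residual ρ g X y i) * (u' i - u i)
      = inner ℝ (residual ρ g (X + D) y' - residual ρ g X y) (u' - u) := by
    rw [euclidean_inner_eq_sum]; rfl
  have e1 : mulVecE X (b' - b) = (y' - y - mulVecE D b')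
      - (residual ρ g (X + D) y' - residual ρ g X y) := by
    simp only [residual, ← hb, ← hb', mulVecE_sub, add_mulVecE]
    abel
  rw [e0, add_mulVecE, inner_add_right] at *
  have e2 : inner ℝ u' (mulVecE X (b' - b)) - inner ℝ u (mulVecE X (b' - b))
      = inner ℝ (y' - y - mulVecE D b') (u' - u)
        - inner ℝ (residual ρ g (X + D) y' - residual ρ g X y) (u' - u) := by
    rw [← inner_sub_left, e1, inner_sub_right, real_inner_comm,
      real_inner_comm (residual ρ g (X + D) y' - residual ρ g X y)]
  linarith

lemma norm_psiHat_sub_sq_le (X X' : Matrix (Fin n) (Fin p) ℝ) (y y' : EuclideanSpace ℝ (Fin n)) :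
    ‖psiHat ρ g X' y' - psiHat ρ g X y‖ ^ 2 / L ≤
      ∑ i, (residual ρ g X' y' i - residual ρ g X y i)
        * (psiHat ρ g X' y' i - psiHat ρ g X y i) := by
  rw [div_le_iff₀ H.L_pos, EuclideanSpace.norm_sq_eq, Finset.sum_mul]
  refine Finset.sum_le_sum fun i _ => ?_
  have := H.loss.cocoercive (residual ρ g X' y' i) (residual ρ g X y i)
  simp only [PiLp.sub_apply, Real.norm_eq_abs, sq_abs, psiHat_apply]
  linarith

/-- Young's inequality on each product, with half of each square absorbed on the left and the result
doubled. -/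
lemma absorb {a d A B : ℝ} (h : n * τ * d ^ 2 + a ^ 2 / L ≤ A * a + B * d) :
    n * τ * d ^ 2 + a ^ 2 / L ≤ L * A ^ 2 + B ^ 2 / (n * τ) := by
  have hL := H.L_pos
  have hnt : 0 < n * τ := mul_pos H.n_pos H.τ_pos
  have h1 : A * a ≤ L * A ^ 2 / 2 + a ^ 2 / L / 2 := by
    have : L * A ^ 2 / 2 + a ^ 2 / L / 2 - A * a = (L * A - a) ^ 2 / (2 * L) := by
      field_simp; ring
    have h2 : 0 ≤ (L * A - a) ^ 2 / (2 * L) := by positivity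
    linarith
  have h2 : B * d ≤ B ^ 2 / (n * τ) / 2 + n * τ * d ^ 2 / 2 := by
    have : B ^ 2 / (n * τ) / 2 + n * τ * d ^ 2 / 2 - B * d
        = (B - n * τ * d) ^ 2 / (2 * (n * τ)) := by
      have := H.n_pos.ne'; have := H.τ_pos.ne'
      field_simp; ring
    have h3 : 0 ≤ (B - n * τ * d) ^ 2 / (2 * (n * τ)) := by positivity
    linarith
  linarith

/-- The right side involves the estimator at the perturbed data only. This yields continuity in the
data without any a priori bound, and derivative bounds after a passage to the limit. -/
lemma perturbation_bound (X D : Matrix (Fin n) (Fin p) ℝ) (y y' : EuclideanSpace ℝ (Fin n)) :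
    n * τ * ‖betaHat ρ g (X + D) y' - betaHat ρ g X y‖ ^ 2
      + ‖psiHat ρ g (X + D) y' - psiHat ρ g X y‖ ^ 2 / L
      ≤ L * ‖y' - y - mulVecE D (betaHat ρ g (X + D) y')‖ ^ 2
        + ‖mulVecE D.transpose (psiHat ρ g (X + D) y')‖ ^ 2 / (n * τ) := by
  apply H.absorb
  have h1 := H.basic_inequality X D y y'
  have h2 := H.norm_psiHat_sub_sq_le X (X + D) y y'
  have h3 := real_inner_le_norm (y' - y - mulVecE D (betaHat ρ g (X + D) y'))
          (psiHat ρ g (X + D) y' - psiHat ρ g X y)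
  have h4 := real_inner_le_norm (mulVecE D.transpose (psiHat ρ g (X + D) y'))
    (betaHat ρ g (X + D) y' - betaHat ρ g X y)
  rw [← inner_mulVecE] at h4
  linarith

lemma perturbation_column_bound (X : Matrix (Fin n) (Fin p) ℝ) (η : EuclideanSpace ℝ (Fin n))
    (j : Fin p) (y y' : EuclideanSpace ℝ (Fin n)) :
    n * τ * ‖betaHat ρ g (X + columnMatrix η j) y' - betaHat ρ g X y‖ ^ 2
      + ‖psiHat ρ g (X + columnMatrix η j) y' - psiHat ρ g X y‖ ^ 2 / L
      ≤ L * ‖y' - y - betaHat ρ g (X + columnMatrix η j) y' j • η‖ ^ 2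
        + inner ℝ η (psiHat ρ g (X + columnMatrix η j) y') ^ 2 / (n * τ) := by
  have h := H.perturbation_bound X (columnMatrix η j) y y'
  rw [mulVecE_columnMatrix] at h
  have e : ‖mulVecE (columnMatrix η j).transpose (psiHat ρ g (X + columnMatrix η j) y')‖ ^ 2
      = inner ℝ η (psiHat ρ g (X + columnMatrix η j) y') ^ 2 := by
    have : mulVecE (columnMatrix η j).transpose (psiHat ρ g (X + columnMatrix η j) y')
        = EuclideanSpace.single j (inner ℝ η (psiHat ρ g (X + columnMatrix η j) y')) := by
      ext k
      rw [mulVecE_apply, euclidean_inner_eq_sum]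
      by_cases hk : k = j <;> simp [columnMatrix, Matrix.transpose_apply, hk]
    rw [this, PiLp.norm_single, Real.norm_eq_abs, sq_abs]
  rwa [e] at h

lemma norm_psiHat_sub_le (X : Matrix (Fin n) (Fin p) ℝ) (y y' : EuclideanSpace ℝ (Fin n)) :
    ‖psiHat ρ g X y' - psiHat ρ g X y‖ ≤ L * ‖y' - y‖ := by
  have h := H.perturbation_bound X 0 y y'
  have e1 : ∀ b : EuclideanSpace ℝ (Fin p), mulVecE (0 : Matrix (Fin n) (Fin p) ℝ) b = 0 := by
    intro b; ext i; simp [mulVecE_apply]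
  have e2 : ∀ b : EuclideanSpace ℝ (Fin n),
      mulVecE (0 : Matrix (Fin n) (Fin p) ℝ).transpose b = 0 := by
    intro b; ext i; simp [mulVecE_apply]
  rw [add_zero, e1, e2, sub_zero, norm_zero] at h
  have hL := H.L_pos
  have h0 : 0 ≤ n * τ * ‖betaHat ρ g X y' - betaHat ρ g X y‖ ^ 2 := by
    have := H.n_pos; have := H.τ_pos; positivity
  have h1 : ‖psiHat ρ g X y' - psiHat ρ g X y‖ ^ 2 / L ≤ L * ‖y' - y‖ ^ 2 := by
    simpa using (le_add_of_nonneg_left h0).trans h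
  rw [div_le_iff₀ hL] at h1
  refine abs_le_of_sq_le_sq' ?_ (by positivity) |>.2
  rw [mul_pow]; linarith

lemma lipschitzWith_psiHat (X : Matrix (Fin n) (Fin p) ℝ) : LipschitzWith L (psiHat ρ g X) :=
  LipschitzWith.of_dist_le_mul fun y' y => by
    rw [dist_eq_norm, dist_eq_norm]; exact H.norm_psiHat_sub_le X y y'

/-- Joint continuity of the estimator and of the score vector. -/
lemma continuous_estimates :
    (Continuous fun q : Matrix (Fin n) (Fin p) ℝ × EuclideanSpace ℝ (Fin n) =>
      betaHat ρ g q.1 q.2) ∧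
    Continuous fun q : Matrix (Fin n) (Fin p) ℝ × EuclideanSpace ℝ (Fin n) =>
      psiHat ρ g q.1 q.2 := by
  have hL := H.L_pos
  have hn := H.n_pos
  have hτ := H.τ_pos
  -- With q' fixed, the right side of the perturbation bound is an explicit continuous function of q
  -- that vanishes at q'.
  have key : ∀ q' : Matrix (Fin n) (Fin p) ℝ × EuclideanSpace ℝ (Fin n),
      Tendsto (fun q : Matrix (Fin n) (Fin p) ℝ × EuclideanSpace ℝ (Fin n) =>
        n * τ * ‖betaHat ρ g q'.1 q'.2 - betaHat ρ g q.1 q.2‖ ^ 2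
      + ‖psiHat ρ g q'.1 q'.2 - psiHat ρ g q.1 q.2‖ ^ 2 / L) (𝓝 q') (𝓝 0) := by
    intro q'
    set b' := betaHat ρ g q'.1 q'.2 with hb'
    set u' := psiHat ρ g q'.1 q'.2 with hu'
    have hcont : Continuous fun q : Matrix (Fin n) (Fin p) ℝ × EuclideanSpace ℝ (Fin n) =>
        L * ‖q'.2 - q.2 - mulVecE (q'.1 - q.1) b'‖ ^ 2
        + ‖mulVecE (q'.1 - q.1).transpose u'‖ ^ 2 / (n * τ) := by
      have c1 : Continuous fun q : Matrix (Fin n) (Fin p) ℝ × EuclideanSpace ℝ (Fin n) =>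
          mulVecE (q'.1 - q.1) b' :=
        continuous_mulVecE.comp ((continuous_const.sub continuous_fst).prodMk continuous_const)
      have c2 : Continuous fun q : Matrix (Fin n) (Fin p) ℝ × EuclideanSpace ℝ (Fin n) =>
          mulVecE (q'.1 - q.1).transpose u' :=
        continuous_mulVecE.comp
          ((continuous_const.sub continuous_fst).matrix_transpose.prodMk continuous_const)
      fun_prop
    have h0 := hcont.tendsto q'
    have e1 : ∀ b : EuclideanSpace ℝ (Fin p), mulVecE (0 : Matrix (Fin n) (Fin p) ℝ) b = 0 := by
      intro b; ext i; simp [mulVecE_apply]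
    have e2 : ∀ b : EuclideanSpace ℝ (Fin n),
        mulVecE (0 : Matrix (Fin n) (Fin p) ℝ).transpose b = 0 := by
      intro b; ext i; simp [mulVecE_apply]
    simp only [sub_self, e1, e2, norm_zero] at h0
    norm_num at h0
    refine squeeze_zero (fun q => by positivity) (fun q => ?_) h0
    have h := H.perturbation_bound q.1 (q'.1 - q.1) q.2 q'.2
    rw [add_sub_cancel] at h
    simpa only [Matrix.transpose_sub] using h
  constructor
  · rw [continuous_iff_continuousAt]
    intro q'
    rw [ContinuousAt, tendsto_iff_norm_sub_tendsto_zero]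
    have h1 : Tendsto (fun q : Matrix (Fin n) (Fin p) ℝ × EuclideanSpace ℝ (Fin n) =>
        ‖betaHat ρ g q'.1 q'.2 - betaHat ρ g q.1 q.2‖ ^ 2) (𝓝 q') (𝓝 0) := by
      refine squeeze_zero (fun q => by positivity) (fun q => ?_)
        (by simpa only [mul_zero] using (key q').const_mul (n * τ)⁻¹)
      rw [mul_add, ← mul_assoc, inv_mul_cancel₀ (by positivity), one_mul]
      exact le_add_of_nonneg_right (by positivity)
    have h2 := h1.sqrt
    simp only [Real.sqrt_zero, Real.sqrt_sq (norm_nonneg _)] at h2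
    exact h2.congr fun q => norm_sub_rev _ _
  · rw [continuous_iff_continuousAt]
    intro q'
    rw [ContinuousAt, tendsto_iff_norm_sub_tendsto_zero]
    have h1 : Tendsto (fun q : Matrix (Fin n) (Fin p) ℝ × EuclideanSpace ℝ (Fin n) =>
        ‖psiHat ρ g q'.1 q'.2 - psiHat ρ g q.1 q.2‖ ^ 2) (𝓝 q') (𝓝 0) := by
      refine squeeze_zero (fun q => by positivity) (fun q => ?_)
        (by simpa only [mul_zero] using (key q').const_mul (L : ℝ))
      rw [mul_add, mul_div_cancel₀ _ hL.ne']
      exact le_add_of_nonneg_left (by positivity)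
    have h2 := h1.sqrt
    simp only [Real.sqrt_zero, Real.sqrt_sq (norm_nonneg _)] at h2
    exact h2.congr fun q => norm_sub_rev _ _

/-- If the score vanishes at two responses, strong monotonicity makes the two estimates equal, and
uniqueness of the zero of ψ makes the two residuals equal. With a noise density, a zero score
therefore has probability zero. -/
lemma subsingleton_psiHat_eq_zero (X : Matrix (Fin n) (Fin p) ℝ) :
    {y | psiHat ρ g X y = 0}.Subsingleton := by
  intro y hy y' hy'
  simp only [Set.mem_ofPred_eq] at hy hy'
  have h := H.strong_monotone X X y y'
  rw [hy, hy', inner_zero_left, sub_zero] at h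
  have hnt : 0 < n * τ := mul_pos H.n_pos H.τ_pos
  have h0 : ‖betaHat ρ g X y' - betaHat ρ g X y‖ ^ 2 = 0 :=
    le_antisymm (by nlinarith) (sq_nonneg _)
  have hb : betaHat ρ g X y' = betaHat ρ g X y := by
    rw [← sub_eq_zero]; simpa using h0
  have hr : residual ρ g X y = residual ρ g X y' := by
    ext i
    refine H.loss.eq_of_deriv_eq_zero H.K_pos ?_ ?_
    · rw [← psiHat_apply, hy]; rfl
    · rw [← psiHat_apply, hy']; rfl
  simp only [residual, hb] at hr
  exact sub_left_injective hr

end Regular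

end Estimator

/-! ### Bounds on the trace of the Jacobian. -/

section Trace

variable {n p : ℕ} {ρ : ℝ → ℝ} {g : EuclideanSpace ℝ (Fin p) → ℝ} {τ K : ℝ} {L : NNReal}

lemma trace_eq_sum_single {m : ℕ} (A : EuclideanSpace ℝ (Fin m) →L[ℝ] EuclideanSpace ℝ (Fin m)) :
    LinearMap.trace ℝ (EuclideanSpace ℝ (Fin m))
      (A : EuclideanSpace ℝ (Fin m) →ₗ[ℝ] EuclideanSpace ℝ (Fin m))
      = ∑ i, A (EuclideanSpace.single i 1) i := by
  rw [LinearMap.trace_eq_sum_inner _ (EuclideanSpace.basisFun (Fin m) ℝ)]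
  refine Finset.sum_congr rfl fun i _ => ?_
  simp [EuclideanSpace.inner_single_left]

lemma trJacobian_eq_sum (X : Matrix (Fin n) (Fin p) ℝ) (y : EuclideanSpace ℝ (Fin n)) :
    trJacobian ρ g X y
      = ∑ i, fderiv ℝ (psiHat ρ g X) y (EuclideanSpace.single i 1) i :=
  trace_eq_sum_single _

lemma continuous_mulVecE_comp {α : Type*} [TopologicalSpace α]
    {X : α → Matrix (Fin n) (Fin p) ℝ} {b : α → EuclideanSpace ℝ (Fin p)} (hX : Continuous X)
    (hb : Continuous b) : Continuous fun a => mulVecE (X a) (b a) := by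
  unfold mulVecE
  exact (PiLp.continuous_toLp 2 _).comp
    (Continuous.matrix_mulVec hX ((PiLp.continuous_ofLp 2 _).comp hb))

/-- Here t, s, w and x stand for the changes of one entry of the response, the residual, the score
and the fitted vector, and D for the squared change of the estimator. Since t = s + x, t² is at most
2s² + 2x², and each of s² and x² is at most a constant times t w. Dividing by t² gives the bound. -/
lemma diag_algebra {N M s w t x D : ℝ} (hK : 0 < K) (hτ : 0 < τ) (hM : 0 ≤ M) (hN : 0 < N)
    (ht : 0 < t) (hs : K ^ 2 / 4 * s ^ 2 ≤ s * w) (h : N * τ * D + s * w ≤ t * w) (hD : 0 ≤ D)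
    (e : s = t - x) (hx : x ^ 2 ≤ M * N * D) :
    (8 / K ^ 2 + 2 * M / τ)⁻¹ ≤ t⁻¹ * w := by
  have h1 : t ^ 2 ≤ 2 * s ^ 2 + 2 * (M * N * D) := by
    have : t = s + x := by linarith
    nlinarith [sq_nonneg (s - x)]
  have hsw : 0 ≤ s * w := le_trans (by positivity) hs
  have hnd : 0 ≤ N * τ * D := by positivity
  have h2 : 2 * s ^ 2 ≤ 8 / K ^ 2 * (t * w) := by
    have : 8 / K ^ 2 * (K ^ 2 / 4 * s ^ 2) ≤ 8 / K ^ 2 * (t * w) :=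
      mul_le_mul_of_nonneg_left (by linarith) (by positivity)
    calc 2 * s ^ 2 = 8 / K ^ 2 * (K ^ 2 / 4 * s ^ 2) := by field_simp; ring
      _ ≤ _ := this
  have h3 : 2 * (M * N * D) ≤ 2 * M / τ * (t * w) := by
    have : 2 * M / τ * (N * τ * D) ≤ 2 * M / τ * (t * w) :=
      mul_le_mul_of_nonneg_left (by linarith) (by positivity)
    calc 2 * (M * N * D) = 2 * M / τ * (N * τ * D) := by field_simp
      _ ≤ _ := this
  have hc : 0 < 8 / K ^ 2 + 2 * M / τ := by positivity
  rw [inv_le_iff_one_le_mul₀ hc, mul_comm, ← mul_assoc, mul_comm _ t⁻¹, mul_assoc,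
    le_inv_mul_iff₀ ht]
  refine le_of_mul_le_mul_left ?_ ht
  linarith

namespace Regular

variable (H : Regular n ρ g τ K L)

include H

lemma continuous_betaHat {α : Type*} [TopologicalSpace α] {X : α → Matrix (Fin n) (Fin p) ℝ}
    {y : α → EuclideanSpace ℝ (Fin n)} (hX : Continuous X) (hy : Continuous y) :
    Continuous fun a => betaHat ρ g (X a) (y a) := by
  have h1 : Continuous fun a => (X a, y a) := hX.prodMk hy
  have h2 := H.continuous_estimates.1.comp h1
  simp only [Function.comp_def] at h2
  exact h2

lemma continuous_psiHat {α : Type*} [TopologicalSpace α] {X : α → Matrix (Fin n) (Fin p) ℝ}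
    {y : α → EuclideanSpace ℝ (Fin n)} (hX : Continuous X) (hy : Continuous y) :
    Continuous fun a => psiHat ρ g (X a) (y a) := by
  have h1 : Continuous fun a => (X a, y a) := hX.prodMk hy
  have h2 := H.continuous_estimates.2.comp h1
  simp only [Function.comp_def] at h2
  exact h2

omit H in
lemma tendsto_diag {X : Matrix (Fin n) (Fin p) ℝ} {y : EuclideanSpace ℝ (Fin n)}
    (hd : DifferentiableAt ℝ (psiHat ρ g X) y) (i : Fin n) :
    Tendsto (fun t : ℝ => t⁻¹ * (psiHat ρ g X (y + t • EuclideanSpace.single i 1) i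
      - psiHat ρ g X y i)) (𝓝[>] 0)
      (𝓝 (fderiv ℝ (psiHat ρ g X) y (EuclideanSpace.single i 1) i)) := by
  have h := (hd.hasFDerivAt.hasLineDerivAt (EuclideanSpace.single i 1)).tendsto_slope_zero_right
  have h2 := ((PiLp.continuous_apply 2 (fun _ : Fin n => ℝ) i).tendsto _).comp h
  exact h2

/-- `basic_inequality` with the design fixed and the response moved along one axis. Of the
nonnegative sum over the residuals only the i-th term is kept. -/
lemma diag_inequality (X : Matrix (Fin n) (Fin p) ℝ) (y : EuclideanSpace ℝ (Fin n)) (i : Fin n)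
    (t : ℝ) :
    n * τ * ‖betaHat ρ g X (y + t • EuclideanSpace.single i 1) - betaHat ρ g X y‖ ^ 2
      + (residual ρ g X (y + t • EuclideanSpace.single i 1) i - residual ρ g X y i)
        * (psiHat ρ g X (y + t • EuclideanSpace.single i 1) i - psiHat ρ g X y i)
      ≤ t * (psiHat ρ g X (y + t • EuclideanSpace.single i 1) i - psiHat ρ g X y i) := by
  have h := H.basic_inequality X 0 y (y + t • EuclideanSpace.single i 1)
  have e1 : ∀ b : EuclideanSpace ℝ (Fin p), mulVecE (0 : Matrix (Fin n) (Fin p) ℝ) b = 0 := by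
    intro b; ext i; simp [mulVecE_apply]
  rw [add_zero, e1, e1, sub_zero, inner_zero_right, add_zero, add_sub_cancel_left,
    real_inner_smul_left, EuclideanSpace.inner_single_left] at h
  simp only [map_one, one_mul, PiLp.sub_apply] at h
  refine le_trans ?_ h
  gcongr
  refine Finset.single_le_sum (f := fun k =>
    (residual ρ g X (y + t • EuclideanSpace.single i 1) k - residual ρ g X y k)
        * (psiHat ρ g X (y + t • EuclideanSpace.single i 1) k - psiHat ρ g X y k))
    (fun k _ => ?_) (Finset.mem_univ i)
  have h3 := H.loss.cocoercive (residual ρ g X (y + t • EuclideanSpace.single i 1) k)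
    (residual ρ g X y k)
  have h4 := (sq_nonneg _).trans h3
  exact nonneg_of_mul_nonneg_right h4 H.L_pos

lemma diag_nonneg {X : Matrix (Fin n) (Fin p) ℝ} {y : EuclideanSpace ℝ (Fin n)}
    (hd : DifferentiableAt ℝ (psiHat ρ g X) y) (i : Fin n) :
    0 ≤ fderiv ℝ (psiHat ρ g X) y (EuclideanSpace.single i 1) i := by
  refine ge_of_tendsto (tendsto_diag hd i) ?_
  filter_upwards [self_mem_nhdsWithin] with t ht
  have h := H.diag_inequality X y i t
  have h3 := H.loss.cocoercive (residual ρ g X (y + t • EuclideanSpace.single i 1) i)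
    (residual ρ g X y i)
  have h4 := nonneg_of_mul_nonneg_right ((sq_nonneg _).trans h3) H.L_pos
  have h5 : 0 ≤ n * τ * ‖betaHat ρ g X (y + t • EuclideanSpace.single i 1)
      - betaHat ρ g X y‖ ^ 2 := by
    have := H.n_pos; have := H.τ_pos; positivity
  have h6 : 0 ≤ t * (psiHat ρ g X (y + t • EuclideanSpace.single i 1) i
      - psiHat ρ g X y i) := by
    refine le_trans ?_ h
    exact add_nonneg h5 h4
  exact mul_nonneg (inv_nonneg.2 (le_of_lt ht)) (nonneg_of_mul_nonneg_right h6 ht)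

lemma diag_le {X : Matrix (Fin n) (Fin p) ℝ} {y : EuclideanSpace ℝ (Fin n)} (i : Fin n) :
    fderiv ℝ (psiHat ρ g X) y (EuclideanSpace.single i 1) i ≤ L := by
  have h1 := (fderiv ℝ (psiHat ρ g X) y).le_opNorm (EuclideanSpace.single i 1)
  have h2 : ‖fderiv ℝ (psiHat ρ g X) y‖ ≤ L :=
    norm_fderiv_le_of_lipschitz ℝ (H.lipschitzWith_psiHat X)
  rw [PiLp.norm_single, norm_one, mul_one] at h1
  exact (le_abs_self _).trans ((PiLp.norm_apply_le _ i).trans (h1.trans h2))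

/-- A lower bound on the diagonal entries of the Jacobian, at the coordinates with a small
score. -/
lemma le_diag {X : Matrix (Fin n) (Fin p) ℝ} {y : EuclideanSpace ℝ (Fin n)}
    (hd : DifferentiableAt ℝ (psiHat ρ g X) y) {M : ℝ} (hM : 0 ≤ M)
    (hX : ∀ b, ‖mulVecE X b‖ ^ 2 ≤ M * n * ‖b‖ ^ 2) (i : Fin n)
    (hi : psiHat ρ g X y i ^ 2 ≤ K ^ 2 / 2) :
    (8 / K ^ 2 + 2 * M / τ)⁻¹ ≤ fderiv ℝ (psiHat ρ g X) y (EuclideanSpace.single i 1) i := by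
  have hK := H.K_pos
  have hτ := H.τ_pos
  have hn := H.n_pos
  refine ge_of_tendsto (tendsto_diag hd i) ?_
  have hpath : Continuous fun t : ℝ => y + t • EuclideanSpace.single i (1 : ℝ) :=
    continuous_const.add (continuous_id.smul continuous_const)
  have hb : Continuous fun t : ℝ => betaHat ρ g X (y + t • EuclideanSpace.single i 1) :=
    H.continuous_betaHat continuous_const hpath
  have hr : Continuous fun t : ℝ => residual ρ g X (y + t • EuclideanSpace.single i 1) i := by
    have h1 : Continuous fun t : ℝ => residual ρ g X (y + t • EuclideanSpace.single i 1) := by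
      unfold residual
      exact hpath.sub (continuous_mulVecE_comp continuous_const hb)
    exact (PiLp.continuous_apply 2 (fun _ : Fin n => ℝ) i).comp h1
  have hr0 := hr.tendsto 0
  rw [zero_smul, add_zero] at hr0
  -- The residual depends continuously on t, so for small t it lies in the neighbourhood where the
  -- slope of ψ is at least K²/4.
  have hslope := hr0.eventually (H.loss.eventually_slope_le hK hi)
  filter_upwards [self_mem_nhdsWithin, nhdsWithin_le_nhds hslope] with t ht hs
  have h := H.diag_inequality X y i t
  rw [← psiHat_apply, ← psiHat_apply] at hs
  have e : residual ρ g X (y + t • EuclideanSpace.single i 1) i - residual ρ g X y i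
      = t - mulVecE X (betaHat ρ g X (y + t • EuclideanSpace.single i 1)
        - betaHat ρ g X y) i := by
    rw [mulVecE_sub]
    simp only [residual, PiLp.sub_apply, PiLp.add_apply, PiLp.smul_apply, PiLp.single_apply,
      if_true, smul_eq_mul]
    ring
  refine diag_algebra hK hτ hM hn ht hs h (sq_nonneg _) e ?_
  refine le_trans ?_ (hX _)
  rw [← sq_abs]
  exact pow_le_pow_left₀ (abs_nonneg _) (PiLp.norm_apply_le (mulVecE X _) i) 2

lemma trJacobian_nonneg {X : Matrix (Fin n) (Fin p) ℝ} {y : EuclideanSpace ℝ (Fin n)}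
    (hd : DifferentiableAt ℝ (psiHat ρ g X) y) : 0 ≤ trJacobian ρ g X y := by
  rw [trJacobian_eq_sum]
  exact Finset.sum_nonneg fun i _ => H.diag_nonneg hd i

lemma trJacobian_le {X : Matrix (Fin n) (Fin p) ℝ} {y : EuclideanSpace ℝ (Fin n)} :
    trJacobian ρ g X y ≤ n * L := by
  rw [trJacobian_eq_sum]
  refine (Finset.sum_le_sum fun i _ => H.diag_le i).trans ?_
  simp

/-- A lower bound on the trace of the Jacobian when the score vector is small. -/
lemma le_trJacobian {X : Matrix (Fin n) (Fin p) ℝ} {y : EuclideanSpace ℝ (Fin n)}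
    (hd : DifferentiableAt ℝ (psiHat ρ g X) y) {M : ℝ} (hM : 0 ≤ M)
    (hX : ∀ b, ‖mulVecE X b‖ ^ 2 ≤ M * n * ‖b‖ ^ 2)
    (hψ : ‖psiHat ρ g X y‖ ^ 2 ≤ n * K ^ 2 / 4) :
    (8 / K ^ 2 + 2 * M / τ)⁻¹ * n / 2 ≤ trJacobian ρ g X y := by
  classical
  have hK := H.K_pos
  have hτ := H.τ_pos
  set c := (8 / K ^ 2 + 2 * M / τ)⁻¹ with hc
  have hc0 : 0 ≤ c := by positivity
  -- The linear function c(1 - 2s/K²) of the squared score s is at most c for small scores and at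
  -- most 0 for large ones. Summed over i, it is at least c n / 2 under the bound on ‖ψ‖².
  have hpt : ∀ i, c * (1 - 2 / K ^ 2 * psiHat ρ g X y i ^ 2)
      ≤ fderiv ℝ (psiHat ρ g X) y (EuclideanSpace.single i 1) i := by
    intro i
    by_cases hi : psiHat ρ g X y i ^ 2 ≤ K ^ 2 / 2
    · refine le_trans ?_ (H.le_diag hd hM hX i hi)
      have : 0 ≤ 2 / K ^ 2 * psiHat ρ g X y i ^ 2 := by positivity
      nlinarith
    · push Not at hi
      refine le_trans ?_ (H.diag_nonneg hd i)
      have : 1 ≤ 2 / K ^ 2 * psiHat ρ g X y i ^ 2 := by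
        rw [div_mul_eq_mul_div, le_div_iff₀ (by positivity)]
        linarith
      nlinarith
  rw [trJacobian_eq_sum]
  refine le_trans ?_ (Finset.sum_le_sum fun i _ => hpt i)
  rw [← Finset.mul_sum, Finset.sum_sub_distrib, ← Finset.mul_sum]
  rw [EuclideanSpace.norm_sq_eq] at hψ
  simp only [Real.norm_eq_abs, sq_abs] at hψ
  simp only [Finset.sum_const, Finset.card_univ, Fintype.card_fin, nsmul_eq_mul, mul_one]
  have h1 : 2 / K ^ 2 * ∑ i, psiHat ρ g X y i ^ 2 ≤ n / 2 := by
    calc 2 / K ^ 2 * ∑ i, psiHat ρ g X y i ^ 2 ≤ 2 / K ^ 2 * (n * K ^ 2 / 4) :=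
          mul_le_mul_of_nonneg_left hψ (by positivity)
      _ = n / 2 := by field_simp; ring
  nlinarith

end Regular

end Trace

/-! ### Perturbation of a single column of the design. -/

section Perturbation

/-- Difference quotients are bounded in terms of the displaced point, which is why the bound `B`
depends on t; only its limit survives. -/
lemma norm_deriv_sq_le {F : Type*} [NormedAddCommGroup F] [NormedSpace ℝ F] {φ : ℝ → F} {v : F}
    {B : ℝ → ℝ} {B₀ : ℝ} (hφ : HasDerivAt φ v 0) (hB : Tendsto B (𝓝 0) (𝓝 B₀))
    (h : ∀ t, ‖φ t - φ 0‖ ^ 2 ≤ t ^ 2 * B t) : ‖v‖ ^ 2 ≤ B₀ := by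
  have h1 := hφ.tendsto_slope_zero_right
  simp only [zero_add] at h1
  refine le_of_tendsto_of_tendsto (h1.norm.pow 2) (hB.mono_left nhdsWithin_le_nhds) ?_
  filter_upwards [self_mem_nhdsWithin] with t ht
  have ht0 : (0 : ℝ) < t := ht
  rw [norm_smul, mul_pow, norm_inv, inv_pow, Real.norm_eq_abs, sq_abs,
    inv_mul_le_iff₀ (by positivity)]
  exact h t

variable {n p : ℕ} {ρ : ℝ → ℝ} {g : EuclideanSpace ℝ (Fin p) → ℝ} {τ K : ℝ} {L : NNReal}

/-- The response vector `X β + e`. -/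
noncomputable def response (β : EuclideanSpace ℝ (Fin p)) (X : Matrix (Fin n) (Fin p) ℝ)
    (e : EuclideanSpace ℝ (Fin n)) : EuclideanSpace ℝ (Fin n) :=
  mulVecE X β + e

/-- The score vector, as a function of the design and the noise. -/
noncomputable def score (ρ : ℝ → ℝ) (g : EuclideanSpace ℝ (Fin p) → ℝ)
    (β : EuclideanSpace ℝ (Fin p)) (X : Matrix (Fin n) (Fin p) ℝ)
    (e : EuclideanSpace ℝ (Fin n)) : EuclideanSpace ℝ (Fin n) :=
  psiHat ρ g X (response β X e)

/-- The estimation error, as a function of the design and the noise. -/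
noncomputable def estError (ρ : ℝ → ℝ) (g : EuclideanSpace ℝ (Fin p) → ℝ)
    (β : EuclideanSpace ℝ (Fin p)) (X : Matrix (Fin n) (Fin p) ℝ)
    (e : EuclideanSpace ℝ (Fin n)) : EuclideanSpace ℝ (Fin p) :=
  betaHat ρ g X (response β X e) - β

/-- A regularized norm of the score vector, bounded away from zero. -/
noncomputable def regNorm (ρ : ℝ → ℝ) (g : EuclideanSpace ℝ (Fin p) → ℝ)
    (β : EuclideanSpace ℝ (Fin p)) (j : Fin p) (ν : ℝ) (X : Matrix (Fin n) (Fin p) ℝ)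
    (e : EuclideanSpace ℝ (Fin n)) : ℝ :=
  √(‖score ρ g β X e‖ ^ 2 + ν * (1 + estError ρ g β X e j ^ 2))

variable (β : EuclideanSpace ℝ (Fin p)) (j : Fin p)

lemma response_add_columnMatrix (X : Matrix (Fin n) (Fin p) ℝ) (η e : EuclideanSpace ℝ (Fin n)) :
    response β (X + columnMatrix η j) e = response β X e + β j • η := by
  simp only [response, add_mulVecE, mulVecE_columnMatrix]
  abel

/-- The constant in the perturbation bounds. -/
noncomputable def pertConst (τ : ℝ) (L : NNReal) : ℝ := (L + 1 / τ) ^ 2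

namespace Regular

variable (H : Regular n ρ g τ K L)

include H

omit H in
lemma pertConst_nonneg : 0 ≤ pertConst τ L := sq_nonneg _

/-- Adding η to column j also moves the response by β_j η, so the effective shift y' - y - β̂'_j η
equals -h'_j η with h' the new estimation error. The factor L + 1/τ enters twice, to remove the
weights on the left and on the right of `perturbation_column_bound`. -/
lemma score_sub_bound (X : Matrix (Fin n) (Fin p) ℝ) (e η : EuclideanSpace ℝ (Fin n)) :
    ‖score ρ g β (X + columnMatrix η j) e - score ρ g β X e‖ ^ 2
      + n * ‖estError ρ g β (X + columnMatrix η j) e - estError ρ g β X e‖ ^ 2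
      ≤ pertConst τ L * (estError ρ g β (X + columnMatrix η j) e j ^ 2 * ‖η‖ ^ 2
        + inner ℝ η (score ρ g β (X + columnMatrix η j) e) ^ 2 / n) := by
  have hL := H.L_pos
  have hn := H.n_pos
  have hτ := H.τ_pos
  have h := H.perturbation_column_bound X η j (response β X e)
    (response β (X + columnMatrix η j) e)
  have e1 : response β (X + columnMatrix η j) e - response β X e
      - betaHat ρ g (X + columnMatrix η j) (response β (X + columnMatrix η j) e) j • η
      = (-(estError ρ g β (X + columnMatrix η j) e j)) • η := by
    rw [estError, response_add_columnMatrix]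
    simp only [PiLp.sub_apply, neg_sub, sub_smul]
    abel
  have e2 : estError ρ g β (X + columnMatrix η j) e - estError ρ g β X e
      = betaHat ρ g (X + columnMatrix η j) (response β (X + columnMatrix η j) e)
        - betaHat ρ g X (response β X e) := by
    simp only [estError]; abel
  rw [e1, norm_smul, norm_neg, mul_pow, Real.norm_eq_abs, sq_abs, ← e2] at h
  change n * τ * ‖_‖ ^ 2 + ‖score ρ g β (X + columnMatrix η j) e - score ρ g β X e‖ ^ 2 / L
    ≤ L * _ + inner ℝ η (score ρ g β (X + columnMatrix η j) e) ^ 2 / (n * τ) at h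
  set a := ‖score ρ g β (X + columnMatrix η j) e - score ρ g β X e‖ ^ 2
  set d := ‖estError ρ g β (X + columnMatrix η j) e - estError ρ g β X e‖ ^ 2
  set A := estError ρ g β (X + columnMatrix η j) e j ^ 2 * ‖η‖ ^ 2 with hA
  set B := inner ℝ η (score ρ g β (X + columnMatrix η j) e) ^ 2 with hB
  have hA0 : 0 ≤ A := by positivity
  have hB0 : 0 ≤ B := by positivity
  have ha0 : 0 ≤ a := by positivity
  have hd0 : 0 ≤ d := by positivity
  have h1 : a + n * d ≤ (L + 1 / τ) * (n * τ * d + a / L) := by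
    have : (L + 1 / τ) * (n * τ * d + a / L) = a + n * d + L * (n * τ * d) + a / (τ * L) := by
      field_simp; ring
    rw [this]
    have : 0 ≤ L * (n * τ * d) + a / (τ * L) := by positivity
    linarith
  have h2 : L * A + B / (n * τ) ≤ (L + 1 / τ) * (A + B / n) := by
    have : (L + 1 / τ) * (A + B / n) = L * A + B / (n * τ) + L * (B / n) + A / τ := by
      field_simp; ring
    rw [this]
    have : 0 ≤ L * (B / n) + A / τ := by positivity
    linarith
  calc a + n * d ≤ (L + 1 / τ) * (n * τ * d + a / L) := h1
    _ ≤ (L + 1 / τ) * ((L + 1 / τ) * (A + B / n)) := by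
      refine mul_le_mul_of_nonneg_left (h.trans h2) (by positivity)
    _ = _ := by rw [pertConst]; ring

/-- The comparison point keeps the old design but translates the response by -h_j η, so the
effective shift is only (h'_j - h_j) η, which is of higher order in η. What remains to first order
is the single functional ⟨η, ψ⟩, the source of the rank one term. -/
lemma score_sub_translate_bound (X : Matrix (Fin n) (Fin p) ℝ)
    (e η : EuclideanSpace ℝ (Fin n)) :
    ‖score ρ g β (X + columnMatrix η j) e
        - psiHat ρ g X (response β X e - estError ρ g β X e j • η)‖ ^ 2
      ≤ L * (L * ((estError ρ g β (X + columnMatrix η j) e j - estError ρ g β X e j) ^ 2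
          * ‖η‖ ^ 2) + inner ℝ η (score ρ g β (X + columnMatrix η j) e) ^ 2 / (n * τ)) := by
  have hL := H.L_pos
  have hn := H.n_pos
  have hτ := H.τ_pos
  have h := H.perturbation_column_bound X η j (response β X e - estError ρ g β X e j • η)
    (response β (X + columnMatrix η j) e)
  have e1 : response β (X + columnMatrix η j) e - (response β X e - estError ρ g β X e j • η)
      - betaHat ρ g (X + columnMatrix η j) (response β (X + columnMatrix η j) e) j • η
      = (-(estError ρ g β (X + columnMatrix η j) e j - estError ρ g β X e j)) • η := by
    rw [estError, estError, response_add_columnMatrix]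
    simp only [PiLp.sub_apply, neg_sub, sub_smul]
    abel
  rw [e1, norm_smul, norm_neg, mul_pow, Real.norm_eq_abs, sq_abs] at h
  have h1 := (le_add_of_nonneg_left (by positivity)).trans h
  rw [div_le_iff₀ hL] at h1
  rw [mul_comm (L : ℝ)]
  exact h1

variable {ν : ℝ}

omit H in
lemma regNorm_sq_pos (hν : 0 < ν) (X : Matrix (Fin n) (Fin p) ℝ)
    (e : EuclideanSpace ℝ (Fin n)) :
    0 < ‖score ρ g β X e‖ ^ 2 + ν * (1 + estError ρ g β X e j ^ 2) := by positivity

omit H in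
lemma regNorm_pos (hν : 0 < ν) (X : Matrix (Fin n) (Fin p) ℝ)
    (e : EuclideanSpace ℝ (Fin n)) : 0 < regNorm ρ g β j ν X e :=
  Real.sqrt_pos.2 (regNorm_sq_pos β j hν X e)

omit H in
lemma regNorm_sq (hν : 0 < ν) (X : Matrix (Fin n) (Fin p) ℝ) (e : EuclideanSpace ℝ (Fin n)) :
    regNorm ρ g β j ν X e ^ 2 = ‖score ρ g β X e‖ ^ 2 + ν * (1 + estError ρ g β X e j ^ 2) :=
  Real.sq_sqrt (regNorm_sq_pos β j hν X e).le

omit H in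
lemma norm_score_le_regNorm (hν : 0 < ν) (X : Matrix (Fin n) (Fin p) ℝ)
    (e : EuclideanSpace ℝ (Fin n)) : ‖score ρ g β X e‖ ≤ regNorm ρ g β j ν X e := by
  refine Real.le_sqrt_of_sq_le ?_
  have : 0 ≤ ν * (1 + estError ρ g β X e j ^ 2) := by positivity
  linarith

omit H in
lemma regNorm_lower (hν : 0 < ν) (X : Matrix (Fin n) (Fin p) ℝ)
    (e : EuclideanSpace ℝ (Fin n)) : √ν ≤ regNorm ρ g β j ν X e := by
  refine Real.sqrt_le_sqrt ?_
  have : 0 ≤ ‖score ρ g β X e‖ ^ 2 + ν * estError ρ g β X e j ^ 2 := by positivity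
  linarith

omit H in
lemma estError_le_regNorm (hν : 0 < ν) (X : Matrix (Fin n) (Fin p) ℝ)
    (e : EuclideanSpace ℝ (Fin n)) : √ν * |estError ρ g β X e j| ≤ regNorm ρ g β j ν X e := by
  refine Real.le_sqrt_of_sq_le ?_
  rw [mul_pow, Real.sq_sqrt hν.le, sq_abs]
  have : 0 ≤ ‖score ρ g β X e‖ ^ 2 + ν := by positivity
  linarith

-- Write D'² - D² as a sum of differences of squares and divide by D' + D: this sum dominates both
-- ‖u'‖ + ‖u‖ and √ν |h' + h|.
omit H in
lemma abs_regNorm_sub_le (hν : 0 < ν) (hν1 : ν ≤ 1) (X X' : Matrix (Fin n) (Fin p) ℝ)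
    (e : EuclideanSpace ℝ (Fin n)) :
    |regNorm ρ g β j ν X' e - regNorm ρ g β j ν X e|
      ≤ ‖score ρ g β X' e - score ρ g β X e‖ + ‖estError ρ g β X' e - estError ρ g β X e‖ := by
  set D := regNorm ρ g β j ν X e with hD
  set D' := regNorm ρ g β j ν X' e with hD'
  have hD0 : 0 < D := regNorm_pos β j hν X e
  have hD0' : 0 < D' := regNorm_pos β j hν X' e
  set u := score ρ g β X e
  set u' := score ρ g β X' e
  set h := estError ρ g β X e j with hh
  set h' := estError ρ g β X' e j with hh'
  have hu : ‖u‖ ≤ D := norm_score_le_regNorm β j hν X e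
  have hu' : ‖u'‖ ≤ D' := norm_score_le_regNorm β j hν X' e
  have hs : √ν * |h| ≤ D := estError_le_regNorm β j hν X e
  have hs' : √ν * |h'| ≤ D' := estError_le_regNorm β j hν X' e
  have hd : |h' - h| ≤ ‖estError ρ g β X' e - estError ρ g β X e‖ := by
    have := PiLp.norm_apply_le (estError ρ g β X' e - estError ρ g β X e) j
    simpa [Real.norm_eq_abs, hh, hh'] using this
  have hsν : √ν ≤ 1 := by rw [Real.sqrt_le_one]; exact hν1
  have hsν0 : 0 ≤ √ν := Real.sqrt_nonneg _
  have e1 : (D' - D) * (D' + D) = (‖u'‖ - ‖u‖) * (‖u'‖ + ‖u‖) + √ν * √ν * ((h' - h) * (h' + h)) := by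
    have a1 := regNorm_sq (ρ := ρ) (g := g) β j hν X e
    have a2 := regNorm_sq (ρ := ρ) (g := g) β j hν X' e
    rw [Real.mul_self_sqrt hν.le]
    linear_combination a2 - a1
  have h1 : |D' - D| * (D' + D) ≤ (‖u' - u‖ + ‖estError ρ g β X' e - estError ρ g β X e‖)
      * (D' + D) := by
    rw [← abs_of_pos (add_pos hD0' hD0), ← abs_mul, e1, abs_of_pos (add_pos hD0' hD0)]
    refine (abs_add_le _ _).trans ?_
    rw [add_mul]
    refine add_le_add ?_ ?_
    · rw [abs_mul]
      refine mul_le_mul (abs_norm_sub_norm_le _ _) ?_ (abs_nonneg _) (norm_nonneg _)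
      rw [abs_of_nonneg (by positivity)]
      linarith
    · rw [abs_mul, abs_mul (h' - h), abs_of_nonneg (mul_nonneg hsν0 hsν0)]
      have h2 : √ν * |h' + h| ≤ D' + D := by
        refine (mul_le_mul_of_nonneg_left (abs_add_le h' h) hsν0).trans ?_
        rw [mul_add]; exact add_le_add hs' hs
      calc √ν * √ν * (|h' - h| * |h' + h|) = √ν * |h' - h| * (√ν * |h' + h|) := by ring
        _ ≤ _ := by
          refine mul_le_mul ?_ h2 (by positivity) (norm_nonneg _)
          calc √ν * |h' - h| ≤ 1 * |h' - h| := mul_le_mul_of_nonneg_right hsν (abs_nonneg _)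
            _ ≤ _ := by rw [one_mul]; exact hd
  exact le_of_mul_le_mul_right h1 (add_pos hD0' hD0)

lemma norm_add_bound (X : Matrix (Fin n) (Fin p) ℝ) (e η : EuclideanSpace ℝ (Fin n)) :
    (2 * ‖score ρ g β (X + columnMatrix η j) e - score ρ g β X e‖
      + ‖estError ρ g β (X + columnMatrix η j) e - estError ρ g β X e‖) ^ 2
      ≤ 8 * pertConst τ L * (estError ρ g β (X + columnMatrix η j) e j ^ 2 * ‖η‖ ^ 2
        + inner ℝ η (score ρ g β (X + columnMatrix η j) e) ^ 2 / n) := by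
  have h := H.score_sub_bound β j X e η
  set a := ‖score ρ g β (X + columnMatrix η j) e - score ρ g β X e‖
  set d := ‖estError ρ g β (X + columnMatrix η j) e - estError ρ g β X e‖
  have hn : (1 : ℝ) ≤ n := by
    have := H.n_pos
    exact_mod_cast this
  have h1 : d ^ 2 ≤ n * d ^ 2 := le_mul_of_one_le_left (sq_nonneg _) hn
  have h2 : (2 * a + d) ^ 2 ≤ 8 * (a ^ 2 + d ^ 2) := by nlinarith [sq_nonneg (2 * a - d), sq_nonneg d]
  linarith

/-- Perturbation bound for the normalized score vector. -/
lemma normalized_score_sub_sq_le (hν : 0 < ν) (hν1 : ν ≤ 1) (X : Matrix (Fin n) (Fin p) ℝ)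
    (e η : EuclideanSpace ℝ (Fin n)) :
    ‖(regNorm ρ g β j ν (X + columnMatrix η j) e)⁻¹ • score ρ g β (X + columnMatrix η j) e
      - (regNorm ρ g β j ν X e)⁻¹ • score ρ g β X e‖ ^ 2
      ≤ 8 * pertConst τ L * ((estError ρ g β (X + columnMatrix η j) e j ^ 2 * ‖η‖ ^ 2
        + inner ℝ η (score ρ g β (X + columnMatrix η j) e) ^ 2 / n)
        / regNorm ρ g β j ν (X + columnMatrix η j) e ^ 2) := by
  have hb := H.norm_add_bound β j X e η
  have hD := abs_regNorm_sub_le (ρ := ρ) (g := g) β j hν hν1 X (X + columnMatrix η j) e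
  set X' := X + columnMatrix η j
  set D := regNorm ρ g β j ν X e with hDd
  set D' := regNorm ρ g β j ν X' e with hDd'
  have hD0 : 0 < D := regNorm_pos β j hν X e
  have hD0' : 0 < D' := regNorm_pos β j hν X' e
  have hu : ‖score ρ g β X e‖ ≤ D := norm_score_le_regNorm β j hν X e
  set u := score ρ g β X e
  set u' := score ρ g β X' e
  -- The second term has norm at most |D' - D| / D', because ‖u‖ ≤ D. The bound on |D' - D|
  -- contributes another ‖u' - u‖, whence the coefficient 2 below.
  have e1 : D'⁻¹ • u' - D⁻¹ • u = D'⁻¹ • (u' - u) + ((D - D') * D'⁻¹ * D⁻¹) • u := by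
    have : (D - D') * D'⁻¹ * D⁻¹ = D'⁻¹ - D⁻¹ := by field_simp
    rw [this, smul_sub, sub_smul]; abel
  have h1 : ‖D'⁻¹ • u' - D⁻¹ • u‖ ≤ D'⁻¹ * (2 * ‖u' - u‖ + ‖estError ρ g β X' e
      - estError ρ g β X e‖) := by
    rw [e1]
    refine (norm_add_le _ _).trans ?_
    rw [norm_smul, norm_smul, norm_inv, Real.norm_of_nonneg hD0'.le, norm_mul, norm_mul, norm_inv,
      norm_inv, Real.norm_of_nonneg hD0'.le, Real.norm_of_nonneg hD0.le, Real.norm_eq_abs,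
      abs_sub_comm]
    have h2 : D⁻¹ * ‖u‖ ≤ 1 := by rw [inv_mul_le_iff₀ hD0]; linarith
    have h3 : |D' - D| * (D⁻¹ * ‖u‖) ≤ |D' - D| * 1 :=
      mul_le_mul_of_nonneg_left h2 (abs_nonneg _)
    have h4 : D'⁻¹ * (|D' - D| * (D⁻¹ * ‖u‖)) ≤ D'⁻¹ * (‖u' - u‖
        + ‖estError ρ g β X' e - estError ρ g β X e‖) :=
      mul_le_mul_of_nonneg_left (by linarith) (by positivity)
    calc _ = D'⁻¹ * ‖u' - u‖ + D'⁻¹ * (|D' - D| * (D⁻¹ * ‖u‖)) := by ring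
      _ ≤ D'⁻¹ * ‖u' - u‖ + D'⁻¹ * (‖u' - u‖ + ‖estError ρ g β X' e - estError ρ g β X e‖) := by
        linarith
      _ = _ := by ring
  calc _ ≤ (D'⁻¹ * (2 * ‖u' - u‖ + ‖estError ρ g β X' e - estError ρ g β X e‖)) ^ 2 :=
        pow_le_pow_left₀ (norm_nonneg _) h1 2
    _ = D'⁻¹ ^ 2 * (2 * ‖u' - u‖ + ‖estError ρ g β X' e - estError ρ g β X e‖) ^ 2 := by ring
    _ ≤ D'⁻¹ ^ 2 * _ := mul_le_mul_of_nonneg_left hb (by positivity)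
    _ = _ := by rw [inv_pow]; ring

/-- Perturbation bound for the inverse of the regularized norm. -/
lemma inv_regNorm_sub_sq_le (hν : 0 < ν) (hν1 : ν ≤ 1) (X : Matrix (Fin n) (Fin p) ℝ)
    (e η : EuclideanSpace ℝ (Fin n)) :
    ((regNorm ρ g β j ν (X + columnMatrix η j) e)⁻¹ - (regNorm ρ g β j ν X e)⁻¹) ^ 2
      ≤ 8 * pertConst τ L * ((estError ρ g β (X + columnMatrix η j) e j ^ 2 * ‖η‖ ^ 2
        + inner ℝ η (score ρ g β (X + columnMatrix η j) e) ^ 2 / n)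
        / regNorm ρ g β j ν (X + columnMatrix η j) e ^ 2) / regNorm ρ g β j ν X e ^ 2 := by
  have hb := H.norm_add_bound β j X e η
  have hD := abs_regNorm_sub_le (ρ := ρ) (g := g) β j hν hν1 X (X + columnMatrix η j) e
  set X' := X + columnMatrix η j
  set D := regNorm ρ g β j ν X e with hDd
  set D' := regNorm ρ g β j ν X' e with hDd'
  have hD0 : 0 < D := regNorm_pos β j hν X e
  have hD0' : 0 < D' := regNorm_pos β j hν X' e
  have e1 : (D'⁻¹ - D⁻¹) ^ 2 = |D' - D| ^ 2 * (D'⁻¹ ^ 2 * D⁻¹ ^ 2) := by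
    rw [sq_abs]; field_simp; ring
  rw [e1]
  calc _ ≤ (2 * ‖score ρ g β X' e - score ρ g β X e‖ + ‖estError ρ g β X' e
        - estError ρ g β X e‖) ^ 2 * (D'⁻¹ ^ 2 * D⁻¹ ^ 2) := by
        refine mul_le_mul_of_nonneg_right (pow_le_pow_left₀ (abs_nonneg _) ?_ 2) (by positivity)
        have := norm_nonneg (score ρ g β X' e - score ρ g β X e)
        linarith
    _ ≤ _ * (D'⁻¹ ^ 2 * D⁻¹ ^ 2) := mul_le_mul_of_nonneg_right hb (by positivity)
    _ = _ := by rw [inv_pow, inv_pow]; field_simp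

end Regular

end Perturbation

/-! ### The score as a function of one Gaussian column. -/

section GaussianColumn

variable {n p : ℕ} {ρ : ℝ → ℝ} {g : EuclideanSpace ℝ (Fin p) → ℝ} {τ K : ℝ} {L : NNReal}

/-- The design obtained by adding `σ z` to column `j`. -/
def shiftColumn (X : Matrix (Fin n) (Fin p) ℝ) (j : Fin p) (σ : ℝ)
    (z : EuclideanSpace ℝ (Fin n)) : Matrix (Fin n) (Fin p) ℝ :=
  X + columnMatrix (σ • z) j

lemma columnMatrix_add (η ζ : EuclideanSpace ℝ (Fin n)) (j : Fin p) :
    columnMatrix (η + ζ) j = columnMatrix η j + columnMatrix ζ j := by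
  ext i k
  by_cases hk : k = j <;> simp [columnMatrix, hk]

lemma shiftColumn_add (X : Matrix (Fin n) (Fin p) ℝ) (j : Fin p) (σ : ℝ)
    (z η : EuclideanSpace ℝ (Fin n)) :
    shiftColumn X j σ (z + η) = shiftColumn X j σ z + columnMatrix (σ • η) j := by
  rw [shiftColumn, shiftColumn, smul_add, columnMatrix_add, add_assoc]

lemma continuous_columnMatrix (j : Fin p) :
    Continuous fun η : EuclideanSpace ℝ (Fin n) => columnMatrix η j := by
  refine continuous_matrix fun i k => ?_
  by_cases hk : k = j
  · simp only [columnMatrix, Matrix.of_apply, hk, if_true]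
    exact PiLp.continuous_apply 2 (fun _ : Fin n => ℝ) i
  · simp only [columnMatrix, Matrix.of_apply, hk, if_false]
    exact continuous_const

lemma continuous_shiftColumn (X : Matrix (Fin n) (Fin p) ℝ) (j : Fin p) (σ : ℝ) :
    Continuous (shiftColumn X j σ) := by
  have h := (continuous_columnMatrix (n := n) j).comp
    (continuous_id.const_smul σ : Continuous fun z : EuclideanSpace ℝ (Fin n) => σ • z)
  simp only [Function.comp_def] at h
  exact continuous_const.add h

variable (β : EuclideanSpace ℝ (Fin p)) (j : Fin p)

lemma continuous_response {α : Type*} [TopologicalSpace α] {X : α → Matrix (Fin n) (Fin p) ℝ}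
    {e : α → EuclideanSpace ℝ (Fin n)} (hX : Continuous X) (he : Continuous e) :
    Continuous fun a => response β (X a) (e a) := by
  unfold response
  exact (continuous_mulVecE_comp hX continuous_const).add he

namespace Regular

variable (H : Regular n ρ g τ K L)

include H

section Continuity

variable {α : Type*} [TopologicalSpace α] {X : α → Matrix (Fin n) (Fin p) ℝ}
    {e : α → EuclideanSpace ℝ (Fin n)} (hX : Continuous X) (he : Continuous e)

include hX he

lemma continuous_score : Continuous fun a => score ρ g β (X a) (e a) := by
  unfold score
  exact H.continuous_psiHat hX (continuous_response β hX he)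

lemma continuous_estError : Continuous fun a => estError ρ g β (X a) (e a) := by
  unfold estError
  exact (H.continuous_betaHat hX (continuous_response β hX he)).sub continuous_const

lemma continuous_estError_apply : Continuous fun a => estError ρ g β (X a) (e a) j := by
  have h := (PiLp.continuous_apply 2 (fun _ : Fin p => ℝ) j).comp (H.continuous_estError β hX he)
  simp only [Function.comp_def] at h
  exact h

lemma continuous_regNorm (ν : ℝ) : Continuous fun a => regNorm ρ g β j ν (X a) (e a) := by
  unfold regNorm
  have h1 := H.continuous_score β hX he
  have h2 := H.continuous_estError_apply β j hX he
  exact ((h1.norm.pow 2).add (continuous_const.mul (continuous_const.add (h2.pow 2)))).sqrt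

end Continuity

variable {ν : ℝ} (X : Matrix (Fin n) (Fin p) ℝ) (e : EuclideanSpace ℝ (Fin n)) (σ : ℝ)

omit H in
/-- The score vector divided by its regularized norm, as a function of the Gaussian column. -/
lemma regNorm_ratio_le (hν : 0 < ν) (η : EuclideanSpace ℝ (Fin n)) (hn : (1 : ℝ) ≤ n) :
    (estError ρ g β X e j ^ 2 * ‖η‖ ^ 2 + inner ℝ η (score ρ g β X e) ^ 2 / n)
      / regNorm ρ g β j ν X e ^ 2 ≤ (1 / ν + 1) * ‖η‖ ^ 2 := by
  have hD := regNorm_pos (ρ := ρ) (g := g) β j hν X e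
  have h1 := norm_score_le_regNorm (ρ := ρ) (g := g) β j hν X e
  have h2 := estError_le_regNorm (ρ := ρ) (g := g) β j hν X e
  set D := regNorm ρ g β j ν X e
  have h3 : ν * estError ρ g β X e j ^ 2 ≤ D ^ 2 := by
    have := pow_le_pow_left₀ (by positivity) h2 2
    rwa [mul_pow, Real.sq_sqrt hν.le, sq_abs] at this
  have h4 : inner ℝ η (score ρ g β X e) ^ 2 / n ≤ ‖η‖ ^ 2 * D ^ 2 := by
    refine (div_le_self (sq_nonneg _) hn).trans ?_
    rw [← mul_pow, ← sq_abs]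
    exact pow_le_pow_left₀ (abs_nonneg _) ((abs_real_inner_le_norm _ _).trans
      (mul_le_mul_of_nonneg_left h1 (norm_nonneg _))) 2
  rw [div_le_iff₀ (by positivity)]
  have h5 : estError ρ g β X e j ^ 2 ≤ 1 / ν * D ^ 2 := by
    rw [div_mul_eq_mul_div, one_mul, le_div_iff₀ hν]; linarith
  have h6 : estError ρ g β X e j ^ 2 * ‖η‖ ^ 2 ≤ 1 / ν * D ^ 2 * ‖η‖ ^ 2 :=
    mul_le_mul_of_nonneg_right h5 (sq_nonneg _)
  linarith

lemma one_le_n : (1 : ℝ) ≤ n := by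
  have := H.n_pos
  exact_mod_cast this

/-- The normalized score vector as a function of the Gaussian column. -/
lemma exists_lipschitzWith_normalized_score (hν : 0 < ν) (hν1 : ν ≤ 1) :
    ∃ C : NNReal, LipschitzWith C fun z => (regNorm ρ g β j ν (shiftColumn X j σ z) e)⁻¹
      • score ρ g β (shiftColumn X j σ z) e := by
  refine ⟨(√(8 * pertConst τ L * ((1 / ν + 1) * σ ^ 2))).toNNReal,
    LipschitzWith.of_dist_le_mul fun z' z => ?_⟩
  rw [dist_eq_norm, dist_eq_norm, Real.coe_toNNReal _ (Real.sqrt_nonneg _)]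
  have h := H.normalized_score_sub_sq_le β j hν hν1 (shiftColumn X j σ z) e (σ • (z' - z))
  rw [← shiftColumn_add, add_sub_cancel] at h
  have h2 := regNorm_ratio_le (ρ := ρ) (g := g) β j (shiftColumn X j σ z') e hν (σ • (z' - z))
    H.one_le_n
  have hC : 0 ≤ 8 * pertConst τ L := mul_nonneg (by norm_num) pertConst_nonneg
  have h3 := h.trans (mul_le_mul_of_nonneg_left h2 hC)
  rw [norm_smul, mul_pow, Real.norm_eq_abs, sq_abs] at h3
  refine abs_le_of_sq_le_sq' ?_ (by positivity) |>.2
  rw [mul_pow, Real.sq_sqrt (by positivity)]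
  linarith

/-- In the regularized norm D, the summand ν h_j² bounds h_j²/D² by 1/ν and the summand ν bounds D
away from zero, which makes the map globally Lipschitz. The constant degenerates as ν → 0 but serves
only to obtain differentiability almost everywhere. -/
lemma exists_lipschitzWith_inv_regNorm (hν : 0 < ν) (hν1 : ν ≤ 1) :
    ∃ C : NNReal, LipschitzWith C fun z => (regNorm ρ g β j ν (shiftColumn X j σ z) e)⁻¹ := by
  refine ⟨(√(8 * pertConst τ L * ((1 / ν + 1) * σ ^ 2) / ν)).toNNReal,
    LipschitzWith.of_dist_le_mul fun z' z => ?_⟩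
  rw [dist_eq_norm, dist_eq_norm, Real.coe_toNNReal _ (Real.sqrt_nonneg _)]
  have h := H.inv_regNorm_sub_sq_le β j hν hν1 (shiftColumn X j σ z) e (σ • (z' - z))
  rw [← shiftColumn_add, add_sub_cancel] at h
  have h2 := regNorm_ratio_le (ρ := ρ) (g := g) β j (shiftColumn X j σ z') e hν (σ • (z' - z))
    H.one_le_n
  have hC : 0 ≤ 8 * pertConst τ L := mul_nonneg (by norm_num) pertConst_nonneg
  have hD : ν ≤ regNorm ρ g β j ν (shiftColumn X j σ z) e ^ 2 := by
    have := pow_le_pow_left₀ (Real.sqrt_nonneg _)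
      (regNorm_lower (ρ := ρ) (g := g) β j hν (shiftColumn X j σ z) e) 2
    rwa [Real.sq_sqrt hν.le] at this
  have h3 := h.trans (div_le_div₀ (by positivity) (mul_le_mul_of_nonneg_left h2 hC) hν hD)
  rw [norm_smul, mul_pow, Real.norm_eq_abs, sq_abs] at h3
  rw [Real.norm_eq_abs]
  refine abs_le_of_sq_le_sq ?_ (by positivity)
  rw [mul_pow, Real.sq_sqrt (by positivity)]
  refine h3.trans (le_of_eq ?_)
  ring

/-- The squared directional sensitivity, relative to the regularized norm. -/
lemma norm_fderiv_normalized_score_sq_le (hν : 0 < ν) (hν1 : ν ≤ 1)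
    {z : EuclideanSpace ℝ (Fin n)}
    (hd : DifferentiableAt ℝ (fun z => (regNorm ρ g β j ν (shiftColumn X j σ z) e)⁻¹
      • score ρ g β (shiftColumn X j σ z) e) z) (η : EuclideanSpace ℝ (Fin n)) :
    ‖fderiv ℝ (fun z => (regNorm ρ g β j ν (shiftColumn X j σ z) e)⁻¹
      • score ρ g β (shiftColumn X j σ z) e) z η‖ ^ 2
      ≤ 8 * pertConst τ L * (σ ^ 2 * ((estError ρ g β (shiftColumn X j σ z) e j ^ 2 * ‖η‖ ^ 2
        + inner ℝ η (score ρ g β (shiftColumn X j σ z) e) ^ 2 / n)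
        / regNorm ρ g β j ν (shiftColumn X j σ z) e ^ 2)) := by
  have hpath : Continuous fun t : ℝ => shiftColumn X j σ (z + t • η) := by
    have h := (continuous_shiftColumn X j σ).comp
      (continuous_const.add (continuous_id.smul continuous_const) :
        Continuous fun t : ℝ => z + t • η)
    simp only [Function.comp_def] at h
    exact h
  have c1 := H.continuous_score β hpath (continuous_const (y := e))
  have c2 := H.continuous_estError_apply β j hpath (continuous_const (y := e))
  have c3 := H.continuous_regNorm β j hpath (continuous_const (y := e)) ν
  have hD : ∀ t : ℝ, regNorm ρ g β j ν (shiftColumn X j σ (z + t • η)) e ^ 2 ≠ 0 := fun t =>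
    (pow_pos (regNorm_pos β j hν _ e) 2).ne'
  have hB : Continuous fun t : ℝ => 8 * pertConst τ L * (σ ^ 2 *
      ((estError ρ g β (shiftColumn X j σ (z + t • η)) e j ^ 2 * ‖η‖ ^ 2
        + inner ℝ η (score ρ g β (shiftColumn X j σ (z + t • η)) e) ^ 2 / n)
        / regNorm ρ g β j ν (shiftColumn X j σ (z + t • η)) e ^ 2)) :=
    continuous_const.mul (continuous_const.mul ((((c2.pow 2).mul continuous_const).add
      (((continuous_const.inner c1).pow 2).div_const _)).div (c3.pow 2) hD))
  have hB0 := hB.tendsto 0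
  simp only [zero_smul, add_zero] at hB0
  -- The perturbation bound is evaluated at z + tη. Along this line it is t² times a continuous
  -- function of t, whose value at 0 is the claim.
  refine norm_deriv_sq_le (hd.hasFDerivAt.hasLineDerivAt η) hB0 fun t => ?_
  have h := H.normalized_score_sub_sq_le β j hν hν1 (shiftColumn X j σ z) e (σ • (t • η))
  rw [← shiftColumn_add] at h
  simp only [zero_smul, add_zero]
  refine h.trans (le_of_eq ?_)
  rw [real_inner_smul_left, real_inner_smul_left, norm_smul, norm_smul, mul_pow, mul_pow,
    Real.norm_eq_abs, sq_abs, Real.norm_eq_abs, sq_abs]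
  ring

lemma fderiv_inv_regNorm_sq_le (hν : 0 < ν) (hν1 : ν ≤ 1) {z : EuclideanSpace ℝ (Fin n)}
    (hd : DifferentiableAt ℝ (fun z => (regNorm ρ g β j ν (shiftColumn X j σ z) e)⁻¹) z)
    (η : EuclideanSpace ℝ (Fin n)) :
    (fderiv ℝ (fun z => (regNorm ρ g β j ν (shiftColumn X j σ z) e)⁻¹) z η) ^ 2
      ≤ 8 * pertConst τ L * (σ ^ 2 * ((estError ρ g β (shiftColumn X j σ z) e j ^ 2 * ‖η‖ ^ 2
        + inner ℝ η (score ρ g β (shiftColumn X j σ z) e) ^ 2 / n)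
        / regNorm ρ g β j ν (shiftColumn X j σ z) e ^ 2))
        / regNorm ρ g β j ν (shiftColumn X j σ z) e ^ 2 := by
  have hpath : Continuous fun t : ℝ => shiftColumn X j σ (z + t • η) := by
    have h := (continuous_shiftColumn X j σ).comp
      (continuous_const.add (continuous_id.smul continuous_const) :
        Continuous fun t : ℝ => z + t • η)
    simp only [Function.comp_def] at h
    exact h
  have c1 := H.continuous_score β hpath (continuous_const (y := e))
  have c2 := H.continuous_estError_apply β j hpath (continuous_const (y := e))
  have c3 := H.continuous_regNorm β j hpath (continuous_const (y := e)) ν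
  have hD : ∀ t : ℝ, regNorm ρ g β j ν (shiftColumn X j σ (z + t • η)) e ^ 2 ≠ 0 := fun t =>
    (pow_pos (regNorm_pos β j hν _ e) 2).ne'
  have hB : Continuous fun t : ℝ => 8 * pertConst τ L * (σ ^ 2 *
      ((estError ρ g β (shiftColumn X j σ (z + t • η)) e j ^ 2 * ‖η‖ ^ 2
        + inner ℝ η (score ρ g β (shiftColumn X j σ (z + t • η)) e) ^ 2 / n)
        / regNorm ρ g β j ν (shiftColumn X j σ (z + t • η)) e ^ 2))
        / regNorm ρ g β j ν (shiftColumn X j σ z) e ^ 2 :=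
    (continuous_const.mul (continuous_const.mul ((((c2.pow 2).mul continuous_const).add
      (((continuous_const.inner c1).pow 2).div_const _)).div (c3.pow 2) hD))).div_const _
  have hB0 := hB.tendsto 0
  simp only [zero_smul, add_zero] at hB0
  have h0 := norm_deriv_sq_le (hd.hasFDerivAt.hasLineDerivAt η) hB0 fun t => by
    have h := H.inv_regNorm_sub_sq_le β j hν hν1 (shiftColumn X j σ z) e (σ • (t • η))
    rw [← shiftColumn_add] at h
    simp only [zero_smul, add_zero]
    rw [Real.norm_eq_abs, sq_abs]
    refine h.trans (le_of_eq ?_)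
    rw [real_inner_smul_left, real_inner_smul_left, norm_smul, norm_smul, mul_pow, mul_pow,
      Real.norm_eq_abs, sq_abs, Real.norm_eq_abs, sq_abs]
    ring
  rwa [Real.norm_eq_abs, sq_abs] at h0

/-- The derivative of the score vector with respect to the Gaussian column agrees with the
Jacobian with respect to the response, up to a rank one term. -/
lemma norm_fderiv_score_add_sq_le {z : EuclideanSpace ℝ (Fin n)}
    (hd : DifferentiableAt ℝ (fun z => score ρ g β (shiftColumn X j σ z) e) z)
    (hV : DifferentiableAt ℝ (psiHat ρ g (shiftColumn X j σ z))
      (response β (shiftColumn X j σ z) e)) (η : EuclideanSpace ℝ (Fin n)) :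
    ‖fderiv ℝ (fun z => score ρ g β (shiftColumn X j σ z) e) z η
      + (σ * estError ρ g β (shiftColumn X j σ z) e j) •
        fderiv ℝ (psiHat ρ g (shiftColumn X j σ z)) (response β (shiftColumn X j σ z) e) η‖ ^ 2
      ≤ L * σ ^ 2 / (n * τ) * inner ℝ η (score ρ g β (shiftColumn X j σ z) e) ^ 2 := by
  have hpath : Continuous fun t : ℝ => shiftColumn X j σ (z + t • η) := by
    have h := (continuous_shiftColumn X j σ).comp
      (continuous_const.add (continuous_id.smul continuous_const) :
        Continuous fun t : ℝ => z + t • η)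
    simp only [Function.comp_def] at h
    exact h
  have c1 := H.continuous_score β hpath (continuous_const (y := e))
  have c2 := H.continuous_estError_apply β j hpath (continuous_const (y := e))
  set h₀ := estError ρ g β (shiftColumn X j σ z) e j with hh₀
  have hB : Continuous fun t : ℝ => L * (L * ((estError ρ g β (shiftColumn X j σ (z + t • η)) e j
      - h₀) ^ 2 * (σ ^ 2 * ‖η‖ ^ 2))
      + σ ^ 2 * inner ℝ η (score ρ g β (shiftColumn X j σ (z + t • η)) e) ^ 2 / (n * τ)) :=
    continuous_const.mul ((continuous_const.mul (((c2.sub continuous_const).pow 2).mul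
      continuous_const)).add ((continuous_const.mul
        ((continuous_const.inner c1).pow 2)).div_const _))
  have hB0 := hB.tendsto 0
  simp only [zero_smul, add_zero, ← hh₀, sub_self] at hB0
  -- The curve subtracted here moves the response linearly at speed -σ h₀ η with the design fixed,
  -- so its derivative is -σ h₀ V η. The difference of the two curves vanishes at t = 0, and the
  -- factor h_j(t) - h₀ tends to 0.
  have hderiv : HasDerivAt (fun t : ℝ => score ρ g β (shiftColumn X j σ (z + t • η)) e
      - psiHat ρ g (shiftColumn X j σ z) (response β (shiftColumn X j σ z) e
        + t • (-(σ * h₀) • η)))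
      (fderiv ℝ (fun z => score ρ g β (shiftColumn X j σ z) e) z η
      + (σ * h₀) • fderiv ℝ (psiHat ρ g (shiftColumn X j σ z))
        (response β (shiftColumn X j σ z) e) η) 0 := by
    have h1 : HasDerivAt (fun t : ℝ => score ρ g β (shiftColumn X j σ (z + t • η)) e)
        (fderiv ℝ (fun z => score ρ g β (shiftColumn X j σ z) e) z η) 0 :=
      hd.hasFDerivAt.hasLineDerivAt η
    have h2 : HasDerivAt (fun t : ℝ => psiHat ρ g (shiftColumn X j σ z)
        (response β (shiftColumn X j σ z) e + t • (-(σ * h₀) • η)))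
        (fderiv ℝ (psiHat ρ g (shiftColumn X j σ z)) (response β (shiftColumn X j σ z) e)
          (-(σ * h₀) • η)) 0 := hV.hasFDerivAt.hasLineDerivAt (-(σ * h₀) • η)
    refine (h1.sub h2).congr_deriv ?_
    rw [map_smul, neg_smul, sub_neg_eq_add]
  have h0 := norm_deriv_sq_le hderiv hB0 fun t => by
    have h := H.score_sub_translate_bound β j (shiftColumn X j σ z) e (σ • (t • η))
    rw [← shiftColumn_add] at h
    have e0 : score ρ g β (shiftColumn X j σ (z + (0 : ℝ) • η)) e
      - psiHat ρ g (shiftColumn X j σ z) (response β (shiftColumn X j σ z) e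
        + (0 : ℝ) • (-(σ * h₀) • η)) = 0 := by
      rw [zero_smul, zero_smul, add_zero, add_zero]
      exact sub_self _
    have e1 : response β (shiftColumn X j σ z) e - h₀ • (σ • (t • η))
        = response β (shiftColumn X j σ z) e + t • (-(σ * h₀) • η) := by
      rw [sub_eq_add_neg, smul_smul, smul_smul, smul_smul, ← neg_smul]
      congr 2
      ring
    rw [e0, sub_zero]
    rw [← hh₀, e1] at h
    refine h.trans (le_of_eq ?_)
    rw [real_inner_smul_left, real_inner_smul_left, norm_smul, norm_smul, mul_pow, mul_pow,
      Real.norm_eq_abs, sq_abs, Real.norm_eq_abs, sq_abs]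
    ring
  refine h0.trans (le_of_eq ?_)
  ring

end Regular

end GaussianColumn

/-! ### Traces of rank one maps. -/

section RankOne

variable {n : ℕ}

lemma sum_inner_basisFun_sq (v : EuclideanSpace ℝ (Fin n)) :
    ∑ i, inner ℝ (EuclideanSpace.basisFun (Fin n) ℝ i) v ^ 2 = ‖v‖ ^ 2 := by
  rw [EuclideanSpace.real_norm_sq_eq]
  exact Finset.sum_congr rfl fun i _ => by
    rw [EuclideanSpace.basisFun_apply, EuclideanSpace.inner_single_left]; simp

/-- A linear map controlled by a single linear functional has rank one. -/
lemma abs_sum_inner_apply_le {W : EuclideanSpace ℝ (Fin n) →L[ℝ] EuclideanSpace ℝ (Fin n)}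
    {ψ : EuclideanSpace ℝ (Fin n)} {c : ℝ} (hW : ∀ η, ‖W η‖ ^ 2 ≤ c * inner ℝ η ψ ^ 2) :
    (∑ i, inner ℝ (EuclideanSpace.basisFun (Fin n) ℝ i)
      (W (EuclideanSpace.basisFun (Fin n) ℝ i))) ^ 2 ≤ c * ‖ψ‖ ^ 2 := by
  have hzero : ∀ η, inner ℝ η ψ = 0 → W η = 0 := fun η hη => by
    have := hW η
    rw [hη] at this
    have h2 : ‖W η‖ ^ 2 ≤ 0 := by simpa using this
    exact norm_eq_zero.1 (pow_eq_zero_iff two_ne_zero |>.1 (le_antisymm h2 (sq_nonneg _)))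
  by_cases hψ : ψ = 0
  · subst hψ
    simp [hzero _ (inner_zero_right _)]
  have hpos : 0 < ‖ψ‖ ^ 2 := by positivity
  -- W vanishes on the orthogonal complement of ψ, hence factors through the projection onto ψ; its
  -- trace has no factor n.
  have hrank : ∀ η, W η = (inner ℝ η ψ / ‖ψ‖ ^ 2) • W ψ := fun η => by
    have := hzero (η - (inner ℝ η ψ / ‖ψ‖ ^ 2) • ψ) (by
      rw [inner_sub_left, real_inner_smul_left, real_inner_self_eq_norm_sq,
        div_mul_cancel₀ _ hpos.ne', sub_self])
    rwa [map_sub, map_smul, sub_eq_zero] at this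
  have htr : ∑ i, inner ℝ (EuclideanSpace.basisFun (Fin n) ℝ i)
      (W (EuclideanSpace.basisFun (Fin n) ℝ i)) = inner ℝ ψ (W ψ) / ‖ψ‖ ^ 2 := by
    rw [← (EuclideanSpace.basisFun (Fin n) ℝ).sum_inner_mul_inner ψ (W ψ), Finset.sum_div]
    refine Finset.sum_congr rfl fun i _ => ?_
    rw [hrank, real_inner_smul_right, real_inner_comm ψ]
    ring
  have h1 : inner ℝ ψ (W ψ) ^ 2 ≤ ‖ψ‖ ^ 2 * ‖W ψ‖ ^ 2 := by
    rw [← mul_pow, ← sq_abs]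
    exact pow_le_pow_left₀ (abs_nonneg _) (abs_real_inner_le_norm _ _) 2
  have h2 := hW ψ
  rw [real_inner_self_eq_norm_sq] at h2
  rw [htr, div_pow, div_le_iff₀ (by positivity)]
  calc _ ≤ ‖ψ‖ ^ 2 * ‖W ψ‖ ^ 2 := h1
    _ ≤ ‖ψ‖ ^ 2 * (c * (‖ψ‖ ^ 2) ^ 2) := mul_le_mul_of_nonneg_left h2 hpos.le
    _ = _ := by ring

end RankOne

/-! ### Derivatives of weighted vector fields. -/

section Differentiation

variable {n : ℕ} {w G : EuclideanSpace ℝ (Fin n) → ℝ}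
  {ψ : EuclideanSpace ℝ (Fin n) → EuclideanSpace ℝ (Fin n)} {z : EuclideanSpace ℝ (Fin n)}

/-- Global Lipschitz bounds are available for the inverse norm and for the normalized score;
differentiability of the score itself is recovered by division. -/
lemma differentiableAt_of_smul (hG0 : ∀ z, G z ≠ 0) (hG : DifferentiableAt ℝ G z)
    (hF : DifferentiableAt ℝ (fun z => G z • ψ z) z) : DifferentiableAt ℝ ψ z := by
  have h := (hG.inv (hG0 z)).smul hF
  refine h.congr_of_eventuallyEq (Eventually.of_forall fun x => ?_)
  simp [smul_smul, inv_mul_cancel₀ (hG0 x)]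

/-- The squared Frobenius norm of the derivative of a product. -/
lemma sum_norm_fderiv_smul_sq_le {F : EuclideanSpace ℝ (Fin n) → EuclideanSpace ℝ (Fin n)}
    (hw : DifferentiableAt ℝ w z) (hF : DifferentiableAt ℝ F z) (hF1 : ‖F z‖ ≤ 1) :
    ∑ i, ‖fderiv ℝ (fun z => w z • F z) z (EuclideanSpace.basisFun (Fin n) ℝ i)‖ ^ 2
      ≤ 2 * w z ^ 2 * ∑ i, ‖fderiv ℝ F z (EuclideanSpace.basisFun (Fin n) ℝ i)‖ ^ 2
        + 2 * ‖fderiv ℝ w z‖ ^ 2 := by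
  have hgrad : ∑ i, (fderiv ℝ w z (EuclideanSpace.basisFun (Fin n) ℝ i)) ^ 2
      = ‖fderiv ℝ w z‖ ^ 2 := by
    have h1 := sum_inner_basisFun_sq ((InnerProductSpace.toDual ℝ _).symm (fderiv ℝ w z))
    rw [LinearIsometryEquiv.norm_map] at h1
    rw [← h1]
    refine Finset.sum_congr rfl fun i _ => ?_
    rw [real_inner_comm, InnerProductSpace.toDual_symm_apply]
  rw [← hgrad, Finset.mul_sum, Finset.mul_sum, ← Finset.sum_add_distrib]
  refine Finset.sum_le_sum fun i _ => ?_
  have h := fderiv_fun_smul hw hF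
  rw [h]
  set b := EuclideanSpace.basisFun (Fin n) ℝ i
  have h2 : ‖w z • fderiv ℝ F z b + (fderiv ℝ w z b) • F z‖
      ≤ |w z| * ‖fderiv ℝ F z b‖ + |fderiv ℝ w z b| := by
    refine (norm_add_le _ _).trans (add_le_add (norm_smul _ _).le ?_)
    rw [norm_smul, Real.norm_eq_abs]
    exact mul_le_of_le_one_right (abs_nonneg _) hF1
  have h3 := pow_le_pow_left₀ (norm_nonneg _) h2 2
  refine h3.trans ?_
  have h4 := add_sq_le (a := |w z| * ‖fderiv ℝ F z b‖) (b := |fderiv ℝ w z b|)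
  rw [mul_pow, sq_abs, sq_abs] at h4
  linarith

lemma sum_inner_fderiv_smul (hw : DifferentiableAt ℝ w z) (hG : DifferentiableAt ℝ G z)
    (hψ : DifferentiableAt ℝ ψ z) :
    ∑ i, inner ℝ (EuclideanSpace.basisFun (Fin n) ℝ i)
        (fderiv ℝ (fun z => w z • G z • ψ z) z (EuclideanSpace.basisFun (Fin n) ℝ i))
      = w z * G z * ∑ i, inner ℝ (EuclideanSpace.basisFun (Fin n) ℝ i)
          (fderiv ℝ ψ z (EuclideanSpace.basisFun (Fin n) ℝ i))
        + w z * fderiv ℝ G z (ψ z) + G z * fderiv ℝ w z (ψ z) := by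
  have hexp : ∀ A : EuclideanSpace ℝ (Fin n) →L[ℝ] ℝ,
      A (ψ z) = ∑ i, inner ℝ (EuclideanSpace.basisFun (Fin n) ℝ i) (ψ z)
        * A (EuclideanSpace.basisFun (Fin n) ℝ i) := fun A => by
    conv_lhs => rw [← (EuclideanSpace.basisFun (Fin n) ℝ).sum_repr' (ψ z)]
    simp only [map_sum, map_smul, smul_eq_mul]
  rw [hexp (fderiv ℝ G z), hexp (fderiv ℝ w z), Finset.mul_sum, Finset.mul_sum, Finset.mul_sum,
    ← Finset.sum_add_distrib, ← Finset.sum_add_distrib]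
  refine Finset.sum_congr rfl fun i _ => ?_
  have h1 := fderiv_fun_smul hw (hG.fun_smul hψ)
  have h2 := fderiv_fun_smul hG hψ
  rw [h1, h2]
  simp only [add_apply, smul_apply,
    ContinuousLinearMap.smulRight_apply, inner_add_right, real_inner_smul_right, smul_add]
  ring

end Differentiation

/-! ### The pivotal quantity as a divergence, for a fixed column. -/

section Pivot

variable {n p : ℕ}

/-- The weighted squared estimation error of coordinate `j`, relative to the regularized norm. -/
noncomputable def energy (ρ : ℝ → ℝ) (g : EuclideanSpace ℝ (Fin p) → ℝ)
    (β : EuclideanSpace ℝ (Fin p)) (j : Fin p) (ν a : ℝ) (X : Matrix (Fin n) (Fin p) ℝ)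
    (e : EuclideanSpace ℝ (Fin n)) : ℝ :=
  a ^ 2 * (n * estError ρ g β X e j ^ 2) / regNorm ρ g β j ν X e ^ 2

/-- The weighted normalized score vector. -/
noncomputable def direction (ρ : ℝ → ℝ) (g : EuclideanSpace ℝ (Fin p) → ℝ)
    (β : EuclideanSpace ℝ (Fin p)) (j : Fin p) (ν a : ℝ) (X : Matrix (Fin n) (Fin p) ℝ)
    (e : EuclideanSpace ℝ (Fin n)) : EuclideanSpace ℝ (Fin n) :=
  a • (regNorm ρ g β j ν X e)⁻¹ • score ρ g β X e

/-- The weighted pivotal quantity associated with the standardized column `z`. -/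
noncomputable def pivot (ρ : ℝ → ℝ) (g : EuclideanSpace ℝ (Fin p) → ℝ)
    (β : EuclideanSpace ℝ (Fin p)) (j : Fin p) (ν σ a : ℝ) (z : EuclideanSpace ℝ (Fin n))
    (X : Matrix (Fin n) (Fin p) ℝ) (e : EuclideanSpace ℝ (Fin n)) : ℝ :=
  a * (regNorm ρ g β j ν X e)⁻¹ * (inner ℝ z (score ρ g β X e)
    + σ * estError ρ g β X e j * trJacobian ρ g X (response β X e))

/-- The constant governing the Gaussian approximation of the pivotal quantity. -/
noncomputable def sensConst (τ : ℝ) (L : NNReal) (B Cw : ℝ) : ℝ :=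
  B * L / τ + 8 * pertConst τ L * B + Cw

variable {ρ : ℝ → ℝ} {g : EuclideanSpace ℝ (Fin p) → ℝ} {τ K : ℝ} {L : NNReal}
  {β : EuclideanSpace ℝ (Fin p)} {j : Fin p} {ν : ℝ}

lemma energy_nonneg (a : ℝ) (X : Matrix (Fin n) (Fin p) ℝ) (e : EuclideanSpace ℝ (Fin n)) :
    0 ≤ energy ρ g β j ν a X e := by
  unfold energy
  positivity

namespace Regular

variable (H : Regular n ρ g τ K L)

lemma norm_normalized_score_le (hν : 0 < ν) (X : Matrix (Fin n) (Fin p) ℝ)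
    (e : EuclideanSpace ℝ (Fin n)) :
    ‖(regNorm ρ g β j ν X e)⁻¹ • score ρ g β X e‖ ≤ 1 := by
  have hD := regNorm_pos (ρ := ρ) (g := g) β j hν X e
  rw [norm_smul, norm_inv, Real.norm_of_nonneg hD.le, inv_mul_le_iff₀ hD, mul_one]
  exact norm_score_le_regNorm (ρ := ρ) (g := g) β j hν X e

include H

variable {X : Matrix (Fin n) (Fin p) ℝ} {e : EuclideanSpace ℝ (Fin n)} {σ B Cw : ℝ}
  {w : EuclideanSpace ℝ (Fin n) → ℝ} {κw : NNReal}

/-- Summing the directional bound over an orthonormal basis turns ‖η‖² into n and ⟨η, ψ⟩² into ‖ψ‖²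
≤ D². This gives n h_j²/D², the energy, plus 1/n. The weight contributes the square of its Lipschitz
constant, at most Cw/n. -/
lemma sum_norm_fderiv_direction_sq_le (hν : 0 < ν) (hν1 : ν ≤ 1) (hσ : σ ^ 2 ≤ B)
    (hw0 : ∀ z, 0 ≤ w z) (hw1 : ∀ z, w z ≤ 1) (hwL : LipschitzWith κw w)
    (hκw : (κw : ℝ) ^ 2 ≤ Cw / n) {z : EuclideanSpace ℝ (Fin n)}
    (hw : DifferentiableAt ℝ w z)
    (hF : DifferentiableAt ℝ (fun z => (regNorm ρ g β j ν (shiftColumn X j σ z) e)⁻¹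
      • score ρ g β (shiftColumn X j σ z) e) z) :
    ∑ i, ‖fderiv ℝ (fun z => direction ρ g β j ν (w z) (shiftColumn X j σ z) e) z
        (EuclideanSpace.basisFun (Fin n) ℝ i)‖ ^ 2
      ≤ 2 * sensConst τ L B Cw * (energy ρ g β j ν (w z) (shiftColumn X j σ z) e + 1 / n) := by
  have h := sum_norm_fderiv_smul_sq_le hw hF (norm_normalized_score_le hν _ e)
  refine h.trans ?_
  have hn := H.n_pos
  have hτ := H.τ_pos
  have hP : 0 ≤ pertConst τ L := pertConst_nonneg
  have hB : 0 ≤ B := (sq_nonneg σ).trans hσ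
  have hD := regNorm_pos (ρ := ρ) (g := g) β j hν (shiftColumn X j σ z) e
  have hψ := norm_score_le_regNorm (ρ := ρ) (g := g) β j hν (shiftColumn X j σ z) e
  have h1 : ‖fderiv ℝ w z‖ ^ 2 ≤ Cw / n :=
    (pow_le_pow_left₀ (norm_nonneg _) (norm_fderiv_le_of_lipschitz ℝ hwL) 2).trans hκw
  have h2 := Finset.sum_le_sum fun i (_ : i ∈ Finset.univ) =>
    H.norm_fderiv_normalized_score_sq_le β j X e σ hν hν1 hF (EuclideanSpace.basisFun (Fin n) ℝ i)
  rw [← Finset.mul_sum, ← Finset.mul_sum, ← Finset.sum_div, Finset.sum_add_distrib,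
    ← Finset.sum_div, sum_inner_basisFun_sq] at h2
  simp only [OrthonormalBasis.norm_eq_one, one_pow, mul_one, Finset.sum_const, Finset.card_univ,
    Fintype.card_fin, nsmul_eq_mul] at h2
  unfold energy sensConst
  set D := regNorm ρ g β j ν (shiftColumn X j σ z) e
  set ψ := score ρ g β (shiftColumn X j σ z) e
  set h₀ := estError ρ g β (shiftColumn X j σ z) e j
  have h3 : (n * h₀ ^ 2 + ‖ψ‖ ^ 2 / n) / D ^ 2 ≤ n * h₀ ^ 2 / D ^ 2 + 1 / n := by
    rw [add_div]
    refine add_le_add_right ?_ _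
    rw [div_div, mul_comm, ← div_div, div_le_div_iff_of_pos_right hn]
    exact div_le_one_of_le₀ (pow_le_pow_left₀ (norm_nonneg _) hψ 2) (by positivity)
  have h4 : w z ^ 2 ≤ 1 := pow_le_one₀ (hw0 z) (hw1 z)
  have h5 : σ ^ 2 * ((n * h₀ ^ 2 + ‖ψ‖ ^ 2 / n) / D ^ 2) ≤ B * (n * h₀ ^ 2 / D ^ 2 + 1 / n) :=
    mul_le_mul hσ h3 (by positivity) hB
  have h6 := h2.trans (mul_le_mul_of_nonneg_left h5 (by positivity))
  have h7 := mul_le_mul_of_nonneg_left h6 (by positivity : 0 ≤ 2 * w z ^ 2)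
  have hCw : 0 ≤ Cw / n := (sq_nonneg _).trans hκw
  have hCw' : 0 ≤ Cw := by
    by_contra hc
    exact absurd (div_neg_of_neg_of_pos (not_le.1 hc) hn) (not_lt.2 hCw)
  set T := n * h₀ ^ 2 / D ^ 2
  have hT : 0 ≤ T := by positivity
  have hT' : w z ^ 2 * (n * h₀ ^ 2) / D ^ 2 = w z ^ 2 * T := by
    simp only [T]; ring
  rw [hT']
  have h8 : w z ^ 2 * (1 / (n : ℝ)) ≤ 1 / n := mul_le_of_le_one_left (by positivity) h4
  have h9 : Cw / n ≤ Cw * (w z ^ 2 * T + 1 / n) := by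
    have : 0 ≤ Cw * (w z ^ 2 * T) := by positivity
    rw [div_eq_mul_one_div]; linarith
  have h10 : 0 ≤ B * L / τ * (w z ^ 2 * T + 1 / n) := by positivity
  have h11 := mul_le_mul_of_nonneg_left h8 (by positivity : 0 ≤ 8 * pertConst τ L * B)
  linarith

-- The product rule for the divergence of w D⁻¹ ψ leaves three remainders: the trace of the rank one
-- part of the derivative of ψ, the derivative of D⁻¹ along ψ, and that of w along ψ. Each square is
-- at most a constant times the energy plus 1/n, and (a₁ + a₂ + a₃)² ≤ 3(a₁² + a₂² + a₃²).
set_option maxHeartbeats 1000000 in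
lemma pivot_remainder_sq_le (hν : 0 < ν) (hν1 : ν ≤ 1) (hσ : σ ^ 2 ≤ B)
    (hw0 : ∀ z, 0 ≤ w z) (hw1 : ∀ z, w z ≤ 1) (hwL : LipschitzWith κw w)
    (hκw : (κw : ℝ) ^ 2 ≤ Cw / n) {z : EuclideanSpace ℝ (Fin n)}
    (hw : DifferentiableAt ℝ w z)
    (hF : DifferentiableAt ℝ (fun z => (regNorm ρ g β j ν (shiftColumn X j σ z) e)⁻¹
      • score ρ g β (shiftColumn X j σ z) e) z)
    (hG : DifferentiableAt ℝ (fun z => (regNorm ρ g β j ν (shiftColumn X j σ z) e)⁻¹) z)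
    (hV : DifferentiableAt ℝ (psiHat ρ g (shiftColumn X j σ z))
      (response β (shiftColumn X j σ z) e)) :
    (pivot ρ g β j ν σ (w z) z (shiftColumn X j σ z) e
      - (inner ℝ z (direction ρ g β j ν (w z) (shiftColumn X j σ z) e)
        - ∑ i, inner ℝ (EuclideanSpace.basisFun (Fin n) ℝ i)
          (fderiv ℝ (fun z => direction ρ g β j ν (w z) (shiftColumn X j σ z) e) z
            (EuclideanSpace.basisFun (Fin n) ℝ i)))) ^ 2
      ≤ 3 * sensConst τ L B Cw * (energy ρ g β j ν (w z) (shiftColumn X j σ z) e + 1 / n) := by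
  have hn := H.n_pos
  have hn1 := H.one_le_n
  have hτ := H.τ_pos
  have hP : 0 ≤ pertConst τ L := pertConst_nonneg
  have hB : 0 ≤ B := (sq_nonneg σ).trans hσ
  have hD := regNorm_pos (ρ := ρ) (g := g) β j hν (shiftColumn X j σ z) e
  have hψd := differentiableAt_of_smul (ψ := fun z => score ρ g β (shiftColumn X j σ z) e)
    (fun z => inv_ne_zero (regNorm_pos (ρ := ρ) (g := g) β j hν (shiftColumn X j σ z) e).ne') hG hF
  have hdiv := sum_inner_fderiv_smul hw hG hψd
  have hψ := norm_score_le_regNorm (ρ := ρ) (g := g) β j hν (shiftColumn X j σ z) e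
  have hGb := H.fderiv_inv_regNorm_sq_le β j X e σ hν hν1 hG (score ρ g β (shiftColumn X j σ z) e)
  have hWb := H.norm_fderiv_score_add_sq_le β j X e σ hψd hV
  have hwb : (fderiv ℝ w z (score ρ g β (shiftColumn X j σ z) e)) ^ 2
      ≤ Cw / n * ‖score ρ g β (shiftColumn X j σ z) e‖ ^ 2 := by
    refine le_trans ?_ (mul_le_mul_of_nonneg_right hκw (sq_nonneg _))
    rw [← mul_pow, ← sq_abs]
    refine pow_le_pow_left₀ (abs_nonneg _) ?_ 2
    exact ((fderiv ℝ w z).le_opNorm _).trans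
      (mul_le_mul_of_nonneg_right (norm_fderiv_le_of_lipschitz ℝ hwL) (norm_nonneg _))
  have hW := abs_sum_inner_apply_le
    (W := fderiv ℝ (fun z => score ρ g β (shiftColumn X j σ z) e) z
      + (σ * estError ρ g β (shiftColumn X j σ z) e j) •
        fderiv ℝ (psiHat ρ g (shiftColumn X j σ z)) (response β (shiftColumn X j σ z) e))
    (ψ := score ρ g β (shiftColumn X j σ z) e) hWb
  have htr : ∑ i, inner ℝ (EuclideanSpace.basisFun (Fin n) ℝ i)
      ((fderiv ℝ (fun z => score ρ g β (shiftColumn X j σ z) e) z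
      + (σ * estError ρ g β (shiftColumn X j σ z) e j) •
        fderiv ℝ (psiHat ρ g (shiftColumn X j σ z)) (response β (shiftColumn X j σ z) e))
        (EuclideanSpace.basisFun (Fin n) ℝ i))
      = ∑ i, inner ℝ (EuclideanSpace.basisFun (Fin n) ℝ i)
          (fderiv ℝ (fun z => score ρ g β (shiftColumn X j σ z) e) z
            (EuclideanSpace.basisFun (Fin n) ℝ i))
        + σ * estError ρ g β (shiftColumn X j σ z) e j
          * trJacobian ρ g (shiftColumn X j σ z) (response β (shiftColumn X j σ z) e) := by
    rw [trJacobian_eq_sum, Finset.mul_sum, ← Finset.sum_add_distrib]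
    refine Finset.sum_congr rfl fun i _ => ?_
    rw [add_apply, smul_apply, inner_add_right, real_inner_smul_right,
      EuclideanSpace.basisFun_apply]
    congr 2
    rw [EuclideanSpace.inner_single_left]
    simp
  rw [htr] at hW
  unfold pivot energy direction sensConst
  rw [hdiv]
  rw [real_inner_smul_right, real_inner_smul_right]
  rw [real_inner_self_eq_norm_sq] at hGb
  set trV := trJacobian ρ g (shiftColumn X j σ z) (response β (shiftColumn X j σ z) e)
  set trψ := ∑ i, inner ℝ (EuclideanSpace.basisFun (Fin n) ℝ i)
          (fderiv ℝ (fun z => score ρ g β (shiftColumn X j σ z) e) z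
            (EuclideanSpace.basisFun (Fin n) ℝ i))
  set D := regNorm ρ g β j ν (shiftColumn X j σ z) e
  set ψ := score ρ g β (shiftColumn X j σ z) e
  set h₀ := estError ρ g β (shiftColumn X j σ z) e j
  set G' := fderiv ℝ (fun z => (regNorm ρ g β j ν (shiftColumn X j σ z) e)⁻¹) z ψ
  set w' := fderiv ℝ w z ψ
  have hψD : ‖ψ‖ ^ 2 ≤ D ^ 2 := pow_le_pow_left₀ (norm_nonneg _) hψ 2
  have hψD' : (D⁻¹) ^ 2 * ‖ψ‖ ^ 2 ≤ 1 := by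
    rw [inv_pow, inv_mul_le_iff₀ (by positivity), mul_one]; exact hψD
  have h4 : w z ^ 2 ≤ 1 := pow_le_one₀ (hw0 z) (hw1 z)
  have hCw : 0 ≤ Cw / n := (sq_nonneg _).trans hκw
  set T := n * h₀ ^ 2 / D ^ 2 with hTdef
  have hT : 0 ≤ T := by positivity
  have hT' : w z ^ 2 * (n * h₀ ^ 2) / D ^ 2 = w z ^ 2 * T := by
    simp only [T]; ring
  have r1 : (w z * D⁻¹ * (trψ + σ * h₀ * trV)) ^ 2 ≤ B * L / τ * (1 / n) := by
    calc (w z * D⁻¹ * (trψ + σ * h₀ * trV)) ^ 2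
        = w z ^ 2 * ((D⁻¹) ^ 2 * (trψ + σ * h₀ * trV) ^ 2) := by ring
      _ ≤ 1 * ((D⁻¹) ^ 2 * (trψ + σ * h₀ * trV) ^ 2) := by gcongr
      _ ≤ 1 * ((D⁻¹) ^ 2 * (L * σ ^ 2 / (n * τ) * ‖ψ‖ ^ 2)) := by gcongr
      _ = L * σ ^ 2 / (n * τ) * ((D⁻¹) ^ 2 * ‖ψ‖ ^ 2) := by ring
      _ ≤ L * B / (n * τ) * 1 := by gcongr
      _ = _ := by field_simp
  have r2 : (w z * G') ^ 2 ≤ 8 * pertConst τ L * B * (w z ^ 2 * T + 1 / n) := by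
    have hq : σ ^ 2 * ((h₀ ^ 2 * ‖ψ‖ ^ 2 + (‖ψ‖ ^ 2) ^ 2 / n) / D ^ 2) / D ^ 2
        ≤ B * (T + 1 / n) := by
      have q1 : h₀ ^ 2 * ‖ψ‖ ^ 2 ≤ n * h₀ ^ 2 * D ^ 2 := by
        have : h₀ ^ 2 * D ^ 2 ≤ n * (h₀ ^ 2 * D ^ 2) :=
          le_mul_of_one_le_left (by positivity) hn1
        nlinarith [mul_le_mul_of_nonneg_left hψD (sq_nonneg h₀)]
      have q2 : (‖ψ‖ ^ 2) ^ 2 / n ≤ (D ^ 2) ^ 2 / n := by gcongr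
      calc σ ^ 2 * ((h₀ ^ 2 * ‖ψ‖ ^ 2 + (‖ψ‖ ^ 2) ^ 2 / n) / D ^ 2) / D ^ 2
          ≤ B * ((n * h₀ ^ 2 * D ^ 2 + (D ^ 2) ^ 2 / n) / D ^ 2) / D ^ 2 := by gcongr
        _ = B * (T + 1 / n) := by rw [hTdef]; field_simp
    calc (w z * G') ^ 2 = w z ^ 2 * G' ^ 2 := by ring
      _ ≤ w z ^ 2 * (8 * pertConst τ L * (B * (T + 1 / n))) := by
        refine mul_le_mul_of_nonneg_left (hGb.trans ?_) (sq_nonneg _)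
        rw [mul_div_assoc]
        exact mul_le_mul_of_nonneg_left hq (by positivity)
      _ = 8 * pertConst τ L * B * (w z ^ 2 * T + w z ^ 2 * (1 / n)) := by ring
      _ ≤ 8 * pertConst τ L * B * (w z ^ 2 * T + 1 / n) := by
        gcongr
        exact mul_le_of_le_one_left (by positivity) h4
  have r3 : (D⁻¹ * w') ^ 2 ≤ Cw * (1 / n) := by
    calc (D⁻¹ * w') ^ 2 = (D⁻¹) ^ 2 * w' ^ 2 := by ring
      _ ≤ (D⁻¹) ^ 2 * (Cw / n * ‖ψ‖ ^ 2) := by gcongr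
      _ = Cw / n * ((D⁻¹) ^ 2 * ‖ψ‖ ^ 2) := by ring
      _ ≤ Cw / n * 1 := by gcongr
      _ = _ := by ring
  have hCw' : 0 ≤ Cw := by
    by_contra hc
    exact absurd (div_neg_of_neg_of_pos (not_le.1 hc) hn) (not_lt.2 hCw)
  rw [hT']
  have hwT : 0 ≤ w z ^ 2 * T := by positivity
  have e1 : B * L / τ * (1 / n) ≤ B * L / τ * (w z ^ 2 * T + 1 / n) := by
    gcongr
    linarith
  have e2 : Cw * (1 / n) ≤ Cw * (w z ^ 2 * T + 1 / n) := by
    gcongr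
    linarith
  set a₁ := w z * D⁻¹ * (trψ + σ * h₀ * trV) with ha₁
  set a₂ := w z * G' with ha₂
  set a₃ := D⁻¹ * w' with ha₃
  have e3 : w z * D⁻¹ * (inner ℝ z ψ + σ * h₀ * trV)
      - (w z * (D⁻¹ * inner ℝ z ψ) - (w z * D⁻¹ * trψ + w z * G' + D⁻¹ * w')) = a₁ + a₂ + a₃ := by
    rw [ha₁, ha₂, ha₃]; ring
  rw [e3]
  nlinarith [sq_nonneg (a₁ - a₂), sq_nonneg (a₁ - a₃), sq_nonneg (a₂ - a₃)]

end Regular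

end Pivot

/-! ### Gaussian approximation conditionally on the other columns and the noise. -/

section PivotIntegral

variable {n p : ℕ} {ρ : ℝ → ℝ} {g : EuclideanSpace ℝ (Fin p) → ℝ} {τ K : ℝ} {L : NNReal}
  {β : EuclideanSpace ℝ (Fin p)} {j : Fin p} {ν : ℝ}

namespace Regular

variable (H : Regular n ρ g τ K L)

include H

variable {X : Matrix (Fin n) (Fin p) ℝ} {e : EuclideanSpace ℝ (Fin n)} {σ B Cw : ℝ}
  {w : EuclideanSpace ℝ (Fin n) → ℝ} {κw : NNReal}

lemma exists_lipschitzWith_direction (hν : 0 < ν) (hν1 : ν ≤ 1)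
    (hw0 : ∀ z, 0 ≤ w z) (hw1 : ∀ z, w z ≤ 1) (hwL : LipschitzWith κw w) :
    ∃ C : NNReal, LipschitzWith C
      fun z => direction ρ g β j ν (w z) (shiftColumn X j σ z) e := by
  obtain ⟨C, hC⟩ := H.exists_lipschitzWith_normalized_score β j X e σ hν hν1
  refine ⟨κw + C, LipschitzWith.of_dist_le_mul fun z z' => ?_⟩
  have h1 := hC.dist_le_mul z z'
  have h2 := hwL.dist_le_mul z z'
  rw [dist_eq_norm] at h1 h2 ⊢
  have h3 := norm_normalized_score_le (ρ := ρ) (g := g) (β := β) (j := j) hν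
    (shiftColumn X j σ z) e
  unfold direction
  set F := (regNorm ρ g β j ν (shiftColumn X j σ z) e)⁻¹ • score ρ g β (shiftColumn X j σ z) e
  set F' := (regNorm ρ g β j ν (shiftColumn X j σ z') e)⁻¹ • score ρ g β (shiftColumn X j σ z') e
  have e1 : w z • F - w z' • F' = (w z - w z') • F + w z' • (F - F') := by
    rw [sub_smul, smul_sub]; abel
  rw [e1]
  refine (norm_add_le _ _).trans ?_
  rw [norm_smul (w z - w z') F, norm_smul (w z') (F - F'), NNReal.coe_add, add_mul]
  refine add_le_add ((mul_le_of_le_one_right (norm_nonneg _) h3).trans h2) (le_trans ?_ h1)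
  refine mul_le_of_le_one_left (norm_nonneg _) ?_
  rw [Real.norm_of_nonneg (hw0 z')]
  exact hw1 z'

lemma continuous_energy {α : Type*} [TopologicalSpace α] {X : α → Matrix (Fin n) (Fin p) ℝ}
    {e : α → EuclideanSpace ℝ (Fin n)} {a : α → ℝ} (ha : Continuous a) (hX : Continuous X)
    (he : Continuous e) (hν : 0 < ν) :
    Continuous fun x => energy ρ g β j ν (a x) (X x) (e x) := by
  unfold energy
  refine ((ha.pow 2).mul (continuous_const.mul
    ((H.continuous_estError_apply β j hX he).pow 2))).div
    ((H.continuous_regNorm β j hX he ν).pow 2) fun x => ?_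
  exact (pow_pos (regNorm_pos β j hν _ _) 2).ne'

/-- Conditionally on the other columns and the noise, the pivotal quantity is close in mean
square to a Gaussian variable whose direction is independent of the column `z`. -/
theorem lintegral_pivot_sub_sq_le (hν : 0 < ν) (hν1 : ν ≤ 1) (hσ : σ ^ 2 ≤ B)
    (hw0 : ∀ z, 0 ≤ w z) (hw1 : ∀ z, w z ≤ 1) (hwL : LipschitzWith κw w)
    (hκw : (κw : ℝ) ^ 2 ≤ Cw / n)
    (hV : ∀ᵐ z ∂(stdGaussian (EuclideanSpace ℝ (Fin n))),
      DifferentiableAt ℝ (psiHat ρ g (shiftColumn X j σ z))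
        (response β (shiftColumn X j σ z) e)) :
    ∫⁻ z', (∫⁻ z, ENNReal.ofReal ((pivot ρ g β j ν σ (w z) z (shiftColumn X j σ z) e
        - inner ℝ z (direction ρ g β j ν (w z') (shiftColumn X j σ z') e)) ^ 2)
        ∂(stdGaussian (EuclideanSpace ℝ (Fin n)))) ∂(stdGaussian (EuclideanSpace ℝ (Fin n)))
      ≤ ENNReal.ofReal ((Real.pi ^ 2 + 10) * sensConst τ L B Cw)
        * (∫⁻ z, ENNReal.ofReal (energy ρ g β j ν (w z) (shiftColumn X j σ z) e)
          ∂(stdGaussian (EuclideanSpace ℝ (Fin n))) + ENNReal.ofReal (1 / n)) := by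
  have hn := H.n_pos
  have hτ := H.τ_pos
  have hP : 0 ≤ pertConst τ L := pertConst_nonneg
  have hB : 0 ≤ B := (sq_nonneg σ).trans hσ
  have hCw : 0 ≤ Cw := by
    by_contra hc
    exact absurd (div_neg_of_neg_of_pos (not_le.1 hc) hn) (not_lt.2 ((sq_nonneg _).trans hκw))
  have hN : 0 ≤ sensConst τ L B Cw := by unfold sensConst; positivity
  set N := sensConst τ L B Cw
  set γ := stdGaussian (EuclideanSpace ℝ (Fin n)) with hγ
  set f := fun z => direction ρ g β j ν (w z) (shiftColumn X j σ z) e with hf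
  set T := fun z => energy ρ g β j ν (w z) (shiftColumn X j σ z) e with hTdef
  have hT0 : ∀ z, 0 ≤ T z := fun z => energy_nonneg _ _ _
  have hTc : Continuous T :=
    H.continuous_energy hwL.continuous (continuous_shiftColumn X j σ) continuous_const hν
  obtain ⟨C, hC⟩ := H.exists_lipschitzWith_direction (β := β) (j := j) (X := X) (e := e) (σ := σ)
    hν hν1 hw0 hw1 hwL
  obtain ⟨CF, hCF⟩ := H.exists_lipschitzWith_normalized_score β j X e σ hν hν1
  obtain ⟨CG, hCG⟩ := H.exists_lipschitzWith_inv_regNorm β j X e σ hν hν1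
  -- By Rademacher's theorem the Lipschitz maps below are differentiable Lebesgue almost everywhere,
  -- hence Gaussian almost everywhere.
  have hac : γ ≪ volume := stdGaussian_absolutelyContinuous
  have dF := hac.ae_le hCF.ae_differentiableAt
  have dG := hac.ae_le hCG.ae_differentiableAt
  have dw := hac.ae_le hwL.ae_differentiableAt
  have hmain := lintegral_divergence_sub_sq_le hC (EuclideanSpace.basisFun (Fin n) ℝ)
  have hM : ∫⁻ z, ENNReal.ofReal (T z + 1 / n) ∂γ
      = ∫⁻ z, ENNReal.ofReal (T z) ∂γ + ENNReal.ofReal (1 / n) := by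
    have : ∀ z, ENNReal.ofReal (T z + 1 / n) = ENNReal.ofReal (T z) + ENNReal.ofReal (1 / n) :=
      fun z => ENNReal.ofReal_add (hT0 z) (by positivity)
    simp_rw [this]
    rw [lintegral_add_right _ measurable_const, lintegral_const, measure_univ, mul_one]
  rw [← hM]
  have hfrob : ∫⁻ z, ENNReal.ofReal (∑ k, ‖fderiv ℝ f z (EuclideanSpace.basisFun (Fin n) ℝ k)‖ ^ 2)
      ∂γ ≤ ENNReal.ofReal (2 * N) * ∫⁻ z, ENNReal.ofReal (T z + 1 / n) ∂γ := by
    rw [← lintegral_const_mul' _ _ ENNReal.ofReal_ne_top]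
    refine lintegral_mono_ae ?_
    filter_upwards [dF, dw] with z hF hw
    rw [← ENNReal.ofReal_mul (by positivity)]
    exact ENNReal.ofReal_le_ofReal (H.sum_norm_fderiv_direction_sq_le hν hν1 hσ hw0 hw1 hwL hκw hw hF)
  -- The difference splits as (⟨z, f z - f z'⟩ - div f z) plus the pivot remainder. The constant 6N
  -- is twice the 3N of `pivot_remainder_sq_le`.
  have hinner : ∀ z', ∫⁻ z, ENNReal.ofReal ((pivot ρ g β j ν σ (w z) z (shiftColumn X j σ z) e
        - inner ℝ z (f z')) ^ 2) ∂γ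
      ≤ ENNReal.ofReal 2 * ∫⁻ z, ENNReal.ofReal ((inner ℝ z (f z - f z')
          - ∑ k, inner ℝ (EuclideanSpace.basisFun (Fin n) ℝ k)
            (fderiv ℝ f z (EuclideanSpace.basisFun (Fin n) ℝ k))) ^ 2) ∂γ
        + ENNReal.ofReal (6 * N) * ∫⁻ z, ENNReal.ofReal (T z + 1 / n) ∂γ := fun z' => by
    rw [← lintegral_const_mul' _ _ ENNReal.ofReal_ne_top,
      ← lintegral_const_mul' _ _ ENNReal.ofReal_ne_top,
      ← lintegral_add_right _ (by fun_prop)]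
    refine lintegral_mono_ae ?_
    filter_upwards [dF, dG, dw, hV] with z hF hG hw hVz
    have h := H.pivot_remainder_sq_le hν hν1 hσ hw0 hw1 hwL hκw hw hF hG hVz
    rw [← ENNReal.ofReal_mul (by positivity),
      ← ENNReal.ofReal_mul (by positivity), ← ENNReal.ofReal_add (by positivity)
        (mul_nonneg (by positivity) (add_nonneg (hT0 z) (by positivity)))]
    refine ENNReal.ofReal_le_ofReal ?_
    rw [inner_sub_right]
    change (pivot ρ g β j ν σ (w z) z (shiftColumn X j σ z) e - (inner ℝ z (f z)
      - ∑ k, inner ℝ (EuclideanSpace.basisFun (Fin n) ℝ k)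
            (fderiv ℝ f z (EuclideanSpace.basisFun (Fin n) ℝ k)))) ^ 2
      ≤ 3 * N * (T z + 1 / n) at h
    generalize (∑ k, inner ℝ (EuclideanSpace.basisFun (Fin n) ℝ k)
            (fderiv ℝ f z (EuclideanSpace.basisFun (Fin n) ℝ k))) = d at h ⊢
    generalize pivot ρ g β j ν σ (w z) z (shiftColumn X j σ z) e = Q at h ⊢
    have h2 := add_sq_le (a := inner ℝ z (f z) - inner ℝ z (f z') - d)
      (b := Q - (inner ℝ z (f z) - d))
    have e2 : inner ℝ z (f z) - inner ℝ z (f z') - d + (Q - (inner ℝ z (f z) - d))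
      = Q - inner ℝ z (f z') := by ring
    rw [e2] at h2
    linarith
  refine (lintegral_mono hinner).trans ?_
  rw [lintegral_add_right _ measurable_const, lintegral_const, measure_univ, mul_one,
    lintegral_const_mul' _ _ ENNReal.ofReal_ne_top]
  -- The constants add up to 2(π²/4 + 1)·2N + 6N = (π² + 10)N.
  have h3 := hmain.trans (mul_le_mul_right hfrob _)
  refine (add_le_add_left (mul_le_mul_right h3 (ENNReal.ofReal 2)) _).trans (le_of_eq ?_)
  rw [← mul_assoc, ← mul_assoc, ← add_mul,
    ← ENNReal.ofReal_mul (by norm_num), ← ENNReal.ofReal_mul (by positivity),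
    ← ENNReal.ofReal_add (by positivity) (by positivity)]
  congr 2
  ring

end Regular

end PivotIntegral

/-! ### The covariance and precision matrices. -/

section Covariance

variable {p : ℕ} {S : Matrix (Fin p) (Fin p) ℝ} {κ : ℝ}

lemma mulVecE_add {n : ℕ} (X : Matrix (Fin n) (Fin p) ℝ) (b c : EuclideanSpace ℝ (Fin p)) :
    mulVecE X (b + c) = mulVecE X b + mulVecE X c := by
  ext i; simp [mulVecE, Matrix.mulVec_add]

lemma mulVecE_mul {n m : ℕ} (X : Matrix (Fin n) (Fin m) ℝ) (Y : Matrix (Fin m) (Fin p) ℝ)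
    (b : EuclideanSpace ℝ (Fin p)) : mulVecE (X * Y) b = mulVecE X (mulVecE Y b) := by
  ext i; simp [mulVecE, Matrix.mulVec_mulVec]

lemma mulVecE_single {n : ℕ} (X : Matrix (Fin n) (Fin p) ℝ) (j : Fin p) (i : Fin n) :
    mulVecE X (EuclideanSpace.single j 1) i = X i j := by
  simp [mulVecE]

/-- The column `S⁻¹ e_j` of the precision matrix. -/
noncomputable def precisionCol (S : Matrix (Fin p) (Fin p) ℝ) (j : Fin p) :
    EuclideanSpace ℝ (Fin p) :=
  mulVecE S⁻¹ (EuclideanSpace.single j 1)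

lemma precisionCol_apply (j : Fin p) : precisionCol S j j = precisionDiag S j :=
  mulVecE_single _ _ _

lemma zvec_eq {n : ℕ} (X : Matrix (Fin n) (Fin p) ℝ) (j : Fin p) :
    zvec S X j = (precisionDiag S j)⁻¹ • mulVecE X (precisionCol S j) := by
  rw [zvec, mulVecE_smul, mulVecE_mul, precisionCol]

namespace CovarianceAssumption

variable (hS : CovarianceAssumption S κ)

include hS

lemma posDef (hκ : 0 < κ) : S.PosDef :=
  hS.hermitian.posDef_iff_eigenvalues_pos.2 fun i => hκ.trans_le (hS.eigenvalues_mem i).1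

lemma inner_mulVecE_comm (u v : EuclideanSpace ℝ (Fin p)) :
    inner ℝ u (mulVecE S v) = inner ℝ (mulVecE S u) v := by
  have h : S.transpose = S := by
    have := hS.hermitian
    rwa [Matrix.IsHermitian, Matrix.conjTranspose_eq_transpose_of_trivial] at this
  rw [inner_mulVecE, h]

lemma inner_mulVecE_eq_sum (v : EuclideanSpace ℝ (Fin p)) :
    inner ℝ v (mulVecE S v)
      = ∑ i, hS.hermitian.eigenvalues i * inner ℝ v (hS.hermitian.eigenvectorBasis i) ^ 2 := by
  rw [← hS.hermitian.eigenvectorBasis.sum_inner_mul_inner v (mulVecE S v)]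
  refine Finset.sum_congr rfl fun i _ => ?_
  rw [hS.inner_mulVecE_comm]
  have h : mulVecE S (hS.hermitian.eigenvectorBasis i)
      = hS.hermitian.eigenvalues i • hS.hermitian.eigenvectorBasis i := by
    ext k
    have := congrFun (hS.hermitian.mulVec_eigenvectorBasis i) k
    exact this
  rw [h, real_inner_smul_left, real_inner_comm v]
  ring

lemma le_inner_mulVecE (v : EuclideanSpace ℝ (Fin p)) :
    κ * ‖v‖ ^ 2 ≤ inner ℝ v (mulVecE S v) := by
  rw [hS.inner_mulVecE_eq_sum, ← hS.hermitian.eigenvectorBasis.sum_sq_inner_left v,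
    Finset.mul_sum]
  exact Finset.sum_le_sum fun i _ =>
    mul_le_mul_of_nonneg_right (hS.eigenvalues_mem i).1 (sq_nonneg _)

lemma inner_mulVecE_le (v : EuclideanSpace ℝ (Fin p)) :
    inner ℝ v (mulVecE S v) ≤ 1 / κ * ‖v‖ ^ 2 := by
  rw [hS.inner_mulVecE_eq_sum, ← hS.hermitian.eigenvectorBasis.sum_sq_inner_left v,
    Finset.mul_sum]
  exact Finset.sum_le_sum fun i _ =>
    mul_le_mul_of_nonneg_right (hS.eigenvalues_mem i).2 (sq_nonneg _)

variable (hκ : 0 < κ)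

include hκ

lemma mulVecE_inv (v : EuclideanSpace ℝ (Fin p)) : mulVecE S (mulVecE S⁻¹ v) = v := by
  have h : IsUnit S.det := (Matrix.isUnit_iff_isUnit_det S).1 (hS.posDef hκ).isUnit
  rw [← mulVecE_mul, Matrix.mul_nonsing_inv _ h]
  simp [mulVecE]

lemma norm_mulVecE_inv_le (v : EuclideanSpace ℝ (Fin p)) : ‖mulVecE S⁻¹ v‖ ≤ 1 / κ * ‖v‖ := by
  have h := hS.le_inner_mulVecE (mulVecE S⁻¹ v)
  rw [hS.mulVecE_inv hκ] at h
  have h2 := h.trans (real_inner_le_norm _ _)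
  rw [div_mul_eq_mul_div, one_mul, le_div_iff₀ hκ]
  by_contra hc
  have h0 : 0 < ‖mulVecE S⁻¹ v‖ := by
    by_contra h0
    have : ‖mulVecE S⁻¹ v‖ = 0 := le_antisymm (not_lt.1 h0) (norm_nonneg _)
    rw [this, zero_mul] at hc
    exact hc (norm_nonneg _)
  nlinarith

lemma mulVecE_precisionCol (j : Fin p) :
    mulVecE S (precisionCol S j) = EuclideanSpace.single j 1 := hS.mulVecE_inv hκ _

lemma precisionDiag_eq_inner (j : Fin p) :
    precisionDiag S j = inner ℝ (precisionCol S j) (mulVecE S (precisionCol S j)) := by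
  rw [hS.mulVecE_precisionCol hκ, EuclideanSpace.inner_single_right, ← precisionCol_apply]
  simp

lemma precisionDiag_le (j : Fin p) : precisionDiag S j ≤ 1 / κ := by
  rw [hS.precisionDiag_eq_inner hκ, hS.mulVecE_precisionCol hκ]
  refine (real_inner_le_norm _ _).trans ?_
  have := hS.norm_mulVecE_inv_le hκ (EuclideanSpace.single j 1)
  simpa [precisionCol] using this

lemma precisionDiag_pos (j : Fin p) : 0 < precisionDiag S j := by
  have h := hS.le_inner_mulVecE (precisionCol S j)
  rw [← hS.precisionDiag_eq_inner hκ] at h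
  have h0 : precisionCol S j ≠ 0 := fun h0 => by
    have := hS.mulVecE_precisionCol hκ j
    rw [h0] at this
    have h1 := congrArg (fun v : EuclideanSpace ℝ (Fin p) => v j) this
    simp [mulVecE] at h1
  have : 0 < κ * ‖precisionCol S j‖ ^ 2 := by positivity
  linarith

/-- The quadratic form of S at e_j - Ω_jj⁻¹ S⁻¹ e_j equals S_jj - Ω_jj⁻¹, which is nonnegative, and
S_jj ≤ 1/κ. -/
lemma le_precisionDiag (j : Fin p) : κ ≤ precisionDiag S j := by
  have hω := hS.precisionDiag_pos hκ j
  set ω := precisionDiag S j with hωdef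
  have h := hS.le_inner_mulVecE (EuclideanSpace.single j 1 - ω⁻¹ • precisionCol S j)
  have h1 := hS.inner_mulVecE_le (EuclideanSpace.single j 1)
  have e : ∀ v : EuclideanSpace ℝ (Fin p), inner ℝ v (EuclideanSpace.single j (1 : ℝ)) = v j :=
    fun v => by rw [EuclideanSpace.inner_single_right]; simp
  have h2 : (EuclideanSpace.single j (1 : ℝ) : EuclideanSpace ℝ (Fin p)) j = 1 := by simp
  have h5 : ‖(EuclideanSpace.single j (1 : ℝ) : EuclideanSpace ℝ (Fin p))‖ = 1 := by simp
  rw [mulVecE_sub, mulVecE_smul, hS.mulVecE_precisionCol hκ, inner_sub_left, inner_sub_right,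
    inner_sub_right, real_inner_smul_left, real_inner_smul_left, real_inner_smul_right,
    real_inner_smul_right, hS.inner_mulVecE_comm (precisionCol S j),
    hS.mulVecE_precisionCol hκ, e, e, h2, precisionCol_apply, ← hωdef,
    inv_mul_cancel₀ hω.ne'] at h
  rw [h5] at h1
  have h3 : 0 ≤ κ * ‖(EuclideanSpace.single j (1 : ℝ) : EuclideanSpace ℝ (Fin p))
    - ω⁻¹ • precisionCol S j‖ ^ 2 := by positivity
  have h4 : ω⁻¹ ≤ 1 / κ := by linarith
  rw [one_div] at h4
  exact (inv_le_inv₀ hω hκ).1 h4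

lemma norm_sqrt_sq (v : EuclideanSpace ℝ (Fin p)) :
    ‖Matrix.toEuclideanCLM (𝕜 := ℝ) (CFC.sqrt S) v‖ ^ 2 = inner ℝ v (mulVecE S v) := by
  have hSp := (hS.posDef hκ).posSemidef
  rw [← real_inner_self_eq_norm_sq, ← ContinuousLinearMap.adjoint_inner_right,
    IsSelfAdjoint.adjoint_eq, ← ContinuousLinearMap.comp_apply, ← ContinuousLinearMap.mul_def,
    ← map_mul, CFC.sqrt_mul_sqrt_self _ hSp.nonneg]
  · rfl
  · exact (CFC.sqrt_nonneg S).isSelfAdjoint.map _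

lemma ofReal_le_predError (b β : EuclideanSpace ℝ (Fin p)) :
    ENNReal.ofReal (κ * ‖b - β‖ ^ 2) ≤ predError S b β := by
  rw [predError, ← ofReal_norm, ← ENNReal.ofReal_pow (norm_nonneg _),
    hS.norm_sqrt_sq hκ]
  exact ENNReal.ofReal_le_ofReal (hS.le_inner_mulVecE _)

/-- The squared correlations of the standardized columns with a vector are jointly controlled
by the operator norm of the design. -/
lemma sum_inner_zvec_sq_le {n : ℕ} (X : Matrix (Fin n) (Fin p) ℝ) {M : ℝ}
    (hM0 : 0 ≤ M) (hM : ∀ b, ‖mulVecE X b‖ ^ 2 ≤ M * ‖b‖ ^ 2) (ψ : EuclideanSpace ℝ (Fin n)) :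
    ∑ j, inner ℝ (√(precisionDiag S j) • zvec S X j) ψ ^ 2 ≤ (1 / κ) ^ 3 * M * ‖ψ‖ ^ 2 := by
  have hSt : S⁻¹.transpose = S⁻¹ := by
    have := hS.hermitian
    rw [Matrix.IsHermitian, Matrix.conjTranspose_eq_transpose_of_trivial] at this
    rw [Matrix.transpose_nonsing_inv, this]
  have h1 : ∀ j, inner ℝ (√(precisionDiag S j) • zvec S X j) ψ ^ 2
      ≤ 1 / κ * (mulVecE S⁻¹ (mulVecE X.transpose ψ)) j ^ 2 := fun j => by
    have hω := hS.precisionDiag_pos hκ j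
    have e1 : inner ℝ (mulVecE X (precisionCol S j)) ψ
        = (mulVecE S⁻¹ (mulVecE X.transpose ψ)) j := by
      rw [real_inner_comm, inner_mulVecE, precisionCol, inner_mulVecE, hSt,
        EuclideanSpace.inner_single_right]
      simp
    rw [zvec_eq, smul_smul, real_inner_smul_left, e1, mul_pow]
    refine mul_le_mul_of_nonneg_right ?_ (sq_nonneg _)
    rw [mul_pow, Real.sq_sqrt hω.le, inv_pow, pow_two, mul_inv, ← mul_assoc,
      mul_inv_cancel₀ hω.ne', one_mul, one_div]
    exact (inv_le_inv₀ hω hκ).2 (hS.le_precisionDiag hκ j)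
  refine (Finset.sum_le_sum fun j _ => h1 j).trans ?_
  rw [← Finset.mul_sum, ← EuclideanSpace.real_norm_sq_eq]
  have h2 := hS.norm_mulVecE_inv_le hκ (mulVecE X.transpose ψ)
  -- The transpose obeys the same bound as X: apply Cauchy–Schwarz to ‖u‖² = ⟨ψ, X u⟩ with u = Xᵀψ.
  have h3 : ‖mulVecE X.transpose ψ‖ ^ 2 ≤ M * ‖ψ‖ ^ 2 := by
    set u := mulVecE X.transpose ψ
    have e : ‖u‖ ^ 2 = inner ℝ ψ (mulVecE X u) := by
      rw [inner_mulVecE, real_inner_self_eq_norm_sq]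
    have h4 := hM u
    have h5 : (‖u‖ ^ 2) ^ 2 ≤ ‖ψ‖ ^ 2 * (M * ‖u‖ ^ 2) := by
      calc (‖u‖ ^ 2) ^ 2 ≤ (‖ψ‖ * ‖mulVecE X u‖) ^ 2 :=
            pow_le_pow_left₀ (sq_nonneg _) (e.le.trans (real_inner_le_norm _ _)) 2
        _ = ‖ψ‖ ^ 2 * ‖mulVecE X u‖ ^ 2 := by ring
        _ ≤ _ := mul_le_mul_of_nonneg_left h4 (sq_nonneg _)
    by_cases hu : u = 0
    · rw [hu, norm_zero, zero_pow two_ne_zero]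
      positivity
    · have hpos : 0 < ‖u‖ ^ 2 := by positivity
      nlinarith
  calc 1 / κ * ‖mulVecE S⁻¹ (mulVecE X.transpose ψ)‖ ^ 2
      ≤ 1 / κ * (1 / κ * ‖mulVecE X.transpose ψ‖) ^ 2 := by gcongr
    _ = (1 / κ) ^ 3 * ‖mulVecE X.transpose ψ‖ ^ 2 := by ring
    _ ≤ (1 / κ) ^ 3 * (M * ‖ψ‖ ^ 2) := by gcongr
    _ = _ := by ring

end CovarianceAssumption

end Covariance

/-! ### Resampling the Gaussian component attached to one coordinate. -/

section Resampling

variable {n p : ℕ}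

/-- The joint law of `n` independent rows distributed as `N(0, S)`. -/
noncomputable abbrev rowLaw (n : ℕ) {p : ℕ} (S : Matrix (Fin p) (Fin p) ℝ) :
    Measure (Fin n → EuclideanSpace ℝ (Fin p)) :=
  Measure.pi fun _ => multivariateGaussian 0 S

/-- The part of a row that is independent of its component along the `j`-th precision column. -/
noncomputable def baseRow (S : Matrix (Fin p) (Fin p) ℝ) (j : Fin p)
    (r : EuclideanSpace ℝ (Fin p)) : EuclideanSpace ℝ (Fin p) :=
  r - ((precisionDiag S j)⁻¹ * inner ℝ (precisionCol S j) r) • EuclideanSpace.single j 1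

/-- The design with the component of the rows along the `j`-th precision column removed. -/
noncomputable def baseDesign (S : Matrix (Fin p) (Fin p) ℝ) (j : Fin p)
    (r : Fin n → EuclideanSpace ℝ (Fin p)) : Matrix (Fin n) (Fin p) ℝ :=
  designMatrix fun i => baseRow S j (r i)

/-- The rows with their component along the `j`-th precision column replaced by `z`. -/
noncomputable def resample (S : Matrix (Fin p) (Fin p) ℝ) (j : Fin p)
    (z : EuclideanSpace ℝ (Fin n)) (r : Fin n → EuclideanSpace ℝ (Fin p)) :
    Fin n → EuclideanSpace ℝ (Fin p) :=
  fun i => baseRow S j (r i) + ((√(precisionDiag S j))⁻¹ * z i) • EuclideanSpace.single j 1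

variable (S : Matrix (Fin p) (Fin p) ℝ) (j : Fin p)

lemma continuous_baseRow : Continuous (baseRow S j) := by
  unfold baseRow
  fun_prop

lemma continuous_designMatrix :
    Continuous (designMatrix : (Fin n → EuclideanSpace ℝ (Fin p)) → Matrix (Fin n) (Fin p) ℝ) := by
  refine continuous_matrix fun i k => ?_
  have h := (PiLp.continuous_apply 2 (fun _ : Fin p => ℝ) k).comp
    (continuous_apply i : Continuous fun r : Fin n → EuclideanSpace ℝ (Fin p) => r i)
  simp only [Function.comp_def] at h
  exact h

lemma continuous_resample :
    Continuous fun q : EuclideanSpace ℝ (Fin n) × (Fin n → EuclideanSpace ℝ (Fin p)) =>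
      resample S j q.1 q.2 := by
  unfold resample
  refine continuous_pi fun i => ((continuous_baseRow S j).comp
    ((continuous_apply i).comp continuous_snd)).add (Continuous.fun_smul ?_ continuous_const)
  exact continuous_const.mul (((PiLp.continuous_apply 2 (fun _ : Fin n => ℝ) i)).comp continuous_fst)

lemma designMatrix_resample (z : EuclideanSpace ℝ (Fin n))
    (r : Fin n → EuclideanSpace ℝ (Fin p)) :
    designMatrix (resample S j z r)
      = shiftColumn (baseDesign S j r) j (√(precisionDiag S j))⁻¹ z := by
  ext i k
  by_cases hk : k = j
  · subst hk
    simp [designMatrix, resample, shiftColumn, baseDesign, columnMatrix]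
  · simp [designMatrix, resample, shiftColumn, baseDesign, columnMatrix, hk]

lemma mulVecE_designMatrix_apply (r : Fin n → EuclideanSpace ℝ (Fin p))
    (b : EuclideanSpace ℝ (Fin p)) (i : Fin n) :
    mulVecE (designMatrix r) b i = inner ℝ b (r i) := by
  rw [mulVecE_apply, euclidean_inner_eq_sum]
  refine Finset.sum_congr rfl fun k _ => ?_
  rw [mul_comm]
  rfl

variable {S} {κ : ℝ}

/-- The base row is orthogonal to S⁻¹e_j, while e_j has inner product Ω_jj with it. The inserted
vector is therefore exactly the standardized column of the new design. -/
lemma CovarianceAssumption.sqrt_smul_zvec_resample (hS : CovarianceAssumption S κ) (hκ : 0 < κ)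
    (z : EuclideanSpace ℝ (Fin n)) (r : Fin n → EuclideanSpace ℝ (Fin p)) :
    √(precisionDiag S j) • zvec S (designMatrix (resample S j z r)) j = z := by
  have hω := hS.precisionDiag_pos hκ j
  ext i
  rw [zvec_eq, PiLp.smul_apply, PiLp.smul_apply, mulVecE_designMatrix_apply, resample, baseRow,
    inner_add_right, inner_sub_right, real_inner_smul_right, real_inner_smul_right,
    EuclideanSpace.inner_single_right]
  simp only [one_mul, starRingEnd_apply, star_trivial, precisionCol_apply, smul_eq_mul]
  set ω := precisionDiag S j
  have h1 : √ω ≠ 0 := (Real.sqrt_pos.2 hω).ne'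
  field_simp
  ring

/-- Characteristic functions. Removing the component along S⁻¹e_j lowers the variance in direction t
by Ω_jj⁻¹ t_j², and the fresh normal variable scaled by Ω_jj^{-1/2} restores precisely that amount.
-/
lemma CovarianceAssumption.map_row (hS : CovarianceAssumption S κ) (hκ : 0 < κ) :
    ((gaussianReal 0 1).prod (multivariateGaussian 0 S)).map
      (fun q => baseRow S j q.2 + ((√(precisionDiag S j))⁻¹ * q.1) • EuclideanSpace.single j 1)
      = multivariateGaussian 0 S := by
  have hSp := (hS.posDef hκ).posSemidef
  have hω := hS.precisionDiag_pos hκ j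
  have hmeas : Measurable fun q : ℝ × EuclideanSpace ℝ (Fin p) =>
      baseRow S j q.2 + ((√(precisionDiag S j))⁻¹ * q.1) • EuclideanSpace.single j (1 : ℝ) :=
    (((continuous_baseRow S j).comp continuous_snd).add
      ((continuous_const.mul continuous_fst).smul continuous_const)).measurable
  have : IsProbabilityMeasure (((gaussianReal 0 1).prod (multivariateGaussian 0 S)).map
      (fun q => baseRow S j q.2 + ((√(precisionDiag S j))⁻¹ * q.1)
        • EuclideanSpace.single j (1 : ℝ))) :=
    Measure.isProbabilityMeasure_map hmeas.aemeasurable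
  refine Measure.ext_of_charFun (funext fun t => ?_)
  set ω := precisionDiag S j with hωdef
  -- The image of t under the adjoint of the base row projection.
  set v : EuclideanSpace ℝ (Fin p) := t - (ω⁻¹ * t j) • precisionCol S j with hv
  have hsplit : ∀ q : ℝ × EuclideanSpace ℝ (Fin p),
      Complex.exp ((inner ℝ (baseRow S j q.2 + ((√ω)⁻¹ * q.1) • EuclideanSpace.single j (1 : ℝ)) t : ℝ)
        * Complex.I)
      = Complex.exp ((inner ℝ q.1 ((√ω)⁻¹ * t j) : ℝ) * Complex.I)
        * Complex.exp ((inner ℝ q.2 v : ℝ) * Complex.I) := fun q => by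
    rw [← Complex.exp_add, ← add_mul, ← Complex.ofReal_add]
    congr 3
    have e : inner ℝ (EuclideanSpace.single j (1 : ℝ)) t = t j := by
      rw [EuclideanSpace.inner_single_left]; simp
    rw [baseRow, hv, inner_add_left, inner_sub_left, inner_sub_right, real_inner_smul_left,
      real_inner_smul_left, real_inner_smul_right, e, real_inner_comm q.2]
    simp only [← hωdef, RCLike.inner_apply, conj_trivial]
    ring
  rw [charFun_apply, integral_map hmeas.aemeasurable (by fun_prop)]
  simp_rw [hsplit]
  rw [integral_prod_mul (fun s : ℝ => Complex.exp ((inner ℝ s ((√ω)⁻¹ * t j) : ℝ) * Complex.I))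
    (fun r : EuclideanSpace ℝ (Fin p) => Complex.exp ((inner ℝ r v : ℝ) * Complex.I)),
    ← charFun_apply, ← charFun_apply, charFun_gaussianReal, charFun_multivariateGaussian hSp,
    charFun_multivariateGaussian hSp, ← Complex.exp_add]
  congr 1
  have hquad : ∀ b : EuclideanSpace ℝ (Fin p), b.ofLp ⬝ᵥ S.mulVec b.ofLp = inner ℝ b (mulVecE S b) :=
    fun b => by rw [euclidean_inner_eq_sum]; rfl
  rw [hquad, hquad, inner_zero_right, inner_zero_right]
  have hkey : inner ℝ v (mulVecE S v) = inner ℝ t (mulVecE S t) - ω⁻¹ * t j ^ 2 := by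
    have e : ∀ b : EuclideanSpace ℝ (Fin p), inner ℝ b (EuclideanSpace.single j (1 : ℝ)) = b j :=
      fun b => by rw [EuclideanSpace.inner_single_right]; simp
    rw [hv, mulVecE_sub, mulVecE_smul, hS.mulVecE_precisionCol hκ, inner_sub_left, inner_sub_right,
      inner_sub_right, real_inner_smul_left, real_inner_smul_left, real_inner_smul_right,
      real_inner_smul_right, hS.inner_mulVecE_comm (precisionCol S j),
      hS.mulVecE_precisionCol hκ, e, e, precisionCol_apply, ← hωdef,
      real_inner_comm t (EuclideanSpace.single j (1 : ℝ)), e]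
    field_simp
    ring
  rw [hkey]
  have hs : ((√ω)⁻¹ * t j) ^ 2 = ω⁻¹ * t j ^ 2 := by
    rw [mul_pow, inv_pow, Real.sq_sqrt hω.le]
  have hs' : ((((√ω)⁻¹ * t j : ℝ) : ℂ)) ^ 2 = ((ω⁻¹ * t j ^ 2 : ℝ) : ℂ) := by
    rw [← hs]; push_cast; ring
  rw [hs']
  push_cast
  ring

/-- Resampling the component of the rows along the `j`-th precision column preserves the law of
the rows. -/
theorem CovarianceAssumption.measurePreserving_resample (hS : CovarianceAssumption S κ)
    (hκ : 0 < κ) :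
    MeasurePreserving (fun q : EuclideanSpace ℝ (Fin n) × (Fin n → EuclideanSpace ℝ (Fin p)) =>
      resample S j q.1 q.2)
      ((stdGaussian (EuclideanSpace ℝ (Fin n))).prod (rowLaw n S)) (rowLaw n S) := by
  refine ⟨(continuous_resample S j).measurable, ?_⟩
  have hrow : Measurable fun q : ℝ × EuclideanSpace ℝ (Fin p) =>
      baseRow S j q.2 + ((√(precisionDiag S j))⁻¹ * q.1) • EuclideanSpace.single j (1 : ℝ) :=
    (((continuous_baseRow S j).comp continuous_snd).add
      ((continuous_const.mul continuous_fst).smul continuous_const)).measurable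
  -- The pairs (z_i, r_i) are regrouped so that the statement for a single row applies
  -- coordinatewise to a product measure.
  have h1 := (measurePreserving_arrowProdEquivProdArrow ℝ (EuclideanSpace ℝ (Fin p)) (Fin n)
    (fun _ => gaussianReal 0 1) (fun _ => multivariateGaussian 0 S))
  have h2 : MeasurePreserving (Prod.map (WithLp.toLp 2) id)
      ((Measure.pi fun _ : Fin n => gaussianReal 0 1).prod (rowLaw n S))
      ((stdGaussian (EuclideanSpace ℝ (Fin n))).prod (rowLaw n S)) :=
    MeasurePreserving.prod ⟨by fun_prop, map_pi_eq_stdGaussian⟩ (MeasurePreserving.id _)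
  have h3 := h2.comp h1
  rw [← h3.map_eq, Measure.map_map (continuous_resample S j).measurable h3.measurable]
  have : IsProbabilityMeasure (((gaussianReal 0 1).prod (multivariateGaussian 0 S)).map
      (fun q => baseRow S j q.2 + ((√(precisionDiag S j))⁻¹ * q.1)
        • EuclideanSpace.single j (1 : ℝ))) :=
    Measure.isProbabilityMeasure_map hrow.aemeasurable
  have h4 := Measure.pi_map_pi (ι := Fin n)
    (μ := fun _ => (gaussianReal 0 1).prod (multivariateGaussian (0 : EuclideanSpace ℝ (Fin p)) S))
    (f := fun _ q => baseRow S j q.2 + ((√(precisionDiag S j))⁻¹ * q.1)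
      • EuclideanSpace.single j (1 : ℝ)) (fun _ => hrow.aemeasurable)
  rw [hS.map_row j hκ] at h4
  exact h4

end Resampling

/-! ### Operator norm of the design and a Lipschitz cutoff. -/

section OperatorNorm

variable {n p : ℕ}

/-- The matrix `X` as a continuous linear map between Euclidean spaces. -/
noncomputable def mulVecCLM : Matrix (Fin n) (Fin p) ℝ →ₗ[ℝ]
    EuclideanSpace ℝ (Fin p) →L[ℝ] EuclideanSpace ℝ (Fin n) where
  toFun X := LinearMap.toContinuousLinearMap
    { toFun := mulVecE X
      map_add' := mulVecE_add X
      map_smul' := fun t b => mulVecE_smul X t b }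
  map_add' X Y := by
    ext b : 1
    exact add_mulVecE X Y b
  map_smul' t X := by
    ext b i
    simp [mulVecE, Matrix.smul_mulVec]

lemma mulVecCLM_apply (X : Matrix (Fin n) (Fin p) ℝ) (b : EuclideanSpace ℝ (Fin p)) :
    mulVecCLM X b = mulVecE X b := rfl

lemma norm_mulVecE_le (X : Matrix (Fin n) (Fin p) ℝ) (b : EuclideanSpace ℝ (Fin p)) :
    ‖mulVecE X b‖ ≤ ‖mulVecCLM X‖ * ‖b‖ := (mulVecCLM X).le_opNorm b

lemma continuous_mulVecCLM :
    Continuous (mulVecCLM : Matrix (Fin n) (Fin p) ℝ →ₗ[ℝ] _) :=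
  LinearMap.continuous_of_finiteDimensional _

lemma norm_mulVecCLM_columnMatrix_le (η : EuclideanSpace ℝ (Fin n)) (j : Fin p) :
    ‖mulVecCLM (columnMatrix η j)‖ ≤ ‖η‖ := by
  refine ContinuousLinearMap.opNorm_le_bound _ (norm_nonneg _) fun b => ?_
  rw [mulVecCLM_apply, mulVecE_columnMatrix, norm_smul, mul_comm]
  exact mul_le_mul_of_nonneg_left (PiLp.norm_apply_le b j) (norm_nonneg _)

/-- A cutoff equal to `1` where the operator norm of `X` is at most `c √n`, and equal to `0` where
it is at least `2 c √n`. -/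
noncomputable def cutoff (c : ℝ) (X : Matrix (Fin n) (Fin p) ℝ) : ℝ :=
  max 0 (min 1 (2 - ‖mulVecCLM X‖ / (c * √n)))

variable {c : ℝ}

lemma cutoff_nonneg (X : Matrix (Fin n) (Fin p) ℝ) : 0 ≤ cutoff c X := le_max_left _ _

lemma cutoff_le_one (X : Matrix (Fin n) (Fin p) ℝ) : cutoff c X ≤ 1 :=
  max_le zero_le_one (min_le_left _ _)

lemma continuous_cutoff : Continuous (cutoff (n := n) (p := p) c) := by
  unfold cutoff
  have h := (continuous_mulVecCLM (n := n) (p := p)).norm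
  exact continuous_const.max (continuous_const.min (continuous_const.sub (h.div_const _)))

lemma cutoff_eq_one (hc : 0 < c) (hn : (0 : ℝ) < n) {X : Matrix (Fin n) (Fin p) ℝ}
    (hX : ‖mulVecCLM X‖ ≤ c * √n) : cutoff c X = 1 := by
  have h : ‖mulVecCLM X‖ / (c * √n) ≤ 1 := div_le_one_of_le₀ hX (by positivity)
  rw [cutoff, min_eq_left (by linarith), max_eq_right zero_le_one]

lemma norm_mulVecE_sq_le_of_cutoff_ne_zero (hc : 0 < c) (hn : (0 : ℝ) < n)
    {X : Matrix (Fin n) (Fin p) ℝ} (hX : cutoff c X ≠ 0) (b : EuclideanSpace ℝ (Fin p)) :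
    ‖mulVecE X b‖ ^ 2 ≤ 4 * c ^ 2 * n * ‖b‖ ^ 2 := by
  have hlt : ‖mulVecCLM X‖ ≤ 2 * (c * √n) := by
    by_contra h
    have : 2 ≤ ‖mulVecCLM X‖ / (c * √n) := by
      rw [le_div_iff₀ (by positivity)]
      exact (not_le.1 h).le
    exact hX (max_eq_left ((min_le_right _ _).trans (by linarith)))
  have h := (norm_mulVecE_le X b).trans (mul_le_mul_of_nonneg_right hlt (norm_nonneg _))
  refine (pow_le_pow_left₀ (norm_nonneg _) h 2).trans (le_of_eq ?_)
  have hs : √(n : ℝ) ^ 2 = n := Real.sq_sqrt hn.le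
  linear_combination (4 * c ^ 2 * ‖b‖ ^ 2) * hs

/-- Clamping is 1-Lipschitz, and a change of one column changes the operator norm by at most the
norm of that change. Thanks to the division by √n the squared constant is of order 1/n, as the
divergence bounds demand of the weight. -/
lemma lipschitzWith_cutoff_shiftColumn (hc : 0 < c) (X : Matrix (Fin n) (Fin p) ℝ) (j : Fin p)
    {σ : ℝ} (hσ : 0 ≤ σ) :
    LipschitzWith (σ / (c * √n)).toNNReal fun z => cutoff c (shiftColumn X j σ z) := by
  refine LipschitzWith.of_dist_le_mul fun z z' => ?_
  rw [Real.coe_toNNReal _ (by positivity), dist_eq_norm, dist_eq_norm, Real.norm_eq_abs]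
  have h1 : ∀ a b : ℝ, |max 0 (min 1 a) - max 0 (min 1 b)| ≤ |a - b| := fun a b => by
    rw [max_comm 0, max_comm 0, min_comm 1, min_comm 1]
    exact (abs_sup_sub_sup_le_abs _ _ _).trans (abs_inf_sub_inf_le_abs _ _ _)
  refine (h1 _ _).trans ?_
  have h2 : ‖mulVecCLM (shiftColumn X j σ z') - mulVecCLM (shiftColumn X j σ z)‖ ≤ σ * ‖z - z'‖ := by
    have e : shiftColumn X j σ z = shiftColumn X j σ z' + columnMatrix (σ • (z - z')) j := by
      rw [← shiftColumn_add, add_sub_cancel]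
    rw [e, map_add, sub_add_cancel_left, norm_neg]
    refine (norm_mulVecCLM_columnMatrix_le _ _).trans ?_
    rw [norm_smul, Real.norm_of_nonneg hσ]
  have h3 := (abs_norm_sub_norm_le (mulVecCLM (shiftColumn X j σ z'))
    (mulVecCLM (shiftColumn X j σ z))).trans h2
  have e2 : 2 - ‖mulVecCLM (shiftColumn X j σ z)‖ / (c * √n)
      - (2 - ‖mulVecCLM (shiftColumn X j σ z')‖ / (c * √n))
      = (‖mulVecCLM (shiftColumn X j σ z')‖ - ‖mulVecCLM (shiftColumn X j σ z)‖) / (c * √n) := by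
    ring
  rw [e2, abs_div, abs_of_nonneg (by positivity : 0 ≤ c * √n), div_mul_eq_mul_div]
  exact div_le_div_of_nonneg_right h3 (by positivity)

end OperatorNorm

/-! ### Exponential tail of the operator norm. -/

section Tail

variable {n p : ℕ} {S : Matrix (Fin p) (Fin p) ℝ} {κ : ℝ}

/-- The exponential moment `E exp(G² / 4)` of a standard normal variable `G`. -/
noncomputable def squareExpMoment : ENNReal :=
  ∫⁻ x, ENNReal.ofReal (Real.exp (x ^ 2 / 4)) ∂(gaussianReal 0 1)

lemma squareExpMoment_ne_top : squareExpMoment ≠ ⊤ := by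
  rw [squareExpMoment, gaussianReal_of_var_ne_zero _ one_ne_zero,
    lintegral_withDensity_eq_lintegral_mul _ (measurable_gaussianPDF _ _) (by fun_prop)]
  have h : ∀ x : ℝ, (gaussianPDF 0 1 * fun x => ENNReal.ofReal (Real.exp (x ^ 2 / 4))) x
      = ENNReal.ofReal ((√(2 * Real.pi))⁻¹ * Real.exp (-(1 / 4) * x ^ 2)) := fun x => by
    rw [Pi.mul_apply, gaussianPDF, ← ENNReal.ofReal_mul (gaussianPDFReal_nonneg _ _ _),
      gaussianPDFReal, mul_assoc, ← Real.exp_add]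
    congr 3
    · simp
    · simp
      ring
  simp_rw [h]
  exact ((integrable_exp_neg_mul_sq (by norm_num)).const_mul _).lintegral_lt_top.ne

lemma squareExpMoment_one_le : 1 ≤ squareExpMoment := by
  have h : ∫⁻ _, 1 ∂(gaussianReal 0 1) ≤ squareExpMoment :=
    lintegral_mono fun x => by
      rw [← ENNReal.ofReal_one]
      exact ENNReal.ofReal_le_ofReal (Real.one_le_exp (by positivity))
  simpa using h

namespace CovarianceAssumption

variable (hS : CovarianceAssumption S κ) (hκ : 0 < κ)

include hS hκ

lemma map_inner_row (v : EuclideanSpace ℝ (Fin p)) :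
    (multivariateGaussian 0 S).map (fun r => inner ℝ v r)
      = (gaussianReal 0 1).map fun x => √(inner ℝ v (mulVecE S v)) * x := by
  have hSp := (hS.posDef hκ).posSemidef
  have hs : 0 ≤ inner ℝ v (mulVecE S v) := le_trans (by positivity) (hS.le_inner_mulVecE v)
  have hm : Measurable fun r : EuclideanSpace ℝ (Fin p) => inner ℝ v r := by fun_prop
  have := Measure.isProbabilityMeasure_map (μ := multivariateGaussian 0 S) hm.aemeasurable
  refine Measure.ext_of_charFun (funext fun t => ?_)
  rw [gaussianReal_map_const_mul, charFun_gaussianReal, charFun_apply,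
    integral_map hm.aemeasurable (by fun_prop)]
  have h : ∀ r, ((inner ℝ (inner ℝ v r) t : ℝ) : ℂ) = ((inner ℝ r (t • v) : ℝ) : ℂ) := fun r => by
    rw [real_inner_smul_right, real_inner_comm r v]
    simp
  simp_rw [h]
  rw [← charFun_apply, charFun_multivariateGaussian hSp]
  have hquad : (t • v).ofLp ⬝ᵥ S.mulVec (t • v).ofLp = t ^ 2 * inner ℝ v (mulVecE S v) := by
    have : (t • v).ofLp ⬝ᵥ S.mulVec (t • v).ofLp = inner ℝ (t • v) (mulVecE S (t • v)) := by
      rw [euclidean_inner_eq_sum]; rfl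
    rw [this, mulVecE_smul, real_inner_smul_left, real_inner_smul_right]
    ring
  rw [hquad, inner_zero_right]
  congr 1
  simp only [mul_one, NNReal.coe_mk, Real.sq_sqrt hs]
  push_cast
  simp
  ring

/-- ⟨v, r⟩ is centred Gaussian with variance at most 1/κ, so κ/4 times its square is dominated by a
quarter of the square of a standard normal variable. -/
lemma lintegral_exp_row_le {v : EuclideanSpace ℝ (Fin p)} (hv : ‖v‖ ≤ 1) :
    ∫⁻ r, ENNReal.ofReal (Real.exp (κ / 4 * inner ℝ v r ^ 2)) ∂(multivariateGaussian 0 S)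
      ≤ squareExpMoment := by
  have hs : 0 ≤ inner ℝ v (mulVecE S v) := le_trans (by positivity) (hS.le_inner_mulVecE v)
  have h1 : ∫⁻ r, ENNReal.ofReal (Real.exp (κ / 4 * inner ℝ v r ^ 2)) ∂(multivariateGaussian 0 S)
      = ∫⁻ x, ENNReal.ofReal (Real.exp (κ / 4 * x ^ 2))
        ∂((multivariateGaussian 0 S).map (fun r => inner ℝ v r)) :=
    (lintegral_map (f := fun x => ENNReal.ofReal (Real.exp (κ / 4 * x ^ 2)))
      (by fun_prop) (by fun_prop)).symm
  rw [h1, hS.map_inner_row hκ, lintegral_map (by fun_prop) (by fun_prop)]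
  refine lintegral_mono fun x => ENNReal.ofReal_le_ofReal (Real.exp_le_exp.2 ?_)
  rw [mul_pow, Real.sq_sqrt hs]
  have h2 := hS.inner_mulVecE_le v
  have h3 : κ * inner ℝ v (mulVecE S v) ≤ 1 := by
    have : inner ℝ v (mulVecE S v) ≤ 1 / κ := h2.trans
      (mul_le_of_le_one_right (by positivity) (pow_le_one₀ (norm_nonneg _) hv))
    calc κ * inner ℝ v (mulVecE S v) ≤ κ * (1 / κ) := by gcongr
      _ = 1 := by field_simp
  nlinarith [mul_le_mul_of_nonneg_right h3 (sq_nonneg x)]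

lemma lintegral_exp_norm_mulVecE_le {v : EuclideanSpace ℝ (Fin p)} (hv : ‖v‖ ≤ 1) :
    ∫⁻ r, ENNReal.ofReal (Real.exp (κ / 4 * ‖mulVecE (designMatrix r) v‖ ^ 2)) ∂(rowLaw n S)
      ≤ squareExpMoment ^ n := by
  have h1 : ∀ r : Fin n → EuclideanSpace ℝ (Fin p),
      ENNReal.ofReal (Real.exp (κ / 4 * ‖mulVecE (designMatrix r) v‖ ^ 2))
      = ∏ i, ENNReal.ofReal (Real.exp (κ / 4 * inner ℝ v (r i) ^ 2)) := fun r => by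
    rw [EuclideanSpace.real_norm_sq_eq, Finset.mul_sum, Real.exp_sum,
      ENNReal.ofReal_prod_of_nonneg fun i _ => (Real.exp_pos _).le]
    simp_rw [mulVecE_designMatrix_apply]
  simp_rw [h1]
  have hind : iIndepFun (fun (i : Fin n) (r : Fin n → EuclideanSpace ℝ (Fin p)) =>
      ENNReal.ofReal (Real.exp (κ / 4 * inner ℝ v (r i) ^ 2))) (rowLaw n S) :=
    iIndepFun_pi (X := fun _ r => ENNReal.ofReal (Real.exp (κ / 4 * inner ℝ v r ^ 2)))
      fun i => by fun_prop
  rw [lintegral_prod_eq_prod_lintegral_of_indepFun _ _ hind fun i => by fun_prop]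
  calc ∏ i : Fin n, ∫⁻ r, ENNReal.ofReal (Real.exp (κ / 4 * inner ℝ v (r i) ^ 2)) ∂(rowLaw n S)
      ≤ ∏ _i : Fin n, squareExpMoment := Finset.prod_le_prod' fun i _ => by
        rw [(measurePreserving_eval (fun _ : Fin n => multivariateGaussian 0 S) i).lintegral_comp
          (f := fun r => ENNReal.ofReal (Real.exp (κ / 4 * inner ℝ v r ^ 2))) (by fun_prop)]
        exact hS.lintegral_exp_row_le hκ hv
    _ = squareExpMoment ^ n := by simp

-- A volume argument in place of a net. Around 3/4 of a nearly maximizing vector v₀, the ball of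
-- radius 1/4 lies in the unit ball, and on it ‖A v‖ ≥ (3/4)(2/3)‖A‖ - ‖A‖/4 = ‖A‖/4. Its share of
-- the volume is 4^{-p}.
omit hS hκ in
lemma exp_mul_volume_le {s : ℝ} (hκ : 0 < κ) (hs : 0 ≤ s)
    {A : EuclideanSpace ℝ (Fin p) →L[ℝ] EuclideanSpace ℝ (Fin n)} (hA : s < ‖A‖) :
    ENNReal.ofReal (Real.exp (κ / 64 * s ^ 2)) * (ENNReal.ofReal ((1 / 4) ^ p)
        * volume (Metric.ball (0 : EuclideanSpace ℝ (Fin p)) 1))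
      ≤ ∫⁻ v in Metric.ball (0 : EuclideanSpace ℝ (Fin p)) 1,
        ENNReal.ofReal (Real.exp (κ / 4 * ‖A v‖ ^ 2)) := by
  have hpos : 0 < ‖A‖ := hs.trans_lt hA
  obtain ⟨v₀, hv₀, hAv⟩ := A.exists_lt_apply_of_lt_opNorm (by linarith : 2 / 3 * ‖A‖ < ‖A‖)
  have hvol := Measure.addHaar_ball_of_pos (volume : Measure (EuclideanSpace ℝ (Fin p)))
    ((3 / 4 : ℝ) • v₀) (by norm_num : (0 : ℝ) < 1 / 4)
  rw [finrank_euclideanSpace_fin] at hvol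
  rw [← hvol, ← setLIntegral_const]
  have hsub : Metric.ball ((3 / 4 : ℝ) • v₀) (1 / 4) ⊆ Metric.ball 0 1 := by
    intro v hv
    rw [mem_ball_iff_norm] at hv
    rw [mem_ball_zero_iff]
    calc ‖v‖ = ‖(v - (3 / 4 : ℝ) • v₀) + (3 / 4 : ℝ) • v₀‖ := by rw [sub_add_cancel]
      _ ≤ ‖v - (3 / 4 : ℝ) • v₀‖ + ‖(3 / 4 : ℝ) • v₀‖ := norm_add_le _ _
      _ < 1 / 4 + 3 / 4 * 1 := by
        rw [norm_smul, Real.norm_of_nonneg (by norm_num : (0 : ℝ) ≤ 3 / 4)]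
        exact add_lt_add hv (by linarith)
      _ = 1 := by norm_num
  refine (setLIntegral_mono (by fun_prop) fun v hv => ?_).trans
    (lintegral_mono_set hsub)
  refine ENNReal.ofReal_le_ofReal (Real.exp_le_exp.2 ?_)
  rw [mem_ball_iff_norm] at hv
  have h1 : s / 4 ≤ ‖A v‖ := by
    have e : A v = (3 / 4 : ℝ) • A v₀ + A (v - (3 / 4 : ℝ) • v₀) := by
      rw [map_sub, map_smul]; abel
    have h2 : ‖A (v - (3 / 4 : ℝ) • v₀)‖ ≤ ‖A‖ * (1 / 4) :=
      (A.le_opNorm _).trans (mul_le_mul_of_nonneg_left hv.le (norm_nonneg _))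
    have h3 : ‖(3 / 4 : ℝ) • A v₀‖ = 3 / 4 * ‖A v₀‖ := by
      rw [norm_smul, Real.norm_of_nonneg (by norm_num : (0 : ℝ) ≤ 3 / 4)]
    have h4 := norm_sub_le_norm_add ((3 / 4 : ℝ) • A v₀) (A (v - (3 / 4 : ℝ) • v₀))
    rw [← e, h3] at h4
    linarith
  have h5 := pow_le_pow_left₀ (by positivity) h1 2
  calc κ / 64 * s ^ 2 = κ / 4 * (s / 4) ^ 2 := by ring
    _ ≤ κ / 4 * ‖A v‖ ^ 2 := by gcongr

/-- Exponential tail bound for the operator norm of a Gaussian design. -/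
theorem rowLaw_lt_norm_mulVecCLM_le {s : ℝ} (hs : 0 ≤ s) :
    ENNReal.ofReal (Real.exp (κ / 64 * s ^ 2)) * ENNReal.ofReal ((1 / 4) ^ p)
      * rowLaw n S {r | s < ‖mulVecCLM (designMatrix r)‖} ≤ squareExpMoment ^ n := by
  set V := volume (Metric.ball (0 : EuclideanSpace ℝ (Fin p)) 1)
  have hV0 : V ≠ 0 := (Metric.measure_ball_pos _ _ one_pos).ne'
  have hVt : V ≠ ⊤ := measure_ball_lt_top.ne
  have hcont : Continuous fun r : Fin n → EuclideanSpace ℝ (Fin p) => mulVecCLM (designMatrix r) := by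
    have h := (continuous_mulVecCLM (n := n) (p := p)).comp (continuous_designMatrix)
    simp only [Function.comp_def] at h
    exact h
  have hset : MeasurableSet {r : Fin n → EuclideanSpace ℝ (Fin p) |
      s < ‖mulVecCLM (designMatrix r)‖} :=
    (isOpen_lt continuous_const hcont.norm).measurableSet
  have hjoint : Measurable fun q : (Fin n → EuclideanSpace ℝ (Fin p)) × EuclideanSpace ℝ (Fin p) =>
      ENNReal.ofReal (Real.exp (κ / 4 * ‖mulVecCLM (designMatrix q.1) q.2‖ ^ 2)) := by
    have h : Continuous fun q : (Fin n → EuclideanSpace ℝ (Fin p)) × EuclideanSpace ℝ (Fin p) =>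
        mulVecCLM (designMatrix q.1) q.2 := (hcont.comp continuous_fst).clm_apply continuous_snd
    have h2 := h.measurable
    fun_prop
  -- Chernoff's bound averaged over the unit ball: a large operator norm makes the average large,
  -- while by Fubini its expectation is controlled direction by direction. The volume V cancels.
  have hlow : ENNReal.ofReal (Real.exp (κ / 64 * s ^ 2)) * (ENNReal.ofReal ((1 / 4) ^ p) * V)
      * rowLaw n S {r | s < ‖mulVecCLM (designMatrix r)‖}
      ≤ ∫⁻ r, (∫⁻ v in Metric.ball (0 : EuclideanSpace ℝ (Fin p)) 1,
        ENNReal.ofReal (Real.exp (κ / 4 * ‖mulVecCLM (designMatrix r) v‖ ^ 2))) ∂(rowLaw n S) := by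
    rw [← setLIntegral_const]
    refine (setLIntegral_mono' hset fun r hr => ?_).trans (setLIntegral_le_lintegral _ _)
    exact exp_mul_volume_le hκ hs hr
  have hup : ∫⁻ r, (∫⁻ v in Metric.ball (0 : EuclideanSpace ℝ (Fin p)) 1,
        ENNReal.ofReal (Real.exp (κ / 4 * ‖mulVecCLM (designMatrix r) v‖ ^ 2))) ∂(rowLaw n S)
      ≤ squareExpMoment ^ n * V := by
    rw [lintegral_lintegral_swap hjoint.aemeasurable, ← setLIntegral_const]
    refine setLIntegral_mono measurable_const fun v hv => ?_
    exact hS.lintegral_exp_norm_mulVecE_le hκ (mem_ball_zero_iff.1 hv).le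
  have h := hlow.trans hup
  rw [← mul_assoc, mul_right_comm] at h
  exact (ENNReal.mul_le_mul_iff_left hV0 hVt).1 h

end CovarianceAssumption

end Tail

/-! ### The cutoff is inactive with overwhelming probability. -/

section CutoffTail

variable {n p : ℕ} {S : Matrix (Fin p) (Fin p) ℝ} {κ γ : ℝ}

/-- The truncation level for the operator norm of the design. -/
noncomputable def cutoffLevel (κ γ : ℝ) : ℝ :=
  √(64 / κ * (γ * Real.log 4 + Real.log squareExpMoment.toReal + 1))

lemma one_le_squareExpMoment_toReal : 1 ≤ squareExpMoment.toReal := by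
  have := ENNReal.toReal_mono squareExpMoment_ne_top squareExpMoment_one_le
  simpa using this

lemma cutoffLevel_pos (hκ : 0 < κ) (hγ : 0 < γ) : 0 < cutoffLevel κ γ := by
  have h1 := Real.log_nonneg one_le_squareExpMoment_toReal
  have h2 : 0 < Real.log 4 := Real.log_pos (by norm_num)
  exact Real.sqrt_pos.2 (by positivity)

theorem CovarianceAssumption.rowLaw_cutoff_ne_one_le (hS : CovarianceAssumption S κ) (hκ : 0 < κ)
    (hγ : 0 < γ) (hn : (0 : ℝ) < n) (hp : (p : ℝ) / n ≤ γ) :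
    (rowLaw n S).real {r | cutoff (cutoffLevel κ γ) (designMatrix r) ≠ 1} ≤ Real.exp (-n) := by
  set m := squareExpMoment.toReal with hm
  have hm1 : 1 ≤ m := one_le_squareExpMoment_toReal
  have hc := cutoffLevel_pos hκ hγ
  set c := cutoffLevel κ γ with hcdef
  have hsub : (rowLaw n S).real {r | cutoff c (designMatrix r) ≠ 1}
      ≤ (rowLaw n S).real {r | c * √n < ‖mulVecCLM (designMatrix r)‖} := by
    refine measureReal_mono fun r hr => ?_
    by_contra h
    exact hr (cutoff_eq_one hc hn (not_lt.1 h))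
  refine hsub.trans ?_
  have h := ENNReal.toReal_mono (ENNReal.pow_ne_top squareExpMoment_ne_top)
    (hS.rowLaw_lt_norm_mulVecCLM_le (n := n) hκ (by positivity : 0 ≤ c * √n))
  rw [ENNReal.toReal_mul, ENNReal.toReal_mul, ENNReal.toReal_ofReal (Real.exp_pos _).le,
    ENNReal.toReal_ofReal (by positivity), ENNReal.toReal_pow, ← hm] at h
  change _ * _ * (rowLaw n S).real _ ≤ _ at h
  set P := (rowLaw n S).real {r | c * √n < ‖mulVecCLM (designMatrix r)‖}
  have h4 : 0 < Real.log 4 := Real.log_pos (by norm_num)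
  have hlm := Real.log_nonneg hm1
  -- The three summands of the level compensate the factor 4^p, at most exp(γ n log 4), and the
  -- factor m^n, and leave exp(-n) to spare.
  have e1 : κ / 64 * (c * √n) ^ 2 = n * (γ * Real.log 4 + Real.log m + 1) := by
    rw [mul_pow, Real.sq_sqrt hn.le, hcdef, cutoffLevel, Real.sq_sqrt (by positivity),
      ← hm]
    field_simp
  have e2 : ((1 : ℝ) / 4) ^ p = Real.exp (-(p * Real.log 4)) := by
    rw [Real.exp_neg, Real.exp_nat_mul, Real.exp_log (by norm_num), one_div, inv_pow]
  have e3 : m ^ n = Real.exp (n * Real.log m) := by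
    rw [Real.exp_nat_mul, Real.exp_log (by linarith)]
  rw [e1, e2, e3, ← Real.exp_add] at h
  have hp' : (p : ℝ) ≤ γ * n := (div_le_iff₀ hn).1 hp
  have h5 : Real.exp (n + n * Real.log m) * P ≤ Real.exp (n * Real.log m) := by
    refine le_trans (mul_le_mul_of_nonneg_right (Real.exp_le_exp.2 ?_) measureReal_nonneg) h
    nlinarith [mul_le_mul_of_nonneg_right hp' h4.le]
  rw [Real.exp_add, mul_right_comm] at h5
  have h6 : Real.exp n * P ≤ 1 :=
    le_of_mul_le_mul_right (by rwa [one_mul]) (Real.exp_pos (n * Real.log m))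
  rw [Real.exp_neg, ← one_div, le_div_iff₀ (Real.exp_pos _), mul_comm]
  exact h6

end CutoffTail

/-! ### Measurability, and the almost sure existence of the statistics. -/

section Measurability

variable {n p : ℕ} {ρ : ℝ → ℝ} {g : EuclideanSpace ℝ (Fin p) → ℝ} {τ K : ℝ} {L : NNReal}

namespace Regular

variable (H : Regular n ρ g τ K L) (β : EuclideanSpace ℝ (Fin p))

include H

lemma continuous_psiHat_designMatrix :
    Continuous (Function.uncurry fun (r : Fin n → EuclideanSpace ℝ (Fin p)) =>
      psiHat ρ g (designMatrix r)) := by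
  have h := continuous_designMatrix.comp (continuous_fst :
    Continuous fun q : (Fin n → EuclideanSpace ℝ (Fin p)) × EuclideanSpace ℝ (Fin n) => q.1)
  simp only [Function.comp_def] at h
  exact H.continuous_psiHat h continuous_snd

lemma measurable_trJacobian :
    Measurable fun q : (Fin n → EuclideanSpace ℝ (Fin p)) × EuclideanSpace ℝ (Fin n) =>
      trJacobian ρ g (designMatrix q.1) q.2 := by
  have h := measurable_fderiv_with_param ℝ H.continuous_psiHat_designMatrix
  simp_rw [trJacobian_eq_sum]
  refine Finset.measurable_sum _ fun i _ => ?_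
  have h1 : Measurable fun q : (Fin n → EuclideanSpace ℝ (Fin p)) × EuclideanSpace ℝ (Fin n) =>
      fderiv ℝ (psiHat ρ g (designMatrix q.1)) q.2 (EuclideanSpace.single i 1) :=
    h.apply_continuousLinearMap _
  have h2 := (PiLp.continuous_apply 2 (fun _ : Fin n => ℝ) i).measurable.comp h1
  simp only [Function.comp_def] at h2
  exact h2

omit H in
lemma continuous_rows_response {α : Type*} [TopologicalSpace α]
    {r : α → Fin n → EuclideanSpace ℝ (Fin p)} {e : α → EuclideanSpace ℝ (Fin n)}
    (hr : Continuous r) (he : Continuous e) :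
    Continuous fun a => (r a, response β (designMatrix (r a)) (e a)) := by
  have h := continuous_designMatrix.comp hr
  simp only [Function.comp_def] at h
  exact hr.prodMk (continuous_response β h he)

lemma measurableSet_wellDefined :
    MeasurableSet {q : (Fin n → EuclideanSpace ℝ (Fin p)) × EuclideanSpace ℝ (Fin n) |
      psiHat ρ g (designMatrix q.1) (response β (designMatrix q.1) q.2) ≠ 0
      ∧ DifferentiableAt ℝ (psiHat ρ g (designMatrix q.1))
        (response β (designMatrix q.1) q.2)} := by
  have hc := continuous_rows_response β (continuous_fst :
    Continuous fun q : (Fin n → EuclideanSpace ℝ (Fin p)) × EuclideanSpace ℝ (Fin n) => q.1)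
    continuous_snd
  have h1 := H.continuous_psiHat_designMatrix.comp hc
  simp only [Function.comp_def, Function.uncurry_def] at h1
  have h2 := measurableSet_of_differentiableAt_with_param ℝ H.continuous_psiHat_designMatrix
  exact (isOpen_ne_fun h1 continuous_const).measurableSet.inter (hc.measurable h2)

/-- For almost every noise vector and design the score vector is nonzero and the estimator is
differentiable with respect to the response. -/
theorem ae_wellDefined (P : Measure (Fin n → EuclideanSpace ℝ (Fin p))) [SFinite P]
    {ν : Measure (EuclideanSpace ℝ (Fin n))} [SFinite ν] (hν : ν ≪ volume) :
    ∀ᵐ q ∂(P.prod ν), psiHat ρ g (designMatrix q.1) (response β (designMatrix q.1) q.2) ≠ 0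
      ∧ DifferentiableAt ℝ (psiHat ρ g (designMatrix q.1))
        (response β (designMatrix q.1) q.2) := by
  have hn : 0 < n := by exact_mod_cast H.n_pos
  -- In positive dimension points are Lebesgue null, and the responses with zero score form at most
  -- one point.
  have : Nonempty (Fin n) := ⟨⟨0, hn⟩⟩
  rw [ae_iff]
  change (P.prod ν) {q | _}ᶜ = 0
  rw [Measure.measure_prod_null (H.measurableSet_wellDefined β).compl]
  refine Eventually.of_forall fun r => ?_
  have hmp := (measurePreserving_add_left (volume : Measure (EuclideanSpace ℝ (Fin n)))
    (mulVecE (designMatrix r) β)).quasiMeasurePreserving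
  have h1 : ∀ᵐ y : EuclideanSpace ℝ (Fin n), psiHat ρ g (designMatrix r) y ≠ 0 := by
    rw [ae_iff]
    simp only [not_not]
    exact (H.subsingleton_psiHat_eq_zero (designMatrix r)).measure_zero _
  have h2 : ∀ᵐ y : EuclideanSpace ℝ (Fin n), DifferentiableAt ℝ (psiHat ρ g (designMatrix r)) y :=
    (H.lipschitzWith_psiHat (designMatrix r)).ae_differentiableAt
  have h3 := hν.ae_le (hmp.ae (h1.and h2))
  exact h3

end Regular

end Measurability

/-! ### Column replacement on samples of design and noise. -/

section JointLaw

variable {n p : ℕ}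

/-- Pairs consisting of the rows of a design and a noise vector. -/
abbrev Sample (n p : ℕ) : Type :=
  (Fin n → EuclideanSpace ℝ (Fin p)) × EuclideanSpace ℝ (Fin n)

/-- Replaces the component of the rows along the `j`-th precision column by a new vector. -/
noncomputable def replaceColumn (S : Matrix (Fin p) (Fin p) ℝ) (j : Fin p)
    (t : Sample n p × EuclideanSpace ℝ (Fin n)) : Sample n p :=
  (resample S j t.2 t.1.1, t.1.2)

lemma continuous_replaceColumn (S : Matrix (Fin p) (Fin p) ℝ) (j : Fin p) :
    Continuous (replaceColumn (n := n) S j) := by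
  have h := (continuous_resample (n := n) S j).comp
    ((continuous_snd.prodMk (continuous_fst.comp continuous_fst)) : Continuous
      fun t : Sample n p × EuclideanSpace ℝ (Fin n) => (t.2, t.1.1))
  simp only [Function.comp_def] at h
  exact h.prodMk (continuous_snd.comp continuous_fst)

variable {S : Matrix (Fin p) (Fin p) ℝ} {κ : ℝ}

lemma CovarianceAssumption.measurePreserving_replaceColumn (hS : CovarianceAssumption S κ)
    (hκ : 0 < κ) (j : Fin p) (Q : Measure (EuclideanSpace ℝ (Fin n))) [IsProbabilityMeasure Q] :
    MeasurePreserving (replaceColumn S j)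
      (((rowLaw n S).prod Q).prod (stdGaussian (EuclideanSpace ℝ (Fin n))))
      ((rowLaw n S).prod Q) := by
  have h1 : MeasurePreserving Prod.swap
      (((rowLaw n S).prod Q).prod (stdGaussian (EuclideanSpace ℝ (Fin n))))
      ((stdGaussian (EuclideanSpace ℝ (Fin n))).prod ((rowLaw n S).prod Q)) :=
    Measure.measurePreserving_swap
  have h2 := (measurePreserving_prodAssoc (stdGaussian (EuclideanSpace ℝ (Fin n)))
    (rowLaw n S) Q).symm
  have h3 := (hS.measurePreserving_resample (n := n) j hκ).prod (MeasurePreserving.id Q)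
  exact h3.comp (h2.comp h1)

end JointLaw

/-! ### Gaussian approximation of the pivot for random samples. -/

section SampleStatistics

variable {n p : ℕ}

/-- The truncated energy of coordinate `j` at a sample. -/
noncomputable def energyAt (ρ : ℝ → ℝ) (g : EuclideanSpace ℝ (Fin p) → ℝ)
    (β : EuclideanSpace ℝ (Fin p)) (c : ℝ) (j : Fin p) (ν : ℝ) (q : Sample n p) : ℝ :=
  energy ρ g β j ν (cutoff c (designMatrix q.1)) (designMatrix q.1) q.2

/-- The truncated normalized score vector at a sample. -/
noncomputable def directionAt (ρ : ℝ → ℝ) (g : EuclideanSpace ℝ (Fin p) → ℝ)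
    (β : EuclideanSpace ℝ (Fin p)) (c : ℝ) (j : Fin p) (ν : ℝ) (q : Sample n p) :
    EuclideanSpace ℝ (Fin n) :=
  direction ρ g β j ν (cutoff c (designMatrix q.1)) (designMatrix q.1) q.2

/-- The truncated pivotal quantity of coordinate `j` at a sample. -/
noncomputable def pivotAt (ρ : ℝ → ℝ) (g : EuclideanSpace ℝ (Fin p) → ℝ)
    (S : Matrix (Fin p) (Fin p) ℝ) (β : EuclideanSpace ℝ (Fin p)) (c : ℝ) (j : Fin p) (ν : ℝ)
    (q : Sample n p) : ℝ :=
  pivot ρ g β j ν (√(precisionDiag S j))⁻¹ (cutoff c (designMatrix q.1))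
    (√(precisionDiag S j) • zvec S (designMatrix q.1) j) (designMatrix q.1) q.2

variable {ρ : ℝ → ℝ} {g : EuclideanSpace ℝ (Fin p) → ℝ} {τ K : ℝ} {L : NNReal}
  (β : EuclideanSpace ℝ (Fin p)) (S : Matrix (Fin p) (Fin p) ℝ) (c : ℝ) (j : Fin p) (ν : ℝ)

lemma continuous_design : Continuous fun q : Sample n p => designMatrix q.1 := by
  have h := (continuous_designMatrix (n := n) (p := p)).comp
    (continuous_fst : Continuous fun q : Sample n p => q.1)
  simp only [Function.comp_def] at h
  exact h

lemma continuous_cutoff_design : Continuous fun q : Sample n p => cutoff c (designMatrix q.1) := by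
  have h := (continuous_cutoff (n := n) (p := p) (c := c)).comp continuous_design
  simp only [Function.comp_def] at h
  exact h

lemma continuous_zvec_design : Continuous fun q : Sample n p => zvec S (designMatrix q.1) j := by
  simp_rw [zvec_eq]
  have h := continuous_mulVecE_comp (continuous_design (n := n) (p := p))
    (continuous_const (y := precisionCol S j))
  exact h.const_smul (precisionDiag S j)⁻¹

namespace Regular

variable (H : Regular n ρ g τ K L)

include H

lemma continuous_score_sample : Continuous fun q : Sample n p => score ρ g β (designMatrix q.1) q.2 :=
  H.continuous_score β continuous_design continuous_snd

lemma measurable_trJacobian_sample : Measurable fun q : Sample n p =>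
    trJacobian ρ g (designMatrix q.1) (response β (designMatrix q.1) q.2) := by
  have h := H.measurable_trJacobian.comp
    (continuous_rows_response β (continuous_fst : Continuous fun q : Sample n p => q.1)
      continuous_snd).measurable
  simp only [Function.comp_def] at h
  exact h

lemma measurable_energyAt : Measurable (energyAt (n := n) ρ g β c j ν) := by
  unfold energyAt energy
  have h1 := (continuous_cutoff_design (n := n) (p := p) c).measurable
  have h2 := (H.continuous_estError_apply β j (continuous_design (n := n)) continuous_snd).measurable
  have h3 := (H.continuous_regNorm β j (continuous_design (n := n)) continuous_snd ν).measurable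
  exact ((h1.pow_const 2).mul (measurable_const.mul (h2.pow_const 2))).div (h3.pow_const 2)

lemma measurable_directionAt : Measurable (directionAt (n := n) ρ g β c j ν) := by
  unfold directionAt direction
  have h1 := (continuous_cutoff_design (n := n) (p := p) c).measurable
  have h2 := (H.continuous_score_sample β).measurable
  have h3 := (H.continuous_regNorm β j (continuous_design (n := n)) continuous_snd ν).measurable
  exact h1.smul (h3.inv.smul h2)

lemma measurable_pivotAt : Measurable (pivotAt (n := n) ρ g S β c j ν) := by
  unfold pivotAt pivot
  have h1 := (continuous_cutoff_design (n := n) (p := p) c).measurable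
  have h2 := (H.continuous_score_sample β).measurable
  have h3 := (H.continuous_regNorm β j (continuous_design (n := n)) continuous_snd ν).measurable
  have h4 := (H.continuous_estError_apply β j (continuous_design (n := n)) continuous_snd).measurable
  have h5 := H.measurable_trJacobian_sample β
  have h6 := (continuous_zvec_design (n := n) S j).measurable
  have h7 : Measurable fun q : Sample n p => √(precisionDiag S j) • zvec S (designMatrix q.1) j :=
    h6.const_smul (√(precisionDiag S j))
  have h8 : Measurable fun q : Sample n p => inner ℝ
      (√(precisionDiag S j) • zvec S (designMatrix q.1) j) (score ρ g β (designMatrix q.1) q.2) :=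
    h7.inner h2
  have h9 := (h4.const_mul (√(precisionDiag S j))⁻¹).mul h5
  have h10 := h1.mul h3.inv
  have h11 := h10.mul (h8.add h9)
  exact h11

variable {S ν c} {κ : ℝ} (hS : CovarianceAssumption S κ) (hκ : 0 < κ) (hc : 0 < c)
  {Q : Measure (EuclideanSpace ℝ (Fin n))} [IsProbabilityMeasure Q] (hQ : Q ≪ volume)

include hS hκ hc hQ

/-- The pivotal quantity is close in mean square to a Gaussian variable whose direction is built
from an independent copy of the column. -/
theorem lintegral_pivotAt_sub_sq_le (hν : 0 < ν) (hν1 : ν ≤ 1) :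
    ∫⁻ t, ENNReal.ofReal ((pivotAt ρ g S β c j ν (replaceColumn S j (t.1, t.2.2))
        - inner ℝ t.2.2 (directionAt ρ g β c j ν (replaceColumn S j (t.1, t.2.1)))) ^ 2)
        ∂(((rowLaw n S).prod Q).prod ((stdGaussian (EuclideanSpace ℝ (Fin n))).prod
          (stdGaussian (EuclideanSpace ℝ (Fin n)))))
      ≤ ENNReal.ofReal ((Real.pi ^ 2 + 10) * sensConst τ L (1 / κ) (1 / κ / c ^ 2))
        * (∫⁻ q, ENNReal.ofReal (energyAt ρ g β c j ν q) ∂((rowLaw n S).prod Q)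
          + ENNReal.ofReal (1 / n)) := by
  have hn := H.n_pos
  have hω := hS.precisionDiag_pos hκ j
  set γ := stdGaussian (EuclideanSpace ℝ (Fin n))
  set M := (rowLaw n S).prod Q
  set σ := (√(precisionDiag S j))⁻¹ with hσdef
  have hσ0 : 0 ≤ σ := by positivity
  have hσ2 : σ ^ 2 ≤ 1 / κ := by
    rw [hσdef, inv_pow, Real.sq_sqrt hω.le, one_div]
    exact (inv_le_inv₀ hω hκ).2 (hS.le_precisionDiag hκ j)
  have hmp := hS.measurePreserving_replaceColumn hκ j Q
  have hae := hmp.quasiMeasurePreserving.ae (H.ae_wellDefined β (rowLaw n S) hQ)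
  -- By Fubini, for almost every base sample the Jacobian exists for almost every column, as the
  -- conditional statement requires.
  have hae2 := Measure.ae_ae_of_ae_prod hae
  have hpm : Measurable fun t : Sample n p × (EuclideanSpace ℝ (Fin n) × EuclideanSpace ℝ (Fin n)) =>
      pivotAt ρ g S β c j ν (replaceColumn S j (t.1, t.2.2)) := by
    have h := (H.measurable_pivotAt β S c j ν).comp ((continuous_replaceColumn (n := n) S j).comp
      (continuous_fst.prodMk (continuous_snd.comp continuous_snd) : Continuous
        fun t : Sample n p × (EuclideanSpace ℝ (Fin n) × EuclideanSpace ℝ (Fin n)) =>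
          (t.1, t.2.2))).measurable
    simp only [Function.comp_def] at h
    exact h
  have hdm : Measurable fun t : Sample n p × (EuclideanSpace ℝ (Fin n) × EuclideanSpace ℝ (Fin n)) =>
      directionAt ρ g β c j ν (replaceColumn S j (t.1, t.2.1)) := by
    have h := (H.measurable_directionAt β c j ν).comp ((continuous_replaceColumn (n := n) S j).comp
      (continuous_fst.prodMk (continuous_fst.comp continuous_snd) : Continuous
        fun t : Sample n p × (EuclideanSpace ℝ (Fin n) × EuclideanSpace ℝ (Fin n)) =>
          (t.1, t.2.1))).measurable
    simp only [Function.comp_def] at h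
    exact h
  have hzm : Measurable fun t : Sample n p × (EuclideanSpace ℝ (Fin n) × EuclideanSpace ℝ (Fin n)) =>
      t.2.2 := measurable_snd.comp measurable_snd
  have hF : Measurable
      fun t : Sample n p × (EuclideanSpace ℝ (Fin n) × EuclideanSpace ℝ (Fin n)) =>
        ENNReal.ofReal ((pivotAt ρ g S β c j ν (replaceColumn S j (t.1, t.2.2))
        - inner ℝ t.2.2 (directionAt ρ g β c j ν (replaceColumn S j (t.1, t.2.1)))) ^ 2) :=
    ((hpm.sub (hzm.inner hdm)).pow_const 2).ennreal_ofReal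
  rw [lintegral_prod _ hF.aemeasurable]
  -- Replacing the column preserves the law of the sample, so averaging the conditional energies
  -- gives back the energy of a plain sample.
  have hen : ∫⁻ q, ENNReal.ofReal (energyAt ρ g β c j ν q) ∂M
      = ∫⁻ q, ∫⁻ z, ENNReal.ofReal (energyAt ρ g β c j ν (replaceColumn S j (q, z))) ∂γ ∂M := by
    rw [← hmp.lintegral_comp (H.measurable_energyAt β c j ν).ennreal_ofReal, lintegral_prod]
    exact ((H.measurable_energyAt β c j ν).ennreal_ofReal.comp
      (continuous_replaceColumn S j).measurable).aemeasurable
  have hadd : ∫⁻ q, ENNReal.ofReal (energyAt ρ g β c j ν q) ∂M + ENNReal.ofReal (1 / n)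
      = ∫⁻ q, (∫⁻ z, ENNReal.ofReal (energyAt ρ g β c j ν (replaceColumn S j (q, z))) ∂γ
        + ENNReal.ofReal (1 / n)) ∂M := by
    rw [lintegral_add_right _ measurable_const, lintegral_const, measure_univ, mul_one, hen]
  rw [hadd, ← lintegral_const_mul' _ _ ENNReal.ofReal_ne_top]
  refine lintegral_mono_ae ?_
  filter_upwards [hae2] with q hq
  have hFq := hF.comp (measurable_prodMk_left (x := q))
  simp only [Function.comp_def] at hFq
  rw [lintegral_prod _ hFq.aemeasurable]
  -- Here σ² ≤ 1/κ, so the constant Cw of the weight may be taken as 1/(κc²).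
  have hκw : ((σ / (c * √n)).toNNReal : ℝ) ^ 2 ≤ 1 / κ / c ^ 2 / n := by
    rw [Real.coe_toNNReal _ (by positivity), div_pow, mul_pow, Real.sq_sqrt hn.le, ← div_div]
    gcongr
  have hVq : ∀ᵐ z ∂γ, DifferentiableAt ℝ (psiHat ρ g (shiftColumn (baseDesign S j q.1) j σ z))
        (response β (shiftColumn (baseDesign S j q.1) j σ z) q.2) := by
    filter_upwards [hq] with z hz
    have := hz.2
    rwa [replaceColumn, designMatrix_resample] at this
  have hM2 := H.lintegral_pivot_sub_sq_le (β := β) (j := j) (X := baseDesign S j q.1) (e := q.2)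
    hν hν1 hσ2 (fun z => cutoff_nonneg (c := c) (shiftColumn (baseDesign S j q.1) j σ z))
    (fun z => cutoff_le_one _) (lipschitzWith_cutoff_shiftColumn hc _ j hσ0) hκw hVq
  have e1 : ∀ z, pivotAt ρ g S β c j ν (replaceColumn S j (q, z))
      = pivot ρ g β j ν σ (cutoff c (shiftColumn (baseDesign S j q.1) j σ z)) z
        (shiftColumn (baseDesign S j q.1) j σ z) q.2 := fun z => by
    rw [pivotAt, replaceColumn]
    simp only
    rw [hS.sqrt_smul_zvec_resample j hκ, designMatrix_resample]
  have e2 : ∀ z, directionAt ρ g β c j ν (replaceColumn S j (q, z))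
      = direction ρ g β j ν (cutoff c (shiftColumn (baseDesign S j q.1) j σ z))
        (shiftColumn (baseDesign S j q.1) j σ z) q.2 := fun z => by
    rw [directionAt, replaceColumn]
    simp only
    rw [designMatrix_resample]
  have e3 : ∀ z, energyAt ρ g β c j ν (replaceColumn S j (q, z))
      = energy ρ g β j ν (cutoff c (shiftColumn (baseDesign S j q.1) j σ z))
        (shiftColumn (baseDesign S j q.1) j σ z) q.2 := fun z => by
    rw [energyAt, replaceColumn]
    simp only
    rw [designMatrix_resample]
  simp_rw [e1, e2, e3]
  exact hM2

end Regular

end SampleStatistics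

/-! ### Second moment of the pivot. -/

section SecondMoment

variable {n p : ℕ} {ρ : ℝ → ℝ} {g : EuclideanSpace ℝ (Fin p) → ℝ} {τ K : ℝ} {L : NNReal}
  (β : EuclideanSpace ℝ (Fin p)) {S : Matrix (Fin p) (Fin p) ℝ} {c : ℝ} (j : Fin p) {ν : ℝ}

/-- A sample together with two independent standard Gaussian vectors. -/
noncomputable abbrev jointLaw (S : Matrix (Fin p) (Fin p) ℝ)
    (Q : Measure (EuclideanSpace ℝ (Fin n))) :
    Measure (Sample n p × (EuclideanSpace ℝ (Fin n) × EuclideanSpace ℝ (Fin n))) :=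
  ((rowLaw n S).prod Q).prod ((stdGaussian (EuclideanSpace ℝ (Fin n))).prod
    (stdGaussian (EuclideanSpace ℝ (Fin n))))

section JointLaw

variable {Q : Measure (EuclideanSpace ℝ (Fin n))} [IsProbabilityMeasure Q] {κ : ℝ}
  (hS : CovarianceAssumption S κ) (hκ : 0 < κ)

include hS hκ

lemma measurePreserving_replaceColumn_snd :
    MeasurePreserving (fun t : Sample n p × (EuclideanSpace ℝ (Fin n) × EuclideanSpace ℝ (Fin n)) =>
      replaceColumn S j (t.1, t.2.2)) (jointLaw S Q) ((rowLaw n S).prod Q) :=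
  (hS.measurePreserving_replaceColumn hκ j Q).comp
    ((MeasurePreserving.id ((rowLaw n S).prod Q)).prod measurePreserving_snd)

lemma measurePreserving_replaceColumn_fst :
    MeasurePreserving (fun t : Sample n p × (EuclideanSpace ℝ (Fin n) × EuclideanSpace ℝ (Fin n)) =>
      replaceColumn S j (t.1, t.2.1)) (jointLaw S Q) ((rowLaw n S).prod Q) :=
  (hS.measurePreserving_replaceColumn hκ j Q).comp
    ((MeasurePreserving.id ((rowLaw n S).prod Q)).prod measurePreserving_fst)

end JointLaw

lemma norm_directionAt_le (hν : 0 < ν) (q : Sample n p) : ‖directionAt ρ g β c j ν q‖ ≤ 1 := by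
  rw [directionAt, direction, norm_smul, Real.norm_of_nonneg (cutoff_nonneg _)]
  exact mul_le_one₀ (cutoff_le_one _) (norm_nonneg _)
    (Regular.norm_normalized_score_le hν _ _)

namespace Regular

variable (H : Regular n ρ g τ K L)

include H

lemma measurable_directionAt_replaceColumn : Measurable
    fun t : Sample n p × (EuclideanSpace ℝ (Fin n) × EuclideanSpace ℝ (Fin n)) =>
      directionAt ρ g β c j ν (replaceColumn S j (t.1, t.2.1)) := by
  have h := (H.measurable_directionAt β c j ν).comp ((continuous_replaceColumn (n := n) S j).comp
      (continuous_fst.prodMk (continuous_fst.comp continuous_snd) : Continuous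
        fun t : Sample n p × (EuclideanSpace ℝ (Fin n) × EuclideanSpace ℝ (Fin n)) =>
          (t.1, t.2.1))).measurable
  simp only [Function.comp_def] at h
  exact h

lemma measurable_inner_directionAt : Measurable
    fun t : Sample n p × (EuclideanSpace ℝ (Fin n) × EuclideanSpace ℝ (Fin n)) =>
      inner ℝ t.2.2 (directionAt ρ g β c j ν (replaceColumn S j (t.1, t.2.1))) := by
  have hzm : Measurable fun t : Sample n p × (EuclideanSpace ℝ (Fin n) × EuclideanSpace ℝ (Fin n)) =>
      t.2.2 := measurable_snd.comp measurable_snd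
  exact hzm.inner (H.measurable_directionAt_replaceColumn β j)

variable {κ : ℝ} (hS : CovarianceAssumption S κ) (hκ : 0 < κ) (hc : 0 < c)
  {Q : Measure (EuclideanSpace ℝ (Fin n))} [IsProbabilityMeasure Q]

/-- Given the direction, which has norm at most 1 and is independent of the last Gaussian vector,
the conditional second moment is its squared norm. -/
lemma lintegral_inner_directionAt_sq_le (hν : 0 < ν) :
    ∫⁻ t, ENNReal.ofReal (inner ℝ t.2.2 (directionAt ρ g β c j ν
      (replaceColumn S j (t.1, t.2.1))) ^ 2) ∂(jointLaw S Q) ≤ 1 := by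
  have hF : Measurable
      fun t : Sample n p × (EuclideanSpace ℝ (Fin n) × EuclideanSpace ℝ (Fin n)) =>
      ENNReal.ofReal (inner ℝ t.2.2 (directionAt ρ g β c j ν
      (replaceColumn S j (t.1, t.2.1))) ^ 2) :=
    ((H.measurable_inner_directionAt β j).pow_const 2).ennreal_ofReal
  rw [lintegral_prod _ hF.aemeasurable]
  have h1 : ∫⁻ _ : Sample n p, 1 ∂((rowLaw n S).prod Q) = 1 := by simp
  rw [← h1]
  refine lintegral_mono fun q => ?_
  have hFq := hF.comp (measurable_prodMk_left (x := q))
  simp only [Function.comp_def] at hFq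
  rw [lintegral_prod _ hFq.aemeasurable]
  have h2 : ∫⁻ _, 1 ∂(stdGaussian (EuclideanSpace ℝ (Fin n))) = 1 := by simp
  rw [← h2]
  refine lintegral_mono fun z' => ?_
  simp only
  simp_rw [real_inner_comm (directionAt ρ g β c j ν (replaceColumn S j (q, z')))]
  rw [lintegral_inner_sq_stdGaussian, ← ENNReal.ofReal_one]
  exact ENNReal.ofReal_le_ofReal (pow_le_one₀ (norm_nonneg _) (norm_directionAt_le β j hν _))

include hS hκ hc

/-- The pivot is its Gaussian approximation, of second moment at most 1, plus an error controlled by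
the energy of the same coordinate. This is one half of the loop between pivots and energies. -/
theorem lintegral_pivotAt_sq_le (hQ : Q ≪ volume) (hν : 0 < ν) (hν1 : ν ≤ 1) :
    ∫⁻ q, ENNReal.ofReal (pivotAt ρ g S β c j ν q ^ 2) ∂((rowLaw n S).prod Q)
      ≤ ENNReal.ofReal 2 * (ENNReal.ofReal ((Real.pi ^ 2 + 10) * sensConst τ L (1 / κ) (1 / κ / c ^ 2))
        * (∫⁻ q, ENNReal.ofReal (energyAt ρ g β c j ν q) ∂((rowLaw n S).prod Q)
          + ENNReal.ofReal (1 / n))) + ENNReal.ofReal 2 := by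
  have hmp := measurePreserving_replaceColumn_snd (n := n) (Q := Q) j hS hκ
  have hm := ((H.measurable_pivotAt β S c j ν).pow_const 2).ennreal_ofReal
  rw [← hmp.lintegral_comp hm]
  refine (lintegral_mono (g := fun t => ENNReal.ofReal 2 *
    ENNReal.ofReal ((pivotAt ρ g S β c j ν (replaceColumn S j (t.1, t.2.2))
        - inner ℝ t.2.2 (directionAt ρ g β c j ν (replaceColumn S j (t.1, t.2.1)))) ^ 2)
    + ENNReal.ofReal 2 * ENNReal.ofReal (inner ℝ t.2.2 (directionAt ρ g β c j ν
      (replaceColumn S j (t.1, t.2.1))) ^ 2)) fun t => ?_).trans ?_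
  · beta_reduce
    rw [← ENNReal.ofReal_mul (by norm_num), ← ENNReal.ofReal_mul (by norm_num),
      ← ENNReal.ofReal_add (by positivity) (by positivity)]
    refine ENNReal.ofReal_le_ofReal ?_
    have h := add_sq_le (a := pivotAt ρ g S β c j ν (replaceColumn S j (t.1, t.2.2))
        - inner ℝ t.2.2 (directionAt ρ g β c j ν (replaceColumn S j (t.1, t.2.1))))
      (b := inner ℝ t.2.2 (directionAt ρ g β c j ν (replaceColumn S j (t.1, t.2.1))))
    rw [sub_add_cancel] at h
    linarith
  · rw [lintegral_add_right _
      (((H.measurable_inner_directionAt β j).pow_const 2).ennreal_ofReal.const_mul _),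
      lintegral_const_mul' _ _ ENNReal.ofReal_ne_top, lintegral_const_mul' _ _ ENNReal.ofReal_ne_top]
    refine add_le_add (mul_le_mul_right (H.lintegral_pivotAt_sub_sq_le β j hS hκ hc hQ hν hν1) _) ?_
    refine (mul_le_mul_right (H.lintegral_inner_directionAt_sq_le β j hν) _).trans ?_
    rw [mul_one]

end Regular

end SecondMoment

/-! ### Energies in terms of pivots. -/

section Loop

variable {n p : ℕ} {ρ : ℝ → ℝ} {g : EuclideanSpace ℝ (Fin p) → ℝ} {τ K : ℝ} {L : NNReal}
  (β : EuclideanSpace ℝ (Fin p)) {S : Matrix (Fin p) (Fin p) ℝ} {c : ℝ} (j : Fin p) {ν : ℝ}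

/-- The constant relating the energy of a coordinate to its pivotal quantity. -/
noncomputable def loopConst (K τ κ c : ℝ) : ℝ :=
  2 / (κ * ((8 / K ^ 2 + 2 * (4 * c ^ 2) / τ)⁻¹ / 2) ^ 2)

/-- The denominator is then at least nK²/4, which cancels the factor n of the energy. -/
lemma energy_le_of_score_large (hn : (0 : ℝ) < n) (hK : 0 < K) (hν : 0 < ν) {a : ℝ} (ha0 : 0 ≤ a)
    (ha1 : a ≤ 1) {X : Matrix (Fin n) (Fin p) ℝ} {e : EuclideanSpace ℝ (Fin n)}
    (hψ : n * K ^ 2 / 4 ≤ ‖score ρ g β X e‖ ^ 2) :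
    energy ρ g β j ν a X e ≤ 4 / K ^ 2 * estError ρ g β X e j ^ 2 := by
  have hD : ‖score ρ g β X e‖ ^ 2 ≤ regNorm ρ g β j ν X e ^ 2 := by
    rw [Regular.regNorm_sq (ρ := ρ) (g := g) β j hν X e]
    have : 0 ≤ ν * (1 + estError ρ g β X e j ^ 2) := by positivity
    linarith
  have hpos : 0 < n * K ^ 2 / 4 := by positivity
  rw [energy, div_le_iff₀ (by linarith)]
  have h1 : a ^ 2 ≤ 1 := pow_le_one₀ ha0 ha1
  calc a ^ 2 * (n * estError ρ g β X e j ^ 2) ≤ 1 * (n * estError ρ g β X e j ^ 2) := by gcongr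
    _ = 4 / K ^ 2 * estError ρ g β X e j ^ 2 * (n * K ^ 2 / 4) := by field_simp
    _ ≤ _ := by gcongr; linarith

namespace Regular

variable (H : Regular n ρ g τ K L) {κ : ℝ} (hS : CovarianceAssumption S κ) (hκ : 0 < κ)
  (hc : 0 < c)

include H hS hκ hc

/-- The trace is then at least t₀ n, so the square of the bias term σ h_j tr V in the pivot is at
least κ t₀² n times the energy after normalization. That term is the pivot minus the normalized ⟨z,
ψ⟩, and the latter can be summed over j by the operator norm bound. -/
lemma energyAt_le_of_score_small (hν : 0 < ν) {q : Sample n p}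
    (hψ0 : score ρ g β (designMatrix q.1) q.2 ≠ 0)
    (hd : DifferentiableAt ℝ (psiHat ρ g (designMatrix q.1)) (response β (designMatrix q.1) q.2))
    (hψ : ‖score ρ g β (designMatrix q.1) q.2‖ ^ 2 ≤ n * K ^ 2 / 4)
    (hcut : cutoff c (designMatrix q.1) ≠ 0) :
    energyAt ρ g β c j ν q ≤ loopConst K τ κ c / n * (pivotAt ρ g S β c j ν q ^ 2
      + inner ℝ (√(precisionDiag S j) • zvec S (designMatrix q.1) j)
        (score ρ g β (designMatrix q.1) q.2) ^ 2 / ‖score ρ g β (designMatrix q.1) q.2‖ ^ 2) := by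
  have hn := H.n_pos
  have hτ := H.τ_pos
  have hK := H.K_pos
  have hω := hS.precisionDiag_pos hκ j
  have htr := H.le_trJacobian hd (by positivity : 0 ≤ 4 * c ^ 2)
    (norm_mulVecE_sq_le_of_cutoff_ne_zero hc hn hcut) hψ
  have hD := regNorm_pos (ρ := ρ) (g := g) β j hν (designMatrix q.1) q.2
  have hDψ := norm_score_le_regNorm (ρ := ρ) (g := g) β j hν (designMatrix q.1) q.2
  have hψpos : 0 < ‖score ρ g β (designMatrix q.1) q.2‖ := norm_pos_iff.2 hψ0
  have ha1 : cutoff c (designMatrix q.1) ^ 2 ≤ 1 := pow_le_one₀ (cutoff_nonneg _) (cutoff_le_one _)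
  rw [energyAt, energy, pivotAt, pivot, loopConst]
  set z := √(precisionDiag S j) • zvec S (designMatrix q.1) j
  set ψ := score ρ g β (designMatrix q.1) q.2
  set D := regNorm ρ g β j ν (designMatrix q.1) q.2
  set h₀ := estError ρ g β (designMatrix q.1) q.2 j
  set trV := trJacobian ρ g (designMatrix q.1) (response β (designMatrix q.1) q.2)
  set a := cutoff c (designMatrix q.1)
  set t₀ := (8 / K ^ 2 + 2 * (4 * c ^ 2) / τ)⁻¹ / 2 with ht₀
  have ht₀pos : 0 < t₀ := by positivity
  have htr' : t₀ * n ≤ trV := by rw [ht₀]; linarith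
  set σ := (√(precisionDiag S j))⁻¹ with hσ
  have hσ2 : κ ≤ σ ^ 2 := by
    rw [hσ, inv_pow, Real.sq_sqrt hω.le]
    rw [← one_div, le_div_iff₀ hω]
    have h2 := hS.precisionDiag_le hκ j
    rw [le_div_iff₀ hκ] at h2
    linarith
  set P := a * D⁻¹ * (inner ℝ z ψ + σ * h₀ * trV) with hP
  have h1 : (a * D⁻¹ * (σ * h₀ * trV)) ^ 2 ≤ 2 * (P ^ 2 + (a * D⁻¹ * inner ℝ z ψ) ^ 2) := by
    have e : a * D⁻¹ * (σ * h₀ * trV) = P + -(a * D⁻¹ * inner ℝ z ψ) := by rw [hP]; ring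
    rw [e]
    have := add_sq_le (a := P) (b := -(a * D⁻¹ * inner ℝ z ψ))
    rwa [neg_sq] at this
  have h2 : (a * D⁻¹ * inner ℝ z ψ) ^ 2 ≤ inner ℝ z ψ ^ 2 / ‖ψ‖ ^ 2 := by
    have h3 : D⁻¹ ^ 2 ≤ (‖ψ‖ ^ 2)⁻¹ := by
      rw [inv_pow]
      exact inv_anti₀ (by positivity) (pow_le_pow_left₀ hψpos.le hDψ 2)
    calc (a * D⁻¹ * inner ℝ z ψ) ^ 2 = a ^ 2 * (D⁻¹ ^ 2 * inner ℝ z ψ ^ 2) := by ring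
      _ ≤ 1 * ((‖ψ‖ ^ 2)⁻¹ * inner ℝ z ψ ^ 2) := by gcongr
      _ = _ := by rw [one_mul, div_eq_inv_mul]
  have h4 : κ * t₀ ^ 2 * n * (a ^ 2 * (n * h₀ ^ 2) / D ^ 2) ≤ (a * D⁻¹ * (σ * h₀ * trV)) ^ 2 := by
    have h5 : (t₀ * n) ^ 2 ≤ trV ^ 2 := pow_le_pow_left₀ (by positivity) htr' 2
    calc κ * t₀ ^ 2 * n * (a ^ 2 * (n * h₀ ^ 2) / D ^ 2)
        = a ^ 2 * D⁻¹ ^ 2 * h₀ ^ 2 * (κ * (t₀ * n) ^ 2) := by field_simp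
      _ ≤ a ^ 2 * D⁻¹ ^ 2 * h₀ ^ 2 * (σ ^ 2 * trV ^ 2) := by gcongr
      _ = _ := by ring
  have h6 : a ^ 2 * (n * h₀ ^ 2) / D ^ 2 * (κ * t₀ ^ 2 * n)
      ≤ 2 * (P ^ 2 + inner ℝ z ψ ^ 2 / ‖ψ‖ ^ 2) := by linarith
  rw [← le_div_iff₀ (by positivity)] at h6
  refine h6.trans (le_of_eq ?_)
  field_simp

/-- The total energy is controlled by the estimation error and by the pivotal quantities. -/
lemma sum_energyAt_le (hν : 0 < ν) {q : Sample n p}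
    (hψ0 : score ρ g β (designMatrix q.1) q.2 ≠ 0)
    (hd : DifferentiableAt ℝ (psiHat ρ g (designMatrix q.1))
      (response β (designMatrix q.1) q.2)) :
    ∑ j, energyAt ρ g β c j ν q ≤ 4 / K ^ 2 * ‖estError ρ g β (designMatrix q.1) q.2‖ ^ 2
      + loopConst K τ κ c / n * ∑ j, pivotAt ρ g S β c j ν q ^ 2
      + loopConst K τ κ c * ((1 / κ) ^ 3 * (4 * c ^ 2)) := by
  have hn := H.n_pos
  have hK := H.K_pos
  have hC : 0 ≤ loopConst K τ κ c := by unfold loopConst; positivity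
  have hpiv : 0 ≤ ∑ j, pivotAt ρ g S β c j ν q ^ 2 := Finset.sum_nonneg fun j _ => sq_nonneg _
  -- The energy vanishes with the cutoff; otherwise the operator norm is at most 2c√n, as needed
  -- when the score is small.
  by_cases hcut : cutoff c (designMatrix q.1) = 0
  · have h0 : ∑ j, energyAt ρ g β c j ν q = 0 := Finset.sum_eq_zero fun j _ => by
      simp [energyAt, energy, hcut]
    rw [h0]
    positivity
  rcases le_total (n * K ^ 2 / 4) (‖score ρ g β (designMatrix q.1) q.2‖ ^ 2) with hψ | hψ
  · have h1 := Finset.sum_le_sum fun j (_ : j ∈ Finset.univ) =>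
      energy_le_of_score_large (ρ := ρ) (g := g) (ν := ν) β j hn hK hν
        (cutoff_nonneg (c := c) (designMatrix q.1)) (cutoff_le_one _) hψ
    rw [← Finset.mul_sum, ← EuclideanSpace.real_norm_sq_eq] at h1
    have h2 : 0 ≤ loopConst K τ κ c / n * ∑ j, pivotAt ρ g S β c j ν q ^ 2 := by positivity
    have h3 : 0 ≤ loopConst K τ κ c * ((1 / κ) ^ 3 * (4 * c ^ 2)) := by positivity
    change ∑ j, energyAt ρ g β c j ν q ≤ _ at h1
    linarith
  · have hψpos : 0 < ‖score ρ g β (designMatrix q.1) q.2‖ := norm_pos_iff.2 hψ0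
    have h1 := Finset.sum_le_sum fun j (_ : j ∈ Finset.univ) =>
      H.energyAt_le_of_score_small β j hS hκ hc hν hψ0 hd hψ hcut
    have h2 := hS.sum_inner_zvec_sq_le hκ (designMatrix q.1) (by positivity : 0 ≤ 4 * c ^ 2 * n)
      (norm_mulVecE_sq_le_of_cutoff_ne_zero hc hn hcut) (score ρ g β (designMatrix q.1) q.2)
    rw [← Finset.mul_sum, Finset.sum_add_distrib, ← Finset.sum_div] at h1
    rw [← div_le_iff₀ (by positivity)] at h2
    have h3 := mul_le_mul_of_nonneg_left h2 (by positivity : 0 ≤ loopConst K τ κ c / n)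
    have h4 : loopConst K τ κ c / n * ((1 / κ) ^ 3 * (4 * c ^ 2 * n))
        = loopConst K τ κ c * ((1 / κ) ^ 3 * (4 * c ^ 2)) := by field_simp
    rw [h4] at h3
    have h5 : 0 ≤ 4 / K ^ 2 * ‖estError ρ g β (designMatrix q.1) q.2‖ ^ 2 := by positivity
    linarith

end Regular

end Loop

/-! ### Bound on the total energy. -/

section EnergyBound

variable {n p : ℕ} {ρ : ℝ → ℝ} {g : EuclideanSpace ℝ (Fin p) → ℝ} {τ K : ℝ} {L : NNReal}
  (β : EuclideanSpace ℝ (Fin p)) {S : Matrix (Fin p) (Fin p) ℝ} {c : ℝ} (j : Fin p) {ν : ℝ}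

/-- The constant in the Gaussian approximation of the pivotal quantities. -/
noncomputable def approxConst (τ : ℝ) (L : NNReal) (κ c : ℝ) : ℝ :=
  (Real.pi ^ 2 + 10) * sensConst τ L (1 / κ) (1 / κ / c ^ 2)

/-- The bound on the total energy of all coordinates. -/
noncomputable def energyConst (R τ K : ℝ) (L : NNReal) (κ γ c : ℝ) : ℝ :=
  2 * (4 / K ^ 2 * (R / κ) + loopConst K τ κ c * (γ * (2 + 2 * approxConst τ L κ c))
    + loopConst K τ κ c * ((1 / κ) ^ 3 * (4 * c ^ 2)))

lemma approxConst_nonneg {κ : ℝ} (hτ : 0 < τ) (hκ : 0 < κ) (hc : 0 < c) :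
    0 ≤ approxConst τ L κ c := by
  have : 0 ≤ pertConst τ L := Regular.pertConst_nonneg
  unfold approxConst sensConst
  positivity

lemma energyAt_nonneg (q : Sample n p) : 0 ≤ energyAt ρ g β c j ν q := energy_nonneg _ _ _

/-- A crude bound from the summand ν h_j² of the regularized norm. It makes the expected energies
finite, without which they could not be absorbed. -/
lemma energyAt_le_div (hν : 0 < ν) (q : Sample n p) : energyAt ρ g β c j ν q ≤ n / ν := by
  have hD := Regular.regNorm_pos (ρ := ρ) (g := g) β j hν (designMatrix q.1) q.2
  have h1 := Regular.estError_le_regNorm (ρ := ρ) (g := g) β j hν (designMatrix q.1) q.2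
  have ha : cutoff c (designMatrix q.1) ^ 2 ≤ 1 := pow_le_one₀ (cutoff_nonneg _) (cutoff_le_one _)
  rw [energyAt, energy]
  set D := regNorm ρ g β j ν (designMatrix q.1) q.2
  set h₀ := estError ρ g β (designMatrix q.1) q.2 j
  have h2 := pow_le_pow_left₀ (by positivity) h1 2
  rw [mul_pow, Real.sq_sqrt hν.le, sq_abs] at h2
  rw [div_le_div_iff₀ (by positivity) hν]
  calc cutoff c (designMatrix q.1) ^ 2 * (n * h₀ ^ 2) * ν ≤ 1 * (n * h₀ ^ 2) * ν := by gcongr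
    _ = n * (ν * h₀ ^ 2) := by ring
    _ ≤ n * D ^ 2 := by gcongr

namespace Regular

variable (H : Regular n ρ g τ K L) {κ γ R : ℝ} (hS : CovarianceAssumption S κ) (hκ : 0 < κ)
  (hc : 0 < c) {Q : Measure (EuclideanSpace ℝ (Fin n))} [IsProbabilityMeasure Q]

include H hS hκ hc

/-- Closing the loop: the total energy is bounded through the pivots with weight of order 1/n
(`sum_energyAt_le`), and the second moment of each pivot through its own energy
(`lintegral_pivotAt_sq_le`). For large n the energies come back with coefficient at most 1/2 and are
absorbed, while p/n ≤ γ controls the sum of the p remaining constants. The bound does not depend on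
ν. -/
theorem sum_lintegral_energyAt_le_of_pos (hQ : Q ≪ volume) (hν : 0 < ν) (hν1 : ν ≤ 1)
    (hR0 : 0 ≤ R) (hγ : 0 ≤ γ) (hp : (p : ℝ) / n ≤ γ)
    (hR : ∫⁻ q, ENNReal.ofReal (‖estError ρ g β (designMatrix q.1) q.2‖ ^ 2)
      ∂((rowLaw n S).prod Q) ≤ ENNReal.ofReal (R / κ))
    (hn4 : 4 * (approxConst τ L κ c * loopConst K τ κ c) ≤ n) :
    ∑ j, ∫⁻ q, ENNReal.ofReal (energyAt ρ g β c j ν q) ∂((rowLaw n S).prod Q)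
      ≤ ENNReal.ofReal (energyConst R τ K L κ γ c) := by
  have hn := H.n_pos
  have hn1 := H.one_le_n
  have hK := H.K_pos
  have hτ := H.τ_pos
  set M := (rowLaw n S).prod Q with hM
  have hC1 : 0 ≤ approxConst τ L κ c := approxConst_nonneg hτ hκ hc
  set C₁ := approxConst τ L κ c with hC₁
  have hC2 : 0 ≤ loopConst K τ κ c := by unfold loopConst; positivity
  set C₂ := loopConst K τ κ c with hC₂
  set C₃ := C₂ * ((1 / κ) ^ 3 * (4 * c ^ 2)) with hC₃
  have hC3 : 0 ≤ C₃ := by positivity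
  have hfin : ∀ j, ∫⁻ q, ENNReal.ofReal (energyAt ρ g β c j ν q) ∂M ≠ ⊤ := fun j => by
    refine ((lintegral_mono fun q => ENNReal.ofReal_le_ofReal
      (energyAt_le_div (ρ := ρ) (g := g) (c := c) β j hν q)).trans_lt ?_).ne
    rw [lintegral_const, measure_univ, mul_one]
    exact ENNReal.ofReal_lt_top
  set α : Fin p → ℝ := fun j => (∫⁻ q, ENNReal.ofReal (energyAt ρ g β c j ν q) ∂M).toReal with hα
  have hα0 : ∀ j, 0 ≤ α j := fun j => ENNReal.toReal_nonneg
  have hαe : ∀ j, ∫⁻ q, ENNReal.ofReal (energyAt ρ g β c j ν q) ∂M = ENNReal.ofReal (α j) :=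
    fun j => (ENNReal.ofReal_toReal (hfin j)).symm
  have hpiv : ∀ j, ∫⁻ q, ENNReal.ofReal (pivotAt ρ g S β c j ν q ^ 2) ∂M
      ≤ ENNReal.ofReal (2 * (C₁ * (α j + 1 / n)) + 2) := fun j => by
    have h := H.lintegral_pivotAt_sq_le β j hS hκ hc hQ hν hν1
    rw [← hM, hαe, ← ENNReal.ofReal_add (hα0 j) (by positivity)] at h
    change _ ≤ ENNReal.ofReal 2 * (ENNReal.ofReal C₁ * _) + _ at h
    have h0 : 0 ≤ α j + 1 / n := add_nonneg (hα0 j) (by positivity)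
    rwa [← ENNReal.ofReal_mul hC1, ← ENNReal.ofReal_mul (by norm_num),
      ← ENNReal.ofReal_add (by positivity) (by norm_num)] at h
  have hsum : ∑ j, ∫⁻ q, ENNReal.ofReal (energyAt ρ g β c j ν q) ∂M
      ≤ ENNReal.ofReal (4 / K ^ 2) * ENNReal.ofReal (R / κ)
        + ENNReal.ofReal (C₂ / n) * ∑ j, ENNReal.ofReal (2 * (C₁ * (α j + 1 / n)) + 2)
        + ENNReal.ofReal C₃ := by
    rw [← lintegral_finsetSum _ fun j _ => (H.measurable_energyAt β c j ν).ennreal_ofReal]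
    have hE := ((H.continuous_estError β (continuous_design (n := n)) continuous_snd).norm.pow
      2).measurable.ennreal_ofReal
    have hP : Measurable fun q : Sample n p =>
        ∑ j, ENNReal.ofReal (pivotAt ρ g S β c j ν q ^ 2) :=
      Finset.measurable_sum _ fun j _ => ((H.measurable_pivotAt β S c j ν).pow_const 2).ennreal_ofReal
    calc ∫⁻ q, ∑ j, ENNReal.ofReal (energyAt ρ g β c j ν q) ∂M
        ≤ ∫⁻ q, (ENNReal.ofReal (4 / K ^ 2)
            * ENNReal.ofReal (‖estError ρ g β (designMatrix q.1) q.2‖ ^ 2)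
          + ENNReal.ofReal (C₂ / n) * ∑ j, ENNReal.ofReal (pivotAt ρ g S β c j ν q ^ 2)
          + ENNReal.ofReal C₃) ∂M := by
          refine lintegral_mono_ae ?_
          filter_upwards [H.ae_wellDefined β (rowLaw n S) hQ] with q hq
          have hpn : 0 ≤ ∑ j, pivotAt ρ g S β c j ν q ^ 2 := Finset.sum_nonneg fun j _ => sq_nonneg _
          rw [← ENNReal.ofReal_sum_of_nonneg fun j _ => energyAt_nonneg β j q,
            ← ENNReal.ofReal_sum_of_nonneg fun j _ => sq_nonneg _,
            ← ENNReal.ofReal_mul (by positivity), ← ENNReal.ofReal_mul (by positivity),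
            ← ENNReal.ofReal_add (by positivity) (by positivity),
            ← ENNReal.ofReal_add (by positivity) hC3]
          exact ENNReal.ofReal_le_ofReal (H.sum_energyAt_le β hS hκ hc hν hq.1 hq.2)
      _ = ENNReal.ofReal (4 / K ^ 2)
            * ∫⁻ q, ENNReal.ofReal (‖estError ρ g β (designMatrix q.1) q.2‖ ^ 2) ∂M
          + ENNReal.ofReal (C₂ / n) * ∑ j, ∫⁻ q, ENNReal.ofReal (pivotAt ρ g S β c j ν q ^ 2) ∂M
          + ENNReal.ofReal C₃ := by
          rw [lintegral_add_right _ measurable_const, lintegral_const, measure_univ, mul_one,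
            lintegral_add_right _ (hP.const_mul _), lintegral_const_mul' _ _ ENNReal.ofReal_ne_top,
            lintegral_const_mul' _ _ ENNReal.ofReal_ne_top,
            lintegral_finsetSum _ fun j _ =>
              ((H.measurable_pivotAt β S c j ν).pow_const 2).ennreal_ofReal]
      _ ≤ _ := by
          gcongr with j
          exact hpiv j
  simp_rw [hαe] at hsum ⊢
  have hterm : ∀ j, 0 ≤ 2 * (C₁ * (α j + 1 / n)) + 2 := fun j => by
    have := hα0 j
    positivity
  have hsn : 0 ≤ ∑ j, (2 * (C₁ * (α j + 1 / n)) + 2) := Finset.sum_nonneg fun j _ => hterm j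
  rw [← ENNReal.ofReal_sum_of_nonneg fun j _ => hα0 j] at hsum ⊢
  have t1 : 0 ≤ 4 / K ^ 2 * (R / κ) := by positivity
  have t2 : 0 ≤ C₂ / n * ∑ j, (2 * (C₁ * (α j + 1 / n)) + 2) := mul_nonneg (by positivity) hsn
  rw [← ENNReal.ofReal_sum_of_nonneg fun j _ => hterm j, ← ENNReal.ofReal_mul (by positivity),
    ← ENNReal.ofReal_mul (by positivity), ← ENNReal.ofReal_add t1 t2,
    ← ENNReal.ofReal_add (add_nonneg t1 t2) hC3,
    ENNReal.ofReal_le_ofReal_iff (add_nonneg (add_nonneg t1 t2) hC3)] at hsum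
  refine ENNReal.ofReal_le_ofReal ?_
  have e1 : ∑ j, (2 * (C₁ * (α j + 1 / n)) + 2) = 2 * C₁ * ∑ j, α j + p * (2 * C₁ / n + 2) := by
    rw [Finset.sum_add_distrib, ← Finset.mul_sum, ← Finset.mul_sum, Finset.sum_add_distrib]
    simp only [Finset.sum_const, Finset.card_univ, Fintype.card_fin, nsmul_eq_mul]
    ring
  rw [e1] at hsum
  have hα : 0 ≤ ∑ j, α j := Finset.sum_nonneg fun j _ => hα0 j
  have e2 : C₂ / n * (2 * C₁ * ∑ j, α j + p * (2 * C₁ / n + 2))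
      ≤ 1 / 2 * ∑ j, α j + C₂ * (γ * (2 + 2 * C₁)) := by
    -- This is where the lower bound on n enters.
    have f1 : C₂ / n * (2 * C₁) ≤ 1 / 2 := by
      rw [div_mul_eq_mul_div, div_le_iff₀ hn]
      linarith
    have f2 : 2 * C₁ / n ≤ 2 * C₁ := div_le_self (by positivity) hn1
    calc C₂ / n * (2 * C₁ * ∑ j, α j + p * (2 * C₁ / n + 2))
        = C₂ / n * (2 * C₁) * ∑ j, α j + C₂ * (p / n * (2 + 2 * C₁ / n)) := by ring
      _ ≤ 1 / 2 * ∑ j, α j + C₂ * (γ * (2 + 2 * C₁)) := by gcongr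
  rw [energyConst]
  linarith

end Regular

end EnergyBound

/-! ### Removal of the regularization. -/

section Limit

variable {n p : ℕ} {ρ : ℝ → ℝ} {g : EuclideanSpace ℝ (Fin p) → ℝ} {τ K : ℝ} {L : NNReal}
  (β : EuclideanSpace ℝ (Fin p)) {S : Matrix (Fin p) (Fin p) ℝ} {c : ℝ} (j : Fin p)

lemma regNorm_zero (X : Matrix (Fin n) (Fin p) ℝ) (e : EuclideanSpace ℝ (Fin n)) :
    regNorm ρ g β j 0 X e = ‖score ρ g β X e‖ := by
  rw [regNorm, zero_mul, add_zero, Real.sqrt_sq (norm_nonneg _)]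

lemma tendsto_regNorm (X : Matrix (Fin n) (Fin p) ℝ) (e : EuclideanSpace ℝ (Fin n)) :
    Tendsto (fun m : ℕ => regNorm ρ g β j (1 / ((m : ℝ) + 1)) X e) atTop
      (𝓝 (regNorm ρ g β j 0 X e)) := by
  have h : Continuous fun ν : ℝ => regNorm ρ g β j ν X e := by
    unfold regNorm
    fun_prop
  exact (h.tendsto 0).comp tendsto_one_div_add_atTop_nhds_zero_nat

variable {q : Sample n p} (hψ : score ρ g β (designMatrix q.1) q.2 ≠ 0)

include hψ

lemma tendsto_energyAt : Tendsto (fun m : ℕ => energyAt ρ g β c j (1 / ((m : ℝ) + 1)) q) atTop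
    (𝓝 (energyAt ρ g β c j 0 q)) := by
  unfold energyAt energy
  refine tendsto_const_nhds.div ((tendsto_regNorm β j _ _).pow 2) ?_
  rw [regNorm_zero]
  exact pow_ne_zero 2 (norm_ne_zero_iff.2 hψ)

lemma tendsto_directionAt : Tendsto (fun m : ℕ => directionAt ρ g β c j (1 / ((m : ℝ) + 1)) q)
    atTop (𝓝 (directionAt ρ g β c j 0 q)) := by
  unfold directionAt direction
  refine (((tendsto_regNorm β j _ _).inv₀ ?_).smul_const _).const_smul _
  rw [regNorm_zero]
  exact norm_ne_zero_iff.2 hψ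

lemma tendsto_pivotAt : Tendsto (fun m : ℕ => pivotAt ρ g S β c j (1 / ((m : ℝ) + 1)) q) atTop
    (𝓝 (pivotAt ρ g S β c j 0 q)) := by
  unfold pivotAt pivot
  refine (((tendsto_regNorm β j _ _).inv₀ ?_).const_mul _).mul_const _
  rw [regNorm_zero]
  exact norm_ne_zero_iff.2 hψ

lemma energyAt_le_energyAt_zero {ν : ℝ} (hν : 0 < ν) :
    energyAt ρ g β c j ν q ≤ energyAt ρ g β c j 0 q := by
  rw [energyAt, energy, energyAt, energy, regNorm_zero]
  have h := Regular.norm_score_le_regNorm (ρ := ρ) (g := g) β j hν (designMatrix q.1) q.2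
  have hpos := norm_pos_iff.2 hψ
  gcongr

end Limit

section LimitIntegral

variable {n p : ℕ} {ρ : ℝ → ℝ} {g : EuclideanSpace ℝ (Fin p) → ℝ} {τ K : ℝ} {L : NNReal}
  (β : EuclideanSpace ℝ (Fin p)) {S : Matrix (Fin p) (Fin p) ℝ} {c : ℝ} (j : Fin p)

namespace Regular

variable (H : Regular n ρ g τ K L) {κ γ R : ℝ} (hS : CovarianceAssumption S κ) (hκ : 0 < κ)
  (hc : 0 < c) {Q : Measure (EuclideanSpace ℝ (Fin n))} [IsProbabilityMeasure Q]
  (hQ : Q ≪ volume)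

include H hS hκ hc hQ

/-- Fatou's lemma along ν = 1/(m + 1), since the bound for positive ν is uniform in ν and the score
is almost surely nonzero. -/
theorem sum_lintegral_energyAt_le (hR0 : 0 ≤ R) (hγ : 0 ≤ γ) (hp : (p : ℝ) / n ≤ γ)
    (hR : ∫⁻ q, ENNReal.ofReal (‖estError ρ g β (designMatrix q.1) q.2‖ ^ 2)
      ∂((rowLaw n S).prod Q) ≤ ENNReal.ofReal (R / κ))
    (hn4 : 4 * (approxConst τ L κ c * loopConst K τ κ c) ≤ n) :
    ∑ j, ∫⁻ q, ENNReal.ofReal (energyAt ρ g β c j 0 q) ∂((rowLaw n S).prod Q)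
      ≤ ENNReal.ofReal (energyConst R τ K L κ γ c) := by
  set M := (rowLaw n S).prod Q
  have hm : ∀ ν : ℝ, Measurable fun q : Sample n p =>
      ∑ j, ENNReal.ofReal (energyAt ρ g β c j ν q) := fun ν =>
    Finset.measurable_sum _ fun j _ => (H.measurable_energyAt β c j ν).ennreal_ofReal
  rw [← lintegral_finsetSum _ fun j _ => (H.measurable_energyAt β c j 0).ennreal_ofReal]
  calc ∫⁻ q, ∑ j, ENNReal.ofReal (energyAt ρ g β c j 0 q) ∂M
      ≤ ∫⁻ q, liminf (fun m : ℕ => ∑ j, ENNReal.ofReal (energyAt ρ g β c j (1 / ((m : ℝ) + 1)) q))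
          atTop ∂M := by
        refine lintegral_mono_ae ?_
        filter_upwards [H.ae_wellDefined β (rowLaw n S) hQ] with q hq
        refine ((tendsto_finsetSum _ fun j _ => ?_).liminf_eq).ge
        exact ENNReal.tendsto_ofReal (tendsto_energyAt β j hq.1)
    _ ≤ liminf (fun m : ℕ => ∫⁻ q, ∑ j, ENNReal.ofReal
          (energyAt ρ g β c j (1 / ((m : ℝ) + 1)) q) ∂M) atTop := lintegral_liminf_le fun m => hm _
    _ ≤ ENNReal.ofReal (energyConst R τ K L κ γ c) := by
        refine liminf_le_of_frequently_le' (Eventually.of_forall fun m => ?_).frequently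
        rw [lintegral_finsetSum _ fun j _ => (H.measurable_energyAt β c j _).ennreal_ofReal]
        refine H.sum_lintegral_energyAt_le_of_pos β hS hκ hc hQ (by positivity) ?_ hR0 hγ hp hR hn4
        rw [div_le_one (by positivity)]
        linarith [(Nat.cast_nonneg m : (0 : ℝ) ≤ m)]

/-- The Gaussian approximation of the pivotal quantities without regularization. -/
theorem lintegral_pivotAt_zero_sub_sq_le :
    ∫⁻ t, ENNReal.ofReal ((pivotAt ρ g S β c j 0 (replaceColumn S j (t.1, t.2.2))
        - inner ℝ t.2.2 (directionAt ρ g β c j 0 (replaceColumn S j (t.1, t.2.1)))) ^ 2)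
        ∂(jointLaw S Q)
      ≤ ENNReal.ofReal (approxConst τ L κ c)
        * (∫⁻ q, ENNReal.ofReal (energyAt ρ g β c j 0 q) ∂((rowLaw n S).prod Q)
          + ENNReal.ofReal (1 / n)) := by
  have hae := H.ae_wellDefined β (rowLaw n S) hQ
  have h1 := (measurePreserving_replaceColumn_snd (Q := Q) j hS hκ).quasiMeasurePreserving.ae hae
  have h2 := (measurePreserving_replaceColumn_fst (Q := Q) j hS hκ).quasiMeasurePreserving.ae hae
  have hpm : ∀ ν, Measurable
      fun t : Sample n p × (EuclideanSpace ℝ (Fin n) × EuclideanSpace ℝ (Fin n)) =>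
      pivotAt ρ g S β c j ν (replaceColumn S j (t.1, t.2.2)) := fun ν => by
    have h := (H.measurable_pivotAt β S c j ν).comp
      (measurePreserving_replaceColumn_snd (Q := Q) j hS hκ).measurable
    simp only [Function.comp_def] at h
    exact h
  calc ∫⁻ t, ENNReal.ofReal ((pivotAt ρ g S β c j 0 (replaceColumn S j (t.1, t.2.2))
        - inner ℝ t.2.2 (directionAt ρ g β c j 0 (replaceColumn S j (t.1, t.2.1)))) ^ 2)
        ∂(jointLaw S Q)
      ≤ ∫⁻ t, liminf (fun m : ℕ => ENNReal.ofReal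
        ((pivotAt ρ g S β c j (1 / ((m : ℝ) + 1)) (replaceColumn S j (t.1, t.2.2))
        - inner ℝ t.2.2 (directionAt ρ g β c j (1 / ((m : ℝ) + 1))
          (replaceColumn S j (t.1, t.2.1)))) ^ 2)) atTop ∂(jointLaw S Q) := by
        refine lintegral_mono_ae ?_
        filter_upwards [h1, h2] with t ht1 ht2
        refine (Tendsto.liminf_eq ?_).ge
        exact ENNReal.tendsto_ofReal (((tendsto_pivotAt β j ht1.1).sub
          (tendsto_const_nhds.inner (tendsto_directionAt β j ht2.1))).pow 2)
    _ ≤ liminf (fun m : ℕ => ∫⁻ t, ENNReal.ofReal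
        ((pivotAt ρ g S β c j (1 / ((m : ℝ) + 1)) (replaceColumn S j (t.1, t.2.2))
        - inner ℝ t.2.2 (directionAt ρ g β c j (1 / ((m : ℝ) + 1))
          (replaceColumn S j (t.1, t.2.1)))) ^ 2) ∂(jointLaw S Q)) atTop :=
        lintegral_liminf_le fun m =>
          (((hpm _).sub (H.measurable_inner_directionAt β j)).pow_const 2).ennreal_ofReal
    _ ≤ _ := by
        refine liminf_le_of_frequently_le' (Eventually.of_forall fun m => ?_).frequently
        have hm1 : 1 / ((m : ℝ) + 1) ≤ 1 := by
          rw [div_le_one (by positivity)]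
          linarith [(Nat.cast_nonneg m : (0 : ℝ) ≤ m)]
        refine (H.lintegral_pivotAt_sub_sq_le β j hS hκ hc hQ (by positivity) hm1).trans ?_
        -- The energy decreases in ν, so the unregularized one dominates uniformly in m.
        refine mul_le_mul_right (add_le_add_left (lintegral_mono_ae ?_) _) _
        filter_upwards [hae] with q hq
        exact ENNReal.ofReal_le_ofReal (energyAt_le_energyAt_zero β j hq.1 (by positivity))

end Regular

end LimitIntegral

/-! ### From closeness in probability to closeness of distribution functions. -/

section NormalComparison

/-- The density is at most 1/√(2π) ≤ 1; in consequence `Phi` is 1-Lipschitz. -/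
lemma gaussianReal_Ioc_le (a b : ℝ) :
    (gaussianReal 0 1) (Set.Ioc a b) ≤ ENNReal.ofReal (b - a) := by
  rw [gaussianReal_apply _ one_ne_zero]
  calc ∫⁻ x in Set.Ioc a b, gaussianPDF 0 1 x ≤ ∫⁻ _ in Set.Ioc a b, 1 := by
        refine lintegral_mono fun x => ?_
        rw [gaussianPDF, ← ENNReal.ofReal_one]
        refine ENNReal.ofReal_le_ofReal ?_
        rw [gaussianPDFReal]
        refine mul_le_one₀ ?_ (Real.exp_pos _).le (Real.exp_le_one_iff.2 ?_)
        · refine inv_le_one_of_one_le₀ (Real.one_le_sqrt.2 ?_)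
          have := Real.pi_gt_three
          simp only [NNReal.coe_one, mul_one]
          linarith
        · exact div_nonpos_of_nonpos_of_nonneg (neg_nonpos.2 (sq_nonneg _)) (by positivity)
    _ = ENNReal.ofReal (b - a) := by simp

lemma Phi_eq (t : ℝ) : Phi t = (gaussianReal 0 1).real (Set.Iic t) := by
  rw [Phi, cdf_eq_real]

lemma Phi_add_le (t : ℝ) {δ : ℝ} (hδ : 0 ≤ δ) : Phi (t + δ) ≤ Phi t + δ := by
  rw [Phi_eq, Phi_eq]
  have h : Set.Iic (t + δ) = Set.Iic t ∪ Set.Ioc t (t + δ) :=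
    (Set.Iic_union_Ioc_eq_Iic (by linarith)).symm
  rw [h]
  refine (measureReal_union_le _ _).trans (add_le_add_right ?_ _)
  have h2 := ENNReal.toReal_mono ENNReal.ofReal_ne_top (gaussianReal_Ioc_le t (t + δ))
  rwa [add_sub_cancel_left, ENNReal.toReal_ofReal hδ] at h2

variable {Θ : Type*} [MeasurableSpace Θ] {P : Measure Θ} [IsProbabilityMeasure P]

/-- A variable close in probability to a standard normal variable has almost its distribution
function. -/
lemma abs_measureReal_le_sub_Phi_le {Y G : Θ → ℝ} (hG : Measurable G)
    (hlaw : P.map G = gaussianReal 0 1) (t : ℝ) {δ : ℝ} (hδ : 0 ≤ δ) :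
    |P.real {x | Y x ≤ t} - Phi t| ≤ P.real {x | δ < |Y x - G x|} + δ := by
  have hΦ : ∀ s, P.real {x | G x ≤ s} = Phi s := fun s => by
    rw [Phi_eq, ← hlaw, map_measureReal_apply hG measurableSet_Iic]
    rfl
  have h1 : P.real {x | Y x ≤ t} ≤ P.real {x | G x ≤ t + δ} + P.real {x | δ < |Y x - G x|} := by
    refine (measureReal_mono fun x hx => ?_).trans (measureReal_union_le _ _)
    by_cases hx2 : δ < |Y x - G x|
    · exact Or.inr hx2
    · refine Or.inl ?_
      have := (abs_le.1 (not_lt.1 hx2)).1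
      have hx' : Y x ≤ t := hx
      change G x ≤ t + δ
      linarith
  have h2 : P.real {x | G x ≤ t - δ} ≤ P.real {x | Y x ≤ t} + P.real {x | δ < |Y x - G x|} := by
    refine (measureReal_mono fun x hx => ?_).trans (measureReal_union_le _ _)
    by_cases hx2 : δ < |Y x - G x|
    · exact Or.inr hx2
    · refine Or.inl ?_
      have := (abs_le.1 (not_lt.1 hx2)).2
      have hx' : G x ≤ t - δ := hx
      change Y x ≤ t
      linarith
  rw [hΦ] at h1 h2
  have h3 := Phi_add_le t hδ
  have h4 := Phi_add_le (t - δ) hδ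
  rw [sub_add_cancel] at h4
  rw [abs_le]
  constructor <;> linarith

omit [IsProbabilityMeasure P] in
lemma measureReal_lt_le_of_lintegral {f : Θ → ℝ} (hf : Measurable f) {δ b : ℝ} (hδ : 0 < δ)
    (hb : 0 ≤ b) (h : ∫⁻ x, ENNReal.ofReal (f x) ∂P ≤ ENNReal.ofReal b) :
    P.real {x | δ < f x} ≤ b / δ := by
  have h1 := meas_ge_le_lintegral_div (μ := P) hf.ennreal_ofReal.aemeasurable
    (ENNReal.ofReal_pos.2 hδ).ne' ENNReal.ofReal_ne_top
  have h2 : P {x | δ < f x} ≤ ENNReal.ofReal (b / δ) := by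
    refine (measure_mono fun x hx => ?_).trans (h1.trans ?_)
    · exact ENNReal.ofReal_le_ofReal (le_of_lt hx)
    · rw [ENNReal.ofReal_div_of_pos hδ]
      exact ENNReal.div_le_div_right h _
  have h3 := ENNReal.toReal_mono ENNReal.ofReal_ne_top h2
  rwa [ENNReal.toReal_ofReal (by positivity)] at h3

end NormalComparison

/-! ### Projections and norms of Gaussian vectors. -/

section GaussianNorm

variable {n : ℕ}

lemma map_inner_stdGaussian {E : Type*} [NormedAddCommGroup E] [InnerProductSpace ℝ E]
    [FiniteDimensional ℝ E] [MeasurableSpace E] [BorelSpace E] {u : E} (hu : ‖u‖ = 1) :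
    (stdGaussian E).map (fun z => inner ℝ z u) = gaussianReal 0 1 := by
  have hm : Measurable fun z : E => inner ℝ z u := by fun_prop
  have := Measure.isProbabilityMeasure_map (μ := stdGaussian E) hm.aemeasurable
  refine Measure.ext_of_charFun (funext fun t => ?_)
  rw [charFun_gaussianReal, charFun_apply, integral_map hm.aemeasurable (by fun_prop)]
  have h : ∀ z : E, ((inner ℝ (inner ℝ z u) t : ℝ) : ℂ) = ((inner ℝ z (t • u) : ℝ) : ℂ) :=
    fun z => by
      rw [real_inner_smul_right]
      simp
  simp_rw [h]
  rw [← charFun_apply, charFun_stdGaussian, norm_smul, hu]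
  congr 1
  simp
  norm_cast
  simp
  ring

/-- The inner product of a standard Gaussian vector with an independent unit vector is standard
normal. -/
lemma map_inner_prod_stdGaussian {E : Type*} [NormedAddCommGroup E] [InnerProductSpace ℝ E]
    [FiniteDimensional ℝ E] [MeasurableSpace E] [BorelSpace E] {Θ : Type*} [MeasurableSpace Θ]
    {m : Measure Θ} [IsProbabilityMeasure m] {U : Θ → E} (hU : Measurable U)
    (hU1 : ∀ᵐ a ∂m, ‖U a‖ = 1) :
    (m.prod (stdGaussian E)).map (fun x => inner ℝ x.2 (U x.1)) = gaussianReal 0 1 := by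
  have hm : Measurable fun x : Θ × E => inner ℝ x.2 (U x.1) :=
    measurable_snd.inner (hU.comp measurable_fst)
  ext A hA
  rw [Measure.map_apply hm hA, Measure.prod_apply (hm hA)]
  have h : ∀ᵐ a ∂m, stdGaussian E (Prod.mk a ⁻¹' ((fun x : Θ × E => inner ℝ x.2 (U x.1)) ⁻¹' A))
      = gaussianReal 0 1 A := by
    filter_upwards [hU1] with a ha
    rw [← map_inner_stdGaussian ha, Measure.map_apply (by fun_prop) hA]
    rfl
  rw [lintegral_congr_ae h, lintegral_const, measure_univ, mul_one]

lemma lintegral_norm_sq_stdGaussian :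
    ∫⁻ z, ENNReal.ofReal (‖z‖ ^ 2) ∂(stdGaussian (EuclideanSpace ℝ (Fin n))) = ENNReal.ofReal n := by
  simp_rw [← sum_inner_basisFun_sq]
  have h : ∀ z : EuclideanSpace ℝ (Fin n),
      ENNReal.ofReal (∑ i, inner ℝ (EuclideanSpace.basisFun (Fin n) ℝ i) z ^ 2)
      = ∑ i, ENNReal.ofReal (inner ℝ (EuclideanSpace.basisFun (Fin n) ℝ i) z ^ 2) := fun z =>
    ENNReal.ofReal_sum_of_nonneg fun i _ => sq_nonneg _
  simp_rw [h]
  rw [lintegral_finsetSum _ fun i _ => by fun_prop]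
  simp_rw [lintegral_inner_sq_stdGaussian]
  simp

/-- Concentration of the squared norm of a standard Gaussian vector. -/
lemma lintegral_norm_sq_sub_sq_le :
    ∫⁻ z, ENNReal.ofReal ((‖z‖ ^ 2 - n) ^ 2) ∂(stdGaussian (EuclideanSpace ℝ (Fin n)))
      ≤ ENNReal.ofReal (10 * n) := by
  set γ := stdGaussian (EuclideanSpace ℝ (Fin n))
  -- For the identity map the divergence is n, so ⟨z, z - z'⟩ - n has second moment at most (π²/4 +
  -- 1)n. The cross term ⟨z, z'⟩ has second moment n, and 2(π²/4 + 1) + 2 ≤ 10.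
  have h := lintegral_divergence_sub_sq_le (LipschitzWith.id (α := EuclideanSpace ℝ (Fin n)))
    (EuclideanSpace.basisFun (Fin n) ℝ)
  have e1 : ∀ x : EuclideanSpace ℝ (Fin n), ∑ k, inner ℝ (EuclideanSpace.basisFun (Fin n) ℝ k)
      (fderiv ℝ (id : EuclideanSpace ℝ (Fin n) → _) x (EuclideanSpace.basisFun (Fin n) ℝ k))
      = n := fun x => by
    rw [fderiv_id]
    simp
  have e2 : ∀ x : EuclideanSpace ℝ (Fin n), ∑ k,
      ‖fderiv ℝ (id : EuclideanSpace ℝ (Fin n) → _) x (EuclideanSpace.basisFun (Fin n) ℝ k)‖ ^ 2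
      = n := fun x => by
    rw [fderiv_id]
    simp
  simp_rw [e1, e2] at h
  rw [lintegral_const, measure_univ, mul_one, ← ENNReal.ofReal_mul (by positivity)] at h
  simp only [id_eq] at h
  have h0 : ∫⁻ z, ENNReal.ofReal ((‖z‖ ^ 2 - n) ^ 2) ∂γ
      = ∫⁻ _z' : EuclideanSpace ℝ (Fin n), (∫⁻ z, ENNReal.ofReal ((‖z‖ ^ 2 - n) ^ 2) ∂γ) ∂γ := by
    rw [lintegral_const, measure_univ, mul_one]
  rw [h0]
  calc ∫⁻ _z' : EuclideanSpace ℝ (Fin n), (∫⁻ z, ENNReal.ofReal ((‖z‖ ^ 2 - n) ^ 2) ∂γ) ∂γ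
      ≤ ∫⁻ z', (ENNReal.ofReal 2 * (∫⁻ z, ENNReal.ofReal ((inner ℝ z (z - z') - n) ^ 2) ∂γ)
        + ENNReal.ofReal 2 * ENNReal.ofReal (‖z'‖ ^ 2)) ∂γ := by
        refine lintegral_mono fun z' => ?_
        rw [← lintegral_inner_sq_stdGaussian z', ← lintegral_const_mul' _ _ ENNReal.ofReal_ne_top,
          ← lintegral_const_mul' _ _ ENNReal.ofReal_ne_top, ← lintegral_add_right _ (by fun_prop)]
        refine lintegral_mono fun z => ?_
        rw [← ENNReal.ofReal_mul (by norm_num), ← ENNReal.ofReal_mul (by norm_num),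
          ← ENNReal.ofReal_add (by positivity) (by positivity)]
        refine ENNReal.ofReal_le_ofReal ?_
        have h2 := add_sq_le (a := inner ℝ z (z - z') - n) (b := inner ℝ z' z)
        rw [inner_sub_right, real_inner_self_eq_norm_sq, real_inner_comm z' z] at h2 ⊢
        have e3 : ‖z‖ ^ 2 - inner ℝ z z' - n + inner ℝ z z' = ‖z‖ ^ 2 - n := by ring
        rw [real_inner_comm z z'] at *
        rw [e3] at h2
        linarith
    _ ≤ ENNReal.ofReal 2 * ENNReal.ofReal ((Real.pi ^ 2 / 4 + 1) * n)
        + ENNReal.ofReal 2 * ENNReal.ofReal n := by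
        rw [lintegral_add_right _ (by fun_prop), lintegral_const_mul' _ _ ENNReal.ofReal_ne_top,
          lintegral_const_mul' _ _ ENNReal.ofReal_ne_top, lintegral_norm_sq_stdGaussian]
        gcongr
    _ ≤ ENNReal.ofReal (10 * n) := by
        rw [← ENNReal.ofReal_mul (by norm_num), ← ENNReal.ofReal_mul (by norm_num),
          ← ENNReal.ofReal_add (by positivity) (by positivity)]
        refine ENNReal.ofReal_le_ofReal ?_
        have hpi : Real.pi ^ 2 ≤ 12 := by
          have h1 := Real.pi_lt_d2
          have h2 := Real.pi_pos
          nlinarith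
        nlinarith [(Nat.cast_nonneg n : (0 : ℝ) ≤ n)]

end GaussianNorm

/-! ### The statistics of the theorem in terms of the pivot. -/

section Standardized

variable {n p : ℕ}

/-- The standardized statistic `Ω_jj^{1/2} ξ_j` at a sample. -/
noncomputable def stdXi (ρ : ℝ → ℝ) (g : EuclideanSpace ℝ (Fin p) → ℝ)
    (S : Matrix (Fin p) (Fin p) ℝ) (β : EuclideanSpace ℝ (Fin p)) (j : Fin p)
    (q : Sample n p) : ℝ :=
  √(precisionDiag S j) * xi ρ g S β (designMatrix q.1) (response β (designMatrix q.1) q.2) j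

/-- The standardized statistic `Ω_jj^{1/2} ξ'_j` at a sample. -/
noncomputable def stdXi' (ρ : ℝ → ℝ) (g : EuclideanSpace ℝ (Fin p) → ℝ)
    (S : Matrix (Fin p) (Fin p) ℝ) (β : EuclideanSpace ℝ (Fin p)) (j : Fin p)
    (q : Sample n p) : ℝ :=
  √(precisionDiag S j) * xi' ρ g S β (designMatrix q.1) (response β (designMatrix q.1) q.2) j

/-- The normalized score vector at a sample. -/
noncomputable def unitScore (ρ : ℝ → ℝ) (g : EuclideanSpace ℝ (Fin p) → ℝ)
    (β : EuclideanSpace ℝ (Fin p)) (q : Sample n p) : EuclideanSpace ℝ (Fin n) :=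
  ‖score ρ g β (designMatrix q.1) q.2‖⁻¹ • score ρ g β (designMatrix q.1) q.2

/-- The scaled deviation of the squared norm of the standardized column from its mean. -/
noncomputable def columnDeviation (S : Matrix (Fin p) (Fin p) ℝ) (j : Fin p)
    (q : Sample n p) : ℝ :=
  ‖√(precisionDiag S j) • zvec S (designMatrix q.1) j‖ ^ 2 / n - 1

/-- The bias correction of the standardized statistic. -/
noncomputable def correction (ρ : ℝ → ℝ) (g : EuclideanSpace ℝ (Fin p) → ℝ)
    (S : Matrix (Fin p) (Fin p) ℝ) (β : EuclideanSpace ℝ (Fin p)) (j : Fin p)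
    (q : Sample n p) : ℝ :=
  ‖score ρ g β (designMatrix q.1) q.2‖⁻¹ * ((√(precisionDiag S j))⁻¹
    * estError ρ g β (designMatrix q.1) q.2 j
    * trJacobian ρ g (designMatrix q.1) (response β (designMatrix q.1) q.2))

variable {ρ : ℝ → ℝ} {g : EuclideanSpace ℝ (Fin p) → ℝ} {τ K : ℝ} {L : NNReal}
  (β : EuclideanSpace ℝ (Fin p)) {S : Matrix (Fin p) (Fin p) ℝ} {c : ℝ} (j : Fin p)

lemma directionAt_zero (q : Sample n p) :
    directionAt ρ g β c j 0 q = cutoff c (designMatrix q.1) • unitScore ρ g β q := by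
  rw [directionAt, direction, regNorm_zero, unitScore]

lemma estError_apply (X : Matrix (Fin n) (Fin p) ℝ) (e : EuclideanSpace ℝ (Fin n)) :
    estError ρ g β X e j = betaHat ρ g X (response β X e) j - β j := rfl

lemma stdXi'_eq (hω : 0 < precisionDiag S j) (q : Sample n p) :
    stdXi' ρ g S β j q = ‖score ρ g β (designMatrix q.1) q.2‖⁻¹
      * inner ℝ (√(precisionDiag S j) • zvec S (designMatrix q.1) j)
        (score ρ g β (designMatrix q.1) q.2) + correction ρ g S β j q := by
  have hs : √(precisionDiag S j) * (precisionDiag S j)⁻¹ = (√(precisionDiag S j))⁻¹ := by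
    have h1 : √(precisionDiag S j) ≠ 0 := (Real.sqrt_pos.2 hω).ne'
    have h2 : precisionDiag S j = √(precisionDiag S j) * √(precisionDiag S j) :=
      (Real.mul_self_sqrt hω.le).symm
    nth_rw 2 [h2]
    field_simp
  rw [stdXi', xi', correction, estError_apply, ← hs, real_inner_smul_left]
  rw [show psiHat ρ g (designMatrix q.1) (response β (designMatrix q.1) q.2)
    = score ρ g β (designMatrix q.1) q.2 from rfl, real_inner_comm (zvec S (designMatrix q.1) j)]
  ring

/-- The statistics differ only in the factor of the bias term, ‖z_j‖²/n against Ω_jj⁻¹. -/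
lemma stdXi_sub_stdXi' (hω : 0 < precisionDiag S j) (q : Sample n p) :
    stdXi ρ g S β j q - stdXi' ρ g S β j q = columnDeviation S j q * correction ρ g S β j q := by
  have h1 : √(precisionDiag S j) ≠ 0 := (Real.sqrt_pos.2 hω).ne'
  have h2 : √(precisionDiag S j) ^ 2 = precisionDiag S j := Real.sq_sqrt hω.le
  rw [stdXi, stdXi', xi, xi', columnDeviation, correction, estError_apply, norm_smul, mul_pow,
    Real.norm_eq_abs, sq_abs]
  rw [show psiHat ρ g (designMatrix q.1) (response β (designMatrix q.1) q.2)
    = score ρ g β (designMatrix q.1) q.2 from rfl, ← h2, Real.sqrt_sq (Real.sqrt_nonneg _)]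
  field_simp
  ring

lemma pivotAt_zero (hω : 0 < precisionDiag S j) (q : Sample n p) :
    pivotAt ρ g S β c j 0 q = cutoff c (designMatrix q.1) * stdXi' ρ g S β j q := by
  rw [stdXi'_eq β j hω, pivotAt, pivot, regNorm_zero, correction]
  ring

namespace Regular

variable (H : Regular n ρ g τ K L)

include H

lemma measurable_correction : Measurable (correction (n := n) ρ g S β j) := by
  unfold correction
  have h1 := (H.continuous_score_sample β).norm.measurable.inv
  have h2 := (H.continuous_estError_apply β j (continuous_design (n := n)) continuous_snd).measurable
  have h3 := H.measurable_trJacobian_sample β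
  exact h1.mul ((h2.const_mul _).mul h3)

lemma measurable_unitScore : Measurable (unitScore (n := n) ρ g β) := by
  unfold unitScore
  have h1 := (H.continuous_score_sample β).norm.measurable.inv
  exact h1.smul (H.continuous_score_sample β).measurable

lemma measurable_stdXi' (hω : 0 < precisionDiag S j) :
    Measurable (stdXi' (n := n) ρ g S β j) := by
  have h1 := (H.continuous_score_sample β).norm.measurable.inv
  have h2 := (H.continuous_score_sample β).measurable
  have h3 : Measurable fun q : Sample n p => √(precisionDiag S j) • zvec S (designMatrix q.1) j :=
    (continuous_zvec_design (n := n) S j).measurable.const_smul (√(precisionDiag S j))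
  have h4 : Measurable fun q : Sample n p => inner ℝ
      (√(precisionDiag S j) • zvec S (designMatrix q.1) j) (score ρ g β (designMatrix q.1) q.2) :=
    h3.inner h2
  have h5 := (h1.mul h4).add (H.measurable_correction (S := S) β j)
  have e : stdXi' (n := n) ρ g S β j = fun q => ‖score ρ g β (designMatrix q.1) q.2‖⁻¹
      * inner ℝ (√(precisionDiag S j) • zvec S (designMatrix q.1) j)
        (score ρ g β (designMatrix q.1) q.2) + correction ρ g S β j q :=
    funext fun q => stdXi'_eq β j hω q
  rw [e]
  exact h5

omit H in
lemma measurable_columnDeviation : Measurable (columnDeviation (n := n) S j) := by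
  unfold columnDeviation
  have h := ((continuous_zvec_design (n := n) S j).const_smul (√(precisionDiag S j))).norm
  exact (((h.pow 2).div_const _).sub continuous_const).measurable

lemma measurable_stdXi (hω : 0 < precisionDiag S j) : Measurable (stdXi (n := n) ρ g S β j) := by
  have h := (H.measurable_stdXi' β j hω).add
    ((measurable_columnDeviation (n := n) (S := S) j).mul (H.measurable_correction (S := S) β j))
  have e : stdXi (n := n) ρ g S β j = fun q => stdXi' ρ g S β j q
      + columnDeviation S j q * correction ρ g S β j q := funext fun q => by
    rw [← stdXi_sub_stdXi' β j hω, add_sub_cancel]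
  rw [e]
  exact h

variable {κ : ℝ} (hS : CovarianceAssumption S κ) (hκ : 0 < κ)

include hS hκ

/-- Since tr V lies between 0 and nL, the squared correction is at most of order n times the energy.
The factor n is later offset by the variance 10/n of the column deviation. -/
lemma cutoff_mul_correction_sq_le {q : Sample n p}
    (hd : DifferentiableAt ℝ (psiHat ρ g (designMatrix q.1))
      (response β (designMatrix q.1) q.2)) :
    (cutoff c (designMatrix q.1) * correction ρ g S β j q) ^ 2
      ≤ L ^ 2 * n / κ * energyAt ρ g β c j 0 q := by
  have hn := H.n_pos
  have hω := hS.precisionDiag_pos hκ j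
  have h1 := H.trJacobian_nonneg hd
  have h2 := H.trJacobian_le (X := designMatrix q.1) (y := response β (designMatrix q.1) q.2)
  rw [correction, energyAt, energy, regNorm_zero]
  set trV := trJacobian ρ g (designMatrix q.1) (response β (designMatrix q.1) q.2)
  set h₀ := estError ρ g β (designMatrix q.1) q.2 j
  set ψ := score ρ g β (designMatrix q.1) q.2
  set a := cutoff c (designMatrix q.1)
  have h3 : trV ^ 2 ≤ (n * L) ^ 2 := pow_le_pow_left₀ h1 h2 2
  have h4 : (√(precisionDiag S j))⁻¹ ^ 2 ≤ 1 / κ := by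
    rw [inv_pow, Real.sq_sqrt hω.le, one_div]
    exact (inv_le_inv₀ hω hκ).2 (hS.le_precisionDiag hκ j)
  calc (a * (‖ψ‖⁻¹ * ((√(precisionDiag S j))⁻¹ * h₀ * trV))) ^ 2
      = a ^ 2 * ‖ψ‖⁻¹ ^ 2 * h₀ ^ 2 * ((√(precisionDiag S j))⁻¹ ^ 2 * trV ^ 2) := by ring
    _ ≤ a ^ 2 * ‖ψ‖⁻¹ ^ 2 * h₀ ^ 2 * (1 / κ * (n * L) ^ 2) := by gcongr
    _ = L ^ 2 * n / κ * (a ^ 2 * (n * h₀ ^ 2) / ‖ψ‖ ^ 2) := by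
      rw [inv_pow, div_eq_mul_inv _ (‖ψ‖ ^ 2)]
      ring

end Regular

section JointLaw

variable {κ : ℝ} (hS : CovarianceAssumption S κ) (hκ : 0 < κ)
  {Q : Measure (EuclideanSpace ℝ (Fin n))} [IsProbabilityMeasure Q]

include hS hκ

lemma lintegral_columnDeviation_sq_le (hn : (0 : ℝ) < n) :
    ∫⁻ q, ENNReal.ofReal (columnDeviation S j q ^ 2) ∂((rowLaw n S).prod Q)
      ≤ ENNReal.ofReal (10 / n) := by
  have hm := ((Regular.measurable_columnDeviation (n := n) (S := S) j).pow_const 2).ennreal_ofReal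
  have hmp := hS.measurePreserving_replaceColumn (n := n) hκ j Q
  rw [← hmp.lintegral_comp hm]
  have e : ∀ t : Sample n p × EuclideanSpace ℝ (Fin n),
      ENNReal.ofReal (columnDeviation S j (replaceColumn S j t) ^ 2)
      = ENNReal.ofReal (1 / n ^ 2) * ENNReal.ofReal ((‖t.2‖ ^ 2 - n) ^ 2) := fun t => by
    rw [columnDeviation, replaceColumn]
    simp only
    rw [hS.sqrt_smul_zvec_resample j hκ, ← ENNReal.ofReal_mul (by positivity)]
    congr 1
    field_simp
  simp_rw [e]
  rw [lintegral_const_mul' _ _ ENNReal.ofReal_ne_top, lintegral_prod _ (by fun_prop)]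
  simp only [lintegral_const, measure_univ, mul_one]
  refine (mul_le_mul_right lintegral_norm_sq_sub_sq_le _).trans (le_of_eq ?_)
  rw [← ENNReal.ofReal_mul (by positivity)]
  congr 1
  field_simp

/-- The unit vector is built from the first resampled column and is independent of the second one,
so conditionally on it the inner product is exactly standard normal. -/
lemma map_inner_unitScore (H : Regular n ρ g τ K L) (hQ : Q ≪ volume) :
    (jointLaw S Q).map (fun t => inner ℝ t.2.2 (unitScore ρ g β (replaceColumn S j (t.1, t.2.1))))
      = gaussianReal 0 1 := by
  have hU : Measurable fun s : Sample n p × EuclideanSpace ℝ (Fin n) =>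
      unitScore ρ g β (replaceColumn S j s) :=
    (H.measurable_unitScore β).comp (continuous_replaceColumn S j).measurable
  have hmp := hS.measurePreserving_replaceColumn (n := n) hκ j Q
  have hU1 : ∀ᵐ s ∂(((rowLaw n S).prod Q).prod (stdGaussian (EuclideanSpace ℝ (Fin n)))),
      ‖unitScore ρ g β (replaceColumn S j s)‖ = 1 := by
    filter_upwards [hmp.quasiMeasurePreserving.ae (H.ae_wellDefined β (rowLaw n S) hQ)] with s hs
    rw [unitScore, norm_smul, norm_inv, norm_norm]
    exact inv_mul_cancel₀ (norm_ne_zero_iff.2 hs.1)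
  have h := map_inner_prod_stdGaussian hU hU1
  have ha := measurePreserving_prodAssoc ((rowLaw n S).prod Q)
    (stdGaussian (EuclideanSpace ℝ (Fin n))) (stdGaussian (EuclideanSpace ℝ (Fin n)))
  have hG : Measurable fun t : Sample n p × (EuclideanSpace ℝ (Fin n) × EuclideanSpace ℝ (Fin n)) =>
      inner ℝ t.2.2 (unitScore ρ g β (replaceColumn S j (t.1, t.2.1))) := by
    have h1 : Measurable fun t : Sample n p × (EuclideanSpace ℝ (Fin n) × EuclideanSpace ℝ (Fin n)) =>
        t.2.2 := measurable_snd.comp measurable_snd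
    have h2 := hU.comp (measurable_fst.prodMk (measurable_fst.comp measurable_snd) : Measurable
      fun t : Sample n p × (EuclideanSpace ℝ (Fin n) × EuclideanSpace ℝ (Fin n)) => (t.1, t.2.1))
    simp only [Function.comp_def] at h2
    exact h1.inner h2
  rw [← h, jointLaw, ← ha.map_eq, Measure.map_map hG ha.measurable]
  rfl

end JointLaw

end Standardized

/-! ### Quantitative normal approximation for one coordinate. -/

section NormalApproximation

variable {n p : ℕ} {ρ : ℝ → ℝ} {g : EuclideanSpace ℝ (Fin p) → ℝ} {τ K : ℝ} {L : NNReal}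
  (β : EuclideanSpace ℝ (Fin p)) {S : Matrix (Fin p) (Fin p) ℝ} (j : Fin p)
  (H : Regular n ρ g τ K L) {κ γ α : ℝ} (hS : CovarianceAssumption S κ) (hκ : 0 < κ)
  (hγ : 0 < γ) (hp : (p : ℝ) / n ≤ γ)
  {Q : Measure (EuclideanSpace ℝ (Fin n))} [IsProbabilityMeasure Q] (hQ : Q ≪ volume)
  (hα : 0 ≤ α) (hA : ∫⁻ q, ENNReal.ofReal (energyAt ρ g β (cutoffLevel κ γ) j 0 q)
    ∂((rowLaw n S).prod Q) ≤ ENNReal.ofReal α)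

namespace Regular

include H hS hκ hγ hp

lemma measureReal_cutoff_ne_one_le :
    ((rowLaw n S).prod Q).real {q | cutoff (cutoffLevel κ γ) (designMatrix q.1) ≠ 1}
      ≤ Real.exp (-n) := by
  refine le_trans (le_of_eq ?_) (hS.rowLaw_cutoff_ne_one_le (n := n) hκ hγ H.n_pos hp)
  have hm : MeasurableSet {r : Fin n → EuclideanSpace ℝ (Fin p) |
      cutoff (cutoffLevel κ γ) (designMatrix r) ≠ 1} := by
    have h := (continuous_cutoff (n := n) (p := p) (c := cutoffLevel κ γ)).comp
      continuous_designMatrix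
    simp only [Function.comp_def] at h
    exact (isOpen_ne_fun h continuous_const).measurableSet
  have hfst : MeasurePreserving Prod.fst ((rowLaw n S).prod Q) (rowLaw n S) :=
    measurePreserving_fst
  exact hfst.measureReal_preimage hm.nullMeasurableSet

include hQ hα hA

/-- The statistic `Ω_jj^{1/2} ξ'_j` is close in probability to a standard normal variable. -/
lemma measureReal_stdXi'_sub_gt_le {δ : ℝ} (hδ : 0 < δ) :
    (jointLaw S Q).real {t | δ < |stdXi' ρ g S β j (replaceColumn S j (t.1, t.2.2))
        - inner ℝ t.2.2 (unitScore ρ g β (replaceColumn S j (t.1, t.2.1)))|}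
      ≤ 2 * Real.exp (-n) + approxConst τ L κ (cutoffLevel κ γ) * (α + 1 / n) / δ ^ 2 := by
  set c := cutoffLevel κ γ with hc
  have hcpos : 0 < c := cutoffLevel_pos hκ hγ
  have hn := H.n_pos
  have hω := hS.precisionDiag_pos hκ j
  have hC := approxConst_nonneg (L := L) H.τ_pos hκ hcpos
  have hcut := H.measureReal_cutoff_ne_one_le (Q := Q) hS hκ hγ hp
  rw [← hc] at hcut
  have hms : MeasurableSet {q : Sample n p | cutoff c (designMatrix q.1) ≠ 1} :=
    (isOpen_ne_fun (continuous_cutoff_design (n := n) (p := p) c) continuous_const).measurableSet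
  have h1 := (measurePreserving_replaceColumn_snd (n := n) (Q := Q) j hS hκ)
  have h2 := (measurePreserving_replaceColumn_fst (n := n) (Q := Q) j hS hκ)
  have hb1 := hcut
  have hb2 := hcut
  rw [← h1.measureReal_preimage hms.nullMeasurableSet] at hb1
  rw [← h2.measureReal_preimage hms.nullMeasurableSet] at hb2
  have hM2 := H.lintegral_pivotAt_zero_sub_sq_le β j hS hκ hcpos hQ
  have hM2' := hM2.trans (mul_le_mul_right (add_le_add_left hA _) _)
  rw [← ENNReal.ofReal_add hα (by positivity), ← ENNReal.ofReal_mul hC] at hM2'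
  have hpm : Measurable
      fun t : Sample n p × (EuclideanSpace ℝ (Fin n) × EuclideanSpace ℝ (Fin n)) =>
      pivotAt ρ g S β c j 0 (replaceColumn S j (t.1, t.2.2)) := by
    have h := (H.measurable_pivotAt β S c j 0).comp h1.measurable
    simp only [Function.comp_def] at h
    exact h
  have hb3 := measureReal_lt_le_of_lintegral (P := jointLaw S Q)
    ((hpm.sub (H.measurable_inner_directionAt β j)).pow_const 2)
    (by positivity : 0 < δ ^ 2) (by positivity) hM2'
  -- When both cutoffs equal 1, the truncated quantities coincide with the original ones. Each of
  -- the two exceptional events costs exp(-n).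
  have hsub : {t : Sample n p × (EuclideanSpace ℝ (Fin n) × EuclideanSpace ℝ (Fin n)) |
      δ < |stdXi' ρ g S β j (replaceColumn S j (t.1, t.2.2))
        - inner ℝ t.2.2 (unitScore ρ g β (replaceColumn S j (t.1, t.2.1)))|}
      ⊆ (fun t => replaceColumn S j (t.1, t.2.2)) ⁻¹' {q | cutoff c (designMatrix q.1) ≠ 1}
        ∪ ((fun t => replaceColumn S j (t.1, t.2.1)) ⁻¹' {q | cutoff c (designMatrix q.1) ≠ 1}
        ∪ {t | δ ^ 2 < (pivotAt ρ g S β c j 0 (replaceColumn S j (t.1, t.2.2))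
          - inner ℝ t.2.2 (directionAt ρ g β c j 0 (replaceColumn S j (t.1, t.2.1)))) ^ 2}) := by
    intro t ht
    by_cases c1 : cutoff c (designMatrix (replaceColumn S j (t.1, t.2.2)).1) = 1
    · by_cases c2 : cutoff c (designMatrix (replaceColumn S j (t.1, t.2.1)).1) = 1
      · refine Or.inr (Or.inr ?_)
        rw [Set.mem_ofPred_eq, pivotAt_zero β j hω, directionAt_zero, c1, c2, one_mul, one_smul,
          ← sq_abs (stdXi' ρ g S β j _ - _)]
        exact pow_lt_pow_left₀ ht hδ.le two_ne_zero
      · exact Or.inr (Or.inl c2)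
    · exact Or.inl c1
  have h4 := (measureReal_mono (μ := jointLaw S Q) hsub).trans ((measureReal_union_le _ _).trans
    (add_le_add_right (measureReal_union_le _ _) _))
  simp only [Pi.sub_apply] at hb3
  linarith

/-- The statistics `Ω_jj^{1/2} ξ_j` and `Ω_jj^{1/2} ξ'_j` are close in probability. -/
lemma measureReal_stdXi_sub_gt_le {δ θ : ℝ} (hδ : 0 < δ) (hθ : 0 < θ) :
    ((rowLaw n S).prod Q).real {q | δ < |stdXi ρ g S β j q - stdXi' ρ g S β j q|}
      ≤ Real.exp (-n) + (5 * θ + L ^ 2 * α / (2 * κ * θ)) / δ := by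
  set c := cutoffLevel κ γ with hc
  have hn := H.n_pos
  have hω := hS.precisionDiag_pos hκ j
  have hcut := H.measureReal_cutoff_ne_one_le (Q := Q) hS hκ hγ hp
  rw [← hc] at hcut
  set M := (rowLaw n S).prod Q
  have hdm := measurable_columnDeviation (n := n) (S := S) j
  have hcm := H.measurable_correction (S := S) β j
  have hmeas : Measurable fun q : Sample n p => cutoff c (designMatrix q.1)
      * |columnDeviation S j q * correction ρ g S β j q| :=
    (continuous_cutoff_design (n := n) (p := p) c).measurable.mul
      (continuous_abs.measurable.comp (hdm.mul hcm))
  have hint : ∫⁻ q, ENNReal.ofReal (cutoff c (designMatrix q.1)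
      * |columnDeviation S j q * correction ρ g S β j q|) ∂M
      ≤ ENNReal.ofReal (5 * θ + L ^ 2 * α / (2 * κ * θ)) := by
    calc ∫⁻ q, ENNReal.ofReal (cutoff c (designMatrix q.1)
        * |columnDeviation S j q * correction ρ g S β j q|) ∂M
        ≤ ∫⁻ q, (ENNReal.ofReal (n * θ / 2) * ENNReal.ofReal (columnDeviation S j q ^ 2)
          + ENNReal.ofReal (L ^ 2 / (2 * κ * θ)) * ENNReal.ofReal (energyAt ρ g β c j 0 q)) ∂M := by
          refine lintegral_mono_ae ?_
          filter_upwards [H.ae_wellDefined β (rowLaw n S) hQ] with q hq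
          have he := energyAt_nonneg (ρ := ρ) (g := g) (c := c) (ν := 0) β j q
          rw [← ENNReal.ofReal_mul (by positivity), ← ENNReal.ofReal_mul (by positivity),
            ← ENNReal.ofReal_add (by positivity) (mul_nonneg (by positivity) he)]
          refine ENNReal.ofReal_le_ofReal ?_
          have h := H.cutoff_mul_correction_sq_le (c := c) β j hS hκ hq.2
          rw [abs_mul, mul_left_comm, ← abs_of_nonneg (cutoff_nonneg (c := c) (designMatrix q.1)),
            ← abs_mul]
          rw [← sq_abs] at h
          rw [← sq_abs (columnDeviation S j q)]
          generalize |cutoff c (designMatrix q.1) * correction ρ g S β j q| = v at h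
          generalize |columnDeviation S j q| = b
          have h5 : L ^ 2 / (2 * κ * θ) * energyAt ρ g β c j 0 q
              = (L ^ 2 * n / κ * energyAt ρ g β c j 0 q) / (2 * (n * θ)) := by
            field_simp
          have h6 : v ^ 2 / (2 * (n * θ)) ≤ L ^ 2 / (2 * κ * θ) * energyAt ρ g β c j 0 q := by
            rw [h5]
            gcongr
          -- Young's inequality with weight nθ, so that n times the mean squared deviation is at
          -- most 10 and the energy loses its factor n. The free parameter θ is tuned in the limit.
          have h7 : b * v ≤ n * θ / 2 * b ^ 2 + v ^ 2 / (2 * (n * θ)) := by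
            have h8 : 0 ≤ (n * θ * b - v) ^ 2 / (2 * (n * θ)) := by positivity
            have h9 : (n * θ * b - v) ^ 2 / (2 * (n * θ))
                = n * θ / 2 * b ^ 2 + v ^ 2 / (2 * (n * θ)) - b * v := by
              field_simp
              ring
            linarith
          linarith
      _ = ENNReal.ofReal (n * θ / 2) * ∫⁻ q, ENNReal.ofReal (columnDeviation S j q ^ 2) ∂M
          + ENNReal.ofReal (L ^ 2 / (2 * κ * θ))
            * ∫⁻ q, ENNReal.ofReal (energyAt ρ g β c j 0 q) ∂M := by
          rw [lintegral_add_right _ ((H.measurable_energyAt β c j 0).ennreal_ofReal.const_mul _),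
            lintegral_const_mul' _ _ ENNReal.ofReal_ne_top,
            lintegral_const_mul' _ _ ENNReal.ofReal_ne_top]
      _ ≤ ENNReal.ofReal (n * θ / 2) * ENNReal.ofReal (10 / n)
          + ENNReal.ofReal (L ^ 2 / (2 * κ * θ)) * ENNReal.ofReal α := by
          gcongr
          exact lintegral_columnDeviation_sq_le j hS hκ hn
      _ = ENNReal.ofReal (5 * θ + L ^ 2 * α / (2 * κ * θ)) := by
          rw [← ENNReal.ofReal_mul (by positivity), ← ENNReal.ofReal_mul (by positivity),
            ← ENNReal.ofReal_add (by positivity) (by positivity)]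
          congr 1
          field_simp
          ring
  have hb := measureReal_lt_le_of_lintegral hmeas hδ (by positivity) hint
  have hsub : {q : Sample n p | δ < |stdXi ρ g S β j q - stdXi' ρ g S β j q|}
      ⊆ {q | cutoff c (designMatrix q.1) ≠ 1} ∪ {q | δ < cutoff c (designMatrix q.1)
        * |columnDeviation S j q * correction ρ g S β j q|} := by
    intro q hq
    by_cases c1 : cutoff c (designMatrix q.1) = 1
    · refine Or.inr ?_
      rw [Set.mem_ofPred_eq, c1, one_mul, ← stdXi_sub_stdXi' β j hω]
      exact hq
    · exact Or.inl c1
  have h4 := (measureReal_mono (μ := M) hsub).trans (measureReal_union_le _ _)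
  linarith

/-- Quantitative normal approximation of both statistics for a single coordinate. -/
theorem abs_cdf_sub_Phi_add_le {δ θ : ℝ} (hδ : 0 < δ) (hθ : 0 < θ) (t : ℝ) :
    |((rowLaw n S).prod Q).real {q | stdXi ρ g S β j q ≤ t} - Phi t|
      + |((rowLaw n S).prod Q).real {q | stdXi' ρ g S β j q ≤ t} - Phi t|
      ≤ 5 * Real.exp (-n) + 2 * (approxConst τ L κ (cutoffLevel κ γ) * (α + 1 / n) / δ ^ 2)
        + (5 * θ + L ^ 2 * α / (2 * κ * θ)) / δ + 3 * δ := by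
  have hω := hS.precisionDiag_pos hκ j
  have hmp := measurePreserving_replaceColumn_snd (n := n) (Q := Q) j hS hκ
  have hlaw := map_inner_unitScore (n := n) (Q := Q) β j hS hκ H hQ
  have hG : Measurable fun t : Sample n p × (EuclideanSpace ℝ (Fin n) × EuclideanSpace ℝ (Fin n)) =>
      inner ℝ t.2.2 (unitScore ρ g β (replaceColumn S j (t.1, t.2.1))) := by
    have h1 : Measurable fun t : Sample n p × (EuclideanSpace ℝ (Fin n) × EuclideanSpace ℝ (Fin n)) =>
        t.2.2 := measurable_snd.comp measurable_snd
    have h2 := (H.measurable_unitScore β).comp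
      (measurePreserving_replaceColumn_fst (n := n) (Q := Q) j hS hκ).measurable
    simp only [Function.comp_def] at h2
    exact h1.inner h2
  have hm := H.measurable_stdXi (S := S) β j hω
  have hm' := H.measurable_stdXi' (S := S) β j hω
  have e1 : ((rowLaw n S).prod Q).real {q | stdXi ρ g S β j q ≤ t}
      = (jointLaw S Q).real {x | stdXi ρ g S β j (replaceColumn S j (x.1, x.2.2)) ≤ t} :=
    (hmp.measureReal_preimage (hm measurableSet_Iic).nullMeasurableSet).symm
  have e2 : ((rowLaw n S).prod Q).real {q | stdXi' ρ g S β j q ≤ t}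
      = (jointLaw S Q).real {x | stdXi' ρ g S β j (replaceColumn S j (x.1, x.2.2)) ≤ t} :=
    (hmp.measureReal_preimage (hm' measurableSet_Iic).nullMeasurableSet).symm
  have b1 := H.measureReal_stdXi'_sub_gt_le β j hS hκ hγ hp hQ hα hA hδ
  have b2 := H.measureReal_stdXi_sub_gt_le β j hS hκ hγ hp hQ hα hA hδ hθ
  have hset : MeasurableSet {q : Sample n p | δ < |stdXi ρ g S β j q - stdXi' ρ g S β j q|} :=
    measurableSet_lt measurable_const (continuous_abs.measurable.comp (hm.sub hm'))
  rw [← hmp.measureReal_preimage hset.nullMeasurableSet] at b2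
  rw [e1, e2]
  -- The tolerance is 2δ here because the distance to the Gaussian variable passes through ξ'_j,
  -- with δ for each of the two steps.
  have c1 := abs_measureReal_le_sub_Phi_le (P := jointLaw S Q)
    (Y := fun x => stdXi ρ g S β j (replaceColumn S j (x.1, x.2.2))) hG hlaw t
    (by positivity : 0 ≤ 2 * δ)
  have c2 := abs_measureReal_le_sub_Phi_le (P := jointLaw S Q)
    (Y := fun x => stdXi' ρ g S β j (replaceColumn S j (x.1, x.2.2))) hG hlaw t hδ.le
  have c3 : (jointLaw S Q).real {x | 2 * δ < |stdXi ρ g S β j (replaceColumn S j (x.1, x.2.2))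
        - inner ℝ x.2.2 (unitScore ρ g β (replaceColumn S j (x.1, x.2.1)))|}
      ≤ (jointLaw S Q).real ((fun x => replaceColumn S j (x.1, x.2.2)) ⁻¹'
          {q | δ < |stdXi ρ g S β j q - stdXi' ρ g S β j q|})
        + (jointLaw S Q).real {x | δ < |stdXi' ρ g S β j (replaceColumn S j (x.1, x.2.2))
        - inner ℝ x.2.2 (unitScore ρ g β (replaceColumn S j (x.1, x.2.1)))|} := by
    refine (measureReal_mono fun x hx => ?_).trans (measureReal_union_le _ _)
    by_contra hcon
    rw [Set.mem_union, not_or] at hcon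
    have h1 : |stdXi ρ g S β j (replaceColumn S j (x.1, x.2.2))
        - stdXi' ρ g S β j (replaceColumn S j (x.1, x.2.2))| ≤ δ := not_lt.1 fun h => hcon.1 h
    have h2 : |stdXi' ρ g S β j (replaceColumn S j (x.1, x.2.2))
        - inner ℝ x.2.2 (unitScore ρ g β (replaceColumn S j (x.1, x.2.1)))| ≤ δ :=
      not_lt.1 fun h => hcon.2 h
    have hx' : 2 * δ < |stdXi ρ g S β j (replaceColumn S j (x.1, x.2.2))
        - inner ℝ x.2.2 (unitScore ρ g β (replaceColumn S j (x.1, x.2.1)))| := hx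
    have h3 := abs_sub_le (stdXi ρ g S β j (replaceColumn S j (x.1, x.2.2)))
      (stdXi' ρ g S β j (replaceColumn S j (x.1, x.2.2)))
      (inner ℝ x.2.2 (unitScore ρ g β (replaceColumn S j (x.1, x.2.1))))
    linarith
  linarith

end Regular

end NormalApproximation

/-! ### Transfer from the probability space to the law of design and noise. -/

section Transfer

variable {Ω : Type*} [MeasurableSpace Ω] {μ : Measure Ω} {n p : ℕ}
  {S : Matrix (Fin p) (Fin p) ℝ} {x : Fin n → Ω → EuclideanSpace ℝ (Fin p)}
  {ε : Ω → EuclideanSpace ℝ (Fin n)}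

lemma SamplingAssumption.aemeasurable_noise (h : SamplingAssumption μ S x ε) :
    AEMeasurable ε μ := by
  have := h.density_noise
  exact HasPDF.aemeasurable ε μ volume

lemma SamplingAssumption.aemeasurable_rows (h : SamplingAssumption μ S x ε) :
    AEMeasurable (fun ω i => x i ω) μ :=
  aemeasurable_pi_lambda _ fun i => (h.law_rows i).aemeasurable

lemma SamplingAssumption.aemeasurable_sample (h : SamplingAssumption μ S x ε) :
    AEMeasurable (fun ω => ((fun i => x i ω, ε ω) : Sample n p)) μ :=
  h.aemeasurable_rows.prodMk h.aemeasurable_noise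

lemma SamplingAssumption.noise_absolutelyContinuous (h : SamplingAssumption μ S x ε) :
    μ.map ε ≪ volume := by
  have := h.density_noise
  exact HasPDF.absolutelyContinuous

variable [IsProbabilityMeasure μ]

/-- The rows and the noise have the product law. -/
lemma SamplingAssumption.map_sample (h : SamplingAssumption μ S x ε) :
    μ.map (fun ω => ((fun i => x i ω, ε ω) : Sample n p)) = (rowLaw n S).prod (μ.map ε) := by
  rw [(indepFun_iff_map_prod_eq_prod_map_map h.aemeasurable_rows h.aemeasurable_noise).1
    h.indep_noise.symm]
  congr 1
  rw [(iIndepFun_iff_map_fun_eq_pi_map fun i => (h.law_rows i).aemeasurable).1 h.indep_rows]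
  congr 1
  funext i
  exact (h.law_rows i).map_eq

variable {ρ : ℝ → ℝ} {g : EuclideanSpace ℝ (Fin p) → ℝ} {τ K κ γ R : ℝ} {L : NNReal}

namespace Regular

lemma ae_sample_wellDefined (H : Regular n ρ g τ K L) (β : EuclideanSpace ℝ (Fin p))
    (h : SamplingAssumption μ S x ε) :
    ∀ᵐ ω ∂μ, psiHat ρ g (designMatrix fun i => x i ω)
        (response β (designMatrix fun i => x i ω) (ε ω)) ≠ 0 ∧
      DifferentiableAt ℝ (psiHat ρ g (designMatrix fun i => x i ω))
        (response β (designMatrix fun i => x i ω) (ε ω)) := by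
  have := Measure.isProbabilityMeasure_map h.aemeasurable_noise
  have h1 := H.ae_wellDefined β (rowLaw n S) h.noise_absolutelyContinuous
  rw [← h.map_sample] at h1
  exact ae_of_ae_map h.aemeasurable_sample h1

/-- The eigenvalues of S are at least κ, so the prediction error dominates κ‖β̂ - β‖². -/
lemma lintegral_estError_le (H : Regular n ρ g τ K L) (β : EuclideanSpace ℝ (Fin p))
    (h : SamplingAssumption μ S x ε) (hS : CovarianceAssumption S κ) (hκ : 0 < κ)
    (hrisk : ∫⁻ ω, predError S (betaHat ρ g (designMatrix fun i => x i ω)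
      (response β (designMatrix fun i => x i ω) (ε ω))) β ∂μ ≤ ENNReal.ofReal R) :
    ∫⁻ q, ENNReal.ofReal (‖estError ρ g β (designMatrix q.1) q.2‖ ^ 2)
      ∂((rowLaw n S).prod (μ.map ε)) ≤ ENNReal.ofReal (R / κ) := by
  have hc := H.continuous_estError β (continuous_design (n := n) (p := p)) continuous_snd
  have hm : Measurable fun q : Sample n p =>
      ENNReal.ofReal (‖estError ρ g β (designMatrix q.1) q.2‖ ^ 2) :=
    (hc.norm.pow 2).measurable.ennreal_ofReal
  rw [← h.map_sample, lintegral_map' hm.aemeasurable h.aemeasurable_sample]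
  have h1 : ENNReal.ofReal κ * ∫⁻ ω, ENNReal.ofReal
      (‖estError ρ g β (designMatrix fun i => x i ω) (ε ω)‖ ^ 2) ∂μ ≤ ENNReal.ofReal R := by
    rw [← lintegral_const_mul' _ _ ENNReal.ofReal_ne_top]
    refine (lintegral_mono fun ω => ?_).trans hrisk
    rw [← ENNReal.ofReal_mul hκ.le]
    exact hS.ofReal_le_predError hκ _ β
  rw [ENNReal.ofReal_div_of_pos hκ, ENNReal.le_div_iff_mul_le
    (Or.inl (by simpa using hκ)) (Or.inl ENNReal.ofReal_ne_top), mul_comm]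
  exact h1

end Regular

lemma SamplingAssumption.measureReal_eq (h : SamplingAssumption μ S x ε) {f : Sample n p → ℝ}
    (hf : Measurable f) (t : ℝ) :
    μ.real {ω | f (fun i => x i ω, ε ω) ≤ t}
      = ((rowLaw n S).prod (μ.map ε)).real {q | f q ≤ t} := by
  rw [← h.map_sample]
  exact congrArg ENNReal.toReal
    (Measure.map_apply_of_aemeasurable h.aemeasurable_sample (hf measurableSet_Iic)).symm

end Transfer

/-- At most `a` of the terms of a family with sum at most `C` exceed `C / a`. -/
lemma exists_finset_forall_le {p : ℕ} (hp : 1 ≤ p) (A : Fin p → ENNReal) {C a : ℝ} (hC : 0 < C)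
    (ha : 0 < a) (hA : ∑ j, A j ≤ ENNReal.ofReal C) :
    ∃ J : Finset (Fin p), 1 - a / p ≤ (J.card : ℝ) / p ∧
      ∀ j ∈ J, A j ≤ ENNReal.ofReal (C / a) := by
  classical
  refine ⟨Finset.univ.filter fun j => A j ≤ ENNReal.ofReal (C / a), ?_, fun j hj => by
    simpa using hj⟩
  set J := Finset.univ.filter fun j => A j ≤ ENNReal.ofReal (C / a) with hJ
  have hp0 : (0 : ℝ) < p := by exact_mod_cast hp
  have h1 : (Jᶜ.card : ENNReal) * ENNReal.ofReal (C / a) ≤ ENNReal.ofReal C := by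
    calc (Jᶜ.card : ENNReal) * ENNReal.ofReal (C / a) = ∑ _j ∈ Jᶜ, ENNReal.ofReal (C / a) := by
          simp
      _ ≤ ∑ j ∈ Jᶜ, A j := Finset.sum_le_sum fun j hj => by
          have : ¬ A j ≤ ENNReal.ofReal (C / a) := by simpa [hJ] using hj
          exact (not_le.1 this).le
      _ ≤ ∑ j, A j := Finset.sum_le_sum_of_subset (Finset.subset_univ _)
      _ ≤ _ := hA
  rw [← ENNReal.ofReal_natCast, ← ENNReal.ofReal_mul (by positivity),
    ENNReal.ofReal_le_ofReal_iff hC.le] at h1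
  have h2 : (Jᶜ.card : ℝ) ≤ a := by
    rw [mul_div_assoc', div_le_iff₀ ha, mul_comm] at h1
    exact le_of_mul_le_mul_left h1 hC
  have h3 : (J.card : ℝ) + Jᶜ.card = p := by
    have := Finset.card_add_card_compl J
    rw [Fintype.card_fin] at this
    exact_mod_cast this
  rw [le_div_iff₀ hp0, sub_mul, div_mul_cancel₀ _ hp0.ne']
  linarith

lemma energyConst_pos {R τ K κ γ c : ℝ} {L : NNReal} (hR : 0 < R) (hτ : 0 < τ) (hK : 0 < K)
    (hκ : 0 < κ) (hγ : 0 < γ) (hc : 0 < c) : 0 < energyConst R τ K L κ γ c := by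
  have h1 := approxConst_nonneg (L := L) hτ hκ hc
  have h2 : 0 < loopConst K τ κ c := by unfold loopConst; positivity
  have h3 : 0 < 4 / K ^ 2 * (R / κ) := by positivity
  have h4 : 0 ≤ loopConst K τ κ c * (γ * (2 + 2 * approxConst τ L κ c)) := by positivity
  have h5 : 0 ≤ loopConst K τ κ c * ((1 / κ) ^ 3 * (4 * c ^ 2)) := by positivity
  unfold energyConst
  linarith

/-- The error bound of the normal approximation vanishes as `n` and `a` grow. -/
lemma eventually_approximation_bound_le {n : ℕ → ℕ} {a : ℕ → ℝ} (hn : Tendsto n atTop atTop)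
    (ha : Tendsto a atTop atTop) (C D M κ : ℝ) {η : ℝ} (hη : 0 < η) :
    ∃ δ > 0, ∃ θ > 0, ∀ᶠ k in atTop,
      5 * Real.exp (-n k) + 2 * (C * (D / a k + 1 / n k) / δ ^ 2)
        + (5 * θ + M ^ 2 * (D / a k) / (2 * κ * θ)) / δ + 3 * δ ≤ η := by
  -- With these values 3δ = η/4 and 5θ/δ = η/4, so the limit of the bound is η/2 < η.
  refine ⟨η / 12, by positivity, η ^ 2 / 240, by positivity, ?_⟩
  have hn' : Tendsto (fun k => (n k : ℝ)) atTop atTop := tendsto_natCast_atTop_atTop.comp hn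
  have h1 : Tendsto (fun k => Real.exp (-n k)) atTop (𝓝 0) :=
    Real.tendsto_exp_neg_atTop_nhds_zero.comp hn'
  have h2 : Tendsto (fun k => D / a k) atTop (𝓝 0) := ha.const_div_atTop D
  have h3 : Tendsto (fun k => 1 / (n k : ℝ)) atTop (𝓝 0) := hn'.const_div_atTop 1
  have h4 : Tendsto (fun k => 5 * Real.exp (-n k)
      + 2 * (C * (D / a k + 1 / n k) / (η / 12) ^ 2)
      + (5 * (η ^ 2 / 240) + M ^ 2 * (D / a k) / (2 * κ * (η ^ 2 / 240))) / (η / 12)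
      + 3 * (η / 12)) atTop
      (𝓝 (5 * 0 + 2 * (C * (0 + 0) / (η / 12) ^ 2)
      + (5 * (η ^ 2 / 240) + M ^ 2 * 0 / (2 * κ * (η ^ 2 / 240))) / (η / 12)
      + 3 * (η / 12))) :=
    (((h1.const_mul 5).add ((((h2.add h3).const_mul C).div_const _).const_mul 2)).add
      ((((h2.const_mul (M ^ 2)).div_const _).const_add _).div_const _)).add_const _
  have h5 : 5 * 0 + 2 * (C * (0 + 0) / (η / 12) ^ 2)
      + (5 * (η ^ 2 / 240) + M ^ 2 * 0 / (2 * κ * (η ^ 2 / 240))) / (η / 12)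
      + 3 * (η / 12) < η := by
    have : 5 * (η ^ 2 / 240) / (η / 12) = η / 4 := by field_simp; norm_num
    simp only [mul_zero, add_zero, zero_div, zero_add, this]
    linarith
  exact (h4.eventually (gt_mem_nhds h5)).mono fun k hk => hk.le

/-- n k ≥ p k / γ, so divergence of p suffices. -/
lemma tendsto_of_tendsto_of_div_le {n p : ℕ → ℕ} {γ : ℝ} (hγ : 0 < γ) (hn : ∀ k, 1 ≤ n k)
    (hp : Tendsto p atTop atTop) (h : ∀ k, (p k : ℝ) / n k ≤ γ) : Tendsto n atTop atTop := by
  rw [← tendsto_natCast_atTop_iff (R := ℝ)] at hp ⊢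
  refine tendsto_atTop_mono (fun k => ?_) (hp.atTop_div_const hγ)
  have hk : (0 : ℝ) < n k := by exact_mod_cast hn k
  rw [div_le_iff₀ hγ, mul_comm]
  exact (div_le_iff₀ hk).1 (h k)

end RobustM

/-! ### Assembly along the sequence. -/

theorem theorem1
    {Ω : ℕ → Type*} [∀ k, MeasurableSpace (Ω k)]
    (μ : ∀ k, Measure (Ω k)) [∀ k, IsProbabilityMeasure (μ k)]
    (R τ κ K γ : ℝ) (L : NNReal)
    (hR : 0 < R) (hτ : 0 < τ) (hκ : κ ∈ Set.Ioo (0 : ℝ) 1) (hK : 0 < K) (hγ : 0 < γ) (hL : 0 < L)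
    (n p : ℕ → ℕ) (hn : ∀ k, 1 ≤ n k) (hp : ∀ k, 1 ≤ p k)
    (hp_lim : Tendsto p atTop atTop)
    (hpn : ∀ k, (p k : ℝ) / (n k : ℝ) ≤ γ)
    (ρ : ℕ → ℝ → ℝ) (hρ : ∀ k, RobustM.LossAssumption (ρ k) K L)
    (g : ∀ k, EuclideanSpace ℝ (Fin (p k)) → ℝ)
    (hg : ∀ k, RobustM.PenaltyAssumption (g k) τ)
    (S : ∀ k, Matrix (Fin (p k)) (Fin (p k)) ℝ)
    (hS : ∀ k, RobustM.CovarianceAssumption (S k) κ)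
    (β : ∀ k, EuclideanSpace ℝ (Fin (p k)))
    (x : ∀ k, Fin (n k) → Ω k → EuclideanSpace ℝ (Fin (p k)))
    (ε : ∀ k, Ω k → EuclideanSpace ℝ (Fin (n k)))
    (hsample : ∀ k, RobustM.SamplingAssumption (μ k) (S k) (x k) (ε k))
    (X : ∀ k, Ω k → Matrix (Fin (n k)) (Fin (p k)) ℝ)
    (hX : ∀ k ω, X k ω = RobustM.designMatrix (fun i => x k i ω))
    (y : ∀ k, Ω k → EuclideanSpace ℝ (Fin (n k)))
    (hy : ∀ k ω, y k ω = RobustM.mulVecE (X k ω) (β k) + ε k ω)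
    (hrisk : ∀ k, ∫⁻ ω, RobustM.predError (S k)
        (RobustM.betaHat (ρ k) (g k) (X k ω) (y k ω)) (β k) ∂(μ k) ≤ ENNReal.ofReal R)
    (a : ℕ → ℝ) (ha_pos : ∀ m, 0 < a m) (ha_lim : Tendsto a atTop atTop) :
    -- the statistics are well defined with probability one
    (∀ k, ∀ᵐ ω ∂(μ k), RobustM.psiHat (ρ k) (g k) (X k ω) (y k ω) ≠ 0 ∧
      DifferentiableAt ℝ (fun y' => RobustM.psiHat (ρ k) (g k) (X k ω) y') (y k ω)) ∧
    -- asymptotic normality, uniformly over all but at most `a (p k)` coordinates;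
    -- the real supremum over an empty `J k` is `0`
    ∃ J : ∀ k, Finset (Fin (p k)),
      (∀ k, 1 - a (p k) / (p k : ℝ) ≤ ((J k).card : ℝ) / (p k : ℝ)) ∧
      ∀ t : ℝ, Tendsto (fun k => ⨆ j : {j // j ∈ J k},
        (|(μ k).real {ω | √(RobustM.precisionDiag (S k) j)
              * RobustM.xi (ρ k) (g k) (S k) (β k) (X k ω) (y k ω) j ≤ t} - RobustM.Phi t|
          + |(μ k).real {ω | √(RobustM.precisionDiag (S k) j)
              * RobustM.xi' (ρ k) (g k) (S k) (β k) (X k ω) (y k ω) j ≤ t} - RobustM.Phi t|))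
        atTop (𝓝 0) := by
  obtain rfl : X = fun k ω => RobustM.designMatrix fun i => x k i ω := funext fun k => funext (hX k)
  obtain rfl : y = fun k ω => RobustM.response (β k) (RobustM.designMatrix fun i => x k i ω) (ε k ω) :=
    funext fun k => funext (hy k)
  have hκ0 := hκ.1
  have H : ∀ k, RobustM.Regular (n k) (ρ k) (g k) τ K L := fun k =>
    ⟨hρ k, hg k, hτ, hK, NNReal.coe_pos.2 hL, by exact_mod_cast hn k⟩
  refine ⟨fun k => (H k).ae_sample_wellDefined (β k) (hsample k), ?_⟩
  set c := RobustM.cutoffLevel κ γ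
  have hc : 0 < c := RobustM.cutoffLevel_pos hκ0 hγ
  set E := RobustM.energyConst R τ K L κ γ c
  have hE : 0 < E := RobustM.energyConst_pos hR hτ hK hκ0 hγ hc
  have hn_lim : Tendsto n atTop atTop := RobustM.tendsto_of_tendsto_of_div_le hγ hn hp_lim hpn
  have hprob : ∀ k, IsProbabilityMeasure ((μ k).map (ε k)) := fun k =>
    Measure.isProbabilityMeasure_map (hsample k).aemeasurable_noise
  have hJ : ∀ k, ∃ J : Finset (Fin (p k)), 1 - a (p k) / p k ≤ (J.card : ℝ) / p k ∧
      (4 * (RobustM.approxConst τ L κ c * RobustM.loopConst K τ κ c) ≤ n k → ∀ j ∈ J,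
        ∫⁻ q, ENNReal.ofReal (RobustM.energyAt (ρ k) (g k) (β k) c j 0 q)
          ∂((RobustM.rowLaw (n k) (S k)).prod ((μ k).map (ε k))) ≤ ENNReal.ofReal (E / a (p k))) := by
    intro k
    -- The energy bound is available only once n k passes the absorption threshold. Below it, which
    -- concerns finitely many k, all coordinates are kept and nothing is claimed of them.
    by_cases hk : 4 * (RobustM.approxConst τ L κ c * RobustM.loopConst K τ κ c) ≤ n k
    · obtain ⟨J, h1, h2⟩ := RobustM.exists_finset_forall_le (hp k) _ hE (ha_pos (p k))
        ((H k).sum_lintegral_energyAt_le (β k) (hS k) hκ0 hc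
          (hsample k).noise_absolutelyContinuous hR.le hγ.le (hpn k)
          ((H k).lintegral_estError_le (β k) (hsample k) (hS k) hκ0 (hrisk k)) hk)
      exact ⟨J, h1, fun _ => h2⟩
    · have hp0 : (0 : ℝ) < p k := by exact_mod_cast hp k
      refine ⟨Finset.univ, ?_, fun h => absurd h hk⟩
      rw [Finset.card_fin, div_self hp0.ne']
      have := (div_pos (ha_pos (p k)) hp0).le
      linarith
  choose J hJcard hJ using hJ
  refine ⟨J, hJcard, fun t => ?_⟩
  -- The supremum of nonnegative terms is nonnegative, also over an empty index set where its value
  -- is 0. Only the upper bound needs the approximation.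
  refine tendsto_order.2 ⟨fun b hb => Eventually.of_forall fun k =>
    hb.trans_le (Real.iSup_nonneg fun j => by positivity), fun b hb => ?_⟩
  obtain ⟨δ, hδ, θ, hθ, hev⟩ := RobustM.eventually_approximation_bound_le hn_lim
    (ha_lim.comp hp_lim) (RobustM.approxConst τ L κ c) E L κ (half_pos hb)
  have hn_large : ∀ᶠ k in atTop,
      4 * (RobustM.approxConst τ L κ c * RobustM.loopConst K τ κ c) ≤ (n k : ℝ) :=
    (tendsto_natCast_atTop_atTop.comp hn_lim).eventually_ge_atTop _
  filter_upwards [hev, hn_large] with k hk hnk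
  refine (Real.iSup_le (fun j => ?_) (half_pos hb).le).trans_lt (half_lt_self hb)
  have hω := (hS k).precisionDiag_pos hκ0 j.1
  have e1 := (hsample k).measureReal_eq ((H k).measurable_stdXi (S := S k) (β k) j.1 hω) t
  have e2 := (hsample k).measureReal_eq ((H k).measurable_stdXi' (S := S k) (β k) j.1 hω) t
  have hb' := (H k).abs_cdf_sub_Phi_add_le (β k) j.1 (hS k) hκ0 hγ (hpn k)
    (hsample k).noise_absolutelyContinuous (div_pos hE (ha_pos (p k))).le
    (hJ k hnk j.1 j.2) hδ hθ t
  rw [← e1, ← e2] at hb'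
  exact hb'.trans hk
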